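/- Let $k$ be a commutative ring. Let $\mathbf{FB}$ be the category of finite sets and bijections. An $\mathbf{FB}$-module is a functor $M\colon \mathbf{FB}\to \mathrm{Mod}_k$; $\mathbf{FB}$-modules form a symmetric tensor category under $$(M\otimes N)(S)=\bigoplus_{S=A\sqcup B} M(A)\otimes_k N(B),$$ with the symmetry $\tau$ that switches the tensor factors. Let $\mathbf V$ be the standard $\mathbf{FB}$-module: $\mathbf V(S)=k$ if $\#S=1$ and $\mathbf V(S)=0$ otherwise. The symmetric and divided power algebras $\mathrm{Sym}(\mathbf V)$ and $\mathrm{Div}(\mathbf V)$ are free of rank one in each $S$, with basis vectors $t^S$ and $t^{[S]}$ of degree $\#S$, on which bijections act trivially; the multiplications and comultiplications are $$m(t^A\otimes t^B)=t^{A\sqcup B},\qquad \Delta(t^S)=\sum_{S=A\sqcup B}t^A\otimes t^B$$ (likewise for $t^{[S]}$), and the averaging map $\mathrm{avg}\colon\mathrm{Sym}(\mathbf V)\to\mathrm{Div}(\mathbf V)$ is $t^S\mapsto t^{[S]}$. **Weyl side.** A representation of the curried Weyl Lie algebra $\underline{\mathfrak a}(\mathbf V\oplus\mathbf V^*)$ is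 an $\mathbf{FB}$-module $M$ with a map of $\mathbf{FB}$-modules $a\colon \mathrm{Sym}(\mathbf V)\otimes M\to\mathrm{Div}(\mathbf V)\otimes M$ such that $$a_1a_2-a_2a_1=a'-a''\colon\ \mathrm{Sym}(\mathbf V)\otimes\mathrm{Sym}(\mathbf V)\otimes M\to\mathrm{Div}(\mathbf V)\otimes\mathrm{Div}(\mathbf V)\otimes M.$$ Here $a_2=\mathrm{id}\otimes a$ and $a_1=\tau_{1,2}a_2\tau_{1,2}$ ($a$ applied to the first factor and $M$). With $\mathsf S=\mathrm{Sym}(\mathbf V)$ and $\mathsf D=\mathrm{Div}(\mathbf V)$, the map $a'$ is the composition $$\mathsf S\otimes \mathsf S\otimes M\xrightarrow{\mathrm{id}\otimes\Delta\otimes\mathrm{id}}\mathsf S\otimes \mathsf S\otimes \mathsf S\otimes M\xrightarrow{\tau\otimes\mathrm{id}\otimes\mathrm{id}}\mathsf S\otimes \mathsf S\otimes \mathsf S\otimes M\xrightarrow{\mathrm{id}\otimes m\otimes\mathrm{id}}\mathsf S\otimes \mathsf S\otimes M\xrightarrow{\mathrm{id}\otimes a}\mathsf S\otimes \mathsf D\otimes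 M$$ $$\xrightarrow{\mathrm{id}\otimes\Delta\otimes\mathrm{id}}\mathsf S\otimes \mathsf D\otimes \mathsf D\otimes M\xrightarrow{\mathrm{avg}\otimes\mathrm{id}\otimes\mathrm{id}\otimes\mathrm{id}}\mathsf D\otimes \mathsf D\otimes \mathsf D\otimes M\xrightarrow{m\otimes\mathrm{id}\otimes\mathrm{id}}\mathsf D\otimes \mathsf D\otimes M,$$ and $a''=\tau_{1,2}a'\tau_{1,2}$. Morphisms of representations are the maps of $\mathbf{FB}$-modules that commute with the maps $a$. For $\epsilon\in k$, the representation is *$\epsilon$-standard* if the composition $\mathbf V\otimes M\to\mathrm{Sym}(\mathbf V)\otimes M\xrightarrow{a}\mathrm{Div}(\mathbf V)\otimes M\to\mathbf V\otimes M$ (inclusion and projection in degree one) is given, for every finite set $S$, $j\in S$ and $x\in M(S\setminus\{j\})$, by $$t^j\otimes x\mapsto t^j\otimes\epsilon x+\sum_{i\in S\setminus\{j\}}t^i\otimes(\iota^S_{i,j})_*(x),$$ where $\iota^S_{i,j}\colon S\setminus\{j\}\to S\setminus\{i\}$ is the bijection sending $i$ to $j$ and fixing all other elements. It has *central character* $\chi\in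 k$ if the composition $M\cong\mathrm{Sym}^0(\mathbf V)\otimes M\to\mathrm{Sym}(\mathbf V)\otimes M\xrightarrow{a}\mathrm{Div}(\mathbf V)\otimes M\to\mathrm{Div}^0(\mathbf V)\otimes M\cong M$ is $\chi\cdot\mathrm{id}_M$. Let $\mathrm{Rep}^\chi_\epsilon(\underline{\mathfrak a}(\mathbf V\oplus\mathbf V^*))$ be the full subcategory of $\epsilon$-standard representations with central character $\chi$. **Partition side.** For $\delta\in k$, the partition category $\mathfrak P(\delta)$ is the $k$-linear category whose objects are finite sets, where $\mathrm{Hom}(S,T)$ is the free $k$-module on the set partitions of $S\sqcup T$. Two partitions, of $S\sqcup T$ and of $T\sqcup U$, are composed by gluing them to a partition of $S\sqcup T\sqcup U$, restricting that to $S\sqcup U$, and multiplying by $\delta^r$, where $r$ is the number of blocks of the glued partition that are contained in $T$. A bijection $S\to T$ is regarded as the morphism given by the partition into the pairs of corresponding elements. If $\mathcal C$ and $\mathcal D$ are $k$-linear categories whose objects are finite sets and which contain all bijections, the star product $\mathcal C\star\mathcal D$ is the $k$-linear category whose objects are finite sets, with $$\mathrm{Hom}_{\mathcal C\star\mathcal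 D}(S,T)=\bigoplus_{S=S_1\sqcup S_2,\ T=T_1\sqcup T_2}\mathrm{Hom}_{\mathcal C}(S_1,T_1)\otimes_k\mathrm{Hom}_{\mathcal D}(S_2,T_2);$$ the composition of morphisms belonging to decompositions $T=T_1\sqcup T_2$ and $T=T_1'\sqcup T_2'$ of the middle object is induced by the compositions of $\mathcal C$ and $\mathcal D$ if the two decompositions agree, and is $0$ otherwise. There is a functor $\mathbf{FB}\to\mathcal C\star\mathcal D$, the identity on objects, that sends a bijection $\varphi\colon S\to T$ to $\sum_{S=S_1\sqcup S_2}(\varphi|_{S_1}\colon S_1\to\varphi(S_1))\otimes(\varphi|_{S_2}\colon S_2\to\varphi(S_2))$. A representation of a $k$-linear category is a $k$-linear functor from it to $\mathrm{Mod}_k$. **Theorem.** For all $\delta,\epsilon\in k$ there is an equivalence of categories $$\mathrm{Rep}^{\delta-\epsilon}_{\epsilon}(\underline{\mathfrak a}(\mathbf V\oplus\mathbf V^*))\simeq\mathrm{Rep}(\mathfrak P(\delta)\star\mathfrak P(\epsilon))$$ which is compatible, up to natural isomorphism, with the functors to $\mathbf{FB}$-modules: the underlying $\mathbf{FB}$-module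 on the left, and restriction along $\mathbf{FB}\to\mathfrak P(\delta)\star\mathfrak P(\epsilon)$ on the right. -/

import Mathlib

open CategoryTheory MonoidalCategory TensorProduct

universe u

noncomputable section

/-- A finite set. -/
structure FB : Type 1 where
  carrier : Type
  [fin : Finite carrier]

namespace FB

instance : CoeSort FB Type := ⟨FB.carrier⟩

instance (S : FB) : Finite S := S.fin

/-- The category of finite sets and bijections. -/
instance : Category FB where
  Hom S T := S ≃ T
  id S := Equiv.refl S
  comp e f := Equiv.trans e f

/-- A subset of a finite set, as a finite set. -/
abbrev sub (S : FB) (A : Set S) : FB := ⟨A⟩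

instance (S : FB) : Fintype (Set S) := Fintype.ofFinite _

instance (S : FB) : DecidableEq (Set S) := Classical.decEq _

/-- The restriction of a bijection `S ≃ T` to subsets `A` and `B` that correspond to each other. -/
abbrev restr {S T : FB} (e : S ≃ T) {A : Set S} {B : Set T} (h : ∀ s, s ∈ A ↔ e s ∈ B) :
    S.sub A ≃ T.sub B :=
  e.subtypeEquiv h

theorem mem_compl_congr {S T : FB} (e : S ≃ T) {A : Set S} {B : Set T}
    (h : ∀ s, s ∈ A ↔ e s ∈ B) (s : S) : s ∈ Aᶜ ↔ e s ∈ Bᶜ :=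
  not_congr (h s)

end FB

/-- `FB`-modules over `k` (linear species). -/
def FBMod (k : Type u) [CommRing k] : Type (u + 1) := FB ⥤ ModuleCat.{u} k

namespace FBMod

variable {k : Type u} [CommRing k]

instance : Category (FBMod k) := inferInstanceAs (Category (FB ⥤ ModuleCat.{u} k))
instance : Preadditive (FBMod k) := inferInstanceAs (Preadditive (FB ⥤ ModuleCat.{u} k))
instance : Linear k (FBMod k) := inferInstanceAs (Linear k (FB ⥤ ModuleCat.{u} k))

/-- The functor underlying an `FB`-module. -/
abbrev toFunctor (M : FBMod k) : FB ⥤ ModuleCat.{u} k := M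

/-- The value `M(S)` of an `FB`-module on a finite set. -/
abbrev val (M : FBMod k) (S : FB) : Type u := ((M.toFunctor.obj S : ModuleCat.{u} k) : Type u)

/-- The action of a bijection on an `FB`-module. -/
def act (M : FBMod k) {S T : FB} (e : S ≃ T) : M.val S →ₗ[k] M.val T :=
  (M.toFunctor.map (show S ⟶ T from e)).hom

theorem act_refl (M : FBMod k) {S : FB} (x : M.val S) : M.act (Equiv.refl S) x = x := by
  have := congrArg (fun f => ModuleCat.Hom.hom f x) (M.toFunctor.map_id S)
  exact this

theorem act_act (M : FBMod k) {S T U : FB} (e : S ≃ T) (f : T ≃ U) (x : M.val S) :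
    M.act f (M.act e x) = M.act (e.trans f) x := by
  have := congrArg (fun f => ModuleCat.Hom.hom f x)
    (M.toFunctor.map_comp (show S ⟶ T from e) (show T ⟶ U from f))
  exact this.symm

/-- The component at `S` of a map of `FB`-modules. -/
def app {M N : FBMod k} (f : M ⟶ N) (S : FB) : M.val S →ₗ[k] N.val S :=
  (NatTrans.app f S).hom

theorem app_act {M N : FBMod k} (f : M ⟶ N) {S T : FB} (e : S ≃ T) (x : M.val S) :
    app f T (M.act e x) = N.act e (app f S x) := by
  have := congrArg (fun g => ModuleCat.Hom.hom g x) (NatTrans.naturality f (show S ⟶ T from e))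
  exact this

@[simp] theorem app_comp {M N P : FBMod k} (f : M ⟶ N) (g : N ⟶ P) (S : FB) (x : M.val S) :
    app (f ≫ g) S x = app g S (app f S x) := rfl

@[simp] theorem app_id {M : FBMod k} (S : FB) (x : M.val S) : app (𝟙 M) S x = x := rfl

theorem hom_ext {M N : FBMod k} {f g : M ⟶ N} (h : ∀ S, app f S = app g S) : f = g := by
  apply NatTrans.ext
  funext S
  exact ModuleCat.hom_ext (h S)

/-- An `FB`-module from linear maps satisfying the axioms of a functor. -/
def mk' (V : FB → Type u) [∀ S, AddCommGroup (V S)] [∀ S, Module k (V S)]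
    (act : ∀ {S T : FB}, (S ≃ T) → (V S →ₗ[k] V T))
    (act_refl : ∀ {S : FB} (x : V S), act (Equiv.refl S) x = x)
    (act_act : ∀ {S T U : FB} (e : S ≃ T) (f : T ≃ U) (x : V S),
      act f (act e x) = act (e.trans f) x) : FBMod k :=
  show FB ⥤ ModuleCat.{u} k from
  { obj := fun S => ModuleCat.of k (V S)
    map := fun e => ModuleCat.ofHom (act e)
    map_id := fun S => by ext x; exact act_refl x
    map_comp := fun e f => by ext x; exact (act_act e f x).symm }

/-- A map of `FB`-modules from a natural family of linear maps. -/
def mkHom {M N : FBMod k} (f : ∀ S, M.val S →ₗ[k] N.val S)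
    (h : ∀ {S T : FB} (e : S ≃ T) (x : M.val S), f T (M.act e x) = N.act e (f S x)) : M ⟶ N :=
  show NatTrans _ _ from
  { app := fun S => ModuleCat.ofHom (f S)
    naturality := fun S T e => by ext x; exact h e x }

@[simp] theorem app_mkHom {M N : FBMod k} (f : ∀ S, M.val S →ₗ[k] N.val S)
    (h : ∀ {S T : FB} (e : S ≃ T) (x : M.val S), f T (M.act e x) = N.act e (f S x)) (S : FB) :
    app (mkHom f h) S = f S := rfl

/-- The tensor product of `FB`-modules: `(M ⊗ N)(S)` is the direct sum over the subsets `A` of `S`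
of `M(A) ⊗ N(S \ A)`, realized as a finite product. -/
def tensor (M N : FBMod k) : FBMod k :=
  mk' (fun S => ∀ A : Set S, M.val (S.sub A) ⊗[k] N.val (S.sub Aᶜ))
    (fun {S T} e => LinearMap.pi fun B : Set T =>
      (TensorProduct.map
        (M.act (FB.restr e (A := e ⁻¹' B) (B := B) fun _ => Iff.rfl))
        (N.act (FB.restr e (A := (e ⁻¹' B)ᶜ) (B := Bᶜ) fun _ => Iff.rfl))) ∘ₗ
        LinearMap.proj (e ⁻¹' B))
    (fun {S} x => by
      funext B
      have h1 : M.act (FB.restr (Equiv.refl S) (A := B) (B := B) fun _ => Iff.rfl)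
          = LinearMap.id := by ext y; exact M.act_refl y
      have h2 : N.act (FB.restr (Equiv.refl S) (A := Bᶜ) (B := Bᶜ) fun _ => Iff.rfl)
          = LinearMap.id := by ext y; exact N.act_refl y
      refine (congrArg (fun f => f (x B)) (congrArg₂ TensorProduct.map h1 h2)).trans ?_
      simp)
    (fun {S T U} e f x => by
      funext B
      simp only [LinearMap.pi_apply, LinearMap.comp_apply, LinearMap.proj_apply]
      rw [← LinearMap.comp_apply, ← TensorProduct.map_comp]
      refine congrArg₂ (fun g g' => TensorProduct.map g g' (x (e ⁻¹' (f ⁻¹' B)))) ?_ ?_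
      · ext y; exact M.act_act _ _ y
      · ext y; exact N.act_act _ _ y)

/-- The elementary tensor `x ⊗ y` in the summand of `(M ⊗ N)(S)` indexed by `A`. -/
def el {M N : FBMod k} {S : FB} (A : Set S) (x : M.val (S.sub A)) (y : N.val (S.sub Aᶜ)) :
    (tensor M N).val S :=
  Pi.single (M := fun A : Set S => M.val (S.sub A) ⊗[k] N.val (S.sub Aᶜ))
    A (x ⊗ₜ[k] y)

theorem act_el {M N : FBMod k} {S T : FB} (e : S ≃ T) {A : Set S} {B : Set T}
    (h : ∀ s, s ∈ A ↔ e s ∈ B) (x : M.val (S.sub A)) (y : N.val (S.sub Aᶜ)) :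
    (tensor M N).act e (el A x y) =
      el B (M.act (FB.restr e h) x) (N.act (FB.restr e (FB.mem_compl_congr _ h)) y) := by
  obtain rfl : A = e ⁻¹' B := Set.ext h
  funext C
  change TensorProduct.map _ _ (el (e ⁻¹' B) x y (e ⁻¹' C)) = el B _ _ C
  unfold el
  by_cases hC : C = B
  · subst hC
    simp only [Pi.single_eq_same]
    exact TensorProduct.map_tmul _ _ _ _
  · rw [Pi.single_eq_of_ne hC, Pi.single_eq_of_ne, map_zero]
    intro h'
    exact hC (e.surjective.preimage_injective h')

theorem act_el_eq {M N : FBMod k} {S T : FB} (e : S ≃ T) {A : Set S} {B : Set T}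
    {x : M.val (S.sub A)} {y : N.val (S.sub Aᶜ)}
    {x' : M.val (T.sub B)} {y' : N.val (T.sub Bᶜ)}
    (h : ∀ s, s ∈ A ↔ e s ∈ B)
    (hx : M.act (FB.restr e h) x = x')
    (hy : N.act (FB.restr e (FB.mem_compl_congr _ h)) y = y') :
    (tensor M N).act e (el A x y) = el B x' y' := by
  rw [act_el e h, hx, hy]

theorem el_eq {M N : FBMod k} {S : FB} {A B : Set S}
    {x : M.val (S.sub A)} {y : N.val (S.sub Aᶜ)}
    {x' : M.val (S.sub B)} {y' : N.val (S.sub Bᶜ)}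
    (h : ∀ s, s ∈ A ↔ s ∈ B)
    (hx : M.act (FB.restr (Equiv.refl S) h) x = x')
    (hy : N.act (FB.restr (Equiv.refl S) (FB.mem_compl_congr (Equiv.refl S) h)) y = y') :
    (el A x y : (tensor M N).val S) = el B x' y' := by
  rw [← act_el_eq (Equiv.refl S) h hx hy, act_refl]

/-- The linear map out of `(M ⊗ N)(S)` with given restrictions to the summands. -/
def desc {M N : FBMod k} {S : FB} {Q : Type u} [AddCommGroup Q] [Module k Q]
    (φ : ∀ A : Set S, M.val (S.sub A) ⊗[k] N.val (S.sub Aᶜ) →ₗ[k] Q) :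
    (tensor M N).val S →ₗ[k] Q :=
  LinearMap.lsum k (fun A : Set S => M.val (S.sub A) ⊗[k] N.val (S.sub Aᶜ)) k φ

@[simp] theorem desc_el {M N : FBMod k} {S : FB} {Q : Type u} [AddCommGroup Q] [Module k Q]
    (φ : ∀ A : Set S, M.val (S.sub A) ⊗[k] N.val (S.sub Aᶜ) →ₗ[k] Q)
    (A : Set S) (x : M.val (S.sub A)) (y : N.val (S.sub Aᶜ)) :
    desc φ (el A x y) = φ A (x ⊗ₜ y) := by
  unfold desc el
  exact LinearMap.lsum_piSingle k _ k φ A (x ⊗ₜ y)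

theorem tensor_ext {M N : FBMod k} {S : FB} {Q : Type u} [AddCommGroup Q] [Module k Q]
    {f g : (tensor M N).val S →ₗ[k] Q}
    (h : ∀ (A : Set S) (x : M.val (S.sub A)) (y : N.val (S.sub Aᶜ)),
      f (el A x y) = g (el A x y)) : f = g := by
  apply LinearMap.pi_ext'
  intro A
  apply TensorProduct.ext'
  intro x y
  exact h A x y

/-- The inclusion of the summand indexed by `A`. -/
def elL (M N : FBMod k) {S : FB} (A : Set S) :
    M.val (S.sub A) ⊗[k] N.val (S.sub Aᶜ) →ₗ[k] (tensor M N).val S :=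
  LinearMap.single k
    (fun A : Set S => M.val (S.sub A) ⊗[k] N.val (S.sub Aᶜ)) A

@[simp] theorem elL_tmul {M N : FBMod k} {S : FB} (A : Set S) (x : M.val (S.sub A))
    (y : N.val (S.sub Aᶜ)) : elL M N A (x ⊗ₜ y) = el A x y := rfl


theorem act_congr (M : FBMod k) {S T : FB} {e f : S ≃ T} (h : ∀ s, e s = f s) (x : M.val S) :
    M.act e x = M.act f x := by
  rw [Equiv.ext h]

theorem tensor_ext_left {M N P : FBMod k} {S : FB} {Q : Type u} [AddCommGroup Q] [Module k Q]
    {f g : (tensor (tensor M N) P).val S →ₗ[k] Q}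
    (h : ∀ (T : Set S) (U : Set (S.sub T)) (x : M.val ((S.sub T).sub U))
      (y : N.val ((S.sub T).sub Uᶜ)) (z : P.val (S.sub Tᶜ)),
      f (el T (el U x y : (tensor M N).val (S.sub T)) z) =
        g (el T (el U x y : (tensor M N).val (S.sub T)) z)) : f = g := by
  apply tensor_ext
  intro T w z
  have : f ∘ₗ elL (tensor M N) P T ∘ₗ (TensorProduct.mk k _ _).flip z =
      g ∘ₗ elL (tensor M N) P T ∘ₗ (TensorProduct.mk k _ _).flip z :=
    tensor_ext fun U x y => h T U x y z
  exact LinearMap.congr_fun this w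

theorem tensor_ext_right {M N P : FBMod k} {S : FB} {Q : Type u} [AddCommGroup Q] [Module k Q]
    {f g : (tensor M (tensor N P)).val S →ₗ[k] Q}
    (h : ∀ (T : Set S) (U : Set (S.sub Tᶜ)) (x : M.val (S.sub T))
      (y : N.val ((S.sub Tᶜ).sub U)) (z : P.val ((S.sub Tᶜ).sub Uᶜ)),
      f (el T x (el U y z : (tensor N P).val (S.sub Tᶜ))) =
        g (el T x (el U y z : (tensor N P).val (S.sub Tᶜ)))) : f = g := by
  apply tensor_ext
  intro T x w
  have : f ∘ₗ elL M (tensor N P) T ∘ₗ (TensorProduct.mk k _ _) x =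
      g ∘ₗ elL M (tensor N P) T ∘ₗ (TensorProduct.mk k _ _) x :=
    tensor_ext fun U y z => h T U x y z
  exact LinearMap.congr_fun this w

/-- The tensor product of two maps of `FB`-modules. -/
def tensorMap {M M' N N' : FBMod k} (f : M ⟶ M') (g : N ⟶ N') : tensor M N ⟶ tensor M' N' :=
  mkHom (fun S => LinearMap.pi fun A : Set S =>
      TensorProduct.map (app f (S.sub A)) (app g (S.sub Aᶜ)) ∘ₗ LinearMap.proj A)
    (by
      intro S T e x
      funext B
      change TensorProduct.map _ _ (TensorProduct.map _ _ (x (e ⁻¹' B))) =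
        TensorProduct.map _ _ (TensorProduct.map _ _ (x (e ⁻¹' B)))
      simp only [← LinearMap.comp_apply, ← TensorProduct.map_comp]
      refine congrArg₂ (fun g g' => TensorProduct.map g g' (x (e ⁻¹' B))) ?_ ?_
      · ext y; exact app_act f _ y
      · ext y; exact app_act g _ y)

@[simp] theorem tensorMap_el {M M' N N' : FBMod k} (f : M ⟶ M') (g : N ⟶ N') {S : FB} (A : Set S)
    (x : M.val (S.sub A)) (y : N.val (S.sub Aᶜ)) :
    app (tensorMap f g) S (el A x y) = el A (app f _ x) (app g _ y) := by
  funext B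
  change TensorProduct.map _ _ (el A x y B) = _
  unfold el
  by_cases hB : B = A
  · subst hB
    simp only [Pi.single_eq_same]
    exact TensorProduct.map_tmul _ _ _ _
  · rw [Pi.single_eq_of_ne hB, Pi.single_eq_of_ne hB, map_zero]

/-- A subset of a subset. -/
def inner {S : FB} {T : Set S} (U : Set (S.sub T)) : Set S := {s | ∃ h : s ∈ T, ⟨s, h⟩ ∈ U}

/-- The trace of a subset on a subset. -/
def trace {S : FB} (A T : Set S) : Set (S.sub A) := {s | s.1 ∈ T}

/-- The union of `A` with a subset of the complement of `A`. -/
def join {S : FB} (A : Set S) (B : Set (S.sub Aᶜ)) : Set S := {s | s ∈ A ∨ s ∈ inner B}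

@[simp] theorem mem_inner {S : FB} {T : Set S} (U : Set (S.sub T)) (s : S) :
    s ∈ inner U ↔ ∃ h : s ∈ T, (⟨s, h⟩ : S.sub T) ∈ U := Iff.rfl

@[simp] theorem mem_trace {S : FB} (A T : Set S) (s : S.sub A) : s ∈ trace A T ↔ s.1 ∈ T := Iff.rfl

@[simp] theorem mem_join {S : FB} (A : Set S) (B : Set (S.sub Aᶜ)) (s : S) :
    s ∈ join A B ↔ s ∈ A ∨ s ∈ inner B := Iff.rfl

def assocEquiv₁ {S : FB} {T : Set S} (U : Set (S.sub T)) :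
    (S.sub T).sub U ≃ S.sub (inner U) where
  toFun s := ⟨s.1.1, s.1.2, s.2⟩
  invFun s := ⟨⟨s.1, s.2.choose⟩, s.2.choose_spec⟩
  left_inv _ := rfl
  right_inv _ := rfl

def assocEquiv₂ {S : FB} {T : Set S} (U : Set (S.sub T)) :
    (S.sub T).sub Uᶜ ≃ (S.sub (inner U)ᶜ).sub (trace _ T) where
  toFun s := ⟨⟨s.1.1, fun h => s.2 h.choose_spec⟩, s.1.2⟩
  invFun s := ⟨⟨s.1.1, s.2⟩, fun h => s.1.2 ⟨s.2, h⟩⟩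
  left_inv _ := rfl
  right_inv _ := rfl

def assocEquiv₃ {S : FB} {T : Set S} (U : Set (S.sub T)) :
    S.sub Tᶜ ≃ (S.sub (inner U)ᶜ).sub (trace _ T)ᶜ where
  toFun s := ⟨⟨s.1, fun h => s.2 h.choose⟩, s.2⟩
  invFun s := ⟨s.1.1, s.2⟩
  left_inv _ := rfl
  right_inv _ := rfl

def assocEquiv₁' {S : FB} {A : Set S} (B : Set (S.sub Aᶜ)) :
    S.sub A ≃ (S.sub (join A B)).sub (trace _ A) where
  toFun s := ⟨⟨s.1, Or.inl s.2⟩, s.2⟩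
  invFun s := ⟨s.1.1, s.2⟩
  left_inv _ := rfl
  right_inv _ := rfl

def assocEquiv₂' {S : FB} {A : Set S} (B : Set (S.sub Aᶜ)) :
    (S.sub Aᶜ).sub B ≃ (S.sub (join A B)).sub (trace _ A)ᶜ where
  toFun s := ⟨⟨s.1.1, Or.inr ⟨s.1.2, s.2⟩⟩, s.1.2⟩
  invFun s := ⟨⟨s.1.1, s.2⟩, (s.1.2.resolve_left s.2).choose_spec⟩
  left_inv _ := rfl
  right_inv _ := rfl

def assocEquiv₃' {S : FB} {A : Set S} (B : Set (S.sub Aᶜ)) :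
    (S.sub Aᶜ).sub Bᶜ ≃ S.sub (join A B)ᶜ where
  toFun s := ⟨s.1.1, fun h => h.elim s.1.2 fun h => s.2 h.choose_spec⟩
  invFun s := ⟨⟨s.1, fun h => s.2 (Or.inl h)⟩, fun h => s.2 (Or.inr ⟨_, h⟩)⟩
  left_inv _ := rfl
  right_inv _ := rfl

/-- The components of the associator. -/
def assocApp (M N P : FBMod k) (S : FB) :
    (tensor (tensor M N) P).val S →ₗ[k] (tensor M (tensor N P)).val S :=
  desc fun T => TensorProduct.lift <| desc fun U => TensorProduct.curry <|
    elL M (tensor N P) (inner U) ∘ₗ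
      TensorProduct.map (M.act (assocEquiv₁ U))
        (elL N P (trace _ T) ∘ₗ
          TensorProduct.map (N.act (assocEquiv₂ U)) (P.act (assocEquiv₃ U))) ∘ₗ
      (TensorProduct.assoc k _ _ _).toLinearMap

@[simp] theorem assocApp_el (M N P : FBMod k) {S : FB} (T : Set S) (U : Set (S.sub T))
    (x : M.val ((S.sub T).sub U)) (y : N.val ((S.sub T).sub Uᶜ)) (z : P.val (S.sub Tᶜ)) :
    assocApp M N P S (el T (el U x y : (tensor M N).val (S.sub T)) z) =
      el (inner U) (M.act (assocEquiv₁ U) x)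
        (el (trace _ T) (N.act (assocEquiv₂ U) y) (P.act (assocEquiv₃ U) z) :
          (tensor N P).val (S.sub (inner U)ᶜ)) := by
  unfold assocApp
  rw [desc_el, TensorProduct.lift.tmul, desc_el, TensorProduct.curry_apply]
  rfl

/-- The components of the inverse associator. -/
def assocInvApp (M N P : FBMod k) (S : FB) :
    (tensor M (tensor N P)).val S →ₗ[k] (tensor (tensor M N) P).val S :=
  desc fun A => TensorProduct.lift <| LinearMap.flip <| desc fun B =>
    LinearMap.flip <| TensorProduct.curry <|
      elL (tensor M N) P (join A B) ∘ₗ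
        TensorProduct.map (elL M N (trace _ A) ∘ₗ
            TensorProduct.map (M.act (assocEquiv₁' B)) (N.act (assocEquiv₂' B)))
          (P.act (assocEquiv₃' B)) ∘ₗ
        (TensorProduct.assoc k _ _ _).symm.toLinearMap

@[simp] theorem assocInvApp_el (M N P : FBMod k) {S : FB} (A : Set S) (B : Set (S.sub Aᶜ))
    (x : M.val (S.sub A)) (y : N.val ((S.sub Aᶜ).sub B)) (z : P.val ((S.sub Aᶜ).sub Bᶜ)) :
    assocInvApp M N P S (el A x (el B y z : (tensor N P).val (S.sub Aᶜ))) =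
      el (join A B) (el (trace _ A) (M.act (assocEquiv₁' B) x) (N.act (assocEquiv₂' B) y) :
          (tensor M N).val (S.sub (join A B))) (P.act (assocEquiv₃' B) z) := by
  unfold assocInvApp
  rw [desc_el, TensorProduct.lift.tmul, LinearMap.flip_apply, desc_el,
    LinearMap.flip_apply, TensorProduct.curry_apply]
  rfl

theorem exists_image {S T : FB} (e : S ≃ T) (A : Set S) : ∃ B : Set T, ∀ s, s ∈ A ↔ e s ∈ B :=
  ⟨e '' A, fun _ => e.injective.mem_set_image.symm⟩

/-- The associator. -/
def assoc (M N P : FBMod k) : tensor (tensor M N) P ≅ tensor M (tensor N P) where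
  hom := mkHom (assocApp M N P) (by
    intro S T e w
    refine LinearMap.congr_fun (f := assocApp M N P T ∘ₗ act _ e)
      (g := act _ e ∘ₗ assocApp M N P S) (tensor_ext_left fun A B x y z => ?_) w
    obtain ⟨A', h⟩ := exists_image e A
    obtain ⟨B', h'⟩ := exists_image (FB.restr e h) B
    simp only [LinearMap.comp_apply]
    rw [act_el e h, act_el _ h', assocApp_el, assocApp_el]
    refine (act_el_eq _ ?_ ?_ (act_el_eq _ (fun s => h s.1) ?_ ?_)).symm
    · exact fun s => ⟨fun ⟨h1, h2⟩ => ⟨(h s).1 h1, (h' _).1 h2⟩,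
        fun ⟨h1, h2⟩ => ⟨(h s).2 h1, (h' ⟨s, (h s).2 h1⟩).2 h2⟩⟩
    · simp only [act_act]; exact M.act_congr (fun s => rfl) _
    · simp only [act_act]; exact N.act_congr (fun s => rfl) _
    · simp only [act_act]; exact P.act_congr (fun s => rfl) _)
  inv := mkHom (assocInvApp M N P) (by
    intro S T e w
    refine LinearMap.congr_fun (f := assocInvApp M N P T ∘ₗ act _ e)
      (g := act _ e ∘ₗ assocInvApp M N P S) (tensor_ext_right fun A B x y z => ?_) w
    obtain ⟨A', h⟩ := exists_image e A
    obtain ⟨B', h'⟩ := exists_image (FB.restr e (FB.mem_compl_congr e h)) B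
    simp only [LinearMap.comp_apply]
    rw [act_el e h, act_el _ h', assocInvApp_el, assocInvApp_el]
    refine (act_el_eq _ ?_ (act_el_eq _ (fun s => h s.1) ?_ ?_) ?_).symm
    · exact fun s => or_congr (h s) ⟨fun ⟨h1, h2⟩ => ⟨fun g => h1 ((h s).2 g), (h' ⟨s, h1⟩).1 h2⟩,
        fun ⟨h1, h2⟩ => ⟨fun g => h1 ((h s).1 g), (h' ⟨s, fun g => h1 ((h s).1 g)⟩).2 h2⟩⟩
    · simp only [act_act]; exact M.act_congr (fun s => rfl) _
    · simp only [act_act]; exact N.act_congr (fun s => rfl) _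
    · simp only [act_act]; exact P.act_congr (fun s => rfl) _)
  hom_inv_id := hom_ext fun S => tensor_ext_left fun A B x y z => by
    simp only [app_comp, app_id, app_mkHom, assocApp_el, assocInvApp_el]
    refine el_eq ?_ (act_el_eq _ ?_ ?_ ?_) ?_
    · intro s
      by_cases hs : s ∈ inner B
      · exact ⟨fun _ => hs.choose, fun _ => Or.inl hs⟩
      · exact ⟨fun h => (h.resolve_left hs).choose_spec, fun h => Or.inr ⟨hs, h⟩⟩
    · exact fun s => ⟨fun h => h.choose_spec, fun h => ⟨_, h⟩⟩
    · simp only [act_act]; exact M.act_refl x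
    · simp only [act_act]; exact N.act_refl y
    · simp only [act_act]; exact P.act_refl z
  inv_hom_id := hom_ext fun S => tensor_ext_right fun A B x y z => by
    simp only [app_comp, app_id, app_mkHom, assocApp_el, assocInvApp_el]
    refine el_eq ?_ ?_ (act_el_eq _ ?_ ?_ ?_)
    · exact fun s => ⟨fun h => h.choose_spec, fun h => ⟨Or.inl h, h⟩⟩
    · simp only [act_act]; exact M.act_refl x
    · exact fun s => ⟨fun h => (h.resolve_left fun g => s.2 ⟨Or.inl g, g⟩).choose_spec,
        fun h => Or.inr ⟨_, h⟩⟩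
    · simp only [act_act]; exact N.act_refl y
    · simp only [act_act]; exact P.act_refl z

/-- The `FB`-module which is `k` on the sets of cardinality `n` and `0` on all other sets.
For `n = 0` this is the unit object; for `n = 1` it is the standard `FB`-module `V`;
in general it is the `n`th symmetric power of `V`. -/
def symPow (k : Type u) [CommRing k] (n : ℕ) : FBMod k :=
  mk' (fun S => PLift (Nat.card S = n) → k)
    (fun e => LinearMap.pi fun h => LinearMap.proj ⟨(Nat.card_congr e).trans h.down⟩)
    (fun _ => rfl) (fun _ _ _ => rfl)

/-- The `FB`-module which is `k` on all sets (with trivial action of bijections). -/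
def const (k : Type u) [CommRing k] : FBMod k :=
  mk' (fun _ => k) (fun _ => LinearMap.id) (fun _ => rfl) (fun _ _ _ => rfl)

theorem card_eq_zero {S : FB} {A : Set S} (h : ∀ s, s ∉ A) : Nat.card (S.sub A) = 0 :=
  Nat.card_eq_zero.2 (Or.inl ⟨fun s => h s.1 s.2⟩)

theorem eq_zero {S : FB} {A : Set S} (h : ¬ ∀ s, s ∉ A) (u : (symPow k 0).val (S.sub A)) :
    u = 0 := by
  funext g
  exfalso
  push Not at h
  obtain ⟨s, hs⟩ := h
  have : Nonempty (S.sub A) := ⟨⟨s, hs⟩⟩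
  exact (Nat.card_pos (α := S.sub A)).ne' g.down

theorem el_zero_left {M N : FBMod k} {S : FB} (A : Set S) (y : N.val (S.sub Aᶜ)) :
    (el A 0 y : (tensor M N).val S) = 0 := by
  rw [← elL_tmul, TensorProduct.zero_tmul, map_zero]

theorem el_zero_right {M N : FBMod k} {S : FB} (A : Set S) (x : M.val (S.sub A)) :
    (el A x 0 : (tensor M N).val S) = 0 := by
  rw [← elL_tmul, TensorProduct.tmul_zero, map_zero]

/-- If `A` is all of `S`, then `A ≃ S`. -/
def allEquiv {S : FB} {A : Set S} (h : ∀ s, s ∈ A) : S.sub A ≃ S where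
  toFun s := s.1
  invFun s := ⟨s, h s⟩
  left_inv _ := rfl
  right_inv _ := rfl

/-- The components of the left unitor: project to the summand indexed by the empty set. -/
def leftUnitorApp (M : FBMod k) (S : FB) : (tensor (symPow k 0) M).val S →ₗ[k] M.val S :=
  TensorProduct.lift ((LinearMap.lsmul k (M.val S)).compl₁₂
      (LinearMap.proj ⟨card_eq_zero (A := (∅ : Set S)) fun _ h => h⟩)
      (M.act (allEquiv (A := (∅ : Set S)ᶜ) fun _ h => h))) ∘ₗ
    LinearMap.proj (∅ : Set S)

theorem leftUnitorApp_el (M : FBMod k) {S : FB} {A : Set S} (h : ∀ s, s ∉ A)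
    (u : (symPow k 0).val (S.sub A)) (x : M.val (S.sub Aᶜ)) :
    leftUnitorApp M S (el A u x) = u ⟨card_eq_zero h⟩ • M.act (allEquiv (A := Aᶜ) h) x := by
  obtain rfl : A = ∅ := Set.eq_empty_iff_forall_notMem.2 h
  change TensorProduct.lift _ (el ∅ u x ∅) = _
  unfold el
  rw [Pi.single_eq_same]
  rfl

/-- The components of the right unitor: project to the summand indexed by the whole set. -/
def rightUnitorApp (M : FBMod k) (S : FB) : (tensor M (symPow k 0)).val S →ₗ[k] M.val S :=
  TensorProduct.lift (((LinearMap.lsmul k (M.val S)).flip).compl₁₂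
      (M.act (allEquiv (A := (Set.univ : Set S)) fun s => Set.mem_univ s))
      (LinearMap.proj ⟨card_eq_zero (A := (Set.univ : Set S)ᶜ) fun _ h => h trivial⟩)) ∘ₗ
    LinearMap.proj (Set.univ : Set S)

theorem rightUnitorApp_el (M : FBMod k) {S : FB} {A : Set S} (h : ∀ s, s ∈ A)
    (u : (symPow k 0).val (S.sub Aᶜ)) (x : M.val (S.sub A)) :
    rightUnitorApp M S (el A x u) =
      u ⟨card_eq_zero fun s hs => hs (h s)⟩ • M.act (allEquiv h) x := by
  obtain rfl : A = Set.univ := Set.eq_univ_iff_forall.2 h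
  change TensorProduct.lift _ (el Set.univ x u Set.univ) = _
  unfold el
  rw [Pi.single_eq_same]
  rfl


theorem symPow_zero_act {S T : FB} (e : S ≃ T) (u : (symPow k 0).val S) (h : Nat.card T = 0)
    (h' : Nat.card S = 0) : (symPow k 0).act e u ⟨h⟩ = u ⟨h'⟩ := rfl

/-- The distinguished basis vector `t^S` of `Sym^n(V)(S)` for a set `S` of cardinality `n`. -/
def basisVec (k : Type u) [CommRing k] (n : ℕ) (S : FB) : (symPow k n).val S := fun _ => 1

def leftUnitorInvApp (M : FBMod k) (S : FB) : M.val S →ₗ[k] (tensor (symPow k 0) M).val S :=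
  elL (symPow k 0) M (∅ : Set S) ∘ₗ TensorProduct.mk k _ _ (basisVec k 0 _) ∘ₗ
      M.act (allEquiv (A := (∅ : Set S)ᶜ) fun _ h => h).symm

theorem leftUnitorInvApp_apply (M : FBMod k) (S : FB) (x : M.val S) :
    leftUnitorInvApp M S x = el ∅ (basisVec k 0 _)
      (M.act (allEquiv (A := (∅ : Set S)ᶜ) fun _ h => h).symm x) := rfl

def rightUnitorInvApp (M : FBMod k) (S : FB) : M.val S →ₗ[k] (tensor M (symPow k 0)).val S :=
  elL M (symPow k 0) (Set.univ : Set S) ∘ₗ (TensorProduct.mk k _ _).flip (basisVec k 0 _) ∘ₗ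
      M.act (allEquiv (A := (Set.univ : Set S)) fun s => Set.mem_univ s).symm

theorem rightUnitorInvApp_apply (M : FBMod k) (S : FB) (x : M.val S) :
    rightUnitorInvApp M S x = el Set.univ
      (M.act (allEquiv (A := (Set.univ : Set S)) fun s => Set.mem_univ s).symm x)
      (basisVec k 0 _) := rfl

theorem smul_el {M N : FBMod k} {S : FB} (A : Set S) (c : k) (x : M.val (S.sub A))
    (y : N.val (S.sub Aᶜ)) : (c • el A x y : (tensor M N).val S) = el A (c • x) y := by
  rw [← elL_tmul, ← map_smul, TensorProduct.smul_tmul', elL_tmul]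

theorem smul_el' {M N : FBMod k} {S : FB} (A : Set S) (c : k) (x : M.val (S.sub A))
    (y : N.val (S.sub Aᶜ)) : (c • el A x y : (tensor M N).val S) = el A x (c • y) := by
  rw [← elL_tmul, ← map_smul, ← TensorProduct.tmul_smul, elL_tmul]

/-- The left unitor. -/
def leftUnitor (M : FBMod k) : tensor (symPow k 0) M ≅ M where
  hom := mkHom (leftUnitorApp M) (by
    intro S T e w
    refine LinearMap.congr_fun (f := leftUnitorApp M T ∘ₗ act _ e)
      (g := act _ e ∘ₗ leftUnitorApp M S) (tensor_ext fun A u x => ?_) w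
    obtain ⟨B, h⟩ := exists_image e A
    by_cases hA : ∀ s, s ∉ A
    · have hB : ∀ s, s ∉ B := fun t ht => hA (e.symm t) ((h _).2 (by simpa using ht))
      simp only [LinearMap.comp_apply]
      rw [act_el e h, leftUnitorApp_el M hA, leftUnitorApp_el M hB, map_smul]
      simp only [act_act]
      congr 1
    · rw [eq_zero hA u, el_zero_left, map_zero, map_zero])
  inv := mkHom (leftUnitorInvApp M) (by
    intro S T e x
    rw [leftUnitorInvApp_apply, leftUnitorInvApp_apply]
    symm
    refine act_el_eq (M := symPow k 0) e (fun _ => Iff.rfl) rfl ?_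
    simp only [act_act]; exact M.act_congr (fun s => rfl) x)
  hom_inv_id := hom_ext fun S => tensor_ext fun A u x => by
    by_cases hA : ∀ s, s ∉ A
    · simp only [app_comp, app_id, app_mkHom]
      rw [leftUnitorApp_el M hA, map_smul, leftUnitorInvApp_apply, smul_el]
      refine el_eq (fun s => ⟨fun h => h.elim, fun h => hA s h⟩) ?_ ?_
      · funext g
        exact mul_one (_ : k)
      · simp only [act_act]; exact M.act_refl x
    · rw [eq_zero hA u, el_zero_left, map_zero, map_zero]
  inv_hom_id := hom_ext fun S => LinearMap.ext fun x => by
    simp only [app_comp, app_id, app_mkHom]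
    rw [leftUnitorInvApp_apply, leftUnitorApp_el M (A := (∅ : Set S)) fun _ h => h, act_act]
    refine (one_smul k _).trans (M.act_refl x)

/-- The right unitor. -/
def rightUnitor (M : FBMod k) : tensor M (symPow k 0) ≅ M where
  hom := mkHom (rightUnitorApp M) (by
    intro S T e w
    refine LinearMap.congr_fun (f := rightUnitorApp M T ∘ₗ act _ e)
      (g := act _ e ∘ₗ rightUnitorApp M S) (tensor_ext fun A x u => ?_) w
    obtain ⟨B, h⟩ := exists_image e A
    by_cases hA : ∀ s, s ∉ Aᶜ
    · have hA' : ∀ s, s ∈ A := fun s => not_not.1 (hA s)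
      have hB : ∀ s, s ∈ B := fun t => by simpa using (h (e.symm t)).1 (hA' _)
      simp only [LinearMap.comp_apply]
      rw [act_el e h, rightUnitorApp_el M hA', rightUnitorApp_el M hB, map_smul]
      simp only [act_act]
      congr 1
    · rw [eq_zero hA u, el_zero_right, map_zero, map_zero])
  inv := mkHom (rightUnitorInvApp M) (by
    intro S T e x
    rw [rightUnitorInvApp_apply, rightUnitorInvApp_apply]
    symm
    refine act_el_eq (N := symPow k 0) e (fun _ => Iff.rfl) ?_ rfl
    simp only [act_act]; exact M.act_congr (fun s => rfl) x)
  hom_inv_id := hom_ext fun S => tensor_ext fun A x u => by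
    by_cases hA : ∀ s, s ∉ Aᶜ
    · have hA' : ∀ s, s ∈ A := fun s => not_not.1 (hA s)
      simp only [app_comp, app_id, app_mkHom]
      rw [rightUnitorApp_el M hA', map_smul, rightUnitorInvApp_apply, smul_el']
      refine el_eq (fun s => ⟨fun _ => hA' s, fun _ => trivial⟩) ?_ ?_
      · simp only [act_act]; exact M.act_refl x
      · funext g
        exact mul_one (_ : k)
    · rw [eq_zero hA u, el_zero_right, map_zero, map_zero]
  inv_hom_id := hom_ext fun S => LinearMap.ext fun x => by
    simp only [app_comp, app_id, app_mkHom]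
    rw [rightUnitorInvApp_apply, rightUnitorApp_el M fun s => Set.mem_univ s, act_act]
    refine (one_smul k _).trans (M.act_refl x)

theorem complCompl {S : FB} (A : Set S) (s : S) : s ∈ A ↔ Equiv.refl S s ∈ Aᶜᶜ := not_not.symm

/-- The components of the braiding: switch the two tensor factors. -/
def braidingApp (M N : FBMod k) (S : FB) : (tensor M N).val S →ₗ[k] (tensor N M).val S :=
  desc fun A => elL N M Aᶜ ∘ₗ
    TensorProduct.map LinearMap.id (M.act (FB.restr (Equiv.refl S) (complCompl A))) ∘ₗ
      (TensorProduct.comm k _ _).toLinearMap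

@[simp] theorem braidingApp_el (M N : FBMod k) {S : FB} (A : Set S) (x : M.val (S.sub A))
    (y : N.val (S.sub Aᶜ)) : braidingApp M N S (el A x y) =
      el Aᶜ y (M.act (FB.restr (Equiv.refl S) (complCompl A)) x) := by
  unfold braidingApp
  rw [desc_el]
  rfl

theorem braiding_braiding (M N : FBMod k) {S : FB} (w : (tensor M N).val S) :
    braidingApp N M S (braidingApp M N S w) = w := by
  refine LinearMap.congr_fun (f := braidingApp N M S ∘ₗ braidingApp M N S) (g := LinearMap.id)
    (tensor_ext fun A x y => ?_) w
  simp only [LinearMap.comp_apply, LinearMap.id_apply, braidingApp_el]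
  refine el_eq (fun s => (complCompl A s).symm) ?_ ?_
  · simp only [act_act]; exact M.act_refl x
  · simp only [act_act]; exact N.act_refl y

theorem braidingApp_act (M N : FBMod k) {S T : FB} (e : S ≃ T) (w : (tensor M N).val S) :
    braidingApp M N T (act _ e w) = act _ e (braidingApp M N S w) := by
  refine LinearMap.congr_fun (f := braidingApp M N T ∘ₗ act _ e)
    (g := act _ e ∘ₗ braidingApp M N S) (tensor_ext fun A x y => ?_) w
  obtain ⟨B, h⟩ := exists_image e A
  simp only [LinearMap.comp_apply]
  rw [act_el e h, braidingApp_el, braidingApp_el]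
  refine (act_el_eq _ (FB.mem_compl_congr e h) ?_ ?_).symm
  · rfl
  · simp only [act_act]; exact M.act_congr (fun s => rfl) x

/-- The braiding. -/
def braiding (M N : FBMod k) : tensor M N ≅ tensor N M where
  hom := mkHom (braidingApp M N) (braidingApp_act M N)
  inv := mkHom (braidingApp N M) (braidingApp_act N M)
  hom_inv_id := hom_ext fun _ => LinearMap.ext fun w => braiding_braiding M N w
  inv_hom_id := hom_ext fun _ => LinearMap.ext fun w => braiding_braiding N M w

theorem tensor_ext_left₄ {M N P R : FBMod k} {S : FB} {Q : Type u} [AddCommGroup Q] [Module k Q]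
    {f g : (tensor (tensor (tensor M N) P) R).val S →ₗ[k] Q}
    (h : ∀ (T : Set S) (U : Set (S.sub T)) (W : Set ((S.sub T).sub U))
      (w : M.val (((S.sub T).sub U).sub W)) (x : N.val (((S.sub T).sub U).sub Wᶜ))
      (y : P.val ((S.sub T).sub Uᶜ)) (z : R.val (S.sub Tᶜ)),
      f (el T (el U (el W w x : (tensor M N).val ((S.sub T).sub U)) y :
          (tensor (tensor M N) P).val (S.sub T)) z) =
        g (el T (el U (el W w x : (tensor M N).val ((S.sub T).sub U)) y :
          (tensor (tensor M N) P).val (S.sub T)) z)) : f = g := by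
  apply tensor_ext
  intro T w z
  have : f ∘ₗ elL (tensor (tensor M N) P) R T ∘ₗ (TensorProduct.mk k _ _).flip z =
      g ∘ₗ elL (tensor (tensor M N) P) R T ∘ₗ (TensorProduct.mk k _ _).flip z :=
    tensor_ext_left fun U W w x y => h T U W w x y z
  exact LinearMap.congr_fun this w

@[simp] theorem app_assoc_hom (M N P : FBMod k) (S : FB) :
    app (assoc M N P).hom S = assocApp M N P S := rfl
@[simp] theorem app_assoc_inv (M N P : FBMod k) (S : FB) :
    app (assoc M N P).inv S = assocInvApp M N P S := rfl
@[simp] theorem app_leftUnitor_hom (M : FBMod k) (S : FB) :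
    app (leftUnitor M).hom S = leftUnitorApp M S := rfl
@[simp] theorem app_rightUnitor_hom (M : FBMod k) (S : FB) :
    app (rightUnitor M).hom S = rightUnitorApp M S := rfl
@[simp] theorem app_braiding_hom (M N : FBMod k) (S : FB) :
    app (braiding M N).hom S = braidingApp M N S := rfl

theorem mem_symm_preimage {S T : FB} (e : S ≃ T) (A : Set S) (s : S) :
    s ∈ A ↔ e s ∈ e.symm ⁻¹' A := by simp

theorem act_el_symm {M N : FBMod k} {S T : FB} (e : S ≃ T) (A : Set S)
    (x : M.val (S.sub A)) (y : N.val (S.sub Aᶜ)) :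
    (tensor M N).act e (el A x y) =
      el (e.symm ⁻¹' A) (M.act (FB.restr e (mem_symm_preimage e A)) x)
        (N.act (FB.restr e (FB.mem_compl_congr e (mem_symm_preimage e A))) y) :=
  act_el e (mem_symm_preimage e A) x y

instance : MonoidalCategoryStruct (FBMod k) where
  tensorObj := tensor
  whiskerLeft M _ _ f := tensorMap (𝟙 M) f
  whiskerRight f N := tensorMap f (𝟙 N)
  tensorHom f g := tensorMap f g
  tensorUnit := symPow k 0
  associator := assoc
  leftUnitor := leftUnitor
  rightUnitor := rightUnitor

/-- The category of `FB`-modules is monoidal. -/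
instance : MonoidalCategory (FBMod k) := MonoidalCategory.ofTensorHom
  (id_tensorHom_id := fun M N => hom_ext fun S => tensor_ext fun A x y =>
    tensorMap_el (𝟙 M) (𝟙 N) A x y)
  (id_tensorHom := fun _ _ _ _ => rfl)
  (tensorHom_id := fun _ _ => rfl)
  (tensorHom_comp_tensorHom := fun f₁ f₂ g₁ g₂ => hom_ext fun S => tensor_ext fun A x y => by
    change app (tensorMap g₁ g₂) S (app (tensorMap f₁ f₂) S _) = app (tensorMap _ _) S _
    simp only [tensorMap_el, app_comp])
  (associator_naturality := fun f₁ f₂ f₃ => hom_ext fun S => tensor_ext_left fun A B x y z => by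
    change app (assoc _ _ _).hom S (app (tensorMap (tensorMap f₁ f₂) f₃) S _) =
      app (tensorMap f₁ (tensorMap f₂ f₃)) S (app (assoc _ _ _).hom S _)
    simp only [tensorMap_el, app_assoc_hom, assocApp_el, app_act])
  (leftUnitor_naturality := fun {M N} f => hom_ext fun S => tensor_ext fun A u x => by
    change app (leftUnitor N).hom S (app (tensorMap (𝟙 (symPow k 0)) f) S _) =
      app f S (app (leftUnitor M).hom S _)
    by_cases hA : ∀ s, s ∉ A
    · simp only [tensorMap_el, app_leftUnitor_hom, leftUnitorApp_el _ hA, map_smul, app_act,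
        app_id]
    · rw [eq_zero hA u, el_zero_left]; simp only [map_zero])
  (rightUnitor_naturality := fun {M N} f => hom_ext fun S => tensor_ext fun A x u => by
    change app (rightUnitor N).hom S (app (tensorMap f (𝟙 (symPow k 0))) S _) =
      app f S (app (rightUnitor M).hom S _)
    by_cases hA : ∀ s, s ∉ Aᶜ
    · have hA' : ∀ s, s ∈ A := fun s => not_not.1 (hA s)
      simp only [tensorMap_el, app_rightUnitor_hom, rightUnitorApp_el _ hA', map_smul, app_act,
        app_id]
    · rw [eq_zero hA u, el_zero_right]; simp only [map_zero])
  (pentagon := fun M N P R => hom_ext fun S => tensor_ext_left₄ fun A B C w x y z => by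
    change app (tensorMap (𝟙 M) (assoc N P R).hom) S (app (assoc M (tensor N P) R).hom S
        (app (tensorMap (assoc M N P).hom (𝟙 R)) S _)) =
      app (assoc M N (tensor P R)).hom S (app (assoc (tensor M N) P R).hom S _)
    simp only [tensorMap_el, app_assoc_hom, assocApp_el, app_id, act_el_symm]
    refine el_eq ?_ ?_ (act_el_eq _ ?_ ?_ (act_el_eq _ ?_ ?_ ?_))
    · exact fun s => ⟨fun ⟨a, b, c⟩ => ⟨⟨a, b⟩, c⟩, fun ⟨⟨a, b⟩, c⟩ => ⟨a, b, c⟩⟩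
    · simp only [act_act]; exact M.act_congr (fun s => rfl) _
    · exact fun s => ⟨fun ⟨a, b⟩ => ⟨a, b⟩, fun ⟨a, b⟩ => ⟨a, b⟩⟩
    · simp only [act_act]; exact N.act_congr (fun s => rfl) _
    · exact fun s => Iff.rfl
    · simp only [act_act]; exact P.act_congr (fun s => rfl) _
    · simp only [act_act]; exact R.act_congr (fun s => rfl) _)
  (triangle := fun M N => hom_ext fun S => tensor_ext_left fun A B x u y => by
    change app (tensorMap (𝟙 M) (leftUnitor N).hom) S (app (assoc M (symPow k 0) N).hom S _) =
      app (tensorMap (rightUnitor M).hom (𝟙 N)) S _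
    by_cases hB : ∀ s, s ∉ Bᶜ
    · simp only [tensorMap_el, app_assoc_hom, assocApp_el, app_id, app_rightUnitor_hom,
        app_leftUnitor_hom]
      have hB' : ∀ s, s ∈ B := fun s => not_not.1 (hB s)
      rw [rightUnitorApp_el M hB', leftUnitorApp_el N
        (show ∀ s, s ∉ trace (inner B)ᶜ A from fun s (h : s.1 ∈ A) => s.2 ⟨h, hB' _⟩), ← elL_tmul,
        ← elL_tmul, TensorProduct.tmul_smul, TensorProduct.smul_tmul']
      refine el_eq (fun s => ⟨fun h => h.choose, fun h => ⟨h, hB' _⟩⟩) ?_ ?_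
      · rw [map_smul, act_act]
        refine congrArg₂ (· • ·) rfl ?_
        exact M.act_congr (fun s => rfl) x
      · simp only [act_act]; exact N.act_refl y
    · rw [eq_zero hB u, el_zero_right, el_zero_left]; simp only [map_zero])

/-- The category of `FB`-modules is symmetric monoidal. -/
instance : SymmetricCategory (FBMod k) where
  braiding := braiding
  braiding_naturality_right M {N P} f := hom_ext fun S => tensor_ext fun A x y => by
    change app (braiding M P).hom S (app (tensorMap (𝟙 M) f) S _) =
      app (tensorMap f (𝟙 M)) S (app (braiding M N).hom S _)
    simp only [tensorMap_el, app_braiding_hom, braidingApp_el, app_id]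
  braiding_naturality_left {M N} f P := hom_ext fun S => tensor_ext fun A x y => by
    change app (braiding N P).hom S (app (tensorMap f (𝟙 P)) S _) =
      app (tensorMap (𝟙 P) f) S (app (braiding M P).hom S _)
    simp only [tensorMap_el, app_braiding_hom, braidingApp_el, app_id, app_act]
  hexagon_forward M N P := hom_ext fun S => tensor_ext_left fun A B x y z => by
    change app (assoc N P M).hom S (app (braiding M (tensor N P)).hom S
        (app (assoc M N P).hom S _)) =
      app (tensorMap (𝟙 N) (braiding M P).hom) S (app (assoc N M P).hom S
        (app (tensorMap (braiding M N).hom (𝟙 P)) S _))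
    simp only [tensorMap_el, app_assoc_hom, assocApp_el, app_id, app_braiding_hom,
      braidingApp_el]
    refine el_eq ?_ ?_ (act_el_eq _ ?_ ?_ ?_)
    · exact fun s => ⟨fun ⟨h, a⟩ => ⟨a, fun b => h ⟨a, b⟩⟩,
        fun ⟨a, b⟩ => ⟨fun h => b h.choose_spec, a⟩⟩
    · simp only [act_act]; exact N.act_congr (fun s => rfl) _
    · exact fun s => ⟨fun h a => s.2 ⟨h, a⟩, fun h b => h b.choose⟩
    · simp only [act_act]; exact P.act_congr (fun s => rfl) _
    · simp only [act_act]; exact M.act_congr (fun s => rfl) _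
  hexagon_reverse M N P := hom_ext fun S => tensor_ext_right fun A B x y z => by
    change app (assoc P M N).inv S (app (braiding (tensor M N) P).hom S
        (app (assoc M N P).inv S _)) =
      app (tensorMap (braiding M P).hom (𝟙 N)) S (app (assoc M P N).inv S
        (app (tensorMap (𝟙 M) (braiding N P).hom) S _))
    simp only [tensorMap_el, app_assoc_inv, assocInvApp_el, app_id, app_braiding_hom,
      braidingApp_el, act_el_symm]
    refine el_eq ?_ (act_el_eq _ ?_ ?_ ?_) ?_
    · refine fun s => ⟨?_, ?_⟩
      · rintro (h | ⟨_, a⟩)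
        · exact Or.inr ⟨fun a => h (Or.inl a), fun b => h (Or.inr ⟨_, b⟩)⟩
        · exact Or.inl a
      · rintro (a | ⟨h, b⟩)
        · exact Or.inr ⟨not_not_intro (Or.inl a), a⟩
        · exact Or.inl fun g => g.elim h fun g => b g.choose_spec
    · exact fun s => ⟨fun h a => h (Or.inl a), fun h => s.2.resolve_right fun g => h g.choose_spec⟩
    · simp only [act_act]; exact P.act_congr (fun s => rfl) _
    · simp only [act_act]; exact M.act_congr (fun s => rfl) _
    · simp only [act_act]; exact N.act_congr (fun s => rfl) _
  symmetry M N := hom_ext fun S => LinearMap.ext fun w => braiding_braiding M N w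

/-! ### The curried Weyl Lie algebra in linear species -/

/-- The symmetric algebra `Sym(V)` of the standard `FB`-module `V`: its value on every finite set
`S` is free of rank one, with basis vector `t^S` (the element `1`). -/
def symV (k : Type u) [CommRing k] : FBMod k := const k

/-- The divided power algebra `Div(V)` of the standard `FB`-module `V`: its value on every finite
set `S` is free of rank one, with basis vector `t^[S]` (the element `1`). -/
def divV (k : Type u) [CommRing k] : FBMod k := const k

/-- The components of the map `t^A ⊗ t^B ↦ t^(A ∪ B)`. -/
def constMulApp (k : Type u) [CommRing k] (S : FB) :
    (tensor (const k) (const k)).val S →ₗ[k] (const k).val S :=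
  desc (M := const k) (N := const k) (Q := (const k).val S) fun _ => LinearMap.mul' k k

theorem constMulApp_el {S : FB} (A : Set S) (x y : k) :
    constMulApp k S (el (M := const k) (N := const k) A x y) = (x * y : k) :=
  desc_el (M := const k) (N := const k) (Q := (const k).val S)
    (fun _ => LinearMap.mul' k k) A x y

/-- The map `t^A ⊗ t^B ↦ t^(A ∪ B)`. -/
def constMul (k : Type u) [CommRing k] : const k ⊗ const k ⟶ const k :=
  mkHom (M := tensor (const k) (const k)) (constMulApp k) (by
    intro S T e w
    refine LinearMap.congr_fun
      (f := constMulApp k T ∘ₗ act (tensor (const k) (const k)) e)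
      (g := act (const k) e ∘ₗ constMulApp k S)
      (tensor_ext fun A x y => ?_) w
    simp only [LinearMap.comp_apply]
    rw [act_el_symm]
    exact (constMulApp_el (k := k) _ _ _).trans (constMulApp_el (k := k) A x y).symm)

/-- The map `t^S ↦ ∑ t^A ⊗ t^B`, the sum over all `A`, `B` with `S = A ⊔ B`. -/
def constComul (k : Type u) [CommRing k] : const k ⟶ const k ⊗ const k :=
  mkHom (N := tensor (const k) (const k))
    (fun S => LinearMap.pi fun _ => (TensorProduct.mk k k k).flip 1) (by
    intro S T e w
    funext B
    symm
    exact TensorProduct.map_tmul (R := k) (LinearMap.id : k →ₗ[k] k) (LinearMap.id : k →ₗ[k] k)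
      w 1)

/-- Multiplication on `Sym(V)`: `t^A ⊗ t^B ↦ t^(A ∪ B)`. -/
def symMul (k : Type u) [CommRing k] : symV k ⊗ symV k ⟶ symV k := constMul k

/-- Comultiplication on `Sym(V)`: `t^S ↦ ∑ t^A ⊗ t^B`. -/
def symComul (k : Type u) [CommRing k] : symV k ⟶ symV k ⊗ symV k := constComul k

/-- Multiplication on `Div(V)`: `t^[A] ⊗ t^[B] ↦ t^[A ∪ B]`. -/
def divMul (k : Type u) [CommRing k] : divV k ⊗ divV k ⟶ divV k := constMul k

/-- Comultiplication on `Div(V)`: `t^[S] ↦ ∑ t^[A] ⊗ t^[B]`. -/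
def divComul (k : Type u) [CommRing k] : divV k ⟶ divV k ⊗ divV k := constComul k

/-- The averaging map `Sym(V) ⟶ Div(V)`: `t^S ↦ t^[S]`. -/
def avg (k : Type u) [CommRing k] : symV k ⟶ divV k := 𝟙 (const k)

open Classical in
/-- The components of the inclusion of `Sym^n(V)` into `Sym(V)`: extension by zero. -/
def symInclFun {n : ℕ} {S : FB} (u : PLift (Nat.card S = n) → k) : k :=
  if h : Nat.card S = n then u ⟨h⟩ else 0

theorem symInclFun_pos {n : ℕ} {S : FB} (h : Nat.card S = n)
    (u : PLift (Nat.card S = n) → k) : symInclFun u = u ⟨h⟩ := dif_pos h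

theorem symInclFun_neg {n : ℕ} {S : FB} (h : ¬ Nat.card S = n)
    (u : PLift (Nat.card S = n) → k) : symInclFun u = 0 := dif_neg h

/-- The components of the inclusion of `Sym^n(V)` into `Sym(V)`, as linear maps. -/
def symInclApp (k : Type u) [CommRing k] (n : ℕ) (S : FB) :
    (PLift (Nat.card S = n) → k) →ₗ[k] k where
  toFun u := symInclFun u
  map_add' u v := by
    by_cases h : Nat.card S = n
    · simp only [symInclFun_pos h, Pi.add_apply]
    · simp only [symInclFun_neg h, add_zero]
  map_smul' c u := by
    by_cases h : Nat.card S = n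
    · simp only [symInclFun_pos h, Pi.smul_apply, RingHom.id_apply]
    · simp only [symInclFun_neg h, smul_zero]

/-- The inclusion of `Sym^n(V)` into `Sym(V)`. -/
def symIncl (k : Type u) [CommRing k] (n : ℕ) : symPow k n ⟶ symV k :=
  mkHom (N := const k) (symInclApp k n) (by
    intro S T e x
    by_cases h : Nat.card S = n
    · have h' : Nat.card T = n := (Nat.card_congr e).symm.trans h
      exact (symInclFun_pos (k := k) h' _).trans (symInclFun_pos (k := k) h _).symm
    · have h' : ¬ Nat.card T = n := fun g => h ((Nat.card_congr e).trans g)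
      exact (symInclFun_neg (k := k) h' _).trans (symInclFun_neg (k := k) h _).symm)

/-- The projection of `Div(V)` onto `Div^n(V)` (identified with `Sym^n(V)`). -/
def divProj (k : Type u) [CommRing k] (n : ℕ) : divV k ⟶ symPow k n :=
  mkHom (M := const k) (fun _ => LinearMap.pi fun _ => LinearMap.id) (fun _ _ => rfl)

/-- Switch the first two factors of a triple tensor product. -/
def swap₁₂ (X Y Z : FBMod k) : X ⊗ (Y ⊗ Z) ⟶ Y ⊗ (X ⊗ Z) :=
  (α_ X Y Z).inv ≫ (β_ X Y).hom ▷ Z ≫ (α_ Y X Z).hom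

/-- The map `a₂ = id ⊗ a`. -/
def act₂ (X : FBMod k) {M : FBMod k} (a : symV k ⊗ M ⟶ divV k ⊗ M) :
    X ⊗ (symV k ⊗ M) ⟶ X ⊗ (divV k ⊗ M) :=
  X ◁ a

/-- The map `a₁ = τ ∘ a₂ ∘ τ`. -/
def act₁ (X : FBMod k) {M : FBMod k} (a : symV k ⊗ M ⟶ divV k ⊗ M) :
    symV k ⊗ (X ⊗ M) ⟶ divV k ⊗ (X ⊗ M) :=
  swap₁₂ (symV k) X M ≫ act₂ X a ≫ swap₁₂ X (divV k) M

/-- The map `a' : Sym(V) ⊗ Sym(V) ⊗ M ⟶ Div(V) ⊗ Div(V) ⊗ M`, a composition of seven maps: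
comultiply the second factor, switch the first two factors, multiply the second and third factors,
apply `a`, comultiply the second factor, average the first factor, and multiply the first two
factors. -/
def aPrime {M : FBMod k} (a : symV k ⊗ M ⟶ divV k ⊗ M) :
    symV k ⊗ (symV k ⊗ M) ⟶ divV k ⊗ (divV k ⊗ M) :=
  symV k ◁ (symComul k ▷ M ≫ (α_ (symV k) (symV k) M).hom) ≫
  swap₁₂ (symV k) (symV k) (symV k ⊗ M) ≫
  symV k ◁ ((α_ (symV k) (symV k) M).inv ≫ symMul k ▷ M) ≫
  symV k ◁ a ≫
  symV k ◁ (divComul k ▷ M ≫ (α_ (divV k) (divV k) M).hom) ≫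
  avg k ▷ (divV k ⊗ (divV k ⊗ M)) ≫
  ((α_ (divV k) (divV k) (divV k ⊗ M)).inv ≫ divMul k ▷ (divV k ⊗ M))

/-- The map `a'' = τ ∘ a' ∘ τ`. -/
def aDoublePrime {M : FBMod k} (a : symV k ⊗ M ⟶ divV k ⊗ M) :
    symV k ⊗ (symV k ⊗ M) ⟶ divV k ⊗ (divV k ⊗ M) :=
  swap₁₂ (symV k) (symV k) M ≫ aPrime a ≫ swap₁₂ (divV k) (divV k) M

theorem mem_swap {S : Type} [DecidableEq S] (i j s : S) :
    s ∈ ({j}ᶜ : Set S) ↔ Equiv.swap i j s ∈ ({i}ᶜ : Set S) := by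
  simp only [Set.mem_compl_iff, Set.mem_singleton_iff, Equiv.swap_apply_eq_iff,
    Equiv.swap_apply_left]

/-- The bijection `S \ {j} → S \ {i}` sending `i` to `j` and fixing all other elements. -/
def iota {S : FB} (i j : S) : S.sub {j}ᶜ ≃ S.sub {i}ᶜ :=
  open Classical in FB.restr (Equiv.swap i j) (mem_swap i j)

end FBMod

open FBMod

/-- A representation of the curried Weyl Lie algebra on `V ⊕ V*`, where `V` is the standard
`FB`-module, in the tensor category of `FB`-modules. -/
structure WeylRep (k : Type u) [CommRing k] where
  M : FBMod k
  a : symV k ⊗ M ⟶ divV k ⊗ M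
  rel : act₂ (symV k) a ≫ act₁ (divV k) a - act₁ (symV k) a ≫ act₂ (divV k) a =
    aPrime a - aDoublePrime a

namespace WeylRep

variable {k : Type u} [CommRing k]

/-- A morphism of representations of the curried Weyl Lie algebra. -/
@[ext]
structure Hom (R R' : WeylRep k) where
  hom : R.M ⟶ R'.M
  comm : R.a ≫ divV k ◁ hom = symV k ◁ hom ≫ R'.a

instance : Category (WeylRep k) where
  Hom := Hom
  id R := ⟨𝟙 R.M, by simp⟩
  comp f g := ⟨f.hom ≫ g.hom, by
    rw [MonoidalCategory.whiskerLeft_comp, MonoidalCategory.whiskerLeft_comp, Category.assoc,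
      ← g.comm, ← Category.assoc, ← Category.assoc, f.comm]⟩

/-- The underlying `FB`-module. -/
def forget (k : Type u) [CommRing k] : WeylRep k ⥤ FBMod k where
  obj R := R.M
  map f := f.hom

/-- The restriction of a representation to the curried general linear Lie algebra. -/
def gl (R : WeylRep k) : symPow k 1 ⊗ R.M ⟶ symPow k 1 ⊗ R.M :=
  symIncl k 1 ▷ R.M ≫ R.a ≫ divProj k 1 ▷ R.M

/-- The representation is `ε`-standard: for `j ∈ S` and `x ∈ M(S \ {j})`, the action of the curried
general linear Lie algebra sends `t^j ⊗ x` to `t^j ⊗ ε x + ∑ t^i ⊗ ι_{i,j}(x)`, where the sum is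
over the elements `i ≠ j` of `S`. -/
def IsStandard (ε : k) (R : WeylRep k) : Prop :=
  ∀ (S : FB) (j : S) (x : R.M.val (S.sub {j}ᶜ)),
    app R.gl S (el {j} (basisVec k 1 _) x) =
      (el {j} (basisVec k 1 _) (ε • x) +
        ∑ i ∈ ({j}ᶜ : Set S).toFinite.toFinset, el {i} (basisVec k 1 _) (R.M.act (iota i j) x) :
        (tensor (symPow k 1) R.M).val S)

/-- The representation has central character `χ`. -/
def HasCentralCharacter (χ : k) (R : WeylRep k) : Prop :=
  (λ_ R.M).inv ≫ symIncl k 0 ▷ R.M ≫ R.a ≫ divProj k 0 ▷ R.M ≫ (λ_ R.M).hom = χ • 𝟙 R.M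

/-- The full subcategory of `ε`-standard representations with central character `χ`. -/
abbrev StdRep (ε χ : k) : Type (u + 1) :=
  ObjectProperty.FullSubcategory fun R : WeylRep k => R.IsStandard ε ∧ R.HasCentralCharacter χ

end WeylRep

/-! ### The partition category -/

namespace PartDiag

theorem map_le {X Y : Type} (r : Setoid X) (f : X → Y) (s : Setoid Y) :
    r.map f ≤ s ↔ r ≤ s.comap f :=
  ⟨fun h _ _ hr => h (Relation.EqvGen.rel _ _ ⟨_, _, hr, rfl, rfl⟩),
    fun h => Setoid.eqvGen_le fun _ _ ⟨_, _, hr, hx, hy⟩ => hx ▸ hy ▸ h hr⟩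

theorem map_map {X Y Z : Type} (r : Setoid X) (f : X → Y) (g : Y → Z) :
    (r.map f).map g = r.map (g ∘ f) :=
  eq_of_forall_ge_iff fun s => by simp only [map_le]; rfl

theorem map_sup {X Y : Type} (r s : Setoid X) (f : X → Y) :
    (r ⊔ s).map f = r.map f ⊔ s.map f :=
  eq_of_forall_ge_iff fun t => by simp only [map_le, sup_le_iff]

theorem map_rel {X Y : Type} (r : Setoid X) {f : X → Y} (hf : Function.Injective f) (x y : Y) :
    r.map f x y ↔ (∃ a b, r a b ∧ f a = x ∧ f b = y) ∨ x = y := by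
  rw [Setoid.coe_map_of_ker_le r f (Setoid.ker_eq_bot_iff.2 hf ▸ bot_le)]
  exact Iff.rfl

/-- The number of classes of `r` that do not meet the image of `f`. -/
def hidden {X Y : Type} (r : Setoid X) (f : Y → X) : ℕ :=
  Nat.card {q : Quotient r // ∀ y, Quotient.mk r (f y) ≠ q}

theorem hidden_comp {X Y Z : Type} [Finite X] (r : Setoid X) (f : Y → X) (g : Z → Y) :
    hidden r (f ∘ g) = hidden r f + hidden (r.comap f) g := by
  classical
  unfold hidden
  rw [← Nat.card_congr (Equiv.sumCompl
    (fun q : {q : Quotient r // ∀ z, Quotient.mk r ((f ∘ g) z) ≠ q} =>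
      ∀ y, Quotient.mk r (f y) ≠ q.1)), Nat.card_sum]
  congr 1
  · refine Nat.card_congr ⟨fun q => ⟨q.1.1, q.2⟩, fun q => ⟨⟨q.1, fun z => q.2 (g z)⟩, q.2⟩,
      fun _ => rfl, fun _ => rfl⟩
  · symm
    refine Nat.card_congr (Equiv.ofBijective (fun q => ⟨⟨Quotient.map' f (fun _ _ h => h) q.1,
      ?_⟩, ?_⟩) ⟨?_, ?_⟩)
    · obtain ⟨q, hq⟩ := q
      induction q using Quotient.inductionOn with | h y =>
      exact fun z h => hq z (Quotient.sound (s := r.comap f) (Quotient.exact (s := r) h))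
    · obtain ⟨q, hq⟩ := q
      induction q using Quotient.inductionOn with | h y =>
      exact fun h => h y rfl
    · rintro ⟨q, hq⟩ ⟨q', hq'⟩ h
      induction q using Quotient.inductionOn with | h y =>
      induction q' using Quotient.inductionOn with | h y' =>
      have h' := congrArg (fun q => q.1.1) h
      exact Subtype.ext (Quotient.sound (s := r.comap f) (Quotient.exact (s := r) h'))
    · rintro ⟨⟨q, hq⟩, hq'⟩
      push Not at hq'
      obtain ⟨y, rfl⟩ := hq'
      exact ⟨⟨Quotient.mk (r.comap f) y, fun z h => hq z
        (Quotient.sound (s := r) (Quotient.exact (s := r.comap f) h))⟩, rfl⟩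

/-- A cartesian square of injective maps with jointly surjective right lower corner. -/
structure IsSquare {X Y Z W : Type} (i : Z → X) (p : Y → X) (o : W → Z) (j : W → Y) : Prop where
  inj_i : Function.Injective i
  inj_p : Function.Injective p
  comm : ∀ w, i (o w) = p (j w)
  cart : ∀ z y, i z = p y → ∃ w, o w = z ∧ j w = y
  cover : ∀ x, (∃ z, i z = x) ∨ ∃ y, p y = x

section

variable {X Y Z W : Type} {i : Z → X} {p : Y → X} {o : W → Z} {j : W → Y}

theorem IsSquare.baseChange (h : IsSquare i p o j) (G : Setoid Z) (a b : Y) :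
    G.map i (p a) (p b) ↔ (G.comap o).map j a b := by
  constructor
  · intro hab
    obtain ⟨z, z', hz, h1, h2⟩ | hab := (map_rel G h.inj_i _ _).1 hab
    · obtain ⟨w, rfl, rfl⟩ := h.cart z a h1
      obtain ⟨w', rfl, rfl⟩ := h.cart z' b h2
      exact Relation.EqvGen.rel _ _ ⟨_, _, hz, rfl, rfl⟩
    · rw [h.inj_p hab]
  · have : (G.comap o).map j ≤ (G.map i).comap p := by
      rw [map_le]
      intro w w' hw
      change G.map i (p (j w)) (p (j w'))
      rw [← h.comm, ← h.comm]
      exact Relation.EqvGen.rel _ _ ⟨_, _, hw, rfl, rfl⟩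
    exact fun hab => this hab

theorem IsSquare.rel (h : IsSquare i p o j) (G : Setoid Z) (N : Setoid Y) {x x' : X}
    (hx : (G.map i ⊔ N.map p) x x') : G.map i x x' ∨ ∃ a b, G.map i x (p a) ∧
      ((G.comap o).map j ⊔ N) a b ∧ G.map i (p b) x' := by
  let R : Setoid X :=
    { r := fun x x' => G.map i x x' ∨ ∃ a b, G.map i x (p a) ∧
        ((G.comap o).map j ⊔ N) a b ∧ G.map i (p b) x'
      iseqv := by
        refine ⟨fun x => Or.inl (Setoid.refl' _ x), ?_, ?_⟩
        · rintro x y (h1 | ⟨a, b, h1, h2, h3⟩)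
          · exact Or.inl (Setoid.symm' _ h1)
          · exact Or.inr ⟨b, a, Setoid.symm' _ h3, Setoid.symm' _ h2, Setoid.symm' _ h1⟩
        · rintro x y z (h1 | ⟨a, b, h1, h2, h3⟩) (h4 | ⟨a', b', h4, h5, h6⟩)
          · exact Or.inl (Setoid.trans' _ h1 h4)
          · exact Or.inr ⟨a', b', Setoid.trans' _ h1 h4, h5, h6⟩
          · exact Or.inr ⟨a, b, h1, h2, Setoid.trans' _ h3 h4⟩
          · have h7 : ((G.comap o).map j ⊔ N) b a' :=
              le_sup_left (a := (G.comap o).map j) ((h.baseChange G b a').1 (Setoid.trans' _ h3 h4))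
            exact Or.inr ⟨a, b', h1, Setoid.trans' _ h2 (Setoid.trans' _ h7 h5), h6⟩ }
  have h1 : G.map i ⊔ N.map p ≤ R := by
    refine sup_le (fun _ _ hr => Or.inl hr) ((map_le _ _ _).2 fun a b hab => ?_)
    exact Or.inr ⟨a, b, Setoid.refl' _ _, le_sup_right (a := (G.comap o).map j) hab,
      Setoid.refl' _ _⟩
  exact h1 hx

theorem IsSquare.comap_sup (h : IsSquare i p o j) (G : Setoid Z) (N : Setoid Y) :
    (G.map i ⊔ N.map p).comap p = (G.comap o).map j ⊔ N := by
  apply le_antisymm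
  · intro y y' hy
    obtain h1 | ⟨a, b, h1, h2, h3⟩ := h.rel G N hy
    · exact le_sup_left (a := (G.comap o).map j) ((h.baseChange G _ _).1 h1)
    · have h4 := le_sup_left (a := (G.comap o).map j) (b := N) ((h.baseChange G _ _).1 h1)
      have h5 := le_sup_left (a := (G.comap o).map j) (b := N) ((h.baseChange G _ _).1 h3)
      exact Setoid.trans' _ h4 (Setoid.trans' _ h2 h5)
  · refine sup_le (fun y y' hy => ?_) fun y y' hy => ?_
    · exact le_sup_left (a := G.map i) ((h.baseChange G _ _).2 hy)
    · exact le_sup_right (a := G.map i) ((map_le N p _).1 le_rfl hy)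

theorem IsSquare.hidden_sup (h : IsSquare i p o j) (G : Setoid Z) (N : Setoid Y) :
    hidden (G.map i ⊔ N.map p) p = hidden G o := by
  have key : ∀ z y, (G.map i ⊔ N.map p) (p y) (i z) → ∃ w, G (o w) z := by
    intro z y hzy
    have : ∀ b, G.map i (p b) (i z) → ∃ w, G (o w) z := by
      intro b hb
      obtain ⟨z', z'', hz, h1, h2⟩ | hab := (map_rel G h.inj_i _ _).1 hb
      · obtain ⟨w, rfl, rfl⟩ := h.cart _ _ h1
        exact ⟨w, h.inj_i h2 ▸ hz⟩
      · obtain ⟨w, rfl, rfl⟩ := h.cart _ _ hab.symm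
        exact ⟨w, Setoid.refl' _ _⟩
    obtain h1 | ⟨a, b, h1, h2, h3⟩ := h.rel G N hzy
    · exact this _ h1
    · exact this _ h3
  have hG : ∀ z z', G z z' → (G.map i ⊔ N.map p) (i z) (i z') := fun z z' hz =>
    le_sup_left (a := G.map i) ((map_le G i _).1 le_rfl hz)
  symm
  refine Nat.card_congr (Equiv.ofBijective
    (fun q => ⟨Quotient.map' i (fun z z' hz => hG z z' hz) q.1, ?_⟩) ⟨?_, ?_⟩)
  · obtain ⟨q, hq⟩ := q
    induction q using Quotient.inductionOn with | h z =>
    intro y hy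
    obtain ⟨w, hw⟩ := key z y (Quotient.exact (s := G.map i ⊔ N.map p) hy)
    exact hq w (Quotient.sound (s := G) hw)
  · rintro ⟨q, hq⟩ ⟨q', hq'⟩ hqq
    induction q using Quotient.inductionOn with | h z =>
    induction q' using Quotient.inductionOn with | h z' =>
    have h' : (G.map i ⊔ N.map p) (i z) (i z') :=
      Quotient.exact (s := G.map i ⊔ N.map p) (congrArg Subtype.val hqq)
    refine Subtype.ext (Quotient.sound (s := G) ?_)
    obtain h1 | ⟨a, b, h1, h2, h3⟩ := h.rel G N h'
    · obtain ⟨a, b, hab, ha, hb⟩ | hab := (map_rel G h.inj_i _ _).1 h1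
      · exact h.inj_i ha ▸ h.inj_i hb ▸ hab
      · exact h.inj_i hab ▸ Setoid.refl' _ _
    · obtain ⟨w, hw⟩ := key z' b (le_sup_left (a := G.map i) h3)
      exact (hq' w (Quotient.sound (s := G) hw)).elim
  · rintro ⟨q, hq⟩
    induction q using Quotient.inductionOn with | h x =>
    obtain ⟨z, rfl⟩ | ⟨y, rfl⟩ := h.cover x
    · refine ⟨⟨Quotient.mk G z, fun w hw => hq (j w) ?_⟩, rfl⟩
      refine Quotient.sound (s := G.map i ⊔ N.map p) ?_
      rw [← h.comm]
      exact hG _ _ (Quotient.exact (s := G) hw)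
    · exact (hq y rfl).elim

end

section

variable {S T U W : Type}

/-- The partition of `S ⊔ T ⊔ U` obtained by gluing a partition diagram from `S` to `T` and a
partition diagram from `T` to `U`. -/
def glue (σ : Setoid (S ⊕ T)) (τ : Setoid (T ⊕ U)) : Setoid (S ⊕ (T ⊕ U)) :=
  σ.map (Sum.map id Sum.inl) ⊔ τ.map Sum.inr

/-- The inclusion of `S ⊔ U` into `S ⊔ T ⊔ U`. -/
def outer (S T U : Type) : S ⊕ U → S ⊕ (T ⊕ U) := Sum.map id Sum.inr

/-- The composition of two partition diagrams, ignoring the blocks that are removed. -/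
def comp (σ : Setoid (S ⊕ T)) (τ : Setoid (T ⊕ U)) : Setoid (S ⊕ U) :=
  (glue σ τ).comap (outer S T U)

/-- The number of blocks that are removed when two partition diagrams are composed, i.e., the
blocks of the glued partition that are contained in the middle set. -/
def loops (σ : Setoid (S ⊕ T)) (τ : Setoid (T ⊕ U)) : ℕ :=
  hidden (glue σ τ) (outer S T U)

/-- The partition diagram of a bijection. -/
def graph (e : S ≃ T) : Setoid (S ⊕ T) := Setoid.ker (Sum.elim e id)

theorem square₁ : IsSquare (X := S ⊕ (T ⊕ (U ⊕ W)))
    (Sum.map id (Sum.map id Sum.inl) : S ⊕ (T ⊕ U) → S ⊕ (T ⊕ (U ⊕ W)))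
    (Sum.map id Sum.inr : S ⊕ (U ⊕ W) → S ⊕ (T ⊕ (U ⊕ W)))
    (outer S T U) (Sum.map id Sum.inl) where
  inj_i := by
    rintro (a | a | a) (b | b | b) h <;> simp_all
  inj_p := by
    rintro (a | a | a) (b | b | b) h <;> simp_all
  comm := by rintro (a | a) <;> rfl
  cart := by
    rintro (a | a | a) (b | b | b) h <;> simp_all [outer]
  cover := by
    rintro (a | a | a | a) <;> simp

theorem square₂ : IsSquare (X := S ⊕ (T ⊕ (U ⊕ W)))
    (Sum.inr : T ⊕ (U ⊕ W) → S ⊕ (T ⊕ (U ⊕ W)))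
    (Sum.map id (Sum.map id Sum.inr) : S ⊕ (T ⊕ W) → S ⊕ (T ⊕ (U ⊕ W)))
    (outer T U W) Sum.inr where
  inj_i := Sum.inr_injective
  inj_p := by
    rintro (a | a | a) (b | b | b) h <;> simp_all
  comm := by rintro (a | a) <;> rfl
  cart := by
    rintro (a | a | a) (b | b | b) h <;> simp_all [outer]
  cover := by
    rintro (a | a | a | a) <;> simp

/-- The partition of `S ⊔ T ⊔ U ⊔ W` obtained by gluing three partition diagrams. -/
def glue₃ (σ : Setoid (S ⊕ T)) (τ : Setoid (T ⊕ U)) (υ : Setoid (U ⊕ W)) :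
    Setoid (S ⊕ (T ⊕ (U ⊕ W))) :=
  σ.map (Sum.map id Sum.inl) ⊔ (τ.map (Sum.inr ∘ Sum.map id Sum.inl) ⊔
    υ.map (Sum.inr ∘ Sum.inr))

theorem glue₃_left (σ : Setoid (S ⊕ T)) (τ : Setoid (T ⊕ U)) (υ : Setoid (U ⊕ W)) :
    glue₃ σ τ υ = (glue σ τ).map (Sum.map id (Sum.map id Sum.inl)) ⊔
      (υ.map Sum.inr).map (Sum.map id Sum.inr) := by
  unfold glue glue₃
  rw [map_sup, map_map, map_map, map_map, sup_assoc]
  congr 2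
  funext x
  obtain a | a := x <;> rfl

theorem glue₃_right (σ : Setoid (S ⊕ T)) (τ : Setoid (T ⊕ U)) (υ : Setoid (U ⊕ W)) :
    glue₃ σ τ υ = (glue τ υ).map Sum.inr ⊔
      (σ.map (Sum.map id Sum.inl)).map (Sum.map id (Sum.map id Sum.inr)) := by
  unfold glue glue₃
  rw [map_sup, map_map, map_map, map_map, sup_comm]
  congr 2
  funext x
  obtain a | a := x <;> rfl

theorem glue_comp_left (σ : Setoid (S ⊕ T)) (τ : Setoid (T ⊕ U)) (υ : Setoid (U ⊕ W)) :
    glue (comp σ τ) υ = (glue₃ σ τ υ).comap (Sum.map id Sum.inr) := by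
  rw [glue₃_left, square₁.comap_sup]
  rfl

theorem glue_comp_right (σ : Setoid (S ⊕ T)) (τ : Setoid (T ⊕ U)) (υ : Setoid (U ⊕ W)) :
    glue σ (comp τ υ) = (glue₃ σ τ υ).comap (Sum.map id (Sum.map id Sum.inr)) := by
  rw [glue₃_right, square₂.comap_sup, sup_comm]
  rfl

theorem comp_assoc (σ : Setoid (S ⊕ T)) (τ : Setoid (T ⊕ U)) (υ : Setoid (U ⊕ W)) :
    comp (comp σ τ) υ = comp σ (comp τ υ) := by
  change (glue (comp σ τ) υ).comap (outer S U W) = (glue σ (comp τ υ)).comap (outer S T W)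
  rw [glue_comp_left, glue_comp_right, ← Setoid.comap_comp, ← Setoid.comap_comp]
  refine congrArg (fun f => (glue₃ σ τ υ).comap f) ?_
  funext x
  obtain a | a := x <;> rfl

theorem loops_assoc [Finite S] [Finite T] [Finite U] [Finite W]
    (σ : Setoid (S ⊕ T)) (τ : Setoid (T ⊕ U)) (υ : Setoid (U ⊕ W)) :
    loops σ τ + loops (comp σ τ) υ = loops τ υ + loops σ (comp τ υ) := by
  have h1 : loops σ τ + loops (comp σ τ) υ =
      hidden (glue₃ σ τ υ) (Sum.map id Sum.inr ∘ outer S U W) := by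
    rw [hidden_comp, loops, loops, glue_comp_left, ← square₁.hidden_sup (glue σ τ) (υ.map Sum.inr),
      ← glue₃_left]
  have h2 : loops τ υ + loops σ (comp τ υ) =
      hidden (glue₃ σ τ υ) (Sum.map id (Sum.map id Sum.inr) ∘ outer S T W) := by
    rw [hidden_comp, loops, loops, glue_comp_right,
      ← square₂.hidden_sup (glue τ υ) (σ.map (Sum.map id Sum.inl)), ← glue₃_right]
  rw [h1, h2]
  congr 1
  funext x
  obtain a | a := x <;> rfl

theorem hidden_eq_zero {X Y : Type} (r : Setoid X) (f : Y → X) (h : ∀ x, ∃ y, r (f y) x) :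
    hidden r f = 0 := by
  refine Nat.card_eq_zero.2 (Or.inl ⟨fun ⟨q, hq⟩ => ?_⟩)
  induction q using Quotient.inductionOn with | h x =>
  obtain ⟨y, hy⟩ := h x
  exact hq y (Quotient.sound (s := r) hy)

theorem glue_graph_left (e : S ≃ T) (τ : Setoid (T ⊕ U)) :
    glue (graph e) τ = τ.comap (Sum.elim (Sum.inl ∘ e) id) := by
  apply le_antisymm
  · refine sup_le ((map_le _ _ _).2 ?_) ((map_le _ _ _).2 fun _ _ h => h)
    rintro x y h
    have h' : Sum.elim e id x = Sum.elim e id y := h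
    have : ∀ x : S ⊕ T, Sum.elim (Sum.inl ∘ e) id (Sum.map id (Sum.inl (β := U)) x) =
        Sum.inl (Sum.elim e id x) := by rintro (a | a) <;> rfl
    change τ _ _
    rw [this, this, h']
  · have key : ∀ x, glue (graph e) τ x (Sum.inr (Sum.elim (Sum.inl ∘ e) id x)) := by
      rintro (a | a)
      · exact le_sup_left (a := (graph e).map _)
          (Relation.EqvGen.rel _ _ ⟨Sum.inl a, Sum.inr (e a), rfl, rfl, rfl⟩)
      · exact Setoid.refl' _ _
    intro x y h
    refine Setoid.trans' _ (key x) (Setoid.trans' _ ?_ (Setoid.symm' _ (key y)))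
    exact le_sup_right (a := (graph e).map _) (Relation.EqvGen.rel _ _ ⟨_, _, h, rfl, rfl⟩)

theorem comp_graph_left (e : S ≃ T) (τ : Setoid (T ⊕ U)) :
    comp (graph e) τ = τ.comap (Sum.map e id) := by
  unfold comp
  rw [glue_graph_left, ← Setoid.comap_comp]
  congr 1
  funext x
  obtain a | a := x <;> rfl

theorem loops_graph_left (e : S ≃ T) (τ : Setoid (T ⊕ U)) : loops (graph e) τ = 0 := by
  unfold loops
  rw [glue_graph_left]
  apply hidden_eq_zero
  rintro (a | a | a)
  · exact ⟨Sum.inl a, Setoid.refl' _ _⟩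
  · exact ⟨Sum.inl (e.symm a), by
      change τ (Sum.inl (e (e.symm a))) (Sum.inl a)
      rw [e.apply_symm_apply]⟩
  · exact ⟨Sum.inr a, Setoid.refl' _ _⟩

theorem glue_graph_right (σ : Setoid (S ⊕ T)) (e : T ≃ U) :
    glue σ (graph e) = σ.comap (Sum.elim Sum.inl (Sum.inr ∘ Sum.elim id e.symm)) := by
  apply le_antisymm
  · refine sup_le ((map_le _ _ _).2 ?_) ((map_le _ _ _).2 ?_)
    · rintro (a | a) (b | b) h <;> exact h
    · intro x y h
      have h' : Sum.elim e id x = Sum.elim e id y := h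
      have : ∀ x : T ⊕ U, Sum.elim id e.symm x = e.symm (Sum.elim e id x) := by
        rintro (a | a) <;> simp
      change σ (Sum.inr (Sum.elim id e.symm x)) (Sum.inr (Sum.elim id e.symm y))
      rw [this, this, h']
  · have key : ∀ x, glue σ (graph e) x
        (Sum.map id Sum.inl (Sum.elim Sum.inl (Sum.inr ∘ Sum.elim id e.symm) x)) := by
      rintro (a | a | a)
      · exact Setoid.refl' _ _
      · exact Setoid.refl' _ _
      · exact le_sup_right (a := σ.map _)
          (Relation.EqvGen.rel _ _ ⟨Sum.inr a, Sum.inl (e.symm a),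
            (e.apply_symm_apply a).symm, rfl, rfl⟩)
    intro x y h
    refine Setoid.trans' _ (key x) (Setoid.trans' _ ?_ (Setoid.symm' _ (key y)))
    exact le_sup_left (a := σ.map _) (Relation.EqvGen.rel _ _ ⟨_, _, h, rfl, rfl⟩)

theorem comp_graph_right (σ : Setoid (S ⊕ T)) (e : T ≃ U) :
    comp σ (graph e) = σ.comap (Sum.map id e.symm) := by
  unfold comp
  rw [glue_graph_right, ← Setoid.comap_comp]
  congr 1
  funext x
  obtain a | a := x <;> rfl

theorem loops_graph_right (σ : Setoid (S ⊕ T)) (e : T ≃ U) : loops σ (graph e) = 0 := by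
  unfold loops
  rw [glue_graph_right]
  apply hidden_eq_zero
  rintro (a | a | a)
  · exact ⟨Sum.inl a, Setoid.refl' _ _⟩
  · exact ⟨Sum.inr (e a), by
      change σ (Sum.inr (e.symm (e a))) (Sum.inr a)
      rw [e.symm_apply_apply]⟩
  · exact ⟨Sum.inr a, Setoid.refl' _ _⟩

theorem comp_graph_graph (e : S ≃ T) (f : T ≃ U) :
    comp (graph e) (graph f) = graph (e.trans f) := by
  rw [comp_graph_left, graph, graph]
  ext x y
  have : ∀ x : S ⊕ U, Sum.elim f id (Sum.map e id x) = Sum.elim (e.trans f) id x := by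
    rintro (a | a) <;> rfl
  change _ = _ ↔ _ = _
  rw [this, this]

end

end PartDiag

/-- A finite set, as an object of the partition category with parameter `δ`. -/
@[ext]
structure PartCat {k : Type u} [CommRing k] (δ : k) : Type 1 where
  set : FB

namespace PartCat

open PartDiag

variable {k : Type u} [CommRing k] {δ : k}

/-- Morphisms are the formal linear combinations of partition diagrams from `S` to `T`, i.e. of
set partitions of `S ⊔ T`. -/
def Hom (S T : PartCat δ) : Type u := Setoid (S.set ⊕ T.set) →₀ k

instance (S T : PartCat δ) : AddCommGroup (Hom S T) :=
  inferInstanceAs (AddCommGroup (Setoid (S.set ⊕ T.set) →₀ k))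

instance (S T : PartCat δ) : Module k (Hom S T) :=
  inferInstanceAs (Module k (Setoid (S.set ⊕ T.set) →₀ k))

/-- A partition diagram as a morphism. -/
def diag {S T : PartCat δ} (σ : Setoid (S.set ⊕ T.set)) : Hom S T := Finsupp.single σ 1

theorem hom_ext {S T : PartCat δ} {P : Type u} [AddCommGroup P] [Module k P]
    {f g : Hom S T →ₗ[k] P} (h : ∀ σ, f (diag σ) = g (diag σ)) : f = g :=
  Finsupp.lhom_ext' fun σ => LinearMap.ext_ring (h σ)

/-- Composition is bilinear, and the composition of two diagrams is the composite diagram times a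
factor of `δ` for each block that has been removed. -/
def compL (S T U : PartCat δ) : Hom S T →ₗ[k] Hom T U →ₗ[k] Hom S U :=
  Finsupp.lsum k fun σ => LinearMap.toSpanSingleton k _ <|
    Finsupp.lsum k fun τ => LinearMap.toSpanSingleton k _ <| δ ^ loops σ τ • diag (comp σ τ)

theorem compL_diag {S T U : PartCat δ} (σ : Setoid (S.set ⊕ T.set)) (τ : Setoid (T.set ⊕ U.set)) :
    compL S T U (diag σ) (diag τ) = δ ^ loops σ τ • diag (comp σ τ) := by
  unfold compL diag
  erw [Finsupp.lsum_single, LinearMap.toSpanSingleton_apply, one_smul, Finsupp.lsum_single,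
    LinearMap.toSpanSingleton_apply, one_smul]

theorem Hom.induction {S T : PartCat δ} {p : Hom S T → Prop} (f : Hom S T)
    (h : ∀ σ, p (diag σ)) (h0 : p 0) (hadd : ∀ f g, p f → p g → p (f + g))
    (hsmul : ∀ (c : k) f, p f → p (c • f)) : p f := by
  refine Finsupp.induction_linear f h0 hadd fun σ c => ?_
  have := hsmul c _ (h σ)
  unfold diag at this
  erw [Finsupp.smul_single, smul_eq_mul, mul_one] at this
  exact this

theorem compL_assoc {S T U W : PartCat δ} (f : Hom S T) (g : Hom T U) (h : Hom U W) :
    compL S U W (compL S T U f g) h = compL S T W f (compL T U W g h) := by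
  induction f using Hom.induction with
  | h σ =>
    induction g using Hom.induction with
    | h τ =>
      induction h using Hom.induction with
      | h υ =>
        simp only [compL_diag, map_smul, LinearMap.smul_apply, smul_smul, ← pow_add]
        rw [comp_assoc, loops_assoc]
      | h0 => simp only [map_zero]
      | hadd h h' e e' => simp only [map_add, e, e']
      | hsmul c h e => simp only [map_smul, e]
    | h0 => simp only [map_zero, LinearMap.zero_apply]
    | hadd h h' e e' => simp only [map_add, LinearMap.add_apply, e, e']
    | hsmul c h e => simp only [map_smul, LinearMap.smul_apply, e]
  | h0 => simp only [map_zero, LinearMap.zero_apply]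
  | hadd h h' e e' => simp only [map_add, LinearMap.add_apply, e, e']
  | hsmul c h e => simp only [map_smul, LinearMap.smul_apply, e]

theorem compL_graph_left {S T U : PartCat δ} (e : S.set ≃ T.set) (τ : Setoid (T.set ⊕ U.set)) :
    compL S T U (diag (graph e)) (diag τ) = diag (τ.comap (Sum.map e id)) := by
  rw [compL_diag, loops_graph_left, pow_zero, one_smul, comp_graph_left]

theorem compL_graph_right {S T U : PartCat δ} (σ : Setoid (S.set ⊕ T.set)) (e : T.set ≃ U.set) :
    compL S T U (diag σ) (diag (graph e)) = diag (σ.comap (Sum.map id e.symm)) := by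
  rw [compL_diag, loops_graph_right, pow_zero, one_smul, comp_graph_right]

/-- The partition category with parameter `δ`. -/
instance : Category.{u} (PartCat δ) where
  Hom := Hom
  id S := diag (graph (Equiv.refl S.set))
  comp {S T U} f g := compL S T U f g
  id_comp {S T} f := by
    induction f using Hom.induction with
    | h σ =>
      refine (compL_graph_left (S := S) (Equiv.refl S.set) σ).trans (congrArg diag ?_)
      rw [Equiv.coe_refl, Sum.map_id_id, Setoid.comap_id]
    | h0 => exact map_zero _
    | hadd f g e e' => exact (map_add _ f g).trans (congrArg₂ _ e e')
    | hsmul c f e => exact (map_smul _ c f).trans (congrArg _ e)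
  comp_id {S T} f := by
    induction f using Hom.induction with
    | h σ =>
      refine (compL_graph_right (U := T) σ (Equiv.refl T.set)).trans (congrArg diag ?_)
      rw [Equiv.refl_symm, Equiv.coe_refl, Sum.map_id_id, Setoid.comap_id]
    | h0 => exact LinearMap.map_zero₂ _ _
    | hadd f g e e' => exact (LinearMap.map_add₂ _ f g _).trans (congrArg₂ _ e e')
    | hsmul c f e => exact (LinearMap.map_smul₂ _ c f _).trans (congrArg _ e)
  assoc f g h := compL_assoc f g h

instance : Preadditive (PartCat δ) where
  homGroup S T := inferInstanceAs (AddCommGroup (Hom S T))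
  add_comp _ _ _ f f' g := LinearMap.map_add₂ (compL _ _ _) f f' g
  comp_add S T U f g g' := LinearMap.map_add (compL S T U f) g g'

instance : Linear k (PartCat δ) where
  homModule S T := inferInstanceAs (Module k (Hom S T))
  smul_comp _ _ _ c f g := LinearMap.map_smul₂ (compL _ _ _) c f g
  comp_smul S T U f c g := LinearMap.map_smul (compL S T U f) c g

/-- The functor from finite sets and bijections to the partition category. -/
def ofFB (δ : k) : FB ⥤ PartCat δ where
  obj S := ⟨S⟩
  map {S T} e := diag (S := ⟨S⟩) (T := ⟨T⟩) (graph (show S ≃ T from e))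
  map_id _ := rfl
  map_comp {S T U} e f := by
    refine Eq.symm ((compL_diag (S := ⟨S⟩) (T := ⟨T⟩) (U := ⟨U⟩) (graph (show S ≃ T from e))
      (graph (show T ≃ U from f))).trans ?_)
    rw [loops_graph_left, pow_zero, one_smul, comp_graph_graph]
    rfl

end PartCat

/-! ### The star product -/

section

variable {k : Type u} [CommRing k] {C D : Type 1} [Category.{u} C] [Preadditive C] [Linear k C]
  [Category.{u} D] [Preadditive D] [Linear k D]

/-- A finite set, as an object of the star product of two `k`-linear categories `C` and `D` that
contain the category of finite sets and bijections via the functors `iC` and `iD`. -/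
@[ext]
structure StarProd (k : Type u) [CommRing k] (iC : FB ⥤ C) (iD : FB ⥤ D) : Type 1 where
  set : FB

namespace StarProd

variable {iC : FB ⥤ C} {iD : FB ⥤ D}

/-- The space `Hom(A, B) ⊗ Hom(S \ A, T \ B)` for subsets `A ⊆ S` and `B ⊆ T`. -/
abbrev Block (S T : StarProd k iC iD) (A : Set S.set) (B : Set T.set) :
    Type u :=
  (iC.obj (S.set.sub A) ⟶ iC.obj (T.set.sub B)) ⊗[k]
    (iD.obj (S.set.sub Aᶜ) ⟶ iD.obj (T.set.sub Bᶜ))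

/-- Morphisms from `S` to `T` are the elements of the direct sum of the spaces
`Hom(A, B) ⊗ Hom(S \ A, T \ B)` over all subsets `A ⊆ S` and `B ⊆ T`, realized as a finite
product. -/
def Hom (S T : StarProd k iC iD) : Type u := ∀ (A : Set S.set) (B : Set T.set), Block S T A B

instance (S T : StarProd k iC iD) : AddCommGroup (Hom S T) :=
  inferInstanceAs (AddCommGroup (∀ (A : Set S.set) (B : Set T.set), Block S T A B))

instance (S T : StarProd k iC iD) : Module k (Hom S T) :=
  inferInstanceAs (Module k (∀ (A : Set S.set) (B : Set T.set), Block S T A B))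

/-- The bilinear map `(f ⊗ f', g ⊗ g') ↦ (f ≫ g) ⊗ (f' ≫ g')`. -/
def blockComp {S T U : StarProd k iC iD} (A : Set S.set) (B : Set T.set) (E : Set U.set) :
    Block S T A B →ₗ[k] Block T U B E →ₗ[k] Block S U A E :=
  TensorProduct.map₂ (Linear.comp _ _ _) (Linear.comp _ _ _)

theorem blockComp_tmul {S T U : StarProd k iC iD} (A : Set S.set) (B : Set T.set) (E : Set U.set)
    (f : iC.obj (S.set.sub A) ⟶ iC.obj (T.set.sub B))
    (f' : iD.obj (S.set.sub Aᶜ) ⟶ iD.obj (T.set.sub Bᶜ))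
    (g : iC.obj (T.set.sub B) ⟶ iC.obj (U.set.sub E))
    (g' : iD.obj (T.set.sub Bᶜ) ⟶ iD.obj (U.set.sub Eᶜ)) :
    blockComp (S := S) (T := T) (U := U) A B E (f ⊗ₜ f') (g ⊗ₜ g') = (f ≫ g) ⊗ₜ (f' ≫ g') :=
  rfl

theorem blockComp_assoc {S T U W : StarProd k iC iD} (A : Set S.set) (B : Set T.set) (E : Set U.set)
    (F : Set W.set) (x : Block S T A B) (y : Block T U B E) (z : Block U W E F) :
    blockComp A E F (blockComp A B E x y) z = blockComp A B F x (blockComp B E F y z) := by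
  induction x using TensorProduct.induction_on with
  | zero => simp only [map_zero, LinearMap.zero_apply]
  | add x x' h h' => simp only [map_add, LinearMap.add_apply, h, h']
  | tmul f f' =>
    induction y using TensorProduct.induction_on with
    | zero => simp only [map_zero, LinearMap.zero_apply]
    | add y y' h h' => simp only [map_add, LinearMap.add_apply, h, h']
    | tmul g g' =>
      induction z using TensorProduct.induction_on with
      | zero => simp only [map_zero]
      | add z z' h h' => simp only [map_add, h, h']
      | tmul h h' => simp only [blockComp_tmul, Category.assoc]

/-- Composition: the composite of the summands for `(A, B)` and `(B', E)` is `0` unless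
`B = B'`, in which case it is the obvious one. -/
def comp {S T U : StarProd k iC iD} (f : Hom S T) (g : Hom T U) : Hom S U :=
  fun A E => ∑ B, blockComp A B E (f A B) (g B E)

open Classical in
/-- The morphism given by a bijection `e`, namely the sum over all `A ⊆ S` of
`(e : A → e(A)) ⊗ (e : S \ A → T \ e(A))`. -/
def ofEquiv {S T : StarProd k iC iD} (e : S.set ≃ T.set) : Hom S T := fun A B =>
  if h : ∀ s, s ∈ A ↔ e s ∈ B then
    iC.map (show S.set.sub A ⟶ T.set.sub B from FB.restr e h) ⊗ₜ
      iD.map (show S.set.sub Aᶜ ⟶ T.set.sub Bᶜ from FB.restr e (FB.mem_compl_congr e h))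
  else 0

theorem ofEquiv_pos {S T : StarProd k iC iD} (e : S.set ≃ T.set) {A : Set S.set} {B : Set T.set}
    (h : ∀ s, s ∈ A ↔ e s ∈ B) : (ofEquiv e : Hom S T) A B =
    iC.map (show S.set.sub A ⟶ T.set.sub B from FB.restr e h) ⊗ₜ
      iD.map (show S.set.sub Aᶜ ⟶ T.set.sub Bᶜ from FB.restr e (FB.mem_compl_congr e h)) :=
  dif_pos h

theorem ofEquiv_neg {S T : StarProd k iC iD} (e : S.set ≃ T.set) {A : Set S.set} {B : Set T.set}
    (h : ¬ ∀ s, s ∈ A ↔ e s ∈ B) : (ofEquiv e : Hom S T) A B = 0 :=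
  dif_neg h

theorem ofEquiv_refl {S : StarProd k iC iD} (A : Set S.set) :
    (ofEquiv (Equiv.refl S.set) : Hom S S) A A = 𝟙 _ ⊗ₜ 𝟙 _ := by
  rw [ofEquiv_pos (Equiv.refl S.set) fun _ => Iff.rfl]
  exact congrArg₂ _ (iC.map_id _) (iD.map_id _)

theorem ofEquiv_refl_ne {S : StarProd k iC iD} {A B : Set S.set} (h : A ≠ B) :
    (ofEquiv (Equiv.refl S.set) : Hom S S) A B = 0 :=
  ofEquiv_neg _ fun h' => h (Set.ext h')

theorem comp_add {S T U : StarProd k iC iD} (f : Hom S T) (g g' : Hom T U) :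
    comp f (g + g') = comp f g + comp f g' := by
  funext A E
  exact (Finset.sum_congr rfl fun B _ =>
    map_add (blockComp A B E (f A B)) (g B E) (g' B E)).trans Finset.sum_add_distrib

theorem add_comp {S T U : StarProd k iC iD} (f f' : Hom S T) (g : Hom T U) :
    comp (f + f') g = comp f g + comp f' g := by
  funext A E
  exact (Finset.sum_congr rfl fun B _ => LinearMap.map_add₂ _ _ _ _).trans Finset.sum_add_distrib

theorem comp_smul {S T U : StarProd k iC iD} (f : Hom S T) (c : k) (g : Hom T U) :
    comp f (c • g) = c • comp f g := by
  funext A E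
  exact (Finset.sum_congr rfl fun B _ =>
    map_smul (blockComp A B E (f A B)) c (g B E)).trans Finset.smul_sum.symm

theorem smul_comp {S T U : StarProd k iC iD} (c : k) (f : Hom S T) (g : Hom T U) :
    comp (c • f) g = c • comp f g := by
  funext A E
  exact (Finset.sum_congr rfl fun B _ => LinearMap.map_smul₂ _ _ _ _).trans Finset.smul_sum.symm

theorem blockComp_id_left {S T : StarProd k iC iD} (A : Set S.set) (B : Set T.set)
    (x : Block S T A B) :
    blockComp (S := S) (T := S) (U := T) A A B (𝟙 _ ⊗ₜ 𝟙 _) x = x := by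
  induction x using TensorProduct.induction_on with
  | zero => exact map_zero _
  | add x x' h h' => rw [map_add, h, h']
  | tmul f f' => rw [blockComp_tmul, Category.id_comp, Category.id_comp]

theorem blockComp_id_right {S T : StarProd k iC iD} (A : Set S.set) (B : Set T.set)
    (x : Block S T A B) :
    blockComp (S := S) (T := T) (U := T) A B B x (𝟙 _ ⊗ₜ 𝟙 _) = x := by
  induction x using TensorProduct.induction_on with
  | zero => exact LinearMap.map_zero₂ _ _
  | add x x' h h' => rw [LinearMap.map_add₂, h, h']
  | tmul f f' => rw [blockComp_tmul, Category.comp_id, Category.comp_id]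

/-- The star product of two `k`-linear categories. -/
instance : Category.{u} (StarProd k iC iD) where
  Hom := Hom
  id S := ofEquiv (Equiv.refl S.set)
  comp := comp
  id_comp {S T} f := by
    funext A E
    refine (Finset.sum_eq_single A (fun B _ h => ?_) fun h => (h (Finset.mem_univ A)).elim).trans ?_
    · rw [ofEquiv_refl_ne h.symm, map_zero, LinearMap.zero_apply]
    · rw [ofEquiv_refl, blockComp_id_left]
  comp_id {S T} f := by
    funext A E
    refine (Finset.sum_eq_single E (fun B _ h => ?_) fun h => (h (Finset.mem_univ E)).elim).trans ?_
    · rw [ofEquiv_refl_ne h, map_zero]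
    · rw [ofEquiv_refl, blockComp_id_right]
  assoc {S T U W} f g h := by
    funext A F
    change ∑ E, blockComp A E F (∑ B, blockComp A B E (f A B) (g B E)) (h E F) =
      ∑ B, blockComp A B F (f A B) (∑ E, blockComp B E F (g B E) (h E F))
    simp only [map_sum, LinearMap.sum_apply, blockComp_assoc]
    exact Finset.sum_comm

instance : Preadditive (StarProd k iC iD) where
  homGroup S T := inferInstanceAs (AddCommGroup (Hom S T))
  add_comp _ _ _ f f' g := add_comp f f' g
  comp_add _ _ _ f g g' := comp_add f g g'

instance : Linear k (StarProd k iC iD) where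
  homModule S T := inferInstanceAs (Module k (Hom S T))
  smul_comp _ _ _ c f g := smul_comp c f g
  comp_smul _ _ _ f c g := comp_smul f c g

/-- The functor from finite sets and bijections to the star product. -/
def ofFB (k : Type u) [CommRing k] [Linear k C] [Linear k D] (iC : FB ⥤ C) (iD : FB ⥤ D) :
    FB ⥤ StarProd k iC iD where
  obj S := ⟨S⟩
  map {S T} e := ofEquiv (S := ⟨S⟩) (T := ⟨T⟩) (show S ≃ T from e)
  map_id _ := rfl
  map_comp {S T U} e f := by
    funext A E
    symm
    obtain ⟨B, hB⟩ : ∃ B : Set T, ∀ s, s ∈ A ↔ (show S ≃ T from e) s ∈ B :=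
      ⟨(show S ≃ T from e) '' A, fun _ => (Equiv.injective _).mem_set_image.symm⟩
    refine (Finset.sum_eq_single B (fun B' _ h => ?_)
      fun h => (h (Finset.mem_univ B)).elim).trans ?_
    · have hne : ¬ ∀ s, s ∈ A ↔ (show S ≃ T from e) s ∈ B' := by
        intro h'
        refine h (Set.ext fun t => ?_)
        obtain ⟨s, rfl⟩ := (show S ≃ T from e).surjective t
        exact (h' s).symm.trans (hB s)
      rw [ofEquiv_neg (S := ⟨S⟩) (T := ⟨T⟩) (iC := iC) (iD := iD) (show S ≃ T from e) hne, map_zero,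
        LinearMap.zero_apply]
    · rw [ofEquiv_pos (S := ⟨S⟩) (T := ⟨T⟩) (iC := iC) (iD := iD) (show S ≃ T from e) hB]
      by_cases hE : ∀ t, t ∈ B ↔ (show T ≃ U from f) t ∈ E
      · rw [ofEquiv_pos (S := ⟨T⟩) (T := ⟨U⟩) (iC := iC) (iD := iD) (show T ≃ U from f) hE]
        refine (blockComp_tmul (S := ⟨S⟩) (T := ⟨T⟩) (U := ⟨U⟩) A B E _ _ _ _).trans ?_
        rw [← Functor.map_comp, ← Functor.map_comp]
        exact (ofEquiv_pos (S := ⟨S⟩) (T := ⟨U⟩) (iC := iC) (iD := iD) (show S ≃ U from e ≫ f)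
          fun s => (hB s).trans (hE _)).symm
      · rw [ofEquiv_neg (S := ⟨T⟩) (T := ⟨U⟩) (iC := iC) (iD := iD) (show T ≃ U from f) hE, map_zero]
        refine (ofEquiv_neg (S := ⟨S⟩) (T := ⟨U⟩) (iC := iC) (iD := iD) (show S ≃ U from e ≫ f)
          fun h' => hE fun t => ?_).symm
        obtain ⟨s, rfl⟩ := (show S ≃ T from e).surjective t
        exact (hB s).symm.trans (h' s)

end StarProd

/-- The category of representations of a `k`-linear category: the `k`-linear functors to the
category of `k`-modules. -/
abbrev LinRep (k : Type u) [CommRing k] (C : Type 1) [Category.{u} C] [Preadditive C]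
    [Linear k C] : Type (u + 1) :=
  ObjectProperty.FullSubcategory fun F : C ⥤ ModuleCat.{u} k =>
    F.Additive ∧ F.Linear k

/-- The restriction of a representation of `C` along a functor from finite sets and bijections. -/
def LinRep.restrict (k : Type u) [CommRing k] [Linear k C] (iC : FB ⥤ C) :
    LinRep k C ⥤ FBMod k :=
  show LinRep k C ⥤ (FB ⥤ ModuleCat.{u} k) from
    ObjectProperty.ι _ ⋙ (Functor.whiskeringLeft FB C (ModuleCat.{u} k)).obj iC

end

end

noncomputable section

namespace FBMod

variable {k : Type u} [CommRing k]

/-- The identification of two equal subsets. -/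
def setEquiv {V : FB} {X Y : Set V} (h : ∀ v, v ∈ X ↔ v ∈ Y) : V.sub X ≃ V.sub Y :=
  FB.restr (Equiv.refl V) h

/-- A subset of a subset, described by a subset of the ambient set. -/
def nestEquiv {V : FB} {R X : Set V} (h : ∀ v, v ∈ X → v ∈ R) {U : Set (V.sub R)}
    (hU : ∀ v, v ∈ U ↔ v.1 ∈ X) : V.sub X ≃ (V.sub R).sub U where
  toFun s := ⟨⟨s.1, h s.1 s.2⟩, (hU _).2 s.2⟩
  invFun s := ⟨s.1.1, (hU _).1 s.2⟩
  left_inv _ := rfl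
  right_inv _ := rfl

theorem act_injective (M : FBMod k) {S T : FB} (e : S ≃ T) : Function.Injective (M.act e) := by
  intro x y h
  have := congrArg (M.act e.symm) h
  rwa [act_act, act_act, Equiv.self_trans_symm, act_refl, act_refl] at this

theorem act_symm_act (M : FBMod k) {S T : FB} (e : S ≃ T) (x : M.val S) :
    M.act e.symm (M.act e x) = x := by
  rw [act_act, Equiv.self_trans_symm, act_refl]

theorem act_act_symm (M : FBMod k) {S T : FB} (e : S ≃ T) (x : M.val T) :
    M.act e (M.act e.symm x) = x := by
  rw [act_act, Equiv.symm_trans_self, act_refl]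

theorem mem_compl' {S : FB} (A : Set S) (s : S) : s ∈ Aᶜ ↔ s ∉ A := Iff.rfl

theorem mem_trace_compl {S : FB} {A B X : Set S} (hX : ∀ s, s ∈ X ↔ s ∉ A ∧ s ∉ B)
    (s : S.sub Aᶜ) : s ∈ trace Aᶜ X ↔ s ∉ trace Aᶜ B :=
  (hX s.1).trans (and_iff_right s.2)

theorem mem_compl_of {S : FB} {A B X : Set S} (hX : ∀ s, s ∈ X ↔ s ∉ A ∧ s ∉ B)
    (s : S) (h : s ∈ X) : s ∈ Aᶜ := ((hX s).1 h).1

/-- A scalar as an element of `Sym(V)(S)` or `Div(V)(S)`. -/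
def cst {S : FB} (c : k) : (const k).val S := c

/-! ### Tensor products with `Sym(V)` and `Div(V)` -/

/-- The element `t^A ⊗ x` of `Sym(V) ⊗ P` or `Div(V) ⊗ P`, where `X` is the complement of `A`. -/
def te (P : FBMod k) {S : FB} (A X : Set S) (h : ∀ s, s ∈ X ↔ s ∉ A) (x : P.val (S.sub X)) :
    (tensor (const k) P).val S :=
  el (M := const k) A (cst 1) (P.act (setEquiv (Y := Aᶜ) h) x)

/-- The isomorphism `Sym(V)(T) ⊗ Q ≅ Q`. -/
def cstLid (T : FB) (Q : Type u) [AddCommGroup Q] [Module k Q] :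
    (const k).val T ⊗[k] Q ≃ₗ[k] Q := TensorProduct.lid k Q

theorem cstLid_tmul (T : FB) {Q : Type u} [AddCommGroup Q] [Module k Q] (c : k) (x : Q) :
    cstLid T Q ((cst c : (const k).val T) ⊗ₜ x) = c • x := TensorProduct.lid_tmul x c

/-- The coefficient of `t^A` in an element of `Sym(V) ⊗ P` or `Div(V) ⊗ P`. -/
def cf (P : FBMod k) {S : FB} (A X : Set S) (h : ∀ s, s ∈ X ↔ s ∉ A) :
    (tensor (const k) P).val S →ₗ[k] P.val (S.sub X) :=
  P.act (setEquiv (X := Aᶜ) fun s => (h s).symm) ∘ₗ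
    (cstLid (S.sub Aᶜ) (P.val (S.sub Aᶜ))).toLinearMap ∘ₗ LinearMap.proj A

theorem cf_te {P : FBMod k} {S : FB} {A X : Set S} {h h' : ∀ s, s ∈ X ↔ s ∉ A}
    (x : P.val (S.sub X)) : cf P A X h (te P A X h' x) = x := by
  change P.act _ (cstLid _ _ (el (M := const k) A (cst 1) _ A)) = x
  unfold el
  rw [Pi.single_eq_same]
  rw [cstLid_tmul, one_smul, act_act]
  exact P.act_refl x

theorem cf_te_ne {P : FBMod k} {S : FB} {A B X Y : Set S} (hAB : A ≠ B) {h : ∀ s, s ∈ Y ↔ s ∉ B}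
    {h' : ∀ s, s ∈ X ↔ s ∉ A}
    (x : P.val (S.sub X)) : cf P B Y h (te P A X h' x) = 0 := by
  change P.act _ (cstLid _ _ (el (M := const k) A (cst 1) _ B)) = 0
  unfold el
  rw [Pi.single_eq_of_ne hAB.symm, map_zero, map_zero]

theorem cf_ext {P : FBMod k} {S : FB} {w w' : (tensor (const k) P).val S}
    (h : ∀ A, cf P A Aᶜ (mem_compl' A) w = cf P A Aᶜ (mem_compl' A) w') : w = w' := by
  funext A
  exact (cstLid _ _).injective (P.act_injective _ (h A))

/-- `te` as a linear map. -/
def teL (P : FBMod k) {S : FB} (A X : Set S) (h : ∀ s, s ∈ X ↔ s ∉ A) :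
    P.val (S.sub X) →ₗ[k] (tensor (const k) P).val S :=
  elL (const k) P A ∘ₗ TensorProduct.mk k ((const k).val (S.sub A)) _ (cst (1 : k)) ∘ₗ
    P.act (setEquiv (Y := Aᶜ) h)

theorem teL_apply (P : FBMod k) {S : FB} (A X : Set S) (h : ∀ s, s ∈ X ↔ s ∉ A)
    (x : P.val (S.sub X)) : teL P A X h x = te P A X h x := rfl

theorem el_eq_te {P : FBMod k} {S : FB} (A : Set S) (c : k) (x : P.val (S.sub Aᶜ)) :
    el (M := const k) A (cst c) x = te P A Aᶜ (mem_compl' A) (c • x) := by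
  unfold te
  rw [show P.act (setEquiv (X := Aᶜ) (Y := Aᶜ) (mem_compl' A)) (c • x) = c • x from
    P.act_refl _, ← smul_el', smul_el]
  congr 1
  exact (mul_one c).symm

theorem te_ext {P : FBMod k} {S : FB} {Q : Type u} [AddCommGroup Q] [Module k Q]
    {f g : (tensor (const k) P).val S →ₗ[k] Q}
    (h : ∀ A X hX x, f (te P A X hX x) = g (te P A X hX x)) : f = g :=
  tensor_ext fun A c x => by
    obtain ⟨c', rfl⟩ : ∃ c' : k, cst c' = c := ⟨c, rfl⟩
    rw [el_eq_te, h]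

theorem sum_te_cf {P : FBMod k} {S : FB} (w : (tensor (const k) P).val S) :
    w = ∑ A, te P A Aᶜ (mem_compl' A) (cf P A Aᶜ (mem_compl' A) w) := by
  apply cf_ext
  intro B
  rw [map_sum, Finset.sum_eq_single B, cf_te]
  · intro A _ h
    rw [cf_te_ne h]
  · intro h
    exact (h (Finset.mem_univ _)).elim

theorem te_congr {P : FBMod k} {S : FB} {A A' X X' : Set S} {h : ∀ s, s ∈ X ↔ s ∉ A}
    {h' : ∀ s, s ∈ X' ↔ s ∉ A'} (hA : ∀ s, s ∈ A ↔ s ∈ A') {x : P.val (S.sub X)}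
    {x' : P.val (S.sub X')} (hX : ∀ s, s ∈ X ↔ s ∈ X') (hx : P.act (setEquiv hX) x = x') :
    te P A X h x = te P A' X' h' x' := by
  obtain rfl : A = A' := Set.ext hA
  obtain rfl : X = X' := Set.ext hX
  subst hx
  congr 1
  exact (P.act_refl x).symm

theorem act_te {P : FBMod k} {S T : FB} (e : S ≃ T) {A X : Set S} {A' X' : Set T}
    {h : ∀ s, s ∈ X ↔ s ∉ A} {h' : ∀ s, s ∈ X' ↔ s ∉ A'} (hA : ∀ s, s ∈ A ↔ e s ∈ A')
    (hX : ∀ s, s ∈ X ↔ e s ∈ X') (x : P.val (S.sub X)) :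
    (tensor (const k) P).act e (te P A X h x) = te P A' X' h' (P.act (FB.restr e hX) x) := by
  unfold te
  rw [act_el e hA]
  congr 1
  simp only [act_act]
  exact P.act_congr (fun _ => rfl) _

theorem whisker_te {P Q : FBMod k} (f : P ⟶ Q) {S : FB} {A X : Set S}
    (h : ∀ s, s ∈ X ↔ s ∉ A) (x : P.val (S.sub X)) :
    app (tensorMap (𝟙 (const k)) f) S (te P A X h x) = te Q A X h (app f _ x) := by
  unfold te
  rw [tensorMap_el, app_act]
  rfl

/-! ### Twofold tensor products -/

/-- The element `t^A ⊗ t^B ⊗ x`, where `X` is the complement of `A ∪ B`. -/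
def te₂ (P : FBMod k) {S : FB} (A B X : Set S) (hX : ∀ s, s ∈ X ↔ s ∉ A ∧ s ∉ B)
    (x : P.val (S.sub X)) : (tensor (const k) (tensor (const k) P)).val S :=
  te (tensor (const k) P) A Aᶜ (mem_compl' A)
    (te P (trace Aᶜ B) (trace Aᶜ X) (mem_trace_compl hX)
      (P.act (nestEquiv (mem_compl_of hX) (mem_trace Aᶜ X)) x))

theorem te₂_congr {P : FBMod k} {S : FB} {A A' B B' X X' : Set S}
    {h : ∀ s, s ∈ X ↔ s ∉ A ∧ s ∉ B} {h' : ∀ s, s ∈ X' ↔ s ∉ A' ∧ s ∉ B'}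
    (hA : A = A') (hB : B = B') {x : P.val (S.sub X)}
    {x' : P.val (S.sub X')} (hX : ∀ s, s ∈ X ↔ s ∈ X') (hx : P.act (setEquiv hX) x = x') :
    te₂ P A B X h x = te₂ P A' B' X' h' x' := by
  subst hA hB
  obtain rfl : X = X' := Set.ext hX
  subst hx
  congr 1
  exact (P.act_refl x).symm

theorem te_te {P : FBMod k} {S : FB} {A Z : Set S} {hZ : ∀ s, s ∈ Z ↔ s ∉ A}
    {U X : Set (S.sub Z)} {h : ∀ s, s ∈ X ↔ s ∉ U} (x : P.val ((S.sub Z).sub X)) {B X' : Set S}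
    (hB : ∀ s, s ∈ U ↔ s.1 ∈ B) {hX' : ∀ s, s ∈ X' ↔ s ∉ A ∧ s ∉ B}
    (hX : ∀ s, s ∈ X ↔ s.1 ∈ X') :
    te (tensor (const k) P) A Z hZ (te P U X h x) =
      te₂ P A B X' hX' (P.act
        (nestEquiv (fun s hs => (hZ s).2 ((hX' s).1 hs).1) hX).symm x) := by
  unfold te₂
  refine te_congr (fun _ => Iff.rfl) hZ ?_
  rw [act_te (A' := trace Aᶜ B) (X' := trace Aᶜ X') (h' := mem_trace_compl hX')]
  · congr 1
    simp only [act_act]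
    exact P.act_congr (fun _ => rfl) _
  · exact hB
  · exact hX

/-- The coefficient of `t^A ⊗ t^B`. -/
def cf₂ (P : FBMod k) {S : FB} (A B X : Set S) (hX : ∀ s, s ∈ X ↔ s ∉ A ∧ s ∉ B) :
    (tensor (const k) (tensor (const k) P)).val S →ₗ[k] P.val (S.sub X) :=
  P.act (nestEquiv (mem_compl_of hX) (mem_trace Aᶜ X)).symm ∘ₗ
    cf P (trace Aᶜ B) (trace Aᶜ X) (mem_trace_compl hX) ∘ₗ
    cf (tensor (const k) P) A Aᶜ (mem_compl' A)

theorem cf₂_te₂ {P : FBMod k} {S : FB} {A B X : Set S} {h h' : ∀ s, s ∈ X ↔ s ∉ A ∧ s ∉ B}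
    (x : P.val (S.sub X)) : cf₂ P A B X h (te₂ P A B X h' x) = x := by
  unfold cf₂ te₂
  simp only [LinearMap.comp_apply]
  rw [cf_te, cf_te, act_symm_act]

theorem cf₂_te₂_ne {P : FBMod k} {S : FB} {A B A' B' X X' : Set S}
    {h : ∀ s, s ∈ X ↔ s ∉ A ∧ s ∉ B} {h' : ∀ s, s ∈ X' ↔ s ∉ A' ∧ s ∉ B'}
    (hA : ∀ s, s ∈ A → s ∉ B) (hA' : ∀ s, s ∈ A' → s ∉ B') (hne : ¬ (A' = A ∧ B' = B))
    (x : P.val (S.sub X')) : cf₂ P A B X h (te₂ P A' B' X' h' x) = 0 := by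
  unfold cf₂ te₂
  simp only [LinearMap.comp_apply]
  by_cases hAA : A' = A
  · subst hAA
    rw [cf_te, cf_te_ne, map_zero]
    intro hB
    refine hne ⟨rfl, Set.ext fun s => ?_⟩
    by_cases hs : s ∈ A'
    · exact ⟨fun h => (hA' s hs h).elim, fun h => (hA s hs h).elim⟩
    · exact (Set.ext_iff.1 hB ⟨s, hs⟩)
  · rw [cf_te_ne hAA, map_zero, map_zero]

theorem cf₂_ext {P : FBMod k} {S : FB} {w w' : (tensor (const k) (tensor (const k) P)).val S}
    (h : ∀ A B X hX, (∀ s, s ∈ A → s ∉ B) → cf₂ P A B X hX w = cf₂ P A B X hX w') : w = w' := by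
  apply cf_ext
  intro A
  apply cf_ext (P := P)
  intro U
  have := h A (inner U) (inner Uᶜ) (fun s => ⟨fun ⟨h1, h2⟩ => ⟨h1, fun ⟨_, h3⟩ => h2 h3⟩,
    fun ⟨h1, h2⟩ => ⟨h1, fun h3 => h2 ⟨h1, h3⟩⟩⟩) fun s h1 ⟨h2, _⟩ => h2 h1
  have this := P.act_injective _ this
  simp only [LinearMap.comp_apply] at this
  have hU : trace Aᶜ (inner U) = U := Set.ext fun s => ⟨fun ⟨_, h⟩ => h, fun h => ⟨s.2, h⟩⟩
  have hU' : trace Aᶜ (inner Uᶜ) = Uᶜ := Set.ext fun s => ⟨fun ⟨_, h⟩ => h, fun h => ⟨s.2, h⟩⟩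
  have key : ∀ (U' Z : Set (S.sub Aᶜ)) (hZ : ∀ s, s ∈ Z ↔ s ∉ U')
      {w w' : (tensor (const k) P).val (S.sub Aᶜ)}, U' = U → Z = Uᶜ →
      cf P U' Z hZ w = cf P U' Z hZ w' →
      cf P U Uᶜ (mem_compl' U) w = cf P U Uᶜ (mem_compl' U) w' := by
    rintro U' Z hZ w w' rfl rfl h
    exact h
  exact key _ _ _ hU hU' this

theorem te₂_ext {P : FBMod k} {S : FB} {Q : Type u} [AddCommGroup Q] [Module k Q]
    {f g : (tensor (const k) (tensor (const k) P)).val S →ₗ[k] Q}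
    (h : ∀ A B X hX x, (∀ s, s ∈ A → s ∉ B) → f (te₂ P A B X hX x) = g (te₂ P A B X hX x)) :
    f = g := by
  apply te_ext
  intro A Z hZ w
  have : f ∘ₗ teL _ A Z hZ = g ∘ₗ teL _ A Z hZ := by
    apply te_ext
    intro U X hX x
    simp only [LinearMap.comp_apply, teL_apply]
    rw [te_te x (B := inner U) (X' := inner X) (hX' := fun s =>
        ⟨fun ⟨h1, h2⟩ => ⟨(hZ s).1 h1, fun ⟨_, h3⟩ => (hX _).1 h2 h3⟩,
        fun ⟨h1, h2⟩ => ⟨(hZ s).2 h1, (hX _).2 fun h3 => h2 ⟨(hZ s).2 h1, h3⟩⟩⟩)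
        (fun s => ⟨fun h => ⟨s.2, h⟩, fun ⟨_, h⟩ => h⟩)
        (fun s => ⟨fun h => ⟨s.2, h⟩, fun ⟨_, h⟩ => h⟩), h]
    exact fun s h1 ⟨h2, _⟩ => (hZ s).1 h2 h1
  exact LinearMap.congr_fun this w

end FBMod
end

noncomputable section

namespace FBMod

variable {k : Type u} [CommRing k]

instance {S : FB} (A : Set S) : Fintype (Set (S.sub A)) :=
  FB.instFintypeSetCarrier (S.sub A)

theorem mem_inner_compl {S : FB} {A : Set S} (D : Set (S.sub A)) (s : S) :
    s ∈ Aᶜ ↔ s ∉ inner D ∧ s ∉ inner Dᶜ := by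
  constructor
  · exact fun h => ⟨fun ⟨h', _⟩ => h h', fun ⟨h', _⟩ => h h'⟩
  · intro ⟨h1, h2⟩ h
    exact h2 ⟨h, fun h3 => h1 ⟨h, h3⟩⟩

theorem cst_act {S T : FB} (e : S ≃ T) (c : k) : (const k).act e (cst c) = cst c := rfl

theorem assoc_cst (P : FBMod k) {S : FB} {A X : Set S} (hX : ∀ s, s ∈ X ↔ s ∉ A)
    (D : Set (S.sub A)) (x : P.val (S.sub X)) :
    assocApp (const k) (const k) P S
      (el A (el D (cst 1) (cst 1) : (tensor (const k) (const k)).val (S.sub A))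
        (P.act (setEquiv (Y := Aᶜ) hX) x)) =
      te₂ P (inner D) (inner Dᶜ) X (fun s => (hX s).trans (mem_inner_compl D s)) x := by
  rw [assocApp_el]
  unfold te₂ te
  simp only [cst_act, act_act]
  refine el_eq (fun _ => Iff.rfl) (cst_act _ _) ?_
  rw [act_el (B := trace (inner D)ᶜ (inner Dᶜ)) (setEquiv (mem_compl' (inner D)))
    (fun s => Iff.rfl)]
  refine act_el_eq (M := const k) _ ?_ (cst_act _ _) ?_
  · exact fun s => ⟨fun h => ⟨h, fun h' => s.2 ⟨h, h'⟩⟩, fun h => h.choose⟩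
  · simp only [act_act]
    exact P.act_congr (fun _ => rfl) _

theorem constComul_one (S : FB) :
    app (constComul k) S (cst 1) = ∑ D : Set S, el D (cst 1) (cst 1) := by
  funext B
  refine Eq.trans (b := (cst (1 : k) : (const k).val (S.sub B)) ⊗ₜ[k]
    (cst (1 : k) : (const k).val (S.sub Bᶜ))) rfl ?_
  refine Eq.trans ?_ (Finset.sum_apply B Finset.univ (M := fun A : Set S =>
    (const k).val (S.sub A) ⊗[k] (const k).val (S.sub Aᶜ))
    fun D : Set S => el D (cst 1) (cst 1)).symm
  rw [Finset.sum_eq_single B]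
  · exact (Pi.single_eq_same (M := fun A : Set S =>
      (const k).val (S.sub A) ⊗[k] (const k).val (S.sub Aᶜ)) B _).symm
  · intro D _ h
    exact Pi.single_eq_of_ne (M := fun A : Set S =>
      (const k).val (S.sub A) ⊗[k] (const k).val (S.sub Aᶜ)) h.symm _
  · exact fun h => (h (Finset.mem_univ B)).elim

theorem comul_te (P : FBMod k) {S : FB} {A X : Set S} (hX : ∀ s, s ∈ X ↔ s ∉ A)
    (x : P.val (S.sub X)) :
    assocApp (const k) (const k) P S (app (tensorMap (constComul k) (𝟙 P)) S (te P A X hX x)) =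
      ∑ D : Set (S.sub A),
        te₂ P (inner D) (inner Dᶜ) X (fun s => (hX s).trans (mem_inner_compl D s)) x := by
  refine Eq.trans ?_ (Finset.sum_congr rfl fun D _ => assoc_cst P hX D x)
  rw [← map_sum]
  congr 1
  unfold te
  refine (tensorMap_el (constComul k) (𝟙 P) A _ _).trans ?_
  refine (congrArg (fun w => el A w _) (constComul_one (S.sub A))).trans ?_
  refine Eq.trans (b := (elL (tensor (const k) (const k)) P A ∘ₗ
    (TensorProduct.mk k _ _).flip (P.act (setEquiv (Y := Aᶜ) hX) x))
      (∑ D : Set (S.sub A), el D (cst 1) (cst 1))) rfl ?_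
  rw [map_sum]
  rfl

theorem mul_te₂ (P : FBMod k) {S : FB} {A B C X : Set S} (hX : ∀ s, s ∈ X ↔ s ∉ A ∧ s ∉ B)
    (hC : ∀ s, s ∈ C ↔ s ∈ A ∨ s ∈ B) (hX' : ∀ s, s ∈ X ↔ s ∉ C)
    (x : P.val (S.sub X)) :
    app (tensorMap (constMul k) (𝟙 P)) S (assocInvApp (const k) (const k) P S (te₂ P A B X hX x)) =
      te P C X hX' x := by
  unfold te₂ te
  rw [act_el (setEquiv (mem_compl' A)) (B := trace Aᶜ B) fun s => Iff.rfl, assocInvApp_el]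
  refine (tensorMap_el (constMul k) (𝟙 P) _ _ _).trans ?_
  have : app (constMul k) (S.sub (join A (trace Aᶜ B)))
      (el (trace (join A (trace Aᶜ B)) A) ((const k).act (assocEquiv₁' _) (cst 1))
        ((const k).act (assocEquiv₂' _) ((const k).act (FB.restr (setEquiv (mem_compl' A))
          fun s => Iff.rfl) (cst 1)))) =
      cst (S := S.sub (join A (trace Aᶜ B))) 1 :=
    (constMulApp_el (k := k) _ _ _).trans (one_mul (1 : k))
  rw [this]
  refine el_eq ?_ (cst_act _ _) ?_
  · refine fun s => Iff.trans ?_ (hC s).symm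
    by_cases hs : s ∈ A
    · exact ⟨fun _ => Or.inl hs, fun _ => Or.inl hs⟩
    · exact ⟨fun h => h.elim Or.inl fun ⟨_, h⟩ => Or.inr h,
        fun h => h.elim Or.inl fun h => Or.inr ⟨hs, h⟩⟩
  · rw [app_id]
    simp only [act_act]
    exact P.act_congr (fun _ => rfl) _

theorem swap_te₂ (P : FBMod k) {S : FB} {A B X : Set S} (hX : ∀ s, s ∈ X ↔ s ∉ A ∧ s ∉ B)
    (hX' : ∀ s, s ∈ X ↔ s ∉ B ∧ s ∉ A) (hAB : ∀ s, s ∈ A → s ∉ B) (x : P.val (S.sub X)) :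
    app (swap₁₂ (const k) (const k) P) S (te₂ P A B X hX x) = te₂ P B A X hX' x := by
  change assocApp (const k) (const k) P S
    (app (tensorMap (braiding (const k) (const k)).hom (𝟙 P)) S
      (assocInvApp (const k) (const k) P S (te₂ P A B X hX x))) = _
  unfold te₂ te
  rw [act_el (setEquiv (mem_compl' A)) (B := trace Aᶜ B) fun s => Iff.rfl, assocInvApp_el,
    tensorMap_el, app_braiding_hom, braidingApp_el, assocApp_el]
  simp only [act_act, app_id, cst_act]
  refine el_eq ?_ (cst_act _ _) ?_
  · refine fun s => ⟨fun ⟨h1, h2⟩ => ?_, fun h => ⟨Or.inr ⟨fun h' => hAB s h' h, h⟩, ?_⟩⟩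
    · exact (h1.resolve_left h2).choose_spec
    · exact fun h' => hAB s h' h
  rw [act_el_eq (B := trace Bᶜ A) _ ?_ (cst_act _ _) rfl]
  · symm
    refine act_el_eq _ (fun _ => Iff.rfl) (cst_act _ _) ?_
    simp only [act_act]
    exact P.act_congr (fun _ => rfl) _
  · exact fun s => ⟨fun h => (by by_contra h'; exact s.2 ⟨h, h'⟩), fun h => Or.inl h⟩

theorem mem_trace_compl₃ {S : FB} {A B C X : Set S}
    (hX : ∀ s, s ∈ X ↔ s ∉ A ∧ s ∉ B ∧ s ∉ C) (s : S.sub Aᶜ) :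
    s ∈ trace Aᶜ X ↔ s ∉ trace Aᶜ B ∧ s ∉ trace Aᶜ C :=
  (hX s.1).trans (and_iff_right s.2)

theorem mem_compl_of₃ {S : FB} {A B C X : Set S}
    (hX : ∀ s, s ∈ X ↔ s ∉ A ∧ s ∉ B ∧ s ∉ C) (s : S) (h : s ∈ X) : s ∈ Aᶜ := ((hX s).1 h).1

/-- The element `t^A ⊗ t^B ⊗ t^C ⊗ x`, where `X` is the complement of `A ∪ B ∪ C`. -/
def te₃ (P : FBMod k) {S : FB} (A B C X : Set S)
    (hX : ∀ s, s ∈ X ↔ s ∉ A ∧ s ∉ B ∧ s ∉ C) (x : P.val (S.sub X)) :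
    (tensor (const k) (tensor (const k) (tensor (const k) P))).val S :=
  te (tensor (const k) (tensor (const k) P)) A Aᶜ (mem_compl' A)
    (te₂ P (trace Aᶜ B) (trace Aᶜ C) (trace Aᶜ X)
      (mem_trace_compl₃ hX)
      (P.act (nestEquiv (mem_compl_of₃ hX) (mem_trace Aᶜ X)) x))

theorem mem_union_compl {S : FB} (A B : Set S) (s : S) : s ∈ (A ∪ B)ᶜ ↔ s ∉ A ∧ s ∉ B := not_or

theorem mem_union_compl_of {S : FB} {A B C X : Set S}
    (hX : ∀ s, s ∈ X ↔ s ∉ A ∧ s ∉ B ∧ s ∉ C) (s : S) (h : s ∈ X) : s ∈ (A ∪ B)ᶜ :=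
  (mem_union_compl A B s).2 ⟨((hX s).1 h).1, ((hX s).1 h).2.1⟩

theorem mem_trace_union_compl {S : FB} {A B C X : Set S}
    (hX : ∀ s, s ∈ X ↔ s ∉ A ∧ s ∉ B ∧ s ∉ C) (s : S.sub (A ∪ B)ᶜ) :
    s ∈ trace (A ∪ B)ᶜ X ↔ s ∉ trace (A ∪ B)ᶜ C :=
  (hX s).trans ⟨fun h => h.2.2, fun h => ⟨fun h' => s.2 (Or.inl h'), fun h' => s.2 (Or.inr h'), h⟩⟩

theorem te₃_eq (P : FBMod k) {S : FB} (A B C X : Set S)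
    (hX : ∀ s, s ∈ X ↔ s ∉ A ∧ s ∉ B ∧ s ∉ C) (x : P.val (S.sub X)) :
    te₃ P A B C X hX x = te₂ (tensor (const k) P) A B (A ∪ B)ᶜ
      (mem_union_compl A B) (te P (trace _ C) (trace _ X) (mem_trace_union_compl hX)
        (P.act (nestEquiv (mem_union_compl_of hX) (mem_trace (A ∪ B)ᶜ X)) x)) := by
  unfold te₃ te₂
  congr 1
  refine te_congr (fun _ => Iff.rfl) ?_ ?_
  · exact fun s => ⟨fun h h' => h'.elim s.2 h, fun h h' => h (Or.inr h')⟩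
  · have hX' : ∀ s, s ∈ trace (trace Aᶜ (A ∪ B)ᶜ) (trace Aᶜ X) ↔
        s ∉ trace (trace Aᶜ (A ∪ B)ᶜ) (trace Aᶜ C) := fun s => (hX s.1.1).trans
      ⟨fun h => h.2.2, fun h => ⟨s.1.2, fun h' => s.2 (Or.inr h'), h⟩⟩
    rw [act_te (A' := trace _ (trace _ C)) (X' := trace _ (trace _ X)) (h' := hX')]
    · rw [act_te (A' := trace _ (trace _ C)) (X' := trace _ (trace _ X)) (h' := hX')]
      · congr 1
        simp only [act_act]
        exact P.act_congr (fun _ => rfl) _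
      · exact fun _ => Iff.rfl
      · exact fun _ => Iff.rfl
    · exact fun _ => Iff.rfl
    · exact fun _ => Iff.rfl

end FBMod
end

noncomputable section

namespace FBMod

variable {k : Type u} [CommRing k]

open Classical in
theorem sum_inner {V : FB} {R : Set V} {Q : Type*} [AddCommMonoid Q] (B : Set V)
    (hB : ∀ v, v ∈ B → v ∈ R) (f : Set V → Q) :
    ∑ D ∈ Finset.univ.filter (fun D : Set (V.sub R) => D ⊆ trace R B), f (inner D) =
      ∑ C ∈ Finset.univ.filter (fun C : Set V => C ⊆ B), f C := by
  refine Finset.sum_bij (fun D _ => inner D) ?_ ?_ ?_ ?_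
  · intro D hD
    rw [Finset.mem_filter] at hD ⊢
    exact ⟨Finset.mem_univ _, fun v ⟨h1, h2⟩ => hD.2 h2⟩
  · intro D _ D' _ h
    ext v
    exact ⟨fun hv => ((Set.ext_iff.1 h v.1).1 ⟨v.2, hv⟩).choose_spec,
      fun hv => ((Set.ext_iff.1 h v.1).2 ⟨v.2, hv⟩).choose_spec⟩
  · intro C hC
    rw [Finset.mem_filter] at hC
    refine ⟨trace R C, ?_, ?_⟩
    · rw [Finset.mem_filter]
      exact ⟨Finset.mem_univ _, fun v hv => hC.2 hv⟩
    · ext v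
      exact ⟨fun ⟨_, h⟩ => h, fun h => ⟨hB v (hC.2 h), h⟩⟩
  · intro D _
    rfl

/-- The matrix coefficients of a map `Sym(V) ⊗ M ⟶ Div(V) ⊗ M`, indexed by the complements. -/
def opr {M : FBMod k} (a : tensor (const k) M ⟶ tensor (const k) M) (S : FB) (X Y : Set S) :
    M.val (S.sub X) →ₗ[k] M.val (S.sub Y) :=
  cf M Yᶜ Y (fun _ => Set.notMem_compl_iff.symm) ∘ₗ app a S ∘ₗ
    teL M Xᶜ X (fun _ => Set.notMem_compl_iff.symm)

theorem te_compl {M : FBMod k} {S : FB} {A X : Set S} (h : ∀ s, s ∈ X ↔ s ∉ A)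
    (x : M.val (S.sub X)) :
    te M A X h x = te M Xᶜ X (fun _ => Set.notMem_compl_iff.symm) x :=
  te_congr (fun s => by rw [Set.mem_compl_iff, h, not_not]) (fun _ => Iff.rfl) (M.act_refl x)

theorem app_te {M : FBMod k} (a : tensor (const k) M ⟶ tensor (const k) M) {S : FB}
    {A X : Set S} (h : ∀ s, s ∈ X ↔ s ∉ A) (x : M.val (S.sub X)) :
    app a S (te M A X h x) =
      ∑ Y, te M Yᶜ Y (fun _ => Set.notMem_compl_iff.symm) (opr a S X Y x) := by
  rw [te_compl, sum_te_cf (app a S _)]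
  refine Finset.sum_nbij' (fun A => Aᶜ) (fun A => Aᶜ) ?_ ?_ ?_ ?_ ?_
  · exact fun _ _ => Finset.mem_univ _
  · exact fun _ _ => Finset.mem_univ _
  · exact fun A _ => compl_compl A
  · exact fun A _ => compl_compl A
  · intro A _
    rw [te_compl]
    congr 1
    have key : ∀ (B : Set S), A = B → ∀ (h h' : ∀ s, s ∈ Aᶜ ↔ s ∉ _) w,
        cf M A Aᶜ h w = cf M B Aᶜ h' w := by
      rintro _ rfl _ _ _
      rfl
    exact key _ (compl_compl A).symm _ (fun _ => Set.notMem_compl_iff.symm) _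

theorem cf_act {P : FBMod k} {S T : FB} (e : S ≃ T) {A X : Set S} {A' X' : Set T}
    {h : ∀ s, s ∈ X ↔ s ∉ A} {h' : ∀ s, s ∈ X' ↔ s ∉ A'} (hA : ∀ s, s ∈ A ↔ e s ∈ A')
    (hX : ∀ s, s ∈ X ↔ e s ∈ X') (w : (tensor (const k) P).val S) :
    cf P A' X' h' ((tensor (const k) P).act e w) = P.act (FB.restr e hX) (cf P A X h w) := by
  refine LinearMap.congr_fun (f := cf P A' X' h' ∘ₗ (tensor (const k) P).act e)
    (g := P.act (FB.restr e hX) ∘ₗ cf P A X h) (te_ext fun B Y hY x => ?_) w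
  simp only [LinearMap.comp_apply]
  have hB' : ∀ s, s ∈ B ↔ e s ∈ e '' B := fun s => e.injective.mem_set_image.symm
  have hY' : ∀ s, s ∈ Y ↔ e s ∈ e '' Y := fun s => e.injective.mem_set_image.symm
  have hYB : ∀ t, t ∈ e '' Y ↔ t ∉ e '' B := by
    intro t
    obtain ⟨s, rfl⟩ := e.surjective t
    rw [← hB', ← hY', hY]
  rw [act_te e (A' := e '' B) (X' := e '' Y) (h' := hYB) hB' hY']
  by_cases hAB : B = A
  · subst hAB
    obtain rfl : A' = e '' B := by
      ext t
      obtain ⟨s, rfl⟩ := e.surjective t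
      rw [← hB', ← hA]
    obtain rfl : Y = X := Set.ext fun s => (hY s).trans (h s).symm
    obtain rfl : X' = e '' Y := Set.ext fun s => (h' s).trans (hYB s).symm
    rw [cf_te, cf_te]
  · rw [cf_te_ne hAB, cf_te_ne, map_zero]
    intro h
    refine hAB (Set.ext fun s => ?_)
    rw [hB', h, hA]

theorem opr_act {M : FBMod k} (a : tensor (const k) M ⟶ tensor (const k) M) {S T : FB}
    (e : S ≃ T) {X Y : Set S} {X' Y' : Set T} (hX : ∀ s, s ∈ X ↔ e s ∈ X')
    (hY : ∀ s, s ∈ Y ↔ e s ∈ Y') (x : M.val (S.sub X)) :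
    opr a T X' Y' (M.act (FB.restr e hX) x) = M.act (FB.restr e hY) (opr a S X Y x) := by
  unfold opr
  simp only [LinearMap.comp_apply, teL_apply]
  rw [← act_te e (FB.mem_compl_congr e hX) hX (h := fun _ => Set.notMem_compl_iff.symm), app_act,
    cf_act e (FB.mem_compl_congr e hY) hY]

/-- The operator `M(X) ⟶ M(Y)` associated to injections of `X` and `Y` into a set `S`. -/
def W {M : FBMod k} (a : tensor (const k) M ⟶ tensor (const k) M) {X Y S : FB} {i : X → S}
    {j : Y → S} (hi : Function.Injective i) (hj : Function.Injective j) :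
    M.val X →ₗ[k] M.val Y :=
  M.act (T := Y) (show S.sub (Set.range j) ≃ Y from (Equiv.ofInjective j hj).symm) ∘ₗ
    opr a S (Set.range i) (Set.range j) ∘ₗ
    M.act (show X ≃ S.sub (Set.range i) from Equiv.ofInjective i hi)

theorem W_act {M : FBMod k} (a : tensor (const k) M ⟶ tensor (const k) M) {X Y S X' Y' S' : FB}
    {i : X → S} {j : Y → S} {i' : X' → S'} {j' : Y' → S'} (hi : Function.Injective i)
    (hj : Function.Injective j) (hi' : Function.Injective i') (hj' : Function.Injective j')
    (b : X ≃ X') (c : Y ≃ Y') (e : S ≃ S') (hb : ∀ x, i' (b x) = e (i x))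
    (hc : ∀ y, j' (c y) = e (j y)) (x : M.val X) :
    W a hi' hj' (M.act b x) = M.act c (W a hi hj x) := by
  have h1 : ∀ s, s ∈ Set.range i ↔ e s ∈ Set.range i' := by
    intro s
    constructor
    · rintro ⟨x, rfl⟩
      exact ⟨b x, hb x⟩
    · rintro ⟨x', hx'⟩
      obtain ⟨x, rfl⟩ := b.surjective x'
      exact ⟨x, e.injective ((hb x).symm.trans hx')⟩
  have h2 : ∀ s, s ∈ Set.range j ↔ e s ∈ Set.range j' := by
    intro s
    constructor
    · rintro ⟨x, rfl⟩
      exact ⟨c x, hc x⟩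
    · rintro ⟨x', hx'⟩
      obtain ⟨x, rfl⟩ := c.surjective x'
      exact ⟨x, e.injective ((hc x).symm.trans hx')⟩
  unfold W
  simp only [LinearMap.comp_apply]
  have h3 : M.act (show X' ≃ S'.sub (Set.range i') from Equiv.ofInjective i' hi') (M.act b x) =
      M.act (FB.restr e h1)
        (M.act (show X ≃ S.sub (Set.range i) from Equiv.ofInjective i hi) x) := by
    rw [act_act, act_act]
    exact M.act_congr (fun x => Subtype.ext (hb x)) _
  rw [h3, opr_act a e h1 h2, act_act, act_act]
  refine M.act_congr (fun s => ?_) _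
  obtain ⟨y, hy⟩ := s.2
  obtain rfl : s = Equiv.ofInjective j hj y := Subtype.ext hy.symm
  apply (Equiv.ofInjective j' hj').injective
  refine ((Equiv.ofInjective j' hj').apply_symm_apply _).trans ?_
  refine Subtype.ext ?_
  refine Eq.trans ?_ (hc _).symm
  exact congrArg (fun y => e (j y)) ((Equiv.ofInjective j hj).symm_apply_apply y).symm

theorem opr_eq_W {M : FBMod k} (a : tensor (const k) M ⟶ tensor (const k) M) (S : FB)
    (X Y : Set S) : opr a S X Y = W a (X := S.sub X) (Y := S.sub Y) (S := S)
      (i := Subtype.val) (j := Subtype.val) Subtype.val_injective Subtype.val_injective := by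
  ext x
  unfold W
  simp only [LinearMap.comp_apply]
  have h1 : ∀ s, s ∈ X ↔ Equiv.refl S s ∈ Set.range (Subtype.val : S.sub X → S) :=
    fun s => ⟨fun h => ⟨⟨s, h⟩, rfl⟩, fun ⟨x, h⟩ => (show x.1 = s from h) ▸ x.2⟩
  have h2 : ∀ s, s ∈ Y ↔ Equiv.refl S s ∈ Set.range (Subtype.val : S.sub Y → S) :=
    fun s => ⟨fun h => ⟨⟨s, h⟩, rfl⟩, fun ⟨x, h⟩ => (show x.1 = s from h) ▸ x.2⟩
  have := opr_act a (Equiv.refl S) h1 h2 x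
  have h3 : M.act (show S.sub X ≃ S.sub (Set.range (Subtype.val : S.sub X → S)) from
      Equiv.ofInjective _ Subtype.val_injective) x = M.act (FB.restr (Equiv.refl S) h1) x :=
    congrArg (fun e => M.act e x) (Equiv.ext fun _ => rfl)
  rw [h3, this, act_act]
  symm
  refine Eq.trans (M.act_congr (fun s => ?_) _) (M.act_refl _)
  exact (Equiv.ofInjective (Subtype.val : S.sub Y → S) Subtype.val_injective).symm_apply_apply s

open Classical in
/-- The operator `M(X) ⟶ M(Y)` associated to subsets `X` and `Y` of `R`. -/
def fr {M : FBMod k} (a : tensor (const k) M ⟶ tensor (const k) M) {V : FB} (R X Y : Set V) :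
    M.val (V.sub X) →ₗ[k] M.val (V.sub Y) :=
  if h : X ⊆ R ∧ Y ⊆ R then
    W a (X := V.sub X) (Y := V.sub Y) (S := V.sub R) (Set.inclusion_injective h.1)
      (Set.inclusion_injective h.2)
  else 0

theorem fr_pos {M : FBMod k} (a : tensor (const k) M ⟶ tensor (const k) M) {V : FB}
    {R X Y : Set V} (hX : X ⊆ R) (hY : Y ⊆ R) : fr a R X Y =
    W a (X := V.sub X) (Y := V.sub Y) (S := V.sub R) (Set.inclusion_injective hX)
      (Set.inclusion_injective hY) := dif_pos ⟨hX, hY⟩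

theorem opr_nest {M : FBMod k} (a : tensor (const k) M ⟶ tensor (const k) M) {V : FB}
    {R X Y : Set V} (hX : X ⊆ R) (hY : Y ⊆ R) {X' Y' : Set (V.sub R)}
    (hX' : ∀ v, v ∈ X' ↔ v.1 ∈ X) (hY' : ∀ v, v ∈ Y' ↔ v.1 ∈ Y) (x : M.val (V.sub X)) :
    opr a (V.sub R) X' Y' (M.act (nestEquiv hX hX') x) =
      M.act (nestEquiv hY hY') (fr a R X Y x) := by
  rw [opr_eq_W, fr_pos a hX hY]
  exact W_act a (S := V.sub R) (S' := V.sub R) (Set.inclusion_injective hX)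
    (Set.inclusion_injective hY) Subtype.val_injective Subtype.val_injective
    (nestEquiv hX hX') (nestEquiv hY hY') (Equiv.refl _) (fun _ => rfl) (fun _ => rfl) x

theorem mem_sdiff_iff {V : FB} (A Y : Set V) (v : V) :
    v ∈ Y \ A ↔ v ∉ A ∧ v ∉ (A ∪ Y)ᶜ := by
  simp only [Set.mem_sdiff, Set.mem_compl_iff, Set.mem_union]
  tauto

theorem mem_inner_iff {V : FB} {R : Set V} (U : Set (V.sub R)) (s : V.sub R) :
    s ∈ U ↔ s.1 ∈ inner U := ⟨fun h => ⟨s.2, h⟩, fun h => h.choose_spec⟩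

open Classical in
theorem whisker_te₂ {M : FBMod k} (a : tensor (const k) M ⟶ tensor (const k) M) {V : FB}
    {A B X : Set V} (h : ∀ v, v ∈ X ↔ v ∉ A ∧ v ∉ B) (x : M.val (V.sub X)) :
    app (tensorMap (𝟙 (const k)) a) V (te₂ M A B X h x) =
      ∑ Y ∈ Finset.univ.filter (fun Y : Set V => Y ⊆ Aᶜ),
        te₂ M A (A ∪ Y)ᶜ (Y \ A) (mem_sdiff_iff A Y) (fr a Aᶜ X (Y \ A) x) := by
  rw [← sum_inner (R := Aᶜ) Aᶜ (fun _ h => h) fun Y =>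
    te₂ M A (A ∪ Y)ᶜ (Y \ A) (mem_sdiff_iff A Y) (fr a Aᶜ X (Y \ A) x)]
  unfold te₂
  rw [whisker_te, app_te, ← teL_apply, map_sum, Finset.filter_true_of_mem fun D _ v _ => v.2]
  refine Finset.sum_congr rfl fun Y _ => ?_
  rw [teL_apply]
  congr 1
  have hY : ∀ v, v ∈ Y ↔ v.1 ∈ inner Y \ A :=
    fun v => (mem_inner_iff Y v).trans ⟨fun h => ⟨h, v.2⟩, fun h => h.1⟩
  rw [opr_nest a (X := X) (Y := inner Y \ A) (mem_compl_of h) (fun v hv => hv.2)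
    (mem_trace Aᶜ X) hY]
  refine te_congr (fun v => ?_) hY ?_
  · refine (Set.mem_compl_iff Y v).trans ?_
    rw [mem_inner_iff Y]
    exact ⟨fun h1 h2 => h2.elim v.2 h1, fun h1 h2 => h1 (Or.inr h2)⟩
  · rw [act_act]
    exact M.act_congr (fun _ => rfl) _

end FBMod
end

noncomputable section

namespace FBMod

variable {k : Type u} [CommRing k]

/-- `Sym(V) ⊗ P ⟶ Sym(V) ⊗ Sym(V) ⊗ P`. -/
def comulMap (P : FBMod k) :
    tensor (const k) P ⟶ tensor (const k) (tensor (const k) P) :=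
  tensorMap (constComul k) (𝟙 P) ≫ (assoc (const k) (const k) P).hom

/-- `Sym(V) ⊗ Sym(V) ⊗ P ⟶ Sym(V) ⊗ P`. -/
def mulMap (P : FBMod k) :
    tensor (const k) (tensor (const k) P) ⟶ tensor (const k) P :=
  (assoc (const k) (const k) P).inv ≫ tensorMap (constMul k) (𝟙 P)

/-- `swap₁₂`, with both factors equal to `Sym(V) = Div(V)`. -/
def swapMap (P : FBMod k) :
    tensor (const k) (tensor (const k) P) ⟶ tensor (const k) (tensor (const k) P) :=
  swap₁₂ (const k) (const k) P

/-- The map `a'`. -/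
def primeMap {M : FBMod k} (a : tensor (const k) M ⟶ tensor (const k) M) :
    tensor (const k) (tensor (const k) M) ⟶ tensor (const k) (tensor (const k) M) :=
  tensorMap (𝟙 (const k)) (comulMap M) ≫ swapMap (tensor (const k) M) ≫
    tensorMap (𝟙 (const k)) (mulMap M) ≫ tensorMap (𝟙 (const k)) a ≫
    tensorMap (𝟙 (const k)) (comulMap M) ≫ tensorMap (𝟙 (const k)) (𝟙 _) ≫
    mulMap (tensor (const k) M)

theorem rel_iff {M : FBMod k} (a : tensor (const k) M ⟶ tensor (const k) M) :
    (act₂ (symV k) (M := M) a ≫ act₁ (divV k) (M := M) a -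
        act₁ (symV k) (M := M) a ≫ act₂ (divV k) (M := M) a =
      aPrime (M := M) a - aDoublePrime (M := M) a) ↔
    tensorMap (𝟙 (const k)) a ≫ swapMap M ≫ tensorMap (𝟙 (const k)) a ≫ swapMap M -
      (swapMap M ≫ tensorMap (𝟙 (const k)) a ≫ swapMap M) ≫ tensorMap (𝟙 (const k)) a =
    primeMap a - swapMap M ≫ primeMap a ≫ swapMap M := Iff.rfl

open Classical in
theorem sum_inner' {V : FB} {R : Set V} {Q : Type*} [AddCommMonoid Q] (f : Set V → Q) :
    ∑ D : Set (V.sub R), f (inner D) =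
      ∑ C ∈ Finset.univ.filter (fun C : Set V => C ⊆ R), f C := by
  rw [← sum_inner R fun _ h => h, Finset.filter_true_of_mem fun D _ v _ => v.2]

theorem mem_inter_sdiff {V : FB} {A X : Set V} (D : Set V) (h : ∀ v, v ∈ X ↔ v ∉ A) (v : V) :
    v ∈ X ↔ v ∉ A ∩ D ∧ v ∉ A \ D := by
  rw [h]
  simp only [Set.mem_inter_iff, Set.mem_sdiff]
  tauto

theorem mem_inter_sdiff₃ {V : FB} {A B X : Set V} (D : Set V) (h : ∀ v, v ∈ X ↔ v ∉ A ∧ v ∉ B)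
    (v : V) : v ∈ X ↔ v ∉ A ∧ v ∉ B ∩ D ∧ v ∉ B \ D := by
  rw [h]
  simp only [Set.mem_inter_iff, Set.mem_sdiff]
  tauto

open Classical in
theorem comulMap_te (P : FBMod k) {S : FB} {A X : Set S} (h : ∀ s, s ∈ X ↔ s ∉ A)
    (x : P.val (S.sub X)) :
    app (comulMap P) S (te P A X h x) = ∑ D ∈ Finset.univ.filter (fun D : Set S => D ⊆ A),
      te₂ P (A ∩ D) (A \ D) X (mem_inter_sdiff D h) x := by
  refine (comul_te P h x).trans ?_
  rw [← sum_inner' fun D => te₂ P (A ∩ D) (A \ D) X (mem_inter_sdiff D h) x]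
  refine Finset.sum_congr rfl fun D _ => te₂_congr ?_ ?_ (fun _ => Iff.rfl) (P.act_refl x)
  · exact Set.ext fun s => ⟨fun h => ⟨h.1, h⟩, fun h => h.2⟩
  · exact Set.ext fun s => ⟨fun h => ⟨h.1, fun h' => h.2 h'.2⟩, fun h => ⟨h.1, fun h' => h.2 ⟨h.1, h'⟩⟩⟩

theorem mulMap_te₂ (P : FBMod k) {S : FB} {A B C X : Set S} (hX : ∀ s, s ∈ X ↔ s ∉ A ∧ s ∉ B)
    (hC : ∀ s, s ∈ C ↔ s ∈ A ∨ s ∈ B) (hX' : ∀ s, s ∈ X ↔ s ∉ C) (x : P.val (S.sub X)) :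
    app (mulMap P) S (te₂ P A B X hX x) = te P C X hX' x :=
  mul_te₂ P hX hC hX' x

theorem swapMap_te₂ (P : FBMod k) {S : FB} {A B X : Set S} (hX : ∀ s, s ∈ X ↔ s ∉ A ∧ s ∉ B)
    (hX' : ∀ s, s ∈ X ↔ s ∉ B ∧ s ∉ A) (hAB : ∀ s, s ∈ A → s ∉ B) (x : P.val (S.sub X)) :
    app (swapMap P) S (te₂ P A B X hX x) = te₂ P B A X hX' x :=
  swap_te₂ P hX hX' hAB x

open Classical in
theorem whisker_comulMap_te₂ (P : FBMod k) {S : FB} {A B X : Set S}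
    (h : ∀ s, s ∈ X ↔ s ∉ A ∧ s ∉ B) (hAB : ∀ s, s ∈ A → s ∉ B) (x : P.val (S.sub X)) :
    app (tensorMap (𝟙 (const k)) (comulMap P)) S (te₂ P A B X h x) =
      ∑ D ∈ Finset.univ.filter (fun D : Set S => D ⊆ B),
        te₃ P A (B ∩ D) (B \ D) X (mem_inter_sdiff₃ D h) x := by
  rw [← sum_inner (R := Aᶜ) B (fun s h h' => hAB s h' h) fun D =>
    te₃ P A (B ∩ D) (B \ D) X (mem_inter_sdiff₃ D h) x]
  unfold te₂
  rw [whisker_te, comulMap_te, ← teL_apply, map_sum]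
  refine Finset.sum_congr rfl fun D _ => ?_
  rw [teL_apply]
  unfold te₃
  congr 1
  refine te₂_congr ?_ ?_ (fun _ => Iff.rfl) (P.act_refl _)
  · exact Set.ext fun s => ⟨fun h => ⟨h.1, s.2, h.2⟩, fun h => ⟨h.1, h.2.2⟩⟩
  · exact Set.ext fun s => ⟨fun h => ⟨h.1, fun h' => h.2 h'.2⟩,
      fun h => ⟨h.1, fun h' => h.2 ⟨s.2, h'⟩⟩⟩

theorem swapMap_te₃ (P : FBMod k) {S : FB} {A B C X : Set S}
    (h : ∀ s, s ∈ X ↔ s ∉ A ∧ s ∉ B ∧ s ∉ C) (h' : ∀ s, s ∈ X ↔ s ∉ B ∧ s ∉ A ∧ s ∉ C)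
    (hAB : ∀ s, s ∈ A → s ∉ B) (x : P.val (S.sub X)) :
    app (swapMap (tensor (const k) P)) S (te₃ P A B C X h x) = te₃ P B A C X h' x := by
  rw [te₃_eq, te₃_eq, swapMap_te₂ _ _ (fun s => (mem_union_compl A B s).trans and_comm) hAB]
  have hu : ∀ s, s ∈ (A ∪ B)ᶜ ↔ s ∈ (B ∪ A)ᶜ := fun s => by rw [Set.union_comm]
  refine te₂_congr rfl rfl hu ?_
  have hC' : ∀ s, s ∈ trace (A ∪ B)ᶜ C ↔ setEquiv hu s ∈ trace (B ∪ A)ᶜ C := fun _ => Iff.rfl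
  have hX' : ∀ s, s ∈ trace (A ∪ B)ᶜ X ↔ setEquiv hu s ∈ trace (B ∪ A)ᶜ X := fun _ => Iff.rfl
  rw [act_te (setEquiv hu) (h' := mem_trace_union_compl h') hC' hX']
  refine te_congr (fun _ => Iff.rfl) (fun _ => Iff.rfl) ?_
  simp only [act_act]
  exact P.act_congr (fun _ => rfl) _

theorem whisker_mulMap_te₃ (P : FBMod k) {S : FB} {A B C E X : Set S}
    (h : ∀ s, s ∈ X ↔ s ∉ A ∧ s ∉ B ∧ s ∉ C) (hE : ∀ s, s ∈ E ↔ s ∈ B ∨ s ∈ C)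
    (h' : ∀ s, s ∈ X ↔ s ∉ A ∧ s ∉ E) (x : P.val (S.sub X)) :
    app (tensorMap (𝟙 (const k)) (mulMap P)) S (te₃ P A B C X h x) = te₂ P A E X h' x := by
  unfold te₃
  rw [whisker_te, mulMap_te₂ (C := trace Aᶜ E) (hX' := mem_trace_compl h')]
  · rfl
  · exact fun s => hE s.1

theorem mulMap_te₃ (P : FBMod k) {S : FB} {A B C E X : Set S}
    (h : ∀ s, s ∈ X ↔ s ∉ A ∧ s ∉ B ∧ s ∉ C) (hE : E = A ∪ B)
    (h' : ∀ s, s ∈ X ↔ s ∉ E ∧ s ∉ C) (x : P.val (S.sub X)) :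
    app (mulMap (tensor (const k) P)) S (te₃ P A B C X h x) = te₂ P E C X h' x := by
  subst hE
  rw [te₃_eq, mulMap_te₂ _ (mem_union_compl A B) (fun _ => Iff.rfl) (mem_compl' (A ∪ B))]
  rfl

theorem prime_aux {V : FB} (A C Y D : Set V) (v : V) : v ∈ Y \ (A ∩ C) ↔
    v ∉ (A ∩ C) ∪ ((A ∩ C ∪ Y)ᶜ ∩ D) ∧ v ∉ (A ∩ C ∪ Y)ᶜ \ D := by
  simp only [Set.mem_inter_iff, Set.mem_sdiff, Set.mem_union, Set.mem_compl_iff]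
  tauto

open Classical in
theorem primeMap_te₂ {M : FBMod k} (a : tensor (const k) M ⟶ tensor (const k) M) {V : FB}
    {A₁ A₂ X : Set V} (h : ∀ v, v ∈ X ↔ v ∉ A₁ ∧ v ∉ A₂) (hA : ∀ v, v ∈ A₁ → v ∉ A₂)
    (x : M.val (V.sub X)) :
    app (primeMap a) V (te₂ M A₁ A₂ X h x) =
      ∑ C ∈ Finset.univ.filter (fun C : Set V => C ⊆ A₂),
      ∑ Y ∈ Finset.univ.filter (fun Y : Set V => Y ⊆ (A₂ ∩ C)ᶜ),
      ∑ D ∈ Finset.univ.filter (fun D : Set V => D ⊆ (A₂ ∩ C ∪ Y)ᶜ),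
        te₂ M ((A₂ ∩ C) ∪ ((A₂ ∩ C ∪ Y)ᶜ ∩ D)) ((A₂ ∩ C ∪ Y)ᶜ \ D) (Y \ (A₂ ∩ C))
          (prime_aux A₂ C Y D) (fr a (A₂ ∩ C)ᶜ X (Y \ (A₂ ∩ C)) x) := by
  unfold primeMap
  simp only [app_comp]
  rw [whisker_comulMap_te₂ M h hA]
  simp only [map_sum]
  refine Finset.sum_congr rfl fun C _ => ?_
  have h1 : ∀ v, v ∈ X ↔ v ∉ A₂ ∩ C ∧ v ∉ A₁ ∧ v ∉ A₂ \ C := fun v =>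
    (mem_inter_sdiff₃ C h v).trans ⟨fun h => ⟨h.2.1, h.1, h.2.2⟩, fun h => ⟨h.2.1, h.1, h.2.2⟩⟩
  have h2 : ∀ v, v ∈ X ↔ v ∉ A₂ ∩ C ∧ v ∉ A₁ ∪ A₂ \ C := fun v =>
    (h1 v).trans (and_congr_right fun _ => not_or.symm)
  rw [swapMap_te₃ M _ h1 fun v h h' => hA v h h'.1, whisker_mulMap_te₃ M (E := A₁ ∪ A₂ \ C) h1 (fun v => Set.mem_union v _ _) h2,
    whisker_te₂]
  simp only [map_sum]
  refine Finset.sum_congr rfl fun Y _ => ?_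
  rw [whisker_comulMap_te₂ M (mem_sdiff_iff (A₂ ∩ C) Y) fun v h h' => h' (Or.inl h)]
  simp only [map_sum]
  refine Finset.sum_congr rfl fun D _ => ?_
  have h3 : tensorMap (𝟙 (const k)) (𝟙 (tensor (const k) (tensor (const k) M))) = 𝟙 _ :=
    id_tensorHom_id (const k) (tensor (const k) (tensor (const k) M))
  rw [h3, app_id, mulMap_te₃ M _ rfl (prime_aux A₂ C Y D)]

theorem cf₂_te₂_eq {P : FBMod k} {S : FB} {A B A' B' X X' : Set S}
    {h : ∀ s, s ∈ X ↔ s ∉ A ∧ s ∉ B} {h' : ∀ s, s ∈ X' ↔ s ∉ A' ∧ s ∉ B'}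
    (hA : A' = A) (hB : B' = B) (hX : ∀ s, s ∈ X' ↔ s ∈ X) (x : P.val (S.sub X')) :
    cf₂ P A B X h (te₂ P A' B' X' h' x) = P.act (setEquiv hX) x := by
  subst hA hB
  obtain rfl : X' = X := Set.ext hX
  rw [cf₂_te₂]
  exact (P.act_refl x).symm

theorem act_fr {M : FBMod k} (a : tensor (const k) M ⟶ tensor (const k) M) {V : FB}
    {R X Y R' Y' : Set V} (hR : R = R') (hY : ∀ v, v ∈ Y ↔ v ∈ Y') (x : M.val (V.sub X)) :
    M.act (setEquiv hY) (fr a R X Y x) = fr a R' X Y' x := by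
  subst hR
  obtain rfl : Y = Y' := Set.ext hY
  exact M.act_refl _

open Classical in
theorem cf₂_primeMap {M : FBMod k} (a : tensor (const k) M ⟶ tensor (const k) M) {V : FB}
    {A₁ A₂ X B₁ B₂ Y : Set V} (h : ∀ v, v ∈ X ↔ v ∉ A₁ ∧ v ∉ A₂) (hA : ∀ v, v ∈ A₁ → v ∉ A₂)
    (h' : ∀ v, v ∈ Y ↔ v ∉ B₁ ∧ v ∉ B₂) (hB : ∀ v, v ∈ B₁ → v ∉ B₂)
    (x : M.val (V.sub X)) :
    cf₂ M B₁ B₂ Y h' (app (primeMap a) V (te₂ M A₁ A₂ X h x)) =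
      ∑ C ∈ Finset.univ.filter (fun C : Set V => C ⊆ A₂ ∩ B₁), fr a Cᶜ X Y x := by
  rw [primeMap_te₂ a h hA]
  simp only [map_sum]
  have hsub : Finset.univ.filter (fun C : Set V => C ⊆ A₂ ∩ B₁) ⊆
      Finset.univ.filter (fun C : Set V => C ⊆ A₂) := by
    intro C hC
    rw [Finset.mem_filter] at hC ⊢
    exact ⟨hC.1, fun v hv => (hC.2 hv).1⟩
  have hdisj : ∀ C Z D : Set V, ∀ v, v ∈ A₂ ∩ C ∪ (A₂ ∩ C ∪ Z)ᶜ ∩ D →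
      v ∉ (A₂ ∩ C ∪ Z)ᶜ \ D := by
    rintro C Z D v (hv | hv) hv'
    · exact hv'.1 (Or.inl hv)
    · exact hv'.2 hv.2
  rw [← Finset.sum_subset hsub]
  · refine Finset.sum_congr rfl fun C hC => ?_
    rw [Finset.mem_filter] at hC
    have hAC : A₂ ∩ C = C := Set.inter_eq_self_of_subset_right fun v hv => (hC.2 hv).1
    have hCA : ∀ v, v ∈ C → v ∈ A₂ := fun v hv => (hC.2 hv).1
    have hCB : ∀ v, v ∈ C → v ∈ B₁ := fun v hv => (hC.2 hv).2
    have hYC : ∀ v, v ∈ Y \ (A₂ ∩ C) ↔ v ∈ Y := fun v =>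
      ⟨fun hv => hv.1, fun hv => ⟨hv, fun hc => ((h' v).1 hv).1 (hCB v hc.2)⟩⟩
    rw [Finset.sum_eq_single_of_mem Y, Finset.sum_eq_single_of_mem (B₁ \ C), cf₂_te₂_eq,
      act_fr a (congrArg _ hAC) hYC]
    · ext v
      have := h' v
      have := hCB v
      have := hCA v
      simp only [Set.mem_union, Set.mem_inter_iff, Set.mem_compl_iff, Set.mem_sdiff]
      tauto
    · ext v
      have := h' v
      have := hCB v
      have := hB v
      have := hCA v
      simp only [Set.mem_union, Set.mem_inter_iff, Set.mem_compl_iff, Set.mem_sdiff]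
      tauto
    · exact hYC
    · rw [Finset.mem_filter]
      refine ⟨Finset.mem_univ _, fun v hv => ?_⟩
      rintro (hv' | hv')
      · exact hv.2 hv'.2
      · exact ((h' v).1 hv').1 hv.1
    · intro D hD hne
      rw [Finset.mem_filter] at hD
      have hd := hdisj C Y D
      refine cf₂_te₂_ne hB hd (fun ⟨e1, e2⟩ => hne ?_) _
      ext v
      have e1 := Set.ext_iff.1 e1 v
      have e2 := Set.ext_iff.1 e2 v
      have h3 := @hD.2 v
      simp only [Set.mem_union, Set.mem_inter_iff, Set.mem_compl_iff, Set.mem_sdiff] at e1 e2 h3 ⊢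
      tauto
    · rw [Finset.mem_filter]
      exact ⟨Finset.mem_univ _, fun v hv hv' => ((h' v).1 hv).1 (hCB v hv'.2)⟩
    · intro Z hZ hne
      rw [Finset.mem_filter] at hZ
      refine Finset.sum_eq_zero fun D hD => ?_
      have hd := hdisj C Z D
      refine cf₂_te₂_ne hB hd (fun ⟨e1, e2⟩ => hne ?_) _
      ext v
      have e1 := Set.ext_iff.1 e1 v
      have e2 := Set.ext_iff.1 e2 v
      have h3 := @hZ.2 v
      have := h' v
      simp only [Set.mem_union, Set.mem_inter_iff, Set.mem_compl_iff, Set.mem_sdiff] at e1 e2 h3 ⊢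
      tauto
  · intro C hC hne
    rw [Finset.mem_filter] at hC
    refine Finset.sum_eq_zero fun Z _ => Finset.sum_eq_zero fun D _ => ?_
    refine cf₂_te₂_ne hB (hdisj C Z D) (fun ⟨e1, e2⟩ => hne ?_) _
    rw [Finset.mem_filter]
    refine ⟨Finset.mem_univ _, fun v hv => ⟨hC.2 hv, ?_⟩⟩
    rw [← e1]
    exact Or.inl ⟨hC.2 hv, hv⟩

end FBMod
end

noncomputable section

namespace FBMod

variable {k : Type u} [CommRing k]

theorem cf₂_swapMap {P : FBMod k} {S : FB} {A B X : Set S} (h : ∀ s, s ∈ X ↔ s ∉ A ∧ s ∉ B)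
    (h' : ∀ s, s ∈ X ↔ s ∉ B ∧ s ∉ A) (hAB : ∀ s, s ∈ A → s ∉ B)
    (w : (tensor (const k) (tensor (const k) P)).val S) :
    cf₂ P A B X h (app (swapMap P) S w) = cf₂ P B A X h' w := by
  refine LinearMap.congr_fun (f := cf₂ P A B X h ∘ₗ app (swapMap P) S) (g := cf₂ P B A X h')
    (te₂_ext fun A' B' Y hY x hA => ?_) w
  have hBA : ∀ s, s ∈ B → s ∉ A := fun s h h' => hAB s h' h
  have hA' : ∀ s, s ∈ B' → s ∉ A' := fun s h h' => hA s h' h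
  have hY' : ∀ s, s ∈ Y ↔ s ∉ B' ∧ s ∉ A' := fun s => (hY s).trans and_comm
  rw [LinearMap.comp_apply, swapMap_te₂ P hY hY' hA]
  by_cases hne : A' = B ∧ B' = A
  · have hX : ∀ s, s ∈ Y ↔ s ∈ X := fun s => by rw [hY, h', hne.1, hne.2]
    rw [cf₂_te₂_eq hne.2 hne.1 hX, cf₂_te₂_eq hne.1 hne.2 hX]
  · rw [cf₂_te₂_ne hAB hA' fun h => hne h.symm, cf₂_te₂_ne hBA hA hne]

open Classical in
theorem cf₂_whisker {M : FBMod k} (a : tensor (const k) M ⟶ tensor (const k) M) {V : FB}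
    {A A' X B B' Y : Set V} (h : ∀ v, v ∈ X ↔ v ∉ A ∧ v ∉ A')
    (h' : ∀ v, v ∈ Y ↔ v ∉ B ∧ v ∉ B') (hB : ∀ v, v ∈ B → v ∉ B')
    (x : M.val (V.sub X)) :
    cf₂ M B B' Y h' (app (tensorMap (𝟙 (const k)) a) V (te₂ M A A' X h x)) =
      if A = B then fr a Aᶜ X Y x else 0 := by
  rw [whisker_te₂, map_sum]
  have hd : ∀ Z v, v ∈ A → v ∉ (A ∪ Z)ᶜ := fun Z v hv hv' => hv' (Or.inl hv)
  split_ifs with hAB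
  · subst hAB
    rw [Finset.sum_eq_single_of_mem Y]
    · have hYA : ∀ v, v ∈ Y \ A ↔ v ∈ Y := fun v =>
        ⟨fun h => h.1, fun hv => ⟨hv, ((h' v).1 hv).1⟩⟩
      rw [cf₂_te₂_eq rfl _ hYA, act_fr a rfl]
      ext v
      have := h' v
      have := hB v
      simp only [Set.mem_compl_iff, Set.mem_union]
      tauto
    · rw [Finset.mem_filter]
      exact ⟨Finset.mem_univ _, fun v hv => ((h' v).1 hv).1⟩
    · intro Z hZ hne
      rw [Finset.mem_filter] at hZ
      refine cf₂_te₂_ne hB (hd Z) (fun ⟨_, e⟩ => hne ?_) _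
      ext v
      have := h' v
      have := hB v
      have := @hZ.2 v
      have e := Set.ext_iff.1 e v
      simp only [Set.mem_compl_iff, Set.mem_union] at *
      tauto
  · refine Finset.sum_eq_zero fun Z _ => cf₂_te₂_ne hB (hd Z) (fun h => hAB h.1) _

theorem fr_fr_congr {M : FBMod k} (a : tensor (const k) M ⟶ tensor (const k) M) {V : FB}
    {R R' X Z Z' U U' Y : Set V} (hR : R = R') (hZ : Z = Z') (hU : U = U')
    (x : M.val (V.sub X)) :
    fr a R Z Y (fr a U X Z x) = fr a R' Z' Y (fr a U' X Z' x) := by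
  subst hR hZ hU
  rfl

open Classical in
theorem cf₂_whisker_swap {M : FBMod k} (a : tensor (const k) M ⟶ tensor (const k) M) {V : FB}
    {A A' X B B' Y : Set V} (h : ∀ v, v ∈ X ↔ v ∉ A ∧ v ∉ A')
    (h' : ∀ v, v ∈ Y ↔ v ∉ B ∧ v ∉ B') (hB : ∀ v, v ∈ B → v ∉ B')
    (x : M.val (V.sub X)) :
    cf₂ M B B' Y h' (app (tensorMap (𝟙 (const k)) a) V (app (swapMap M) V
      (app (tensorMap (𝟙 (const k)) a) V (te₂ M A A' X h x)))) =
      if ∀ v, v ∈ A → v ∉ B then fr a Bᶜ (A ∪ B)ᶜ Y (fr a Aᶜ X (A ∪ B)ᶜ x) else 0 := by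
  rw [whisker_te₂]
  simp only [map_sum]
  have key : ∀ Z : Set V, cf₂ M B B' Y h' (app (tensorMap (𝟙 (const k)) a) V
      (app (swapMap M) V (te₂ M A (A ∪ Z)ᶜ (Z \ A) (mem_sdiff_iff A Z) (fr a Aᶜ X (Z \ A) x)))) =
      if (A ∪ Z)ᶜ = B then fr a (A ∪ Z)ᶜᶜ (Z \ A) Y (fr a Aᶜ X (Z \ A) x) else 0 := by
    intro Z
    have hZ : ∀ v, v ∈ Z \ A ↔ v ∉ (A ∪ Z)ᶜ ∧ v ∉ A := fun v => (mem_sdiff_iff A Z v).trans and_comm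
    rw [swapMap_te₂ M _ hZ (fun v hv hv' => hv' (Or.inl hv)), cf₂_whisker a hZ h' hB]
  simp only [key]
  split_ifs with hAB
  · rw [Finset.sum_eq_single_of_mem (A ∪ B)ᶜ]
    · have e : (A ∪ (A ∪ B)ᶜ)ᶜ = B := by
        ext v
        have := hAB v
        simp only [Set.mem_compl_iff, Set.mem_union]
        tauto
      rw [if_pos e]
      refine fr_fr_congr a (congrArg _ e) ?_ rfl x
      ext v
      simp only [Set.mem_compl_iff, Set.mem_union, Set.mem_sdiff]
      tauto
    · rw [Finset.mem_filter]
      exact ⟨Finset.mem_univ _, fun v hv hv' => hv (Or.inl hv')⟩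
    · intro Z hZ hne
      rw [Finset.mem_filter] at hZ
      refine if_neg fun e => hne ?_
      ext v
      have := @hZ.2 v
      have e := Set.ext_iff.1 e v
      simp only [Set.mem_compl_iff, Set.mem_union] at *
      tauto
  · refine Finset.sum_eq_zero fun Z _ => if_neg fun e => hAB fun v hv hv' => ?_
    rw [← e] at hv'
    exact hv' (Or.inl hv)

open Classical in
/-- The relation that defines the curried Weyl algebra, in terms of matrix coefficients. -/
def WeylRel {M : FBMod k} (w : ∀ {V : FB} (_ X Y : Set V), M.val (V.sub X) →ₗ[k] M.val (V.sub Y)) :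
    Prop :=
  ∀ {V : FB} {A₁ A₂ B₁ B₂ X Y : Set V} (_ : ∀ v, v ∈ X ↔ v ∉ A₁ ∧ v ∉ A₂)
    (_ : ∀ v, v ∈ Y ↔ v ∉ B₁ ∧ v ∉ B₂) (_ : ∀ v, v ∈ A₁ → v ∉ A₂) (_ : ∀ v, v ∈ B₁ → v ∉ B₂)
    (x : M.val (V.sub X)),
    ((if ∀ v, v ∈ A₁ → v ∉ B₂ then w B₂ᶜ (A₁ ∪ B₂)ᶜ Y (w A₁ᶜ X (A₁ ∪ B₂)ᶜ x) else 0) -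
      if ∀ v, v ∈ A₂ → v ∉ B₁ then w B₁ᶜ (A₂ ∪ B₁)ᶜ Y (w A₂ᶜ X (A₂ ∪ B₁)ᶜ x) else 0) =
    ∑ C ∈ Finset.univ.filter (fun C : Set V => C ⊆ A₂ ∩ B₁), w Cᶜ X Y x -
      ∑ C ∈ Finset.univ.filter (fun C : Set V => C ⊆ A₁ ∩ B₂), w Cᶜ X Y x

theorem rel_iff_weylRel {M : FBMod k} (a : tensor (const k) M ⟶ tensor (const k) M) :
    (act₂ (symV k) (M := M) a ≫ act₁ (divV k) (M := M) a -
        act₁ (symV k) (M := M) a ≫ act₂ (divV k) (M := M) a =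
      aPrime (M := M) a - aDoublePrime (M := M) a) ↔ WeylRel (fr a) := by
  rw [rel_iff]
  constructor
  · intro H V A₁ A₂ B₁ B₂ X Y hX hY hA hB x
    have hX' : ∀ v, v ∈ X ↔ v ∉ A₂ ∧ v ∉ A₁ := fun v => (hX v).trans and_comm
    have hY' : ∀ v, v ∈ Y ↔ v ∉ B₂ ∧ v ∉ B₁ := fun v => (hY v).trans and_comm
    have hA' : ∀ v, v ∈ A₂ → v ∉ A₁ := fun v h h' => hA v h' h
    have hB' : ∀ v, v ∈ B₂ → v ∉ B₁ := fun v h h' => hB v h' h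
    have h1 := cf₂_whisker_swap a hX hY' hB' x
    have h2 := cf₂_whisker_swap a hX' hY hB x
    have h3 := cf₂_primeMap a hX hA hY hB x
    have h4 := cf₂_primeMap a hX' hA' hY' hB' x
    have H := congrArg (fun f => cf₂ M B₁ B₂ Y hY (app f V (te₂ M A₁ A₂ X hX x))) H
    change cf₂ M B₁ B₂ Y hY (app (swapMap M) V (app (tensorMap (𝟙 (const k)) a) V
        (app (swapMap M) V (app (tensorMap (𝟙 (const k)) a) V (te₂ M A₁ A₂ X hX x)))) -
        app (tensorMap (𝟙 (const k)) a) V (app (swapMap M) V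
        (app (tensorMap (𝟙 (const k)) a) V (app (swapMap M) V (te₂ M A₁ A₂ X hX x))))) =
      cf₂ M B₁ B₂ Y hY (app (primeMap a) V (te₂ M A₁ A₂ X hX x) -
        app (swapMap M) V (app (primeMap a) V (app (swapMap M) V (te₂ M A₁ A₂ X hX x)))) at H
    rw [map_sub, map_sub, cf₂_swapMap hY hY' hB, cf₂_swapMap hY hY' hB, swapMap_te₂ M hX hX' hA,
      h1, h2, h3, h4] at H
    exact H
  · intro H
    refine hom_ext fun V => te₂_ext fun A₁ A₂ X hX x hA => cf₂_ext fun B₁ B₂ Y hY hB => ?_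
    have hX' : ∀ v, v ∈ X ↔ v ∉ A₂ ∧ v ∉ A₁ := fun v => (hX v).trans and_comm
    have hY' : ∀ v, v ∈ Y ↔ v ∉ B₂ ∧ v ∉ B₁ := fun v => (hY v).trans and_comm
    have hA' : ∀ v, v ∈ A₂ → v ∉ A₁ := fun v h h' => hA v h' h
    have hB' : ∀ v, v ∈ B₂ → v ∉ B₁ := fun v h h' => hB v h' h
    have h1 := cf₂_whisker_swap a hX hY' hB' x
    have h2 := cf₂_whisker_swap a hX' hY hB x
    have h3 := cf₂_primeMap a hX hA hY hB x
    have h4 := cf₂_primeMap a hX' hA' hY' hB' x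
    change cf₂ M B₁ B₂ Y hY (app (swapMap M) V (app (tensorMap (𝟙 (const k)) a) V
        (app (swapMap M) V (app (tensorMap (𝟙 (const k)) a) V (te₂ M A₁ A₂ X hX x)))) -
        app (tensorMap (𝟙 (const k)) a) V (app (swapMap M) V
        (app (tensorMap (𝟙 (const k)) a) V (app (swapMap M) V (te₂ M A₁ A₂ X hX x))))) =
      cf₂ M B₁ B₂ Y hY (app (primeMap a) V (te₂ M A₁ A₂ X hX x) -
        app (swapMap M) V (app (primeMap a) V (app (swapMap M) V (te₂ M A₁ A₂ X hX x))))
    rw [map_sub, map_sub, cf₂_swapMap hY hY' hB, cf₂_swapMap hY hY' hB, swapMap_te₂ M hX hX' hA,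
      h1, h2, h3, h4]
    exact H hX hY hA hB x

end FBMod
end

noncomputable section

namespace FBMod

variable {k : Type u} [CommRing k]

theorem mem_iff_not_compl {S : FB} (X : Set S) (s : S) : s ∈ X ↔ s ∉ Xᶜ :=
  Set.notMem_compl_iff.symm

theorem opr_apply {M : FBMod k} (a : tensor (const k) M ⟶ tensor (const k) M) (S : FB)
    (X Y : Set S) (x : M.val (S.sub X)) :
    opr a S X Y x =
      cf M Yᶜ Y (mem_iff_not_compl Y) (app a S (te M Xᶜ X (mem_iff_not_compl X) x)) := rfl

theorem cf_congr {M : FBMod k} {S : FB} {A B X : Set S} (hAB : A = B) {h : ∀ s, s ∈ X ↔ s ∉ A}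
    {h' : ∀ s, s ∈ X ↔ s ∉ B} (w : (tensor (const k) M).val S) :
    cf M A X h w = cf M B X h' w := by
  subst hAB
  rfl

theorem opr_eq {M : FBMod k} (a : tensor (const k) M ⟶ tensor (const k) M) {S : FB}
    {X Y A B : Set S} (hA : ∀ s, s ∈ X ↔ s ∉ A) (hB : ∀ s, s ∈ Y ↔ s ∉ B)
    (x : M.val (S.sub X)) :
    opr a S X Y x = cf M B Y hB (app a S (te M A X hA x)) := by
  rw [te_compl, opr_apply]
  refine cf_congr (Set.ext fun s => ?_) _
  rw [Set.mem_compl_iff, hB, not_not]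

/-! ### Standard representations and central characters -/

theorem card_singleton {S : FB} (i : S) : Nat.card (S.sub {i}) = 1 := Nat.card_unique

/-- The coefficient of `t^i` in an element of `V ⊗ M`. -/
def cfV (M : FBMod k) {S : FB} (i : S) :
    (tensor (symPow k 1) M).val S →ₗ[k] M.val (S.sub {i}ᶜ) :=
  TensorProduct.lift ((LinearMap.lsmul k (M.val (S.sub {i}ᶜ))).comp
    (LinearMap.proj ⟨card_singleton i⟩)) ∘ₗ LinearMap.proj ({i} : Set S)

theorem cfV_el {M : FBMod k} {S : FB} (i : S) (u : (symPow k 1).val (S.sub {i}))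
    (x : M.val (S.sub {i}ᶜ)) :
    cfV M i (el {i} u x) = u ⟨card_singleton i⟩ • x := by
  change TensorProduct.lift _ (el {i} u x {i}) = _
  unfold el
  rw [Pi.single_eq_same]
  rfl

theorem cfV_el_ne {M : FBMod k} {S : FB} {i : S} {A : Set S} (h : A ≠ {i})
    (u : (symPow k 1).val (S.sub A)) (x : M.val (S.sub Aᶜ)) :
    cfV M i (el A u x) = 0 := by
  change TensorProduct.lift _ (el A u x {i}) = _
  unfold el
  rw [Pi.single_eq_of_ne h.symm, map_zero]

theorem cfV_ext {M : FBMod k} {S : FB} {w w' : (tensor (symPow k 1) M).val S}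
    (h : ∀ i, cfV M i w = cfV M i w') : w = w' := by
  funext A
  by_cases hA : Nat.card (S.sub A) = 1
  · have hA' := (Nat.card_eq_one_iff_unique.1 hA)
    obtain ⟨⟨hs⟩, ⟨j⟩⟩ := hA'
    have hAj : ∃ i : S.carrier, A = ({i} : Set S.carrier) := by
      refine ⟨j.1, ?_⟩
      ext s
      exact ⟨fun h => congrArg Subtype.val (hs ⟨s, h⟩ j), fun h => (show s = j.1 from h) ▸ j.2⟩
    clear hs j
    obtain ⟨i, rfl⟩ := hAj
    have key : TensorProduct.mk k ((symPow k 1).val (S.sub ({i} : Set S.carrier)))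
        (M.val (S.sub ({i} : Set S.carrier)ᶜ)) (basisVec k 1 _) ∘ₗ
        TensorProduct.lift ((LinearMap.lsmul k (M.val (S.sub ({i} : Set S.carrier)ᶜ))).comp
          (LinearMap.proj ⟨card_singleton i⟩)) = LinearMap.id := TensorProduct.ext' fun u x => by
      refine (TensorProduct.tmul_smul _ _ _).trans ?_
      refine (TensorProduct.smul_tmul' _ _ _).trans ?_
      congr 1
      funext g
      exact mul_one (u g)
    have h1 := LinearMap.congr_fun key (w {i})
    have h2 := LinearMap.congr_fun key (w' {i})
    exact h1.symm.trans ((congrArg (fun y => basisVec k 1 _ ⊗ₜ y) (h i)).trans h2)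
  · have : ∀ u : (symPow k 1).val (S.sub A), u = 0 := fun u => funext fun g => (hA g.down).elim
    have h0 : ∀ z : (symPow k 1).val (S.sub A) ⊗[k] M.val (S.sub Aᶜ), z = 0 := by
      intro z
      induction z using TensorProduct.induction_on with
      | zero => rfl
      | add z z' hz hz' => rw [hz, hz', add_zero]
      | tmul u x => rw [this u, TensorProduct.zero_tmul]
    rw [h0 (w A), h0 (w' A)]

/-- The projection of `Div(V)` onto `Div^n(V)`, with source written as `const k`. -/
def constProj (k : Type u) [CommRing k] (n : ℕ) : const k ⟶ symPow k n := divProj k n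

theorem cfV_divProj {M : FBMod k} {S : FB} (i : S) (w : (tensor (const k) M).val S) :
    cfV M i (app (tensorMap (constProj k 1) (𝟙 M)) S w) =
      cf M {i} {i}ᶜ (mem_compl' {i}) w := by
  refine LinearMap.congr_fun
    (f := cfV M i ∘ₗ app (tensorMap (constProj k 1) (𝟙 M)) S)
    (g := cf M {i} {i}ᶜ (mem_compl' {i})) (te_ext fun A X hX x => ?_) w
  rw [LinearMap.comp_apply]
  have h1 : app (tensorMap (constProj k 1) (𝟙 M)) S (te M A X hX x) =
    el A (basisVec k 1 _) (M.act (setEquiv (Y := Aᶜ) hX) x) := tensorMap_el _ _ _ _ _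
  rw [h1]
  by_cases hA : A = {i}
  · subst hA
    obtain rfl : X = {i}ᶜ := Set.ext hX
    rw [cf_te, cfV_el]
    exact (one_smul k _).trans (M.act_refl x)
  · rw [cfV_el_ne hA, cf_te_ne hA]

theorem symIncl_basisVec {M : FBMod k} {S : FB} {n : ℕ} {A : Set S} (hA : Nat.card (S.sub A) = n)
    (x : M.val (S.sub Aᶜ)) :
    app (tensorMap (symIncl k n) (𝟙 M)) S (el A (basisVec k n _) x) =
      te M A Aᶜ (mem_compl' A) x := by
  refine (tensorMap_el _ _ _ _ _).trans ?_
  unfold te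
  refine congrArg₂ (fun c y => el (M := const k) A c y) (symInclFun_pos (k := k) hA _) ?_
  exact (M.act_refl x).symm

theorem isStandard_iff (R : WeylRep k) (ε : k) : R.IsStandard ε ↔
    (∀ (S : FB) (j : S) (x : R.M.val (S.sub {j}ᶜ)), opr R.a S {j}ᶜ {j}ᶜ x = ε • x) ∧
    ∀ (S : FB) (i j : S) (x : R.M.val (S.sub {j}ᶜ)), i ≠ j →
      opr R.a S {j}ᶜ {i}ᶜ x = R.M.act (iota i j) x := by
  have key1 : ∀ (S : FB) (i j : S) (x : R.M.val (S.sub {j}ᶜ)),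
      cfV R.M i (app R.gl S (el {j} (basisVec k 1 _) x)) = opr R.a S {j}ᶜ {i}ᶜ x := by
    intro S i j x
    rw [opr_eq R.a (mem_compl' {j}) (mem_compl' {i})]
    refine (cfV_divProj i _).trans ?_
    have := symIncl_basisVec (M := R.M) (card_singleton j) x
    exact congrArg (fun w => cf R.M {i} {i}ᶜ (mem_compl' {i}) (app R.a S w)) this
  have key2 : ∀ (S : FB) (i j : S) (x : R.M.val (S.sub {j}ᶜ)), i ≠ j →
      cfV R.M i (el {j} (basisVec k 1 _) (ε • x) + ∑ i ∈ ({j}ᶜ : Set S).toFinite.toFinset,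
        el {i} (basisVec k 1 _) (R.M.act (iota i j) x) : (tensor (symPow k 1) R.M).val S) =
      R.M.act (iota i j) x := by
    intro S i j x hij
    rw [map_add, cfV_el_ne (fun h => hij (Set.singleton_injective h).symm), zero_add, map_sum,
      Finset.sum_eq_single_of_mem i, cfV_el]
    · exact one_smul k _
    · rw [Set.Finite.mem_toFinset]
      exact hij
    · intro i' _ h
      exact cfV_el_ne (fun h' => h (Set.singleton_injective h')) _ _
  have key3 : ∀ (S : FB) (j : S) (x : R.M.val (S.sub {j}ᶜ)),
      cfV R.M j (el {j} (basisVec k 1 _) (ε • x) + ∑ i ∈ ({j}ᶜ : Set S).toFinite.toFinset,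
        el {i} (basisVec k 1 _) (R.M.act (iota i j) x) : (tensor (symPow k 1) R.M).val S) =
      ε • x := by
    intro S j x
    rw [map_add, cfV_el, map_sum, Finset.sum_eq_zero, add_zero]
    · exact one_smul k _
    · intro i hi
      rw [Set.Finite.mem_toFinset] at hi
      exact cfV_el_ne (fun h' => hi (Set.singleton_injective h')) _ _
  constructor
  · intro h
    refine ⟨fun S j x => ?_, fun S i j x hij => ?_⟩
    · rw [← key1, h S j x, key3]
    · rw [← key1, h S j x, key2 S i j x hij]
  · intro h S j x
    refine cfV_ext fun i => ?_
    rw [key1]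
    by_cases hij : i = j
    · subst hij
      rw [key3, h.1]
    · rw [key2 S i j x hij, h.2 S i j x hij]

theorem leftUnitorApp_divProj {M : FBMod k} {S : FB} (w : (tensor (const k) M).val S) :
    leftUnitorApp M S (app (tensorMap (constProj k 0) (𝟙 M)) S w) =
      M.act (allEquiv (A := (∅ : Set S)ᶜ) fun _ h => h)
        (cf M ∅ ∅ᶜ (mem_compl' ∅) w) := by
  refine LinearMap.congr_fun
    (f := leftUnitorApp M S ∘ₗ app (tensorMap (constProj k 0) (𝟙 M)) S)
    (g := M.act (allEquiv (A := (∅ : Set S)ᶜ) fun _ h => h) ∘ₗ cf M ∅ ∅ᶜ (mem_compl' ∅))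
    (te_ext fun A X hX x => ?_) w
  rw [LinearMap.comp_apply, LinearMap.comp_apply]
  have h1 : app (tensorMap (constProj k 0) (𝟙 M)) S (te M A X hX x) =
    el A (basisVec k 0 _) (M.act (setEquiv (Y := Aᶜ) hX) x) := tensorMap_el _ _ _ _ _
  rw [h1]
  by_cases hA : A = ∅
  · subst hA
    obtain rfl : X = ∅ᶜ := Set.ext hX
    rw [cf_te, leftUnitorApp_el M (A := (∅ : Set S)) fun _ h => h]
    exact (one_smul k _).trans (congrArg _ (M.act_refl x))
  · rw [cf_te_ne hA, map_zero, eq_zero (fun h => hA (Set.eq_empty_iff_forall_notMem.2 h))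
      (basisVec k 0 _), el_zero_left, map_zero]

theorem hasCentralCharacter_iff (R : WeylRep k) (χ : k) : R.HasCentralCharacter χ ↔
    ∀ (S : FB) (x : R.M.val (S.sub ∅ᶜ)), opr R.a S ∅ᶜ ∅ᶜ x = χ • x := by
  have key : ∀ (S : FB) (x : R.M.val S),
      app ((λ_ R.M).inv ≫ symIncl k 0 ▷ R.M ≫ R.a ≫ divProj k 0 ▷ R.M ≫ (λ_ R.M).hom) S x =
      R.M.act (allEquiv (A := (∅ : Set S)ᶜ) fun _ h => h) (opr R.a S ∅ᶜ ∅ᶜ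
        (R.M.act (allEquiv (A := (∅ : Set S)ᶜ) fun _ h => h).symm x)) := by
    intro S x
    rw [opr_eq R.a (mem_compl' ∅) (mem_compl' ∅)]
    refine (leftUnitorApp_divProj _).trans ?_
    have := symIncl_basisVec (M := R.M) (card_eq_zero (A := (∅ : Set S)) fun _ h => h)
      (R.M.act (allEquiv (A := (∅ : Set S)ᶜ) fun _ h => h).symm x)
    exact congrArg (fun w => R.M.act (allEquiv (A := (∅ : Set S)ᶜ) fun _ h => h)
      (cf R.M ∅ ∅ᶜ (mem_compl' ∅) (app R.a S w))) this
  constructor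
  · intro h S x
    have := congrArg (fun f => app f S (R.M.act (allEquiv (A := (∅ : Set S)ᶜ) fun _ h => h) x)) h
    refine R.M.act_injective (allEquiv (A := (∅ : Set S)ᶜ) fun _ h => h) ?_
    rw [map_smul]
    refine Eq.trans ?_ this
    refine Eq.trans ?_ (key S _).symm
    rw [act_symm_act]
  · intro h
    refine hom_ext fun S => LinearMap.ext fun x => (key S x).trans ?_
    rw [h, map_smul, act_act_symm]
    rfl

/-! ### Morphisms and construction of representations -/

theorem comm_iff {M N : FBMod k} (a : tensor (const k) M ⟶ tensor (const k) M)
    (b : tensor (const k) N ⟶ tensor (const k) N) (h : M ⟶ N) :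
    a ≫ tensorMap (𝟙 (const k)) h = tensorMap (𝟙 (const k)) h ≫ b ↔
      ∀ (S : FB) (X Y : Set S) (x : M.val (S.sub X)),
        app h _ (opr a S X Y x) = opr b S X Y (app h _ x) := by
  have key : ∀ {S : FB} {A X : Set S} (hA : ∀ s, s ∈ X ↔ s ∉ A) (w : (tensor (const k) M).val S),
      cf N A X hA (app (tensorMap (𝟙 (const k)) h) S w) = app h _ (cf M A X hA w) := by
    intro S A X hA w
    refine LinearMap.congr_fun
      (f := cf N A X hA ∘ₗ app (tensorMap (𝟙 (const k)) h) S)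
      (g := app h _ ∘ₗ cf M A X hA) (te_ext fun B Y hY x => ?_) w
    rw [LinearMap.comp_apply, LinearMap.comp_apply, whisker_te]
    by_cases hAB : B = A
    · subst hAB
      obtain rfl : Y = X := Set.ext fun s => (hY s).trans (hA s).symm
      rw [cf_te, cf_te]
    · rw [cf_te_ne hAB, cf_te_ne hAB, map_zero]
  constructor
  · intro H S X Y x
    rw [opr_apply, opr_apply, ← whisker_te, ← key, ← app_comp, ← app_comp, H]
  · intro H
    refine hom_ext fun S => te_ext fun A X hX x => cf_ext fun B => ?_
    rw [app_comp, app_comp, key, whisker_te, ← opr_eq, ← opr_eq, H]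

/-- The map `Sym(V) ⊗ M ⟶ Div(V) ⊗ M` with given matrix coefficients. -/
def ofOpr {M : FBMod k} (w : ∀ (S : FB) (X Y : Set S), M.val (S.sub X) →ₗ[k] M.val (S.sub Y))
    (hw : ∀ {S T : FB} (e : S ≃ T) {X Y : Set S} {X' Y' : Set T} (hX : ∀ s, s ∈ X ↔ e s ∈ X')
      (hY : ∀ s, s ∈ Y ↔ e s ∈ Y') (x : M.val (S.sub X)),
      w T X' Y' (M.act (FB.restr e hX) x) = M.act (FB.restr e hY) (w S X Y x)) :
    tensor (const k) M ⟶ tensor (const k) M :=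
  mkHom (fun S => ∑ X : Set S, ∑ Y : Set S, teL M Yᶜ Y (mem_iff_not_compl Y) ∘ₗ w S X Y ∘ₗ
    cf M Xᶜ X (mem_iff_not_compl X)) (by
    intro S T e v
    simp only [LinearMap.sum_apply, LinearMap.comp_apply, map_sum]
    symm
    have hE : ∀ (X : Set S) (s : S), s ∈ X ↔ e s ∈ Equiv.Set.congr e X :=
      fun X s => e.injective.mem_set_image.symm
    refine Fintype.sum_equiv (Equiv.Set.congr e) _ _ fun X => ?_
    refine Fintype.sum_equiv (Equiv.Set.congr e) _ _ fun Y => ?_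
    rw [teL_apply, teL_apply, act_te e (h' := mem_iff_not_compl _) (FB.mem_compl_congr e (hE Y))
      (hE Y), ← hw e (hE X) (hE Y), ← cf_act e (FB.mem_compl_congr e (hE X)) (hE X)])

theorem app_ofOpr {M : FBMod k}
    (w : ∀ (S : FB) (X Y : Set S), M.val (S.sub X) →ₗ[k] M.val (S.sub Y))
    (hw : ∀ {S T : FB} (e : S ≃ T) {X Y : Set S} {X' Y' : Set T} (hX : ∀ s, s ∈ X ↔ e s ∈ X')
      (hY : ∀ s, s ∈ Y ↔ e s ∈ Y') (x : M.val (S.sub X)),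
      w T X' Y' (M.act (FB.restr e hX) x) = M.act (FB.restr e hY) (w S X Y x)) (S : FB) :
    app (ofOpr w hw) S = ∑ X : Set S, ∑ Y : Set S, teL M Yᶜ Y (mem_iff_not_compl Y) ∘ₗ w S X Y ∘ₗ
      cf M Xᶜ X (mem_iff_not_compl X) := rfl

theorem opr_ofOpr {M : FBMod k}
    (w : ∀ (S : FB) (X Y : Set S), M.val (S.sub X) →ₗ[k] M.val (S.sub Y))
    (hw : ∀ {S T : FB} (e : S ≃ T) {X Y : Set S} {X' Y' : Set T} (hX : ∀ s, s ∈ X ↔ e s ∈ X')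
      (hY : ∀ s, s ∈ Y ↔ e s ∈ Y') (x : M.val (S.sub X)),
      w T X' Y' (M.act (FB.restr e hX) x) = M.act (FB.restr e hY) (w S X Y x))
    (S : FB) (X Y : Set S) : opr (ofOpr w hw) S X Y = w S X Y := by
  ext x
  rw [opr_apply, app_ofOpr]
  simp only [LinearMap.sum_apply, LinearMap.comp_apply, map_sum]
  rw [Finset.sum_eq_single_of_mem X (Finset.mem_univ _),
    Finset.sum_eq_single_of_mem Y (Finset.mem_univ _), teL_apply, cf_te, cf_te]
  · intro Z _ h
    rw [teL_apply, cf_te_ne fun h' => h (compl_injective h')]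
  · intro Z _ h
    refine Finset.sum_eq_zero fun Z' _ => ?_
    rw [cf_te_ne (fun h' => h (compl_injective h').symm), map_zero, map_zero, map_zero]

end FBMod
end

noncomputable section

namespace FBMod

variable {k : Type u} [CommRing k]

theorem fr_map {M : FBMod k} (a : tensor (const k) M ⟶ tensor (const k) M) {V V' : FB}
    {φ : V → V'} (hφ : Function.Injective φ) {R X Y : Set V} {R' X' Y' : Set V'}
    (hX : X ⊆ R) (hY : Y ⊆ R) (hR : ∀ v', v' ∈ R' ↔ ∃ v ∈ R, φ v = v')
    (b : V.sub X ≃ V'.sub X') (c : V.sub Y ≃ V'.sub Y') (hb : ∀ x, (b x).1 = φ x.1)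
    (hc : ∀ y, (c y).1 = φ y.1) (x : M.val (V.sub X)) :
    fr a R' X' Y' (M.act b x) = M.act c (fr a R X Y x) := by
  have hX' : X' ⊆ R' := fun v' hv' => (hR v').2 ⟨(b.symm ⟨v', hv'⟩).1, hX (b.symm ⟨v', hv'⟩).2, by
    rw [← hb, Equiv.apply_symm_apply]⟩
  have hY' : Y' ⊆ R' := fun v' hv' => (hR v').2 ⟨(c.symm ⟨v', hv'⟩).1, hY (c.symm ⟨v', hv'⟩).2, by
    rw [← hc, Equiv.apply_symm_apply]⟩
  rw [fr_pos a hX hY, fr_pos a hX' hY']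
  have he : Function.Bijective (fun r : V.sub R => (⟨φ r.1, (hR _).2 ⟨r.1, r.2, rfl⟩⟩ : V'.sub R')) := by
    constructor
    · intro r s h
      exact Subtype.ext (hφ (congrArg Subtype.val h))
    · rintro ⟨v', hv'⟩
      obtain ⟨v, hv, rfl⟩ := (hR v').1 hv'
      exact ⟨⟨v, hv⟩, rfl⟩
  exact W_act a (S := V.sub R) (S' := V'.sub R') (Set.inclusion_injective hX)
    (Set.inclusion_injective hY) (Set.inclusion_injective hX') (Set.inclusion_injective hY') b c
    (Equiv.ofBijective _ he) (fun x => Subtype.ext (hb x)) (fun y => Subtype.ext (hc y)) x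

/-- The operator for an ambient set that contains one element outside of `X ∪ Y`. -/
def frOne {M : FBMod k} (a : tensor (const k) M ⟶ tensor (const k) M) {V : FB} (X Y : Set V) :
    M.val (V.sub X) →ₗ[k] M.val (V.sub Y) :=
  W a (X := V.sub X) (Y := V.sub Y) (S := ⟨Option (V.sub (X ∪ Y))⟩)
    (i := some ∘ Set.inclusion Set.subset_union_left)
    (j := some ∘ Set.inclusion Set.subset_union_right)
    ((Option.some_injective _).comp (Set.inclusion_injective _))
    ((Option.some_injective _).comp (Set.inclusion_injective _))

theorem frOne_eq {M : FBMod k} (a : tensor (const k) M ⟶ tensor (const k) M) {V V' : FB}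
    {φ : V → V'} (hφ : Function.Injective φ) {X Y : Set V} {R' X' Y' : Set V'}
    (p : V') (hp : p ∉ φ '' (X ∪ Y)) (hR : ∀ v', v' ∈ R' ↔ v' = p ∨ v' ∈ φ '' (X ∪ Y))
    (b : V.sub X ≃ V'.sub X') (c : V.sub Y ≃ V'.sub Y') (hb : ∀ x, (b x).1 = φ x.1)
    (hc : ∀ y, (c y).1 = φ y.1) (x : M.val (V.sub X)) :
    fr a R' X' Y' (M.act b x) = M.act c (frOne a X Y x) := by
  have hX' : X' ⊆ R' := fun v' hv' => (hR v').2 (Or.inr ⟨(b.symm ⟨v', hv'⟩).1,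
    Or.inl (b.symm ⟨v', hv'⟩).2, by rw [← hb, Equiv.apply_symm_apply]⟩)
  have hY' : Y' ⊆ R' := fun v' hv' => (hR v').2 (Or.inr ⟨(c.symm ⟨v', hv'⟩).1,
    Or.inr (c.symm ⟨v', hv'⟩).2, by rw [← hc, Equiv.apply_symm_apply]⟩)
  rw [fr_pos a hX' hY']
  let f : Option (V.sub (X ∪ Y)) → V'.sub R' := fun o => o.elim ⟨p, (hR p).2 (Or.inl rfl)⟩
    fun v => ⟨φ v.1, (hR _).2 (Or.inr ⟨v.1, v.2, rfl⟩)⟩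
  have he : Function.Bijective f := by
    constructor
    · rintro (_ | r) (_ | s) h
      · rfl
      · exact (hp ⟨s.1, s.2, (congrArg Subtype.val h).symm⟩).elim
      · exact (hp ⟨r.1, r.2, congrArg Subtype.val h⟩).elim
      · exact congrArg some (Subtype.ext (hφ (congrArg Subtype.val h)))
    · rintro ⟨v', hv'⟩
      rcases (hR v').1 hv' with rfl | ⟨v, hv, rfl⟩
      · exact ⟨none, rfl⟩
      · exact ⟨some ⟨v, hv⟩, rfl⟩
  exact W_act a (S := ⟨Option (V.sub (X ∪ Y))⟩) (S' := V'.sub R') _ _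
    (Set.inclusion_injective hX') (Set.inclusion_injective hY') b c
    (Equiv.ofBijective f he) (fun x => Subtype.ext (hb x)) (fun y => Subtype.ext (hc y)) x

theorem fr_eq_frOne {M : FBMod k} (a : tensor (const k) M ⟶ tensor (const k) M) {V : FB}
    {R X Y : Set V} (p : V) (hp : p ∉ X ∪ Y) (hR : ∀ v, v ∈ R ↔ v = p ∨ v ∈ X ∪ Y) :
    fr a R X Y = frOne a X Y := by
  ext x
  have := frOne_eq a (φ := id) Function.injective_id (X := X) (Y := Y) (R' := R) p
    (by rwa [Set.image_id]) (by rwa [Set.image_id]) (Equiv.refl _) (Equiv.refl _) (fun _ => rfl)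
    (fun _ => rfl) x
  rwa [act_refl, act_refl] at this

theorem exists_image_equiv {V V' : FB} {φ : V → V'} (hφ : Function.Injective φ) (X : Set V) :
    ∃ e : V.sub X ≃ V'.sub (φ '' X), ∀ x, (e x).1 = φ x.1 :=
  ⟨Equiv.Set.image φ X hφ, fun _ => rfl⟩

theorem frOne_map {M : FBMod k} (a : tensor (const k) M ⟶ tensor (const k) M) {V V' : FB}
    {φ : V → V'} (hφ : Function.Injective φ) {X Y : Set V} {X' Y' : Set V'}
    (b : V.sub X ≃ V'.sub X') (c : V.sub Y ≃ V'.sub Y') (hb : ∀ x, (b x).1 = φ x.1)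
    (hc : ∀ y, (c y).1 = φ y.1) (x : M.val (V.sub X)) :
    frOne a X' Y' (M.act b x) = M.act c (frOne a X Y x) := by
  have hs : Function.Injective (some : V' → Option V') := Option.some_injective _
  obtain ⟨b', hb'⟩ := exists_image_equiv (V := V') (V' := ⟨Option V'⟩) hs X'
  obtain ⟨c', hc'⟩ := exists_image_equiv (V := V') (V' := ⟨Option V'⟩) hs Y'
  have h1 := frOne_eq a (V := V') (V' := ⟨Option V'⟩) hs (X := X') (Y := Y')
    (R' := insert none (some '' (X' ∪ Y'))) none (by rintro ⟨_, _, h⟩; cases h)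
    (fun v' => Iff.rfl) b' c' hb' hc' (M.act b x)
  have hXY : ∀ v', v' ∈ X' ∪ Y' ↔ ∃ v ∈ X ∪ Y, φ v = v' := by
    intro v'
    constructor
    · rintro (h | h)
      · exact ⟨(b.symm ⟨v', h⟩).1, Or.inl (b.symm ⟨v', h⟩).2, by rw [← hb, Equiv.apply_symm_apply]⟩
      · exact ⟨(c.symm ⟨v', h⟩).1, Or.inr (c.symm ⟨v', h⟩).2, by rw [← hc, Equiv.apply_symm_apply]⟩
    · rintro ⟨v, h | h, rfl⟩
      · exact Or.inl (by rw [← hb ⟨v, h⟩]; exact (b _).2)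
      · exact Or.inr (by rw [← hc ⟨v, h⟩]; exact (c _).2)
  have h2 := frOne_eq a (V := V) (V' := ⟨Option V'⟩) (hs.comp hφ) (X := X) (Y := Y)
    (R' := insert none (some '' (X' ∪ Y'))) none (by rintro ⟨_, _, h⟩; cases h)
    (fun v' => or_congr_right (by
      constructor
      · rintro ⟨v', h, rfl⟩
        obtain ⟨v, hv, rfl⟩ := (hXY v').1 h
        exact ⟨v, hv, rfl⟩
      · rintro ⟨v, h, rfl⟩
        exact ⟨φ v, (hXY _).2 ⟨v, h, rfl⟩, rfl⟩)) (b.trans b') (c.trans c')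
    (fun x => (hb' _).trans (congrArg _ (hb x))) (fun x => (hc' _).trans (congrArg _ (hc x))) x
  rw [← act_act, ← act_act, h1] at h2
  exact M.act_injective _ h2

theorem fr_nest {M : FBMod k} (a : tensor (const k) M ⟶ tensor (const k) M) {V : FB}
    {S R X Y : Set V} (hXR : X ⊆ R) (hYR : Y ⊆ R) (hRS : R ⊆ S) (hXS : ∀ v, v ∈ X → v ∈ S)
    (hYS : ∀ v, v ∈ Y → v ∈ S) {R' X' Y' : Set (V.sub S)}
    (hR' : ∀ v, v ∈ R' ↔ v.1 ∈ R) (hX' : ∀ v, v ∈ X' ↔ v.1 ∈ X) (hY' : ∀ v, v ∈ Y' ↔ v.1 ∈ Y)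
    (x : M.val (V.sub X)) :
    fr a R' X' Y' (M.act (nestEquiv hXS hX') x) = M.act (nestEquiv hYS hY') (fr a R X Y x) := by
  have h := fr_map a (V := V.sub S) (V' := V) (φ := Subtype.val) Subtype.val_injective
    (R := R') (X := X') (Y := Y') (R' := R) (X' := X) (Y' := Y)
    (fun v hv => (hR' v).2 (hXR ((hX' v).1 hv))) (fun v hv => (hR' v).2 (hYR ((hY' v).1 hv)))
    (fun v => ⟨fun hv => ⟨⟨v, hRS hv⟩, (hR' _).2 hv, rfl⟩, by
      rintro ⟨v, hv, rfl⟩; exact (hR' v).1 hv⟩)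
    (nestEquiv hXS hX').symm (nestEquiv hYS hY').symm (fun _ => rfl) (fun _ => rfl)
    (M.act (nestEquiv hXS hX') x)
  rw [act_symm_act] at h
  rw [h, act_act_symm]

open Classical in
/-- The relation that defines the curried Weyl algebra, for a subset `S` of an ambient set. -/
theorem WeylRel.on {M : FBMod k} {a : tensor (const k) M ⟶ tensor (const k) M}
    (H : WeylRel (fr a)) {V : FB} {S A₁ A₂ B₁ B₂ X Y : Set V}
    (hX : ∀ v, v ∈ X ↔ v ∈ S ∧ v ∉ A₁ ∧ v ∉ A₂) (hY : ∀ v, v ∈ Y ↔ v ∈ S ∧ v ∉ B₁ ∧ v ∉ B₂)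
    (hA₁ : A₁ ⊆ S) (hA₂ : A₂ ⊆ S)
    (hA : ∀ v, v ∈ A₁ → v ∉ A₂) (hB : ∀ v, v ∈ B₁ → v ∉ B₂) (x : M.val (V.sub X)) :
    ((if ∀ v, v ∈ A₁ → v ∉ B₂ then
        fr a (S \ B₂) (S \ (A₁ ∪ B₂)) Y (fr a (S \ A₁) X (S \ (A₁ ∪ B₂)) x) else 0) -
      if ∀ v, v ∈ A₂ → v ∉ B₁ then
        fr a (S \ B₁) (S \ (A₂ ∪ B₁)) Y (fr a (S \ A₂) X (S \ (A₂ ∪ B₁)) x) else 0) =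
    ∑ C ∈ Finset.univ.filter (fun C : Set V => C ⊆ A₂ ∩ B₁), fr a (S \ C) X Y x -
      ∑ C ∈ Finset.univ.filter (fun C : Set V => C ⊆ A₁ ∩ B₂), fr a (S \ C) X Y x := by
  have hXS : ∀ v, v ∈ X → v ∈ S := fun v hv => ((hX v).1 hv).1
  have hYS : ∀ v, v ∈ Y → v ∈ S := fun v hv => ((hY v).1 hv).1
  have h := H (V := V.sub S) (A₁ := trace S A₁) (A₂ := trace S A₂) (B₁ := trace S B₁)
    (B₂ := trace S B₂) (X := trace S X) (Y := trace S Y)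
    (fun v => (hX v).trans (and_iff_right v.2)) (fun v => (hY v).trans (and_iff_right v.2))
    (fun v => hA v) (fun v => hB v) (M.act (nestEquiv hXS (mem_trace S X)) x)
  apply M.act_injective (nestEquiv hYS (mem_trace S Y))
  rw [map_sub, map_sub]
  beta_reduce at h
  refine Eq.trans ?_ (h.trans ?_)
  · have key : ∀ A A' B B' : Set V, A ⊆ S → (∀ v, v ∈ X ↔ v ∈ S ∧ v ∉ A ∧ v ∉ A') →
        (∀ v, v ∈ Y ↔ v ∈ S ∧ v ∉ B' ∧ v ∉ B) →
        M.act (nestEquiv hYS (mem_trace S Y)) (if ∀ v, v ∈ A → v ∉ B then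
          fr a (S \ B) (S \ (A ∪ B)) Y (fr a (S \ A) X (S \ (A ∪ B)) x) else 0) =
        if ∀ v, v ∈ trace S A → v ∉ trace S B then
          fr a (trace S B)ᶜ (trace S A ∪ trace S B)ᶜ (trace S Y)
            (fr a (trace S A)ᶜ (trace S X) (trace S A ∪ trace S B)ᶜ
              (M.act (nestEquiv hXS (mem_trace S X)) x)) else 0 := by
      intro A A' B B' hAS hX hY
      by_cases hAB : ∀ v, v ∈ A → v ∉ B
      · have hZ : ∀ v, v ∈ S \ (A ∪ B) → v ∈ S := fun v hv => hv.1
        have hZ' : ∀ v, v ∈ (trace S A ∪ trace S B)ᶜ ↔ v.1 ∈ S \ (A ∪ B) :=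
          fun v => ⟨fun h => ⟨v.2, h⟩, fun h => h.2⟩
        have hA' : ∀ v, v ∈ (trace S A)ᶜ ↔ v.1 ∈ S \ A := fun v => ⟨fun h => ⟨v.2, h⟩, fun h => h.2⟩
        have hB' : ∀ v, v ∈ (trace S B)ᶜ ↔ v.1 ∈ S \ B := fun v => ⟨fun h => ⟨v.2, h⟩, fun h => h.2⟩
        have hAB' : ∀ v, v ∈ trace S A → v ∉ trace S B := fun v => hAB v.1
        rw [if_pos hAB, if_pos hAB', fr_nest a (R := S \ A) (Y := S \ (A ∪ B)) (S := S)
          (fun v hv => ⟨((hX v).1 hv).1, ((hX v).1 hv).2.1⟩)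
          (fun v hv => ⟨hv.1, fun h => hv.2 (Or.inl h)⟩) (fun v hv => hv.1) hXS hZ hA'
          (mem_trace S X) hZ', fr_nest a (R := S \ B) (S := S) (fun v hv => ⟨hv.1, fun h => hv.2 (Or.inr h)⟩)
          (fun v hv => ⟨((hY v).1 hv).1, ((hY v).1 hv).2.2⟩) (fun v hv => hv.1) hZ hYS hB'
          hZ' (mem_trace S Y)]
      · rw [if_neg hAB, if_neg, map_zero]
        exact fun h => hAB fun v hv => h ⟨v, hAS hv⟩ hv
    exact congrArg₂ _ (key A₁ A₂ B₂ B₁ hA₁ hX hY)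
      (key A₂ A₁ B₁ B₂ hA₂ (fun v => (hX v).trans (and_congr_right fun _ => and_comm))
        (fun v => (hY v).trans (and_congr_right fun _ => and_comm)))
  · have key : ∀ A A' B B' : Set V, A ⊆ S → (∀ v, v ∈ X ↔ v ∈ S ∧ v ∉ A ∧ v ∉ A') →
        (∀ v, v ∈ Y ↔ v ∈ S ∧ v ∉ B' ∧ v ∉ B) →
        ∑ C ∈ Finset.univ.filter (fun C : Set (V.sub S) => C ⊆ trace S A ∩ trace S B),
          fr a Cᶜ (trace S X) (trace S Y) (M.act (nestEquiv hXS (mem_trace S X)) x) =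
        M.act (nestEquiv hYS (mem_trace S Y))
          (∑ C ∈ Finset.univ.filter (fun C : Set V => C ⊆ A ∩ B), fr a (S \ C) X Y x) := by
      intro A A' B B' hAS hX hY
      rw [← sum_inner (A ∩ B) (fun v hv => hAS hv.1) fun C => fr a (S \ C) X Y x, map_sum]
      refine Finset.sum_congr rfl fun C hC => ?_
      rw [Finset.mem_filter] at hC
      refine fr_nest a (R := S \ inner C) (S := S) (fun v hv => ⟨hXS v hv, fun ⟨h1, h2⟩ => ?_⟩)
        (fun v hv => ⟨hYS v hv, fun ⟨h1, h2⟩ => ?_⟩)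
        (fun v hv => hv.1) hXS hYS ?_ (mem_trace S X) (mem_trace S Y) x
      · exact ((hX v).1 hv).2.1 (hC.2 h2).1
      · exact ((hY v).1 hv).2.2 (hC.2 h2).2
      · exact fun v => ⟨fun h => ⟨v.2, fun ⟨_, h'⟩ => h h'⟩, fun h h' => h.2 ⟨v.2, h'⟩⟩
    exact congrArg₂ _ (key A₂ A₁ B₁ B₂ hA₂ (fun v => (hX v).trans (and_congr_right fun _ => and_comm))
        (fun v => (hY v).trans (and_congr_right fun _ => and_comm))) (key A₁ A₂ B₂ B₁ hA₁ hX hY)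

theorem fr_congr_bij {M : FBMod k} (a : tensor (const k) M ⟶ tensor (const k) M) {V : FB}
    {R R' X Y : Set V} {φ : V → V} (hφ : Function.Injective φ)
    (hX : X ⊆ R) (hY : Y ⊆ R) (hR : ∀ v', v' ∈ R' ↔ ∃ v ∈ R, φ v = v')
    (hφX : ∀ v ∈ X, φ v = v) (hφY : ∀ v ∈ Y, φ v = v) (x : M.val (V.sub X)) :
    fr a R' X Y x = fr a R X Y x := by
  have := fr_map a hφ hX hY hR (Equiv.refl _) (Equiv.refl _) (fun x => (hφX x.1 x.2).symm)
    (fun x => (hφY x.1 x.2).symm) x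
  rwa [act_refl, act_refl] at this

theorem fr_insert_aux {M : FBMod k} {a : tensor (const k) M ⟶ tensor (const k) M}
    (H : WeylRel (fr a)) {V : FB} {R X Y : Set V} (hX : X ⊆ R) (hY : Y ⊆ R) {u v n : V}
    (hv : v ∈ R) (hvX : v ∉ X) (hvY : v ∉ Y) (hn : n ∉ R) (hu : u ∉ R) (hnu : n ≠ u)
    (x : M.val (V.sub X)) :
    fr a (insert n R) X Y x = - fr a R X Y x := by
  classical
  have hvn : v ≠ n := fun h => hn (h ▸ hv)
  have hvu : v ≠ u := fun h => hu (h ▸ hv)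
  let S : Set V := insert n (insert u R)
  let A₁ : Set V := S \ (X ∪ {n, u})
  let B₂ : Set V := {v}
  let A₂ : Set V := {n, u}
  let B₁ : Set V := S \ (Y ∪ {v})
  have hXn : ∀ w ∈ X, w ≠ n ∧ w ≠ u ∧ w ≠ v := fun w hw =>
    ⟨fun h => hn (h ▸ hX hw), fun h => hu (h ▸ hX hw), fun h => hvX (h ▸ hw)⟩
  have hYn : ∀ w ∈ Y, w ≠ n ∧ w ≠ u ∧ w ≠ v := fun w hw =>
    ⟨fun h => hn (h ▸ hY hw), fun h => hu (h ▸ hY hw), fun h => hvY (h ▸ hw)⟩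
  have h := H.on (S := S) (A₁ := A₁) (A₂ := A₂) (B₁ := B₁) (B₂ := B₂) (X := X) (Y := Y) ?_ ?_ ?_ ?_
    ?_ ?_ x
  · have e1 : ¬ ∀ w, w ∈ A₁ → w ∉ B₂ := fun h => h v ⟨Or.inr (Or.inr hv), by
      rintro (h | h | h)
      exacts [hvX h, hvn h, hvu h]⟩ rfl
    have e2 : ¬ ∀ w, w ∈ A₂ → w ∉ B₁ := fun h => h n (Or.inl rfl) ⟨Or.inl rfl, by
      rintro (h | h)
      exacts [hn (hY h), hvn h.symm]⟩
    have e3 : A₂ ∩ B₁ = {n, u} := by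
      ext w
      constructor
      · exact fun h => h.1
      · rintro (rfl | rfl)
        · exact ⟨Or.inl rfl, Or.inl rfl, by
            rintro (h | h)
            exacts [hn (hY h), hvn h.symm]⟩
        · exact ⟨Or.inr rfl, Or.inr (Or.inl rfl), by
            rintro (h | h)
            exacts [hu (hY h), hvu h.symm]⟩
    have e4 : A₁ ∩ B₂ = {v} := by
      ext w
      constructor
      · exact fun h => h.2
      · rintro rfl
        exact ⟨⟨Or.inr (Or.inr hv), by
          rintro (h | h | h)
          exacts [hvX h, hvn h, hvu h]⟩, rfl⟩
    rw [if_neg e1, if_neg e2, e3, e4] at h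
    have f1 : Finset.univ.filter (fun C : Set V => C ⊆ {n, u}) = {∅, {n}, {u}, {n, u}} := by
      ext C
      simp only [Finset.mem_filter, Finset.mem_univ, true_and, Finset.mem_insert,
        Finset.mem_singleton]
      exact Set.subset_pair_iff_eq
    have f2 : Finset.univ.filter (fun C : Set V => C ⊆ {v}) = {∅, {v}} := by
      ext C
      simp only [Finset.mem_filter, Finset.mem_univ, true_and, Finset.mem_insert,
        Finset.mem_singleton]
      exact Set.subset_singleton_iff_eq
    have g1 : (∅ : Set V) ≠ {n} := (Set.singleton_ne_empty n).symm
    have g2 : (∅ : Set V) ≠ {u} := (Set.singleton_ne_empty u).symm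
    have g3 : (∅ : Set V) ≠ {n, u} := (Set.insert_nonempty _ _).ne_empty.symm
    have g4 : ({n} : Set V) ≠ {u} := fun h => hnu (Set.singleton_injective h)
    have g5 : ({n} : Set V) ≠ {n, u} := fun h =>
      hnu ((show u ∈ ({n} : Set V) by rw [h]; exact Or.inr rfl) : u = n).symm
    have g6 : ({u} : Set V) ≠ {n, u} := fun h =>
      hnu ((show n ∈ ({u} : Set V) by rw [h]; exact Or.inl rfl) : n = u)
    have g7 : (∅ : Set V) ≠ {v} := (Set.singleton_ne_empty v).symm
    rw [f1, f2, Finset.sum_insert (by simp [g1, g2, g3]), Finset.sum_insert (by simp [g4, g5]),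
      Finset.sum_insert (by simp [g6]), Finset.sum_singleton, Finset.sum_insert (by simp [g7]),
      Finset.sum_singleton] at h
    have i1 : fr a (S \ {n}) X Y x = fr a (S \ {v}) X Y x := by
      refine fr_congr_bij a (φ := Equiv.swap n v) (Equiv.injective _) ?_ ?_ ?_ ?_ ?_ x
      · exact fun w hw => ⟨Or.inr (Or.inr (hX hw)), (hXn w hw).2.2⟩
      · exact fun w hw => ⟨Or.inr (Or.inr (hY hw)), (hYn w hw).2.2⟩
      · intro w
        constructor
        · rintro ⟨h1, h2⟩
          refine ⟨Equiv.swap n v w, ⟨?_, fun h => h2 ?_⟩, Equiv.swap_apply_self _ _ _⟩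
          · rcases eq_or_ne w v with rfl | hwv
            · rw [Equiv.swap_apply_right]
              exact Or.inl rfl
            · rwa [Equiv.swap_apply_of_ne_of_ne h2 hwv]
          · have h' := congrArg (Equiv.swap n v) h
            rwa [Equiv.swap_apply_self, Equiv.swap_apply_right] at h'
        · rintro ⟨w, ⟨h1, h2⟩, rfl⟩
          constructor
          · rcases eq_or_ne w n with rfl | hwn
            · rw [Equiv.swap_apply_left]
              exact Or.inr (Or.inr hv)
            · rwa [Equiv.swap_apply_of_ne_of_ne hwn h2]
          · intro h
            have h' := congrArg (Equiv.swap n v) h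
            rw [Equiv.swap_apply_self, Equiv.swap_apply_left] at h'
            exact h2 h'
      · exact fun w hw => Equiv.swap_apply_of_ne_of_ne (hXn w hw).1 (hXn w hw).2.2
      · exact fun w hw => Equiv.swap_apply_of_ne_of_ne (hYn w hw).1 (hYn w hw).2.2
    have i2 : S \ {u} = insert n R := by
      ext w
      constructor
      · rintro ⟨h1 | h1 | h1, h2⟩
        exacts [Or.inl h1, (h2 h1).elim, Or.inr h1]
      · rintro (rfl | h)
        exacts [⟨Or.inl rfl, hnu⟩, ⟨Or.inr (Or.inr h), fun h' => hu (h' ▸ h)⟩]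
    have i3 : S \ {n, u} = R := by
      ext w
      constructor
      · rintro ⟨h1 | h1 | h1, h2⟩
        exacts [(h2 (Or.inl h1)).elim, (h2 (Or.inr h1)).elim, h1]
      · exact fun hw => ⟨Or.inr (Or.inr hw), by
          rintro (rfl | rfl)
          exacts [hn hw, hu hw]⟩
    rw [i1, i2, i3, sub_zero] at h
    rw [eq_neg_iff_add_eq_zero, h]
    abel
  · intro w
    constructor
    · exact fun h => ⟨Or.inr (Or.inr (hX h)), fun h' => h'.2 (Or.inl h), by
        rintro (h' | h')
        exacts [(hXn w h).1 h', (hXn w h).2.1 h']⟩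
    · rintro ⟨h1, h2, h3⟩
      by_contra h4
      exact h2 ⟨h1, fun h => h.elim h4 h3⟩
  · intro w
    constructor
    · exact fun h => ⟨Or.inr (Or.inr (hY h)), fun h' => h'.2 (Or.inl h), (hYn w h).2.2⟩
    · rintro ⟨h1, h2, h3⟩
      by_contra h4
      exact h2 ⟨h1, fun h => h.elim h4 h3⟩
  · exact fun w hw => hw.1
  · rintro w (rfl | rfl)
    exacts [Or.inl rfl, Or.inr (Or.inl rfl)]
  · exact fun w hw hw' => hw.2 (Or.inr hw')
  · exact fun w hw hw' => hw.2 (Or.inr hw')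

theorem fr_insert {M : FBMod k} {a : tensor (const k) M ⟶ tensor (const k) M}
    (H : WeylRel (fr a)) {V : FB} {R X Y : Set V} (hX : X ⊆ R) (hY : Y ⊆ R) {v n : V}
    (hv : v ∈ R) (hvX : v ∉ X) (hvY : v ∉ Y) (hn : n ∉ R) (x : M.val (V.sub X)) :
    fr a (insert n R) X Y x = - fr a R X Y x := by
  have hs : Function.Injective (some : V → Option V) := Option.some_injective _
  obtain ⟨b, hb⟩ := exists_image_equiv (V := V) (V' := ⟨Option V⟩) hs X
  obtain ⟨c, hc⟩ := exists_image_equiv (V := V) (V' := ⟨Option V⟩) hs Y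
  have h1 := fr_map a (V := V) (V' := ⟨Option V⟩) hs (R := R) (R' := some '' R) hX hY
    (fun _ => Iff.rfl) b c hb hc x
  have h2 := fr_map a (V := V) (V' := ⟨Option V⟩) hs (R := insert n R)
    (R' := insert (some n) (some '' R)) (hX.trans (Set.subset_insert _ _))
    (hY.trans (Set.subset_insert _ _)) (fun v' => by
      rw [← Set.image_insert_eq]
      exact Iff.rfl) b c hb hc x
  have h3 := fr_insert_aux H (V := ⟨Option V⟩) (R := some '' R) (X := some '' X) (Y := some '' Y)
    (u := none) (v := some v) (n := some n) (Set.image_mono hX) (Set.image_mono hY)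
    ⟨v, hv, rfl⟩ (by rwa [hs.mem_set_image]) (by rwa [hs.mem_set_image])
    (by rwa [hs.mem_set_image]) (by rintro ⟨_, _, h⟩; cases h) (by rintro ⟨⟩) (M.act b x)
  rw [h1, h2, ← map_neg] at h3
  exact M.act_injective _ h3

end FBMod
end

noncomputable section

namespace FBMod

variable {k : Type u} [CommRing k]

/-- A family of operators that are indexed by a colour and by two subsets `X` and `Y` of a finite
set, and that behave like the operators of the partitions of `X ⊔ Y` whose blocks are the
identity strands of `X ∩ Y` and the block that consists of all other elements. -/
structure BlockOps (M : FBMod k) (d : Bool → k) where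
  D : Bool → ∀ {V : FB} (X Y : Set V), M.val (V.sub X) →ₗ[k] M.val (V.sub Y)
  nat : ∀ (c : Bool) {V V' : FB} {φ : V → V'} (_ : Function.Injective φ) {X Y : Set V}
    {X' Y' : Set V'} (a : V.sub X ≃ V'.sub X') (b : V.sub Y ≃ V'.sub Y')
    (_ : ∀ x, (a x).1 = φ x.1) (_ : ∀ y, (b y).1 = φ y.1) (x : M.val (V.sub X)),
    D c X' Y' (M.act a x) = M.act b (D c X Y x)
  comm : ∀ (c c' : Bool) {V : FB} {X₀ X₁ X₂ X₃ : Set V}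
    (_ : ∀ v, ((v ∈ X₀ ↔ v ∈ X₁) ∧ (v ∈ X₂ ↔ v ∈ X₃)) ∨ ((v ∈ X₀ ↔ v ∈ X₂) ∧ (v ∈ X₁ ↔ v ∈ X₃)))
    (x : M.val (V.sub X₀)), D c X₁ X₃ (D c' X₀ X₁ x) = D c' X₂ X₃ (D c X₀ X₂ x)
  merge : ∀ (c : Bool) {V : FB} {X₀ X₁ X₂ : Set V} (_ : ∃ v, v ∉ X₀ ∧ v ∈ X₁ ∧ v ∉ X₂)
    (_ : ∀ v, v ∈ X₀ → v ∈ X₂ → v ∈ X₁) (x : M.val (V.sub X₀)),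
    D c X₁ X₂ (D c X₀ X₁ x) = D c X₀ X₂ x
  zero : ∀ {c c' : Bool} (_ : c ≠ c') {V : FB} {X₀ X₁ X₂ : Set V}
    (_ : ∃ v, v ∉ X₀ ∧ v ∈ X₁ ∧ v ∉ X₂) (_ : ∀ v, v ∈ X₀ → v ∈ X₂ → v ∈ X₁)
    (x : M.val (V.sub X₀)), D c X₁ X₂ (D c' X₀ X₁ x) = 0
  scalar : ∀ (c : Bool) {V : FB} (X : Set V) (x : M.val (V.sub X)), D c X X x = d c • x
  unit : ∀ {V : FB} {X Y : Set V} (e : V.sub X ≃ V.sub Y) {u v : V} (_ : u ∈ X) (_ : u ∉ Y)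
    (_ : v ∈ Y) (_ : v ∉ X) (_ : ∀ x, x.1 ≠ u → (e x).1 = x.1) (_ : ∀ x, x.1 = u → (e x).1 = v)
    (x : M.val (V.sub X)), D true X Y x + D false X Y x = M.act e x

/-- The sign `(-1)^n`. -/
def sgn (k : Type u) [CommRing k] (n : ℕ) : k := (-1) ^ n

theorem sgn_add (m n : ℕ) : sgn k (m + n) = sgn k m * sgn k n := pow_add _ _ _

theorem sgn_mul_self (n : ℕ) : sgn k n * sgn k n = 1 := by
  unfold sgn
  rw [← mul_pow, neg_mul_neg, one_mul, one_pow]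

theorem sgn_succ (n : ℕ) : sgn k (n + 1) = - sgn k n := by
  rw [sgn_add]
  unfold sgn
  rw [pow_one, mul_neg, mul_one]

open Classical in
/-- The coefficient of `D true X Y` in the matrix coefficient for `X`, `Y` and the set `R`. -/
def coeffT (k : Type u) [CommRing k] {V : FB} (R X Y : Set V) : k := if R = X ∪ Y then 1 else 0

/-- The coefficient of `D false X Y` in the matrix coefficient for `X`, `Y` and the set `R`. -/
def coeffF (k : Type u) [CommRing k] {V : FB} (R X : Set V) : k := - sgn k (R \ X).ncard

/-- The relation between the matrix coefficients of a representation and block operators. -/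
def IsBlockForm {M : FBMod k} (w : ∀ {V : FB} (_ X Y : Set V), M.val (V.sub X) →ₗ[k] M.val (V.sub Y))
    (D : Bool → ∀ {V : FB} (X Y : Set V), M.val (V.sub X) →ₗ[k] M.val (V.sub Y)) : Prop :=
  ∀ {V : FB} {R X Y : Set V} (_ : X ⊆ R) (_ : Y ⊆ R) (x : M.val (V.sub X)),
    w R X Y x = coeffT k R X Y • D true X Y x + coeffF k R X • D false X Y x

theorem ncard_sdiff_insert {V : FB} {R X : Set V} {u : V} (hu : u ∉ R) (huX : u ∉ X) :
    (insert u R \ X).ncard = (R \ X).ncard + 1 := by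
  rw [Set.insert_sdiff_of_notMem _ huX, Set.ncard_insert_of_notMem fun h => hu h.1]

open Classical in
theorem sum_sgn {V : FB} {S X I : Set V} (g : Set V → Set V) (hg : ∀ C v, v ∈ g C ↔ v ∈ S ∧ v ∉ C)
    (hIS : I ⊆ S) (hIX : ∀ v ∈ I, v ∉ X) {u : V} (hu : u ∈ I) :
    ∑ C ∈ Finset.univ.filter (fun C : Set V => C ⊆ I), sgn k (g C \ X).ncard = 0 := by
  have hone : ∀ C : Set V, u ∈ C → sgn k (g (C \ {u}) \ X).ncard = - sgn k (g C \ X).ncard := by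
    intro C hC
    have : g (C \ {u}) = insert u (g C) := by
      ext v
      rw [hg, Set.mem_insert_iff, hg]
      constructor
      · rintro ⟨h1, h2⟩
        by_cases h : v = u
        · exact Or.inl h
        · exact Or.inr ⟨h1, fun h' => h2 ⟨h', h⟩⟩
      · rintro (rfl | ⟨h1, h2⟩)
        · exact ⟨hIS hu, fun h => h.2 rfl⟩
        · exact ⟨h1, fun h => h2 h.1⟩
    rw [this, ncard_sdiff_insert (fun h => ((hg _ _).1 h).2 hC) (hIX u hu), sgn_succ]
  refine Finset.sum_involution (fun C _ => if u ∈ C then C \ {u} else insert u C) ?_ ?_ ?_ ?_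
  · intro C _
    split_ifs with h
    · rw [hone C h, add_neg_cancel]
    · have := hone (insert u C) (Set.mem_insert _ _)
      rw [Set.insert_sdiff_self_of_notMem h] at this
      rw [this, neg_add_cancel]
  · intro C _ _ h'
    split_ifs at h' with h
    · rw [← h'] at h
      exact h.2 rfl
    · exact h (h' ▸ Set.mem_insert _ _)
  · intro C hC
    rw [Finset.mem_filter] at hC ⊢
    refine ⟨Finset.mem_univ _, ?_⟩
    split_ifs with h
    · exact fun v hv => hC.2 hv.1
    · exact Set.insert_subset hu hC.2
  · intro C hC
    by_cases h : u ∈ C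
    · simp only [if_pos h]
      rw [if_neg fun h' => h'.2 rfl, Set.insert_sdiff_singleton, Set.insert_eq_of_mem h]
    · simp only [if_neg h]
      rw [if_pos (Set.mem_insert _ _), Set.insert_sdiff_self_of_notMem h]

open Classical in
theorem sum_blockForm {M : FBMod k}
    {w : ∀ {V : FB} (_ X Y : Set V), M.val (V.sub X) →ₗ[k] M.val (V.sub Y)}
    {D : Bool → ∀ {V : FB} (X Y : Set V), M.val (V.sub X) →ₗ[k] M.val (V.sub Y)}
    (hw : IsBlockForm w D) {V : FB} {S X Y I : Set V}
    (g : Set V → Set V) (hg : ∀ C v, v ∈ g C ↔ v ∈ S ∧ v ∉ C) (hXS : X ⊆ S) (hYS : Y ⊆ S)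
    (hIS : I ⊆ S) (hIX : ∀ v ∈ I, v ∉ X) (hIY : ∀ v ∈ I, v ∉ Y) (hI : I.Nonempty)
    (x : M.val (V.sub X)) :
    ∑ C ∈ Finset.univ.filter (fun C : Set V => C ⊆ I), w (g C) X Y x =
      coeffT k (g I) X Y • D true X Y x := by
  have h1 : ∀ C ∈ Finset.univ.filter (fun C : Set V => C ⊆ I), w (g C) X Y x =
      coeffT k (g C) X Y • D true X Y x + coeffF k (g C) X • D false X Y x := by
    intro C hC
    rw [Finset.mem_filter] at hC
    exact hw (fun v hv => (hg _ _).2 ⟨hXS hv, fun h => hIX v (hC.2 h) hv⟩)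
      (fun v hv => (hg _ _).2 ⟨hYS hv, fun h => hIY v (hC.2 h) hv⟩) x
  obtain ⟨u, hu⟩ := hI
  rw [Finset.sum_congr rfl h1, Finset.sum_add_distrib, ← Finset.sum_smul, ← Finset.sum_smul]
  unfold coeffF
  rw [Finset.sum_neg_distrib, sum_sgn g hg hIS hIX hu, neg_zero, zero_smul, add_zero]
  congr 1
  refine Finset.sum_eq_single_of_mem I ?_ fun C hC hne => if_neg fun h => hne ?_
  · rw [Finset.mem_filter]
    exact ⟨Finset.mem_univ _, subset_rfl⟩
  · rw [Finset.mem_filter] at hC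
    refine hC.2.antisymm fun v hv => ?_
    by_contra hvC
    have : v ∈ g C := (hg _ _).2 ⟨hIS hv, hvC⟩
    rw [h] at this
    exact this.elim (hIX v hv) (hIY v hv)

theorem coeffT_congr {V V' : FB} {R X Y : Set V} {R' X' Y' : Set V'} (h : R = X ∪ Y ↔ R' = X' ∪ Y') :
    coeffT k R X Y = coeffT k R' X' Y' := by
  unfold coeffT
  by_cases h' : R = X ∪ Y
  · rw [if_pos h', if_pos (h.1 h')]
  · rw [if_neg h', if_neg fun h'' => h' (h.2 h'')]

theorem merge_aux {V : FB} {S R₁ R₂ X₀ X₁ X₃ I J : Set V} (hJ : ∀ v, v ∈ J ↔ v ∈ S ∧ v ∉ I)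
    (hS : ∀ v, v ∈ S ↔ v ∈ R₁ ∨ v ∈ R₂) (hR : ∀ v, v ∈ X₁ ↔ v ∈ R₁ ∧ v ∈ R₂) (h₀ : X₀ ⊆ R₁)
    (h₃ : X₃ ⊆ R₂) (hI : ∀ v, v ∈ I ↔ v ∈ X₁ ∧ v ∉ X₀ ∧ v ∉ X₃) :
    J = X₀ ∪ X₃ ↔ R₁ = X₀ ∪ X₁ ∧ R₂ = X₁ ∪ X₃ := by
  simp only [Set.ext_iff, Set.mem_union, ← forall_and, hJ, hS, hI, hR]
  refine forall_congr' fun v => ?_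
  have h₀ := @h₀ v
  have h₃ := @h₃ v
  clear hJ hS hR hI
  by_cases h1 : v ∈ R₁ <;> by_cases h2 : v ∈ R₂ <;> by_cases h3 : v ∈ X₀ <;> by_cases h4 : v ∈ X₃ <;>
    simp_all

open Classical in
theorem merge_rhs {M : FBMod k}
    {w : ∀ {V : FB} (_ X Y : Set V), M.val (V.sub X) →ₗ[k] M.val (V.sub Y)}
    {D : Bool → ∀ {V : FB} (X Y : Set V), M.val (V.sub X) →ₗ[k] M.val (V.sub Y)}
    (hw : IsBlockForm w D) {V : FB} {S R₁ R₂ X₀ X₁ X₃ I : Set V}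
    (g : Set V → Set V) (hg : ∀ C v, v ∈ g C ↔ v ∈ S ∧ v ∉ C) (hS : ∀ v, v ∈ S ↔ v ∈ R₁ ∨ v ∈ R₂)
    (hR : ∀ v, v ∈ X₁ ↔ v ∈ R₁ ∧ v ∈ R₂) (h₀ : X₀ ⊆ R₁) (h₃ : X₃ ⊆ R₂)
    (hI : ∀ v, v ∈ I ↔ v ∈ X₁ ∧ v ∉ X₀ ∧ v ∉ X₃) (hne : I.Nonempty) (x : M.val (V.sub X₀)) :
    ∑ C ∈ Finset.univ.filter (fun C : Set V => C ⊆ I), w (g C) X₀ X₃ x - w S X₀ X₃ x =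
      (coeffT k R₁ X₀ X₁ * coeffT k R₂ X₁ X₃) • D true X₀ X₃ x +
        (coeffF k R₁ X₀ * coeffF k R₂ X₁) • D false X₀ X₃ x := by
  have hX₀ : X₀ ⊆ S := fun v hv => (hS v).2 (Or.inl (h₀ hv))
  have hX₃ : X₃ ⊆ S := fun v hv => (hS v).2 (Or.inr (h₃ hv))
  have hIS : I ⊆ S := fun v hv => (hS v).2 (Or.inl ((hR v).1 ((hI v).1 hv).1).1)
  rw [sum_blockForm hw g hg hX₀ hX₃ hIS (fun v hv => ((hI v).1 hv).2.1)
    (fun v hv => ((hI v).1 hv).2.2) hne, hw hX₀ hX₃]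
  obtain ⟨u, hu⟩ := hne
  have e1 : coeffT k S X₀ X₃ = 0 := if_neg fun h => by
    have := hIS hu
    rw [h] at this
    exact this.elim ((hI u).1 hu).2.1 ((hI u).1 hu).2.2
  have e2 : coeffT k (g I) X₀ X₃ = coeffT k R₁ X₀ X₁ * coeffT k R₂ X₁ X₃ := by
    unfold coeffT
    rw [ite_zero_mul_ite_zero, one_mul]
    exact if_congr (merge_aux (hg I) hS hR h₀ h₃ hI) rfl rfl
  have e3 : coeffF k R₁ X₀ * coeffF k R₂ X₁ = - coeffF k S X₀ := by
    unfold coeffF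
    rw [neg_mul_neg, neg_neg, ← sgn_add, ← Set.ncard_union_eq]
    · congr 2
      ext v
      have := hS v
      have := hR v
      have := @h₀ v
      simp only [Set.mem_union, Set.mem_sdiff]
      tauto
    · rw [Set.disjoint_left]
      rintro v ⟨h1, _⟩ ⟨h2, h3⟩
      exact h3 ((hR v).2 ⟨h1, h2⟩)
  rw [e1, e2, e3, zero_smul, zero_add, neg_smul, sub_eq_add_neg]

end FBMod
end

noncomputable section

namespace FBMod

variable {k : Type u} [CommRing k]

/-! ### From representations to block operators -/

/-- The block operators of a representation. -/
def blockOp {M : FBMod k} (a : tensor (const k) M ⟶ tensor (const k) M) (c : Bool) {V : FB}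
    (X Y : Set V) : M.val (V.sub X) →ₗ[k] M.val (V.sub Y) :=
  match c with
  | true => fr a (X ∪ Y) X Y + frOne a X Y
  | false => sgn k (Y \ X).ncard • frOne a X Y

theorem blockOp_map {M : FBMod k} (a : tensor (const k) M ⟶ tensor (const k) M) (c : Bool)
    {V V' : FB} {φ : V → V'} (hφ : Function.Injective φ) {X Y : Set V} {X' Y' : Set V'}
    (b : V.sub X ≃ V'.sub X') (e : V.sub Y ≃ V'.sub Y') (hb : ∀ x, (b x).1 = φ x.1)
    (he : ∀ y, (e y).1 = φ y.1) (x : M.val (V.sub X)) :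
    blockOp a c X' Y' (M.act b x) = M.act e (blockOp a c X Y x) := by
  obtain rfl : X' = φ '' X := Set.ext fun v' => ⟨fun h => ⟨(b.symm ⟨v', h⟩).1, (b.symm ⟨v', h⟩).2,
    by rw [← hb, Equiv.apply_symm_apply]⟩, by rintro ⟨v, h, rfl⟩; rw [← hb ⟨v, h⟩]; exact (b _).2⟩
  obtain rfl : Y' = φ '' Y := Set.ext fun v' => ⟨fun h => ⟨(e.symm ⟨v', h⟩).1, (e.symm ⟨v', h⟩).2,
    by rw [← he, Equiv.apply_symm_apply]⟩, by rintro ⟨v, h, rfl⟩; rw [← he ⟨v, h⟩]; exact (e _).2⟩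
  cases c
  · change sgn k _ • frOne a _ _ _ = M.act e (sgn k _ • frOne a _ _ _)
    rw [frOne_map a hφ b e hb he, map_smul, ← Set.image_sdiff hφ, Set.ncard_image_of_injective _ hφ]
  · change fr a _ _ _ _ + frOne a _ _ _ = M.act e (fr a _ _ _ _ + frOne a _ _ _)
    rw [frOne_map a hφ b e hb he, map_add, fr_map a hφ Set.subset_union_left
      Set.subset_union_right (fun v' => by rw [← Set.image_union]; exact Iff.rfl) b e hb he]

theorem fr_eq_sgn_smul_frOne {M : FBMod k} {a : tensor (const k) M ⟶ tensor (const k) M}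
    (H : WeylRel (fr a)) {V : FB} {X Y : Set V} (n : ℕ) : ∀ {R : Set V} (_ : X ⊆ R) (_ : Y ⊆ R)
    (_ : (R \ (X ∪ Y)).ncard = n + 1) (x : M.val (V.sub X)),
    fr a R X Y x = sgn k n • frOne a X Y x := by
  induction n with
  | zero =>
    intro R hX hY hn x
    obtain ⟨p, hp⟩ := Set.ncard_eq_one.1 hn
    have hp' : p ∈ R \ (X ∪ Y) := hp ▸ rfl
    rw [fr_eq_frOne a p hp'.2]
    · unfold sgn
      rw [pow_zero, one_smul]
    · intro v
      constructor
      · intro hv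
        by_cases h : v ∈ X ∪ Y
        · exact Or.inr h
        · left
          have : v ∈ R \ (X ∪ Y) := ⟨hv, h⟩
          rwa [hp] at this
      · rintro (rfl | h | h)
        exacts [hp'.1, hX h, hY h]
  | succ n ih =>
    intro R hX hY hn x
    obtain ⟨p, hp⟩ : (R \ (X ∪ Y)).Nonempty := Set.nonempty_of_ncard_ne_zero (by omega)
    have hXp : X ⊆ R \ {p} := fun v hv => ⟨hX hv, fun h => hp.2 (Or.inl (h ▸ hv))⟩
    have hYp : Y ⊆ R \ {p} := fun v hv => ⟨hY hv, fun h => hp.2 (Or.inr (h ▸ hv))⟩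
    have hR : insert p (R \ {p}) = R := by
      rw [Set.insert_sdiff_singleton, Set.insert_eq_of_mem hp.1]
    have hn' : ((R \ {p}) \ (X ∪ Y)).ncard = n + 1 := by
      have := ncard_sdiff_insert (R := R \ {p}) (X := X ∪ Y) (u := p) (fun h => h.2 rfl) hp.2
      rw [hR, hn] at this
      omega
    obtain ⟨v, hv⟩ : ((R \ {p}) \ (X ∪ Y)).Nonempty := Set.nonempty_of_ncard_ne_zero (by omega)
    have h1 := fr_insert H hXp hYp hv.1 (fun h => hv.2 (Or.inl h)) (fun h => hv.2 (Or.inr h))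
      (n := p) (fun h => h.2 rfl) x
    rw [hR] at h1
    rw [h1, ih hXp hYp hn', sgn_succ, neg_smul]

theorem fr_isBlockForm {M : FBMod k} {a : tensor (const k) M ⟶ tensor (const k) M}
    (H : WeylRel (fr a)) : IsBlockForm (fr a) (blockOp a) := by
  intro V R X Y hX hY x
  change _ = coeffT k R X Y • (fr a _ _ _ _ + frOne a _ _ _) +
    coeffF k R X • sgn k (Y \ X).ncard • frOne a X Y x
  unfold coeffT coeffF
  by_cases h : R = X ∪ Y
  · subst h
    rw [if_pos rfl, one_smul, smul_smul, Set.union_sdiff_left, neg_mul, sgn_mul_self, neg_smul,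
      one_smul, add_neg_cancel_right]
  · have hne : (R \ (X ∪ Y)).ncard ≠ 0 := by
      intro h0
      rw [Set.ncard_eq_zero] at h0
      exact h ((Set.sdiff_eq_empty.1 h0).antisymm (Set.union_subset hX hY))
    obtain ⟨n, hn⟩ := Nat.exists_eq_succ_of_ne_zero hne
    have hcard : (R \ X).ncard = (n + 1) + (Y \ X).ncard := by
      rw [← Nat.succ_eq_add_one, ← hn, ← Set.ncard_union_eq]
      · congr 1
        ext v
        have := @hY v
        simp only [Set.mem_union, Set.mem_sdiff]
        tauto
      · rw [Set.disjoint_left]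
        exact fun v h1 h2 => h1.2 (Or.inr h2.1)
    rw [if_neg h, zero_smul, zero_add, fr_eq_sgn_smul_frOne H n hX hY hn, smul_smul, hcard, sgn_add,
      neg_mul, mul_assoc, sgn_mul_self, mul_one, sgn_succ, neg_neg]

/-- The equation obtained from the defining relation when exactly one of the two products of
matrix coefficients vanishes. -/
theorem WeylRel.merge_eq {M : FBMod k} {a : tensor (const k) M ⟶ tensor (const k) M}
    (H : WeylRel (fr a)) {V : FB} {R₁ R₂ X₀ X₁ X₃ : Set V}
    (hR : ∀ v, v ∈ X₁ ↔ v ∈ R₁ ∧ v ∈ R₂) (h₀ : X₀ ⊆ R₁) (h₃ : X₃ ⊆ R₂)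
    (hne : ∃ v, v ∉ X₀ ∧ v ∈ X₁ ∧ v ∉ X₃) (x : M.val (V.sub X₀)) :
    fr a R₂ X₁ X₃ (fr a R₁ X₀ X₁ x) =
      (coeffT k R₁ X₀ X₁ * coeffT k R₂ X₁ X₃) • blockOp a true X₀ X₃ x +
        (coeffF k R₁ X₀ * coeffF k R₂ X₁) • blockOp a false X₀ X₃ x := by
  classical
  have h := H.on (S := R₁ ∪ R₂) (A₁ := R₂ \ R₁) (A₂ := R₁ \ X₀) (B₁ := R₂ \ X₃) (B₂ := R₁ \ R₂)
    (X := X₀) (Y := X₃) ?_ ?_ ?_ ?_ ?_ ?_ x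
  · have e1 : ∀ v, v ∈ R₂ \ R₁ → v ∉ R₁ \ R₂ := fun v hv hv' => hv.2 hv'.1
    obtain ⟨u, hu₀, hu₁, hu₃⟩ := hne
    have e2 : ¬ ∀ v, v ∈ R₁ \ X₀ → v ∉ R₂ \ X₃ := fun h =>
      h u ⟨((hR u).1 hu₁).1, hu₀⟩ ⟨((hR u).1 hu₁).2, hu₃⟩
    have e3 : (R₁ ∪ R₂) \ (R₁ \ R₂) = R₂ := by ext v; simp; tauto
    have e4 : (R₁ ∪ R₂) \ (R₂ \ R₁) = R₁ := by ext v; simp; tauto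
    have e5 : (R₁ ∪ R₂) \ (R₂ \ R₁ ∪ R₁ \ R₂) = X₁ := by ext v; rw [hR]; simp; tauto
    have e6 : R₂ \ R₁ ∩ (R₁ \ R₂) = ∅ := by ext v; simp; tauto
    have e7 : ∀ C : Set V, C ⊆ ∅ ↔ C ∈ ({∅} : Finset (Set V)) := fun C => by
      rw [Finset.mem_singleton, Set.subset_empty_iff]
    rw [if_pos e1, if_neg e2, sub_zero, fr_fr_congr a e3 e5 e4, e6] at h
    simp only [e7] at h
    rw [Finset.filter_univ_mem, Finset.sum_singleton, Set.sdiff_empty] at h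
    rw [h]
    refine merge_rhs (fr_isBlockForm H) (fun C => (R₁ ∪ R₂) \ C) (fun C v => Iff.rfl)
      (fun v => Iff.rfl) hR h₀ h₃ (fun v => ?_) ⟨u, ?_⟩ x
    · rw [hR]; simp; tauto
    · exact ⟨⟨((hR u).1 hu₁).1, hu₀⟩, ⟨((hR u).1 hu₁).2, hu₃⟩⟩
  · intro v
    have := @h₀ v
    simp
    tauto
  · intro v
    have := @h₃ v
    simp
    tauto
  · exact fun v hv => Or.inr hv.1
  · exact fun v hv => Or.inl hv.1
  · exact fun v hv hv' => hv.2 hv'.1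
  · exact fun v hv hv' => hv'.2 hv.1

theorem comm_aux {V : FB} {R₁ R₂ R₁' R₂' X₀ X₁ X₂ X₃ : Set V}
    (hR : ∀ v, v ∈ X₁ ↔ v ∈ R₁ ∧ v ∈ R₂) (h₀ : X₀ ⊆ R₁) (h₃ : X₃ ⊆ R₂)
    (hX : ∀ v, v ∈ X₁ → v ∈ X₀ ∨ v ∈ X₃)
    (hR₁' : ∀ v, v ∈ R₁' ↔ v ∈ X₀ ∨ v ∈ R₂ ∧ v ∉ R₁) (hR₂' : ∀ v, v ∈ R₂' ↔ v ∈ X₃ ∨ v ∈ R₁ ∧ v ∉ R₂)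
    (hX₂ : ∀ v, v ∈ X₂ ↔ v ∈ R₁' ∧ v ∈ R₂') : (R₁ ∪ R₂) \ (R₁ \ X₀ ∪ R₂ \ X₃) = X₂ := by
  ext v
  have h₀ := @h₀ v
  have h₃ := @h₃ v
  have hX := hX v
  simp only [hX₂, hR₁', hR₂', Set.mem_sdiff, Set.mem_union]
  rw [hR] at hX
  clear hX₂ hR₁' hR₂' hR
  by_cases h1 : v ∈ R₁ <;> by_cases h2 : v ∈ R₂ <;> by_cases h3 : v ∈ X₀ <;> by_cases h4 : v ∈ X₃ <;>
    simp_all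

/-- The equation obtained from the defining relation when the right hand side vanishes. -/
theorem WeylRel.comm_eq {M : FBMod k} {a : tensor (const k) M ⟶ tensor (const k) M}
    (H : WeylRel (fr a)) {V : FB} {R₁ R₂ R₁' R₂' X₀ X₁ X₂ X₃ : Set V}
    (hR : ∀ v, v ∈ X₁ ↔ v ∈ R₁ ∧ v ∈ R₂) (h₀ : X₀ ⊆ R₁) (h₃ : X₃ ⊆ R₂)
    (hX : ∀ v, v ∈ X₁ → v ∈ X₀ ∨ v ∈ X₃)
    (hR₁' : ∀ v, v ∈ R₁' ↔ v ∈ X₀ ∨ v ∈ R₂ ∧ v ∉ R₁) (hR₂' : ∀ v, v ∈ R₂' ↔ v ∈ X₃ ∨ v ∈ R₁ ∧ v ∉ R₂)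
    (hX₂ : ∀ v, v ∈ X₂ ↔ v ∈ R₁' ∧ v ∈ R₂') (x : M.val (V.sub X₀)) :
    fr a R₂ X₁ X₃ (fr a R₁ X₀ X₁ x) = fr a R₂' X₂ X₃ (fr a R₁' X₀ X₂ x) := by
  classical
  have h := H.on (S := R₁ ∪ R₂) (A₁ := R₂ \ R₁) (A₂ := R₁ \ X₀) (B₁ := R₂ \ X₃) (B₂ := R₁ \ R₂)
    (X := X₀) (Y := X₃) ?_ ?_ ?_ ?_ ?_ ?_ x
  · have e1 : ∀ v, v ∈ R₂ \ R₁ → v ∉ R₁ \ R₂ := fun v hv hv' => hv.2 hv'.1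
    have e2 : ∀ v, v ∈ R₁ \ X₀ → v ∉ R₂ \ X₃ := fun v h1 h2 =>
      (hX v ((hR v).2 ⟨h1.1, h2.1⟩)).elim h1.2 h2.2
    have e3 : (R₁ ∪ R₂) \ (R₁ \ R₂) = R₂ := by ext v; simp; tauto
    have e4 : (R₁ ∪ R₂) \ (R₂ \ R₁) = R₁ := by ext v; simp; tauto
    have e5 : (R₁ ∪ R₂) \ (R₂ \ R₁ ∪ R₁ \ R₂) = X₁ := by ext v; rw [hR]; simp; tauto
    have e6 : R₂ \ R₁ ∩ (R₁ \ R₂) = ∅ := by ext v; simp; tauto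
    have e7 : R₁ \ X₀ ∩ (R₂ \ X₃) = ∅ := by
      ext v
      simp only [Set.mem_inter_iff, Set.mem_empty_iff_false, iff_false]
      exact fun h => e2 v h.1 h.2
    have e8 : (R₁ ∪ R₂) \ (R₂ \ X₃) = R₂' := by
      ext v
      have := hR₂' v
      have := @h₃ v
      simp
      tauto
    have e9 : (R₁ ∪ R₂) \ (R₁ \ X₀) = R₁' := by
      ext v
      have := hR₁' v
      have := @h₀ v
      simp
      tauto
    have e10 : (R₁ ∪ R₂) \ (R₁ \ X₀ ∪ R₂ \ X₃) = X₂ := by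
      exact comm_aux hR h₀ h₃ hX hR₁' hR₂' hX₂
    rw [if_pos e1, if_pos e2, fr_fr_congr a e3 e5 e4, fr_fr_congr a e8 e10 e9, e6, e7, sub_self] at h
    exact sub_eq_zero.1 h
  · intro v
    have := @h₀ v
    simp
    tauto
  · intro v
    have := @h₃ v
    simp
    tauto
  · exact fun v hv => Or.inr hv.1
  · exact fun v hv => Or.inl hv.1
  · exact fun v hv hv' => hv.2 hv'.1
  · exact fun v hv hv' => hv'.2 hv.1

end FBMod
end

noncomputable section

namespace FBMod

variable {k : Type u} [CommRing k]

theorem coeffF_mul_self {V : FB} (R X : Set V) : coeffF k R X * coeffF k R X = 1 := by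
  unfold coeffF
  rw [neg_mul_neg, sgn_mul_self]

theorem coeffT_union {V : FB} (X Y : Set V) : coeffT k (X ∪ Y) X Y = 1 := if_pos rfl

theorem coeffT_insert {V : FB} {X Y : Set V} {p : V} (hX : p ∉ X) (hY : p ∉ Y) :
    coeffT k (insert p (X ∪ Y)) X Y = 0 := if_neg fun h => by
  have : p ∈ X ∪ Y := h ▸ Set.mem_insert _ _
  exact this.elim hX hY

theorem coeffF_insert {V : FB} {X Y : Set V} {p : V} (hX : p ∉ X) (hY : p ∉ Y) :
    coeffF k (insert p (X ∪ Y)) X = - coeffF k (X ∪ Y) X := by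
  unfold coeffF
  rw [ncard_sdiff_insert (fun h => h.elim hX hY) hX, sgn_succ]

theorem smul_cancel {P : Type*} [AddCommGroup P] [Module k P] {s : k} (hs : s * s = 1) {x y : P}
    (h : s • x = s • y) : x = y := by
  have := congrArg (fun z => s • z) h
  simpa only [smul_smul, hs, one_smul] using this

/-- The value of a product of two matrix coefficients in terms of block operators. -/
theorem fr_fr_eq {M : FBMod k} {a : tensor (const k) M ⟶ tensor (const k) M}
    (H : WeylRel (fr a)) {V : FB} {R₁ R₂ X₀ X₁ X₃ : Set V} (h₀ : X₀ ⊆ R₁) (h₁ : X₁ ⊆ R₁)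
    (h₁' : X₁ ⊆ R₂) (h₃ : X₃ ⊆ R₂) (x : M.val (V.sub X₀)) :
    fr a R₂ X₁ X₃ (fr a R₁ X₀ X₁ x) =
      coeffT k R₂ X₁ X₃ • coeffT k R₁ X₀ X₁ •
          blockOp a true X₁ X₃ (blockOp a true X₀ X₁ x) +
        coeffT k R₂ X₁ X₃ • coeffF k R₁ X₀ • blockOp a true X₁ X₃ (blockOp a false X₀ X₁ x) +
        (coeffF k R₂ X₁ • coeffT k R₁ X₀ X₁ •
          blockOp a false X₁ X₃ (blockOp a true X₀ X₁ x) +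
        coeffF k R₂ X₁ • coeffF k R₁ X₀ • blockOp a false X₁ X₃ (blockOp a false X₀ X₁ x)) := by
  rw [fr_isBlockForm H h₁' h₃, fr_isBlockForm H h₀ h₁]
  simp only [map_add, map_smul, smul_add]

theorem merge_all {M : FBMod k} {a : tensor (const k) M ⟶ tensor (const k) M}
    (H : WeylRel (fr a)) {V : FB} {X₀ X₁ X₃ : Set V} {p q : V} (hpq : p ≠ q)
    (hp₀ : p ∉ X₀) (hp₁ : p ∉ X₁) (hp₃ : p ∉ X₃) (hq₀ : q ∉ X₀) (hq₁ : q ∉ X₁) (hq₃ : q ∉ X₃)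
    (hne : ∃ v, v ∉ X₀ ∧ v ∈ X₁ ∧ v ∉ X₃) (hX : ∀ v, v ∈ X₀ → v ∈ X₃ → v ∈ X₁)
    (x : M.val (V.sub X₀)) :
    blockOp a false X₁ X₃ (blockOp a false X₀ X₁ x) = blockOp a false X₀ X₃ x ∧
      blockOp a true X₁ X₃ (blockOp a false X₀ X₁ x) = 0 ∧
      blockOp a false X₁ X₃ (blockOp a true X₀ X₁ x) = 0 ∧
      blockOp a true X₁ X₃ (blockOp a true X₀ X₁ x) = blockOp a true X₀ X₃ x := by
  have hX' : ∀ v, v ∈ X₁ ↔ v ∈ X₀ ∪ X₁ ∧ v ∈ X₁ ∪ X₃ := fun v =>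
    ⟨fun h => ⟨Or.inr h, Or.inl h⟩, fun h => h.2.elim id fun h3 => h.1.elim (fun h0 => hX v h0 h3) id⟩
  have l₀ : X₀ ⊆ X₀ ∪ X₁ := Set.subset_union_left
  have l₁ : X₁ ⊆ X₀ ∪ X₁ := Set.subset_union_right
  have r₁ : X₁ ⊆ X₁ ∪ X₃ := Set.subset_union_left
  have r₃ : X₃ ⊆ X₁ ∪ X₃ := Set.subset_union_right
  have lp := Set.subset_insert p (X₀ ∪ X₁)
  have lq := Set.subset_insert q (X₁ ∪ X₃)
  have q01 : q ∉ X₀ ∪ X₁ := fun h => h.elim hq₀ hq₁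
  have p13 : p ∉ X₁ ∪ X₃ := fun h => h.elim hp₁ hp₃
  have e1 := H.merge_eq (R₁ := insert p (X₀ ∪ X₁)) (R₂ := insert q (X₁ ∪ X₃)) (X₁ := X₁)
    (fun v => (hX' v).trans ⟨fun h => ⟨Or.inr h.1, Or.inr h.2⟩, fun h => ⟨h.1.resolve_left (by
      rintro rfl
      exact h.2.elim hpq p13), h.2.resolve_left (by
      rintro rfl
      exact h.1.elim (Ne.symm hpq) q01)⟩⟩) (l₀.trans lp) (r₃.trans lq) hne x
  have e2 := H.merge_eq (R₁ := insert p (X₀ ∪ X₁)) (R₂ := X₁ ∪ X₃) (X₁ := X₁)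
    (fun v => (hX' v).trans ⟨fun h => ⟨Or.inr h.1, h.2⟩, fun h => ⟨h.1.resolve_left (by
      rintro rfl
      exact p13 h.2), h.2⟩⟩) (l₀.trans lp) r₃ hne x
  have e3 := H.merge_eq (R₁ := X₀ ∪ X₁) (R₂ := insert q (X₁ ∪ X₃)) (X₁ := X₁)
    (fun v => (hX' v).trans ⟨fun h => ⟨h.1, Or.inr h.2⟩, fun h => ⟨h.1, h.2.resolve_left (by
      rintro rfl
      exact q01 h.1)⟩⟩) l₀ (r₃.trans lq) hne x
  have e4 := H.merge_eq (R₁ := X₀ ∪ X₁) (R₂ := X₁ ∪ X₃) hX' l₀ r₃ hne x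
  rw [fr_fr_eq H (l₀.trans lp) (l₁.trans lp) (r₁.trans lq) (r₃.trans lq)] at e1
  rw [fr_fr_eq H (l₀.trans lp) (l₁.trans lp) r₁ r₃] at e2
  rw [fr_fr_eq H l₀ l₁ (r₁.trans lq) (r₃.trans lq)] at e3
  rw [fr_fr_eq H l₀ l₁ r₁ r₃] at e4
  rw [coeffT_insert hp₀ hp₁, coeffT_insert hq₁ hq₃, coeffF_insert hp₀ hp₁,
    coeffF_insert hq₁ hq₃] at e1
  rw [coeffT_insert hp₀ hp₁, coeffT_union, coeffF_insert hp₀ hp₁] at e2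
  rw [coeffT_insert hq₁ hq₃, coeffT_union, coeffF_insert hq₁ hq₃] at e3
  rw [coeffT_union, coeffT_union] at e4
  have s1 : coeffF k (X₀ ∪ X₁) X₀ * coeffF k (X₀ ∪ X₁) X₀ = 1 := coeffF_mul_self _ _
  have s2 : coeffF k (X₁ ∪ X₃) X₁ * coeffF k (X₁ ∪ X₃) X₁ = 1 := coeffF_mul_self _ _
  generalize coeffF k (X₀ ∪ X₁) X₀ = s at *
  generalize coeffF k (X₁ ∪ X₃) X₁ = t at *
  have hst : (t * s) * (t * s) = 1 := by linear_combination t * t * s1 + s2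
  have h1 : blockOp a false X₁ X₃ (blockOp a false X₀ X₁ x) = blockOp a false X₀ X₃ x := by
    refine smul_cancel hst ?_
    linear_combination (norm := module) (1 : k) • e1
  rw [h1] at e2 e3 e4
  have h2 : blockOp a true X₁ X₃ (blockOp a false X₀ X₁ x) = 0 := by
    refine smul_cancel s1 ?_
    linear_combination (norm := module) (-1 : k) • e2
  have h3 : blockOp a false X₁ X₃ (blockOp a true X₀ X₁ x) = 0 := by
    refine smul_cancel s2 ?_
    linear_combination (norm := module) (-1 : k) • e3
  refine ⟨h1, h2, h3, ?_⟩
  rw [h2, h3] at e4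
  linear_combination (norm := module) (1 : k) • e4

theorem comm_pt {p q a b c d : Prop} (hp : p → ¬ q ∧ ¬ a ∧ ¬ b ∧ ¬ c ∧ ¬ d)
    (hq : q → ¬ p ∧ ¬ a ∧ ¬ b ∧ ¬ c ∧ ¬ d) (h : ((a ↔ b) ∧ (c ↔ d)) ∨ ((a ↔ c) ∧ (b ↔ d))) :
    (b ↔ (p ∨ a ∨ b) ∧ (q ∨ b ∨ d)) ∧ (b → a ∨ d) ∧
      ((q ∨ a ∨ c) ↔ a ∨ (q ∨ b ∨ d) ∧ ¬ (p ∨ a ∨ b)) ∧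
      ((p ∨ c ∨ d) ↔ d ∨ (p ∨ a ∨ b) ∧ ¬ (q ∨ b ∨ d)) ∧ (c ↔ (q ∨ a ∨ c) ∧ (p ∨ c ∨ d)) := by
  by_cases hp' : p <;> by_cases hq' : q <;> by_cases ha : a <;> by_cases hb : b <;>
    by_cases hc : c <;> by_cases hd : d <;> simp_all

theorem comm_all {M : FBMod k} {a : tensor (const k) M ⟶ tensor (const k) M}
    (H : WeylRel (fr a)) {V : FB} {X₀ X₁ X₂ X₃ : Set V} {p q : V} (hpq : p ≠ q)
    (hp₀ : p ∉ X₀) (hp₁ : p ∉ X₁) (hp₂ : p ∉ X₂) (hp₃ : p ∉ X₃)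
    (hq₀ : q ∉ X₀) (hq₁ : q ∉ X₁) (hq₂ : q ∉ X₂) (hq₃ : q ∉ X₃)
    (hX : ∀ v, ((v ∈ X₀ ↔ v ∈ X₁) ∧ (v ∈ X₂ ↔ v ∈ X₃)) ∨ ((v ∈ X₀ ↔ v ∈ X₂) ∧ (v ∈ X₁ ↔ v ∈ X₃)))
    (c c' : Bool) (x : M.val (V.sub X₀)) :
    blockOp a c X₁ X₃ (blockOp a c' X₀ X₁ x) = blockOp a c' X₂ X₃ (blockOp a c X₀ X₂ x) := by
  have l₀ : X₀ ⊆ X₀ ∪ X₁ := Set.subset_union_left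
  have l₁ : X₁ ⊆ X₀ ∪ X₁ := Set.subset_union_right
  have r₁ : X₁ ⊆ X₁ ∪ X₃ := Set.subset_union_left
  have r₃ : X₃ ⊆ X₁ ∪ X₃ := Set.subset_union_right
  have m₀ : X₀ ⊆ X₀ ∪ X₂ := Set.subset_union_left
  have m₂ : X₂ ⊆ X₀ ∪ X₂ := Set.subset_union_right
  have n₂ : X₂ ⊆ X₂ ∪ X₃ := Set.subset_union_left
  have n₃ : X₃ ⊆ X₂ ∪ X₃ := Set.subset_union_right
  have lp := Set.subset_insert p (X₀ ∪ X₁)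
  have rq := Set.subset_insert q (X₁ ∪ X₃)
  have mq := Set.subset_insert q (X₀ ∪ X₂)
  have np := Set.subset_insert p (X₂ ∪ X₃)
  have key : ∀ P Q : Set V, (∀ v ∈ P, v = p) → (∀ v ∈ Q, v = q) → ∀ R₁ R₂ R₁' R₂' : Set V,
      (∀ v, v ∈ R₁ ↔ v ∈ P ∨ v ∈ X₀ ∪ X₁) → (∀ v, v ∈ R₂ ↔ v ∈ Q ∨ v ∈ X₁ ∪ X₃) →
      (∀ v, v ∈ R₁' ↔ v ∈ Q ∨ v ∈ X₀ ∪ X₂) → (∀ v, v ∈ R₂' ↔ v ∈ P ∨ v ∈ X₂ ∪ X₃) →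
      fr a R₂ X₁ X₃ (fr a R₁ X₀ X₁ x) = fr a R₂' X₂ X₃ (fr a R₁' X₀ X₂ x) := by
    intro P Q hP hQ R₁ R₂ R₁' R₂' hR₁ hR₂ hR₁' hR₂'
    have hP' : ∀ v, v ∈ P → v ∉ Q ∧ v ∉ X₀ ∧ v ∉ X₁ ∧ v ∉ X₂ ∧ v ∉ X₃ := by
      intro v hv
      obtain rfl := hP v hv
      exact ⟨fun h => hpq (hQ _ h), hp₀, hp₁, hp₂, hp₃⟩
    have hQ' : ∀ v, v ∈ Q → v ∉ P ∧ v ∉ X₀ ∧ v ∉ X₁ ∧ v ∉ X₂ ∧ v ∉ X₃ := by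
      intro v hv
      obtain rfl := hQ v hv
      exact ⟨fun h => hpq (hP _ h).symm, hq₀, hq₁, hq₂, hq₃⟩
    have hpt := fun v => comm_pt (hP' v) (hQ' v) (hX v)
    refine H.comm_eq (fun v => ?_) (fun v hv => (hR₁ v).2 (Or.inr (Or.inl hv)))
      (fun v hv => (hR₂ v).2 (Or.inr (Or.inr hv))) (fun v => (hpt v).2.1) (fun v => ?_)
      (fun v => ?_) (fun v => ?_) x
    · rw [hR₁, hR₂]
      exact (hpt v).1
    · rw [hR₁, hR₂, hR₁']
      exact (hpt v).2.2.1
    · rw [hR₁, hR₂, hR₂']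
      exact (hpt v).2.2.2.1
    · rw [hR₁', hR₂']
      exact (hpt v).2.2.2.2
  have hp : ∀ v ∈ ({p} : Set V), v = p := fun v h => h
  have hq : ∀ v ∈ ({q} : Set V), v = q := fun v h => h
  have hp' : ∀ v ∈ (∅ : Set V), v = p := fun v h => h.elim
  have hq' : ∀ v ∈ (∅ : Set V), v = q := fun v h => h.elim
  have hi : ∀ (A : Set V) (v w : V), v ∈ insert w A ↔ v ∈ ({w} : Set V) ∨ v ∈ A :=
    fun _ _ _ => Iff.rfl
  have hi' : ∀ (A : Set V) (v : V), v ∈ A ↔ v ∈ (∅ : Set V) ∨ v ∈ A :=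
    fun _ _ => ⟨Or.inr, fun h => h.elim False.elim id⟩
  have e1 := key _ _ hp hq _ _ _ _ (fun v => hi _ v p) (fun v => hi _ v q) (fun v => hi _ v q)
    fun v => hi _ v p
  have e2 := key _ _ hp hq' _ _ _ _ (fun v => hi _ v p) (fun v => hi' _ v) (fun v => hi' _ v)
    fun v => hi _ v p
  have e3 := key _ _ hp' hq _ _ _ _ (fun v => hi' _ v) (fun v => hi _ v q) (fun v => hi _ v q)
    fun v => hi' _ v
  have e4 := key _ _ hp' hq' _ _ _ _ (fun v => hi' _ v) (fun v => hi' _ v) (fun v => hi' _ v)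
    fun v => hi' _ v
  rw [fr_fr_eq H (l₀.trans lp) (l₁.trans lp) (r₁.trans rq) (r₃.trans rq),
    fr_fr_eq H (m₀.trans mq) (m₂.trans mq) (n₂.trans np) (n₃.trans np)] at e1
  rw [fr_fr_eq H (l₀.trans lp) (l₁.trans lp) r₁ r₃,
    fr_fr_eq H m₀ m₂ (n₂.trans np) (n₃.trans np)] at e2
  rw [fr_fr_eq H l₀ l₁ (r₁.trans rq) (r₃.trans rq),
    fr_fr_eq H (m₀.trans mq) (m₂.trans mq) n₂ n₃] at e3
  rw [fr_fr_eq H l₀ l₁ r₁ r₃, fr_fr_eq H m₀ m₂ n₂ n₃] at e4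
  have hs : coeffF k (X₂ ∪ X₃) X₂ = coeffF k (X₀ ∪ X₁) X₀ := by
    unfold coeffF
    congr 3
    ext v
    have hX := hX v
    simp only [Set.mem_sdiff, Set.mem_union]
    tauto
  have ht : coeffF k (X₀ ∪ X₂) X₀ = coeffF k (X₁ ∪ X₃) X₁ := by
    unfold coeffF
    congr 3
    ext v
    have hX := hX v
    simp only [Set.mem_sdiff, Set.mem_union]
    tauto
  rw [coeffT_insert hp₀ hp₁, coeffT_insert hq₁ hq₃, coeffF_insert hp₀ hp₁,
    coeffF_insert hq₁ hq₃, coeffT_insert hq₀ hq₂, coeffT_insert hp₂ hp₃, coeffF_insert hq₀ hq₂,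
    coeffF_insert hp₂ hp₃, hs, ht] at e1
  rw [coeffT_insert hp₀ hp₁, coeffT_union, coeffF_insert hp₀ hp₁, coeffT_union,
    coeffT_insert hp₂ hp₃, coeffF_insert hp₂ hp₃, hs, ht] at e2
  rw [coeffT_union, coeffT_insert hq₁ hq₃, coeffF_insert hq₁ hq₃, coeffT_union,
    coeffT_insert hq₀ hq₂, coeffF_insert hq₀ hq₂, hs, ht] at e3
  rw [coeffT_union, coeffT_union, coeffT_union, coeffT_union, hs, ht] at e4
  have s1 : coeffF k (X₀ ∪ X₁) X₀ * coeffF k (X₀ ∪ X₁) X₀ = 1 := coeffF_mul_self _ _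
  have s2 : coeffF k (X₁ ∪ X₃) X₁ * coeffF k (X₁ ∪ X₃) X₁ = 1 := coeffF_mul_self _ _
  generalize coeffF k (X₀ ∪ X₁) X₀ = s at *
  generalize coeffF k (X₁ ∪ X₃) X₁ = t at *
  have hst : (t * s) * (t * s) = 1 := by linear_combination t * t * s1 + s2
  have h1 : blockOp a false X₁ X₃ (blockOp a false X₀ X₁ x) =
      blockOp a false X₂ X₃ (blockOp a false X₀ X₂ x) := by
    refine smul_cancel hst ?_
    linear_combination (norm := module) (1 : k) • e1
  rw [h1] at e2 e3 e4
  have h2 : blockOp a true X₁ X₃ (blockOp a false X₀ X₁ x) =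
      blockOp a false X₂ X₃ (blockOp a true X₀ X₂ x) := by
    refine smul_cancel s1 ?_
    linear_combination (norm := module) (-1 : k) • e2
  have h3 : blockOp a false X₁ X₃ (blockOp a true X₀ X₁ x) =
      blockOp a true X₂ X₃ (blockOp a false X₀ X₂ x) := by
    refine smul_cancel s2 ?_
    linear_combination (norm := module) (-1 : k) • e3
  rw [h2, h3] at e4
  have h4 : blockOp a true X₁ X₃ (blockOp a true X₀ X₁ x) =
      blockOp a true X₂ X₃ (blockOp a true X₀ X₂ x) := by
    linear_combination (norm := module) (1 : k) • e4
  cases c <;> cases c'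
  exacts [h1, h3, h2, h4]

end FBMod
end

noncomputable section

namespace FBMod

variable {k : Type u} [CommRing k]

theorem exists_equiv_of_range {X S : FB} {i : X → S} (hi : Function.Injective i) {A : Set S}
    (hA : ∀ s, s ∈ A ↔ ∃ x, i x = s) : ∃ b : X ≃ S.sub A, ∀ x, (b x).1 = i x :=
  ⟨(Equiv.ofInjective i hi).trans (Equiv.subtypeEquivRight fun s => (hA s).symm), fun _ => rfl⟩

theorem opr_act_W {M : FBMod k} (a : tensor (const k) M ⟶ tensor (const k) M) {X Y S : FB}
    {i : X → S} {j : Y → S} (hi : Function.Injective i) (hj : Function.Injective j) {A B : Set S}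
    (b : X ≃ S.sub A) (c : Y ≃ S.sub B) (hb : ∀ x, (b x).1 = i x) (hc : ∀ y, (c y).1 = j y)
    (x : M.val X) : opr a S A B (M.act b x) = M.act c (W a hi hj x) := by
  rw [opr_eq_W]
  exact W_act a hi hj Subtype.val_injective Subtype.val_injective b c (Equiv.refl _) hb hc x

theorem opr_eq_fr {M : FBMod k} (a : tensor (const k) M ⟶ tensor (const k) M) (S : FB)
    (X Y : Set S) (x : M.val (S.sub X)) : opr a S X Y x = fr a Set.univ X Y x := by
  rw [opr_eq_W, fr_pos a (Set.subset_univ X) (Set.subset_univ Y)]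
  have := W_act a (S := S.sub Set.univ) (S' := S) (X := S.sub X) (Y := S.sub Y) (X' := S.sub X)
    (Y' := S.sub Y) (Set.inclusion_injective (Set.subset_univ X))
    (Set.inclusion_injective (Set.subset_univ Y)) Subtype.val_injective Subtype.val_injective
    (Equiv.refl _) (Equiv.refl _) (Equiv.Set.univ S) (fun _ => rfl) (fun _ => rfl) x
  rwa [act_refl, act_refl] at this

theorem fr_self {M : FBMod k} {a : tensor (const k) M ⟶ tensor (const k) M} {χ : k}
    (h : ∀ (S : FB) (x : M.val (S.sub ∅ᶜ)), opr a S ∅ᶜ ∅ᶜ x = χ • x) {V : FB} (X : Set V)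
    (x : M.val (V.sub X)) : fr a X X X x = χ • x := by
  have hX : ∀ v : V.sub X, v ∈ (∅ : Set (V.sub X))ᶜ ↔ v.1 ∈ X := fun v => ⟨fun _ => v.2, fun _ h => h⟩
  have h1 := opr_nest a (R := X) subset_rfl subset_rfl hX hX x
  rw [h, ← map_smul] at h1
  exact (M.act_injective _ h1).symm

theorem frOne_self {M : FBMod k} {a : tensor (const k) M ⟶ tensor (const k) M} {ε : k}
    (h : ∀ (S : FB) (j : S) (x : M.val (S.sub {j}ᶜ)), opr a S {j}ᶜ {j}ᶜ x = ε • x) {V : FB}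
    (X : Set V) (x : M.val (V.sub X)) : frOne a X X x = ε • x := by
  let S : FB := ⟨Option (V.sub (X ∪ X))⟩
  let i : V.sub X → S := some ∘ Set.inclusion Set.subset_union_left
  have hi : Function.Injective i := (Option.some_injective _).comp (Set.inclusion_injective _)
  have hA : ∀ s, s ∈ ({(none : Option (V.sub (X ∪ X)))}ᶜ : Set S) ↔ ∃ x, i x = s := by
    rintro (_ | s)
    · constructor
      · exact fun h => (h rfl).elim
      · rintro ⟨_, h⟩
        cases h
    · exact ⟨fun _ => ⟨⟨s.1, s.2.elim id id⟩, rfl⟩, fun _ h => by cases h⟩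
  obtain ⟨b, hb⟩ := exists_equiv_of_range (X := V.sub X) hi hA
  have h1 := opr_act_W a (X := V.sub X) (Y := V.sub X) hi hi b b hb hb x
  rw [h, ← map_smul] at h1
  exact (M.act_injective _ h1).symm

theorem iota_apply_self {S : FB} {i j : S} {s : S.sub {j}ᶜ} (h : s.1 = i) :
    (iota i j s).1 = j := by
  classical
  refine Eq.trans (b := Equiv.swap i j s.1) ?_ (by rw [h, Equiv.swap_apply_left])
  unfold iota
  simp only [FB.restr, Equiv.subtypeEquiv_apply]

theorem iota_apply_ne {S : FB} {i j : S} {s : S.sub {j}ᶜ} (h : s.1 ≠ i) :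
    (iota i j s).1 = s.1 := by
  classical
  refine Eq.trans (b := Equiv.swap i j s.1) ?_ (Equiv.swap_apply_of_ne_of_ne h s.2)
  unfold iota
  simp only [FB.restr, Equiv.subtypeEquiv_apply]

theorem fr_move {M : FBMod k} {a : tensor (const k) M ⟶ tensor (const k) M}
    (h : ∀ (S : FB) (i j : S) (x : M.val (S.sub {j}ᶜ)), i ≠ j →
      opr a S {j}ᶜ {i}ᶜ x = M.act (iota i j) x) {V : FB} {X Y : Set V}
    (e : V.sub X ≃ V.sub Y) {u v : V} (huX : u ∈ X) (huY : u ∉ Y)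
    (hvY : v ∈ Y) (hvX : v ∉ X) (he : ∀ x, x.1 ≠ u → (e x).1 = x.1) (heu : ∀ x, x.1 = u → (e x).1 = v)
    (x : M.val (V.sub X)) : fr a (X ∪ Y) X Y x = M.act e x := by
  let u' : V.sub (X ∪ Y) := ⟨u, Or.inl huX⟩
  let v' : V.sub (X ∪ Y) := ⟨v, Or.inr hvY⟩
  have huv : u' ≠ v' := fun h => huY ((show u = v from congrArg Subtype.val h) ▸ hvY)
  have hX : ∀ s : V.sub (X ∪ Y), s ∈ ({v'}ᶜ : Set (V.sub (X ∪ Y))) ↔ s.1 ∈ X := by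
    intro s
    refine ⟨fun hs => s.2.elim id fun hY => ?_, fun hs h => hvX ((show s.1 = v from congrArg Subtype.val (show s = v' from h)) ▸ hs)⟩
    obtain ⟨z, hz⟩ := e.surjective ⟨s.1, hY⟩
    by_cases hzu : z.1 = u
    · exact (hs (Subtype.ext ((congrArg Subtype.val hz).symm.trans (heu z hzu)))).elim
    · rw [← show z.1 = s.1 from (he z hzu).symm.trans (congrArg Subtype.val hz)]
      exact z.2
  have hY : ∀ s : V.sub (X ∪ Y), s ∈ ({u'}ᶜ : Set (V.sub (X ∪ Y))) ↔ s.1 ∈ Y := by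
    intro s
    refine ⟨fun hs => s.2.elim (fun hsX => ?_) id, fun hs h => huY ((show s.1 = u from congrArg Subtype.val (show s = u' from h)) ▸ hs)⟩
    rw [← he ⟨s.1, hsX⟩ fun h => hs (Subtype.ext h)]
    exact (e _).2
  have h1 := opr_nest a (R := X ∪ Y) Set.subset_union_left Set.subset_union_right hX hY x
  rw [h _ _ _ _ huv, act_act] at h1
  refine M.act_injective (nestEquiv (fun _ h => Set.subset_union_right h) hY) ?_
  refine h1.symm.trans ?_
  rw [act_act]
  refine M.act_congr (fun s => ?_) _
  refine Subtype.ext (Subtype.ext ?_)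
  by_cases hs : s.1 = u
  · exact (congrArg Subtype.val (iota_apply_self (i := u') (j := v') (Subtype.ext hs))).trans
      (heu s hs).symm
  · exact (congrArg Subtype.val (iota_apply_ne (i := u') (j := v')
      fun h => hs (congrArg Subtype.val h))).trans (he s hs).symm

theorem blockOp_blockOp_map {M : FBMod k} (a : tensor (const k) M ⟶ tensor (const k) M)
    (c c' : Bool) {V V' : FB} {φ : V → V'} {X₀ X₁ X₂ : Set V} {X₀' X₁' X₂' : Set V'}
    (hφ : Function.Injective φ) {e₀ : V.sub X₀ ≃ V'.sub X₀'} {e₁ : V.sub X₁ ≃ V'.sub X₁'}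
    {e₂ : V.sub X₂ ≃ V'.sub X₂'} (h₀ : ∀ x, (e₀ x).1 = φ x.1) (h₁ : ∀ x, (e₁ x).1 = φ x.1)
    (h₂ : ∀ x, (e₂ x).1 = φ x.1) (x : M.val (V.sub X₀)) :
    M.act e₂ (blockOp a c X₁ X₂ (blockOp a c' X₀ X₁ x)) =
      blockOp a c X₁' X₂' (blockOp a c' X₀' X₁' (M.act e₀ x)) := by
  rw [blockOp_map a c' hφ e₀ e₁ h₀ h₁, blockOp_map a c hφ e₁ e₂ h₁ h₂]

theorem exists_fresh (V : FB) : ∃ (V' : FB) (φ : V → V') (p q : V'), Function.Injective φ ∧ p ≠ q ∧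
    (∀ v, φ v ≠ p) ∧ ∀ v, φ v ≠ q :=
  ⟨⟨Option (Option V)⟩, some ∘ some, none, some none,
    (Option.some_injective _).comp (Option.some_injective _), fun h => (by cases h),
    fun _ h => (by cases h), fun _ h => (by cases h)⟩

theorem merge_of_rel {M : FBMod k} {a : tensor (const k) M ⟶ tensor (const k) M}
    (H : WeylRel (fr a)) {V : FB} {X₀ X₁ X₃ : Set V}
    (hne : ∃ v, v ∉ X₀ ∧ v ∈ X₁ ∧ v ∉ X₃) (hX : ∀ v, v ∈ X₀ → v ∈ X₃ → v ∈ X₁)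
    (x : M.val (V.sub X₀)) :
    blockOp a false X₁ X₃ (blockOp a false X₀ X₁ x) = blockOp a false X₀ X₃ x ∧
      blockOp a true X₁ X₃ (blockOp a false X₀ X₁ x) = 0 ∧
      blockOp a false X₁ X₃ (blockOp a true X₀ X₁ x) = 0 ∧
      blockOp a true X₁ X₃ (blockOp a true X₀ X₁ x) = blockOp a true X₀ X₃ x := by
  obtain ⟨V', φ, p, q, hφ, hpq, hp, hq⟩ := exists_fresh V
  obtain ⟨e₀, h₀⟩ := exists_image_equiv hφ X₀
  obtain ⟨e₁, h₁⟩ := exists_image_equiv hφ X₁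
  obtain ⟨e₃, h₃⟩ := exists_image_equiv hφ X₃
  have hp' : ∀ X : Set V, p ∉ φ '' X := fun X ⟨v, _, h⟩ => hp v h
  have hq' : ∀ X : Set V, q ∉ φ '' X := fun X ⟨v, _, h⟩ => hq v h
  have hX' : ∀ v, v ∈ φ '' X₀ → v ∈ φ '' X₃ → v ∈ φ '' X₁ := by
    rintro _ ⟨v, hv, rfl⟩ hv'
    rw [hφ.mem_set_image] at hv' ⊢
    exact hX v hv hv'
  have hne' : ∃ v, v ∉ φ '' X₀ ∧ v ∈ φ '' X₁ ∧ v ∉ φ '' X₃ := by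
    obtain ⟨v, h⟩ := hne
    refine ⟨φ v, ?_⟩
    rwa [hφ.mem_set_image, hφ.mem_set_image, hφ.mem_set_image]
  obtain ⟨f1, f2, f3, f4⟩ := merge_all H hpq (hp' X₀) (hp' X₁) (hp' X₃) (hq' X₀) (hq' X₁) (hq' X₃)
    hne' hX' (M.act e₀ x)
  refine ⟨?_, ?_, ?_, ?_⟩ <;> apply M.act_injective e₃ <;>
    rw [blockOp_blockOp_map a _ _ hφ h₀ h₁ h₃]
  · rw [f1, blockOp_map a _ hφ _ _ h₀ h₃]
  · rw [f2, map_zero]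
  · rw [f3, map_zero]
  · rw [f4, blockOp_map a _ hφ _ _ h₀ h₃]

/-- The block operators of a standard representation. -/
def BlockOps.ofRep {M : FBMod k} (a : tensor (const k) M ⟶ tensor (const k) M) {δ ε : k}
    (H : WeylRel (fr a))
    (hχ : ∀ (S : FB) (x : M.val (S.sub ∅ᶜ)), opr a S ∅ᶜ ∅ᶜ x = (δ - ε) • x)
    (hε : ∀ (S : FB) (j : S) (x : M.val (S.sub {j}ᶜ)), opr a S {j}ᶜ {j}ᶜ x = ε • x)
    (hι : ∀ (S : FB) (i j : S) (x : M.val (S.sub {j}ᶜ)), i ≠ j →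
      opr a S {j}ᶜ {i}ᶜ x = M.act (iota i j) x) : BlockOps M (fun c => cond c δ ε) where
  D := blockOp a
  nat := blockOp_map a
  comm c c' V X₀ X₁ X₂ X₃ hX x := by
    obtain ⟨V', φ, p, q, hφ, hpq, hp, hq⟩ := exists_fresh V
    obtain ⟨e₀, h₀⟩ := exists_image_equiv hφ X₀
    obtain ⟨e₁, h₁⟩ := exists_image_equiv hφ X₁
    obtain ⟨e₂, h₂⟩ := exists_image_equiv hφ X₂
    obtain ⟨e₃, h₃⟩ := exists_image_equiv hφ X₃
    have hp' : ∀ X : Set V, p ∉ φ '' X := fun X ⟨v, _, h⟩ => hp v h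
    have hq' : ∀ X : Set V, q ∉ φ '' X := fun X ⟨v, _, h⟩ => hq v h
    apply M.act_injective e₃
    rw [blockOp_blockOp_map a _ _ hφ h₀ h₁ h₃, blockOp_blockOp_map a _ _ hφ h₀ h₂ h₃]
    refine comm_all H hpq (hp' _) (hp' _) (hp' _) (hp' _) (hq' _) (hq' _) (hq' _) (hq' _) ?_ c c' _
    intro v'
    by_cases h : ∃ v, φ v = v'
    · obtain ⟨v, rfl⟩ := h
      simp only [hφ.mem_set_image]
      exact hX v
    · have h' : ∀ X : Set V, v' ∉ φ '' X := fun X ⟨v, _, hv⟩ => h ⟨v, hv⟩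
      exact Or.inl ⟨iff_of_false (h' _) (h' _), iff_of_false (h' _) (h' _)⟩
  merge c V X₀ X₁ X₂ hne hX x := by
    obtain ⟨h1, _, _, h2⟩ := merge_of_rel H hne hX x
    cases c
    exacts [h1, h2]
  zero {c c'} hc V X₀ X₁ X₂ hne hX x := by
    obtain ⟨_, h1, h2, _⟩ := merge_of_rel H hne hX x
    cases c <;> cases c'
    exacts [(hc rfl).elim, h2, h1, (hc rfl).elim]
  scalar c V X x := by
    cases c
    · change sgn k (X \ X).ncard • frOne a X X x = ε • x
      rw [Set.sdiff_self, Set.ncard_empty, frOne_self hε]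
      unfold sgn
      rw [pow_zero, one_smul]
    · change fr a (X ∪ X) X X x + frOne a X X x = δ • x
      rw [Set.union_self, fr_self hχ, frOne_self hε, ← add_smul, sub_add_cancel]
  unit {V X Y} e u v huX huY hvY hvX he heu x := by
    change fr a (X ∪ Y) X Y x + frOne a X Y x + sgn k (Y \ X).ncard • frOne a X Y x = _
    have hYX : Y \ X = {v} := by
      ext y
      constructor
      · rintro ⟨h1, h2⟩
        obtain ⟨z, hz⟩ := e.surjective ⟨y, h1⟩
        by_cases hzu : z.1 = u
        · exact (congrArg Subtype.val hz).symm.trans (heu z hzu)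
        · refine (h2 ?_).elim
          rw [← show z.1 = y from (he z hzu).symm.trans (congrArg Subtype.val hz)]
          exact z.2
      · rintro rfl
        exact ⟨hvY, hvX⟩
    rw [hYX, Set.ncard_singleton, fr_move hι e huX huY hvY hvX he heu]
    unfold sgn
    rw [pow_one, neg_smul, one_smul, add_neg_cancel_right]

end FBMod
end

noncomputable section

namespace FBMod

variable {k : Type u} [CommRing k]

/-! ### From block operators to representations -/

namespace BlockOps

variable {M : FBMod k} {d : Bool → k}

/-- The matrix coefficients determined by block operators. -/
def coeff (B : BlockOps M d) {V : FB} (R X Y : Set V) : M.val (V.sub X) →ₗ[k] M.val (V.sub Y) :=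
  coeffT k R X Y • B.D true X Y + coeffF k R X • B.D false X Y

theorem coeff_apply (B : BlockOps M d) {V : FB} (R X Y : Set V) (x : M.val (V.sub X)) :
    B.coeff R X Y x = coeffT k R X Y • B.D true X Y x + coeffF k R X • B.D false X Y x := rfl

theorem coeff_map (B : BlockOps M d) {V V' : FB} {φ : V → V'} (hφ : Function.Injective φ)
    {R X Y : Set V} {R' X' Y' : Set V'} (hR : ∀ v', v' ∈ R' ↔ ∃ v ∈ R, φ v = v')
    (b : V.sub X ≃ V'.sub X') (e : V.sub Y ≃ V'.sub Y') (hb : ∀ x, (b x).1 = φ x.1)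
    (he : ∀ y, (e y).1 = φ y.1) (x : M.val (V.sub X)) :
    B.coeff R' X' Y' (M.act b x) = M.act e (B.coeff R X Y x) := by
  obtain rfl : X' = φ '' X := Set.ext fun v' => ⟨fun h => ⟨(b.symm ⟨v', h⟩).1, (b.symm ⟨v', h⟩).2,
    by rw [← hb, Equiv.apply_symm_apply]⟩, by rintro ⟨v, h, rfl⟩; rw [← hb ⟨v, h⟩]; exact (b _).2⟩
  obtain rfl : Y' = φ '' Y := Set.ext fun v' => ⟨fun h => ⟨(e.symm ⟨v', h⟩).1, (e.symm ⟨v', h⟩).2,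
    by rw [← he, Equiv.apply_symm_apply]⟩, by rintro ⟨v, h, rfl⟩; rw [← he ⟨v, h⟩]; exact (e _).2⟩
  obtain rfl : R' = φ '' R := Set.ext hR
  rw [coeff_apply, coeff_apply, B.nat true hφ b e hb he, B.nat false hφ b e hb he, map_add,
    map_smul, map_smul]
  congr 2
  · refine coeffT_congr ?_
    rw [← Set.image_union]
    exact hφ.image_injective.eq_iff
  · unfold coeffF
    rw [← Set.image_sdiff hφ, Set.ncard_image_of_injective _ hφ]

theorem coeff_univ_map (B : BlockOps M d) {S T : FB} (e : S ≃ T) {X Y : Set S} {X' Y' : Set T}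
    (hX : ∀ s, s ∈ X ↔ e s ∈ X') (hY : ∀ s, s ∈ Y ↔ e s ∈ Y') (x : M.val (S.sub X)) :
    B.coeff Set.univ X' Y' (M.act (FB.restr e hX) x) =
      M.act (FB.restr e hY) (B.coeff Set.univ X Y x) :=
  B.coeff_map (R := Set.univ) (R' := Set.univ) e.injective (fun v' =>
    ⟨fun _ => ⟨e.symm v', Set.mem_univ _, e.apply_symm_apply v'⟩, fun _ => Set.mem_univ _⟩)
    (FB.restr e hX) (FB.restr e hY) (fun _ => rfl) (fun _ => rfl) x

/-- The map `Sym(V) ⊗ M ⟶ Div(V) ⊗ M` determined by block operators. -/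
def toMap (B : BlockOps M d) : tensor (const k) M ⟶ tensor (const k) M :=
  ofOpr (fun _ X Y => B.coeff Set.univ X Y) B.coeff_univ_map

theorem opr_toMap (B : BlockOps M d) (S : FB) (X Y : Set S) :
    opr B.toMap S X Y = B.coeff Set.univ X Y :=
  opr_ofOpr (fun _ X Y => B.coeff Set.univ X Y) B.coeff_univ_map S X Y

theorem fr_toMap (B : BlockOps M d) {V : FB} {R X Y : Set V} (hX : X ⊆ R) (hY : Y ⊆ R)
    (x : M.val (V.sub X)) : fr B.toMap R X Y x = B.coeff R X Y x := by
  have h := opr_nest B.toMap hX hY (X' := trace R X) (Y' := trace R Y) (mem_trace R X)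
    (mem_trace R Y) x
  rw [opr_toMap] at h
  have h' := B.coeff_map (V := V.sub R) (V' := V) (φ := Subtype.val) Subtype.val_injective
    (R := Set.univ) (R' := R) (fun v => ⟨fun hv => ⟨⟨v, hv⟩, trivial, rfl⟩, by
      rintro ⟨v, _, rfl⟩
      exact v.2⟩) (nestEquiv (U := trace R X) hX (mem_trace R X)).symm
      (nestEquiv (U := trace R Y) hY (mem_trace R Y)).symm
    (fun _ => rfl) (fun _ => rfl) (M.act (nestEquiv (U := trace R X) hX (mem_trace R X)) x)
  rw [act_symm_act] at h'
  rw [h', h, act_symm_act]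

theorem fr_isBlockForm (B : BlockOps M d) : IsBlockForm (fr B.toMap) B.D :=
  fun hX hY x => B.fr_toMap hX hY x

theorem coeff_coeff_eq (B : BlockOps M d) {V : FB} {R₁ R₂ X₀ X₁ X₃ : Set V}
    (x : M.val (V.sub X₀)) :
    B.coeff R₂ X₁ X₃ (B.coeff R₁ X₀ X₁ x) =
      coeffT k R₂ X₁ X₃ • coeffT k R₁ X₀ X₁ • B.D true X₁ X₃ (B.D true X₀ X₁ x) +
        coeffT k R₂ X₁ X₃ • coeffF k R₁ X₀ • B.D true X₁ X₃ (B.D false X₀ X₁ x) +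
        (coeffF k R₂ X₁ • coeffT k R₁ X₀ X₁ • B.D false X₁ X₃ (B.D true X₀ X₁ x) +
        coeffF k R₂ X₁ • coeffF k R₁ X₀ • B.D false X₁ X₃ (B.D false X₀ X₁ x)) := by
  simp only [coeff_apply, map_add, map_smul, smul_add]
  module

theorem comm_set {V : FB} {A₁ A₂ B₁ B₂ X Y : Set V} (hX : ∀ v, v ∈ X ↔ v ∉ A₁ ∧ v ∉ A₂)
    (hY : ∀ v, v ∈ Y ↔ v ∉ B₁ ∧ v ∉ B₂) (hA : ∀ v, v ∈ A₁ → v ∉ A₂) (hB : ∀ v, v ∈ B₁ → v ∉ B₂)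
    (hI : ∀ v, v ∈ A₂ → v ∉ B₁) (hJ : ∀ v, v ∈ A₁ → v ∉ B₂) (v : V) :
    (((v ∈ X ↔ v ∈ (A₁ ∪ B₂)ᶜ) ∧ (v ∈ (A₂ ∪ B₁)ᶜ ↔ v ∈ Y)) ∨
      ((v ∈ X ↔ v ∈ (A₂ ∪ B₁)ᶜ) ∧ (v ∈ (A₁ ∪ B₂)ᶜ ↔ v ∈ Y))) ∧
    ((v ∈ A₁ᶜ ↔ v ∈ X ∨ v ∈ (A₁ ∪ B₂)ᶜ) ↔ (v ∈ B₁ᶜ ↔ v ∈ (A₂ ∪ B₁)ᶜ ∨ v ∈ Y)) ∧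
    ((v ∈ B₂ᶜ ↔ v ∈ (A₁ ∪ B₂)ᶜ ∨ v ∈ Y) ↔ (v ∈ A₂ᶜ ↔ v ∈ X ∨ v ∈ (A₂ ∪ B₁)ᶜ)) ∧
    (v ∈ A₁ᶜ \ X ↔ v ∈ B₁ᶜ \ (A₂ ∪ B₁)ᶜ) ∧ (v ∈ B₂ᶜ \ (A₁ ∪ B₂)ᶜ ↔ v ∈ A₂ᶜ \ X) := by
  have hA := hA v
  have hB := hB v
  have hI := hI v
  have hJ := hJ v
  simp only [hX, hY, Set.mem_compl_iff, Set.mem_union, Set.mem_sdiff]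
  clear hX hY
  by_cases h1 : v ∈ A₁ <;> by_cases h2 : v ∈ A₂ <;> by_cases h3 : v ∈ B₁ <;> by_cases h4 : v ∈ B₂ <;>
    simp_all

theorem filter_subset_empty {V : FB} {I : Set V} [DecidablePred fun C : Set V => C ⊆ I]
    (h : ∀ v, v ∉ I) : Finset.univ.filter (fun C : Set V => C ⊆ I) = {∅} := by
  obtain rfl : I = ∅ := Set.eq_empty_iff_forall_notMem.2 h
  ext C
  rw [Finset.mem_filter, Finset.mem_singleton, Set.subset_empty_iff]
  exact and_iff_right (Finset.mem_univ _)

open Classical in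
theorem merge_case (B : BlockOps M d) {V : FB} {A A' E E' X Y : Set V}
    (hX : ∀ v, v ∈ X ↔ v ∉ A ∧ v ∉ A') (hY : ∀ v, v ∈ Y ↔ v ∉ E' ∧ v ∉ E)
    (hA : ∀ v, v ∈ A → v ∉ A') (hE : ∀ v, v ∈ E' → v ∉ E)
    (hJ : ∀ v, v ∈ A → v ∉ E) (hI : ¬ ∀ v, v ∈ A' → v ∉ E') (x : M.val (V.sub X)) :
    fr B.toMap Eᶜ (A ∪ E)ᶜ Y (fr B.toMap Aᶜ X (A ∪ E)ᶜ x) =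
      ∑ C ∈ Finset.univ.filter (fun C : Set V => C ⊆ A' ∩ E'), fr B.toMap Cᶜ X Y x -
        ∑ C ∈ Finset.univ.filter (fun C : Set V => C ⊆ A ∩ E), fr B.toMap Cᶜ X Y x := by
  push Not at hI
  obtain ⟨u, huA, huE⟩ := hI
  have hXA : X ⊆ Aᶜ := fun v hv => ((hX v).1 hv).1
  have hYE : Y ⊆ Eᶜ := fun v hv => ((hY v).1 hv).2
  have hne : ∃ v, v ∉ X ∧ v ∈ (A ∪ E)ᶜ ∧ v ∉ Y := ⟨u, fun h => ((hX u).1 h).2 huA,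
    fun h => h.elim (fun h => hA u h huA) (hE u huE), fun h => ((hY u).1 h).1 huE⟩
  have hXY : ∀ v, v ∈ X → v ∈ Y → v ∈ (A ∪ E)ᶜ := fun v h1 h2 h =>
    h.elim ((hX v).1 h1).1 ((hY v).1 h2).2
  rw [filter_subset_empty (I := A ∩ E) fun v h => hJ v h.1 h.2, Finset.sum_singleton,
    merge_rhs B.fr_isBlockForm (S := ∅ᶜ) (R₁ := Aᶜ) (R₂ := Eᶜ) (X₁ := (A ∪ E)ᶜ)
      (I := A' ∩ E') (fun C => Cᶜ)
      (fun C v => ⟨fun h => ⟨fun h' => h', h⟩, fun h => h.2⟩)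
      (fun v => ⟨fun _ => by
        by_cases h : v ∈ A
        exacts [Or.inr (hJ v h), Or.inl h], fun _ h => h⟩)
      (mem_union_compl A E) hXA hYE (fun v => ?_)
      ⟨u, huA, huE⟩ x, B.fr_toMap (Set.compl_subset_compl.2 Set.subset_union_right) hYE,
    B.fr_toMap hXA (Set.compl_subset_compl.2 Set.subset_union_left), B.coeff_coeff_eq, B.merge true hne hXY,
    B.merge false hne hXY, B.zero (c := true) (c' := false) (by decide) hne hXY, B.zero (c := false) (c' := true) (by decide) hne hXY]
  · module
  · have := hX v
    have := hY v
    have := hA v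
    have := hE v
    simp only [Set.mem_inter_iff, Set.mem_compl_iff, Set.mem_union]
    tauto

open Classical in
theorem weylRel_toMap (B : BlockOps M d) : WeylRel (fr B.toMap) := by
  intro V A₁ A₂ B₁ B₂ X Y hX hY hA hB x
  beta_reduce
  have hX' : ∀ v, v ∈ X ↔ v ∉ A₂ ∧ v ∉ A₁ := fun v => (hX v).trans and_comm
  have hY' : ∀ v, v ∈ Y ↔ v ∉ B₂ ∧ v ∉ B₁ := fun v => (hY v).trans and_comm
  have hA' : ∀ v, v ∈ A₂ → v ∉ A₁ := fun v h h' => hA v h' h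
  have hB' : ∀ v, v ∈ B₂ → v ∉ B₁ := fun v h h' => hB v h' h
  by_cases hJ : ∀ v, v ∈ A₁ → v ∉ B₂
  · by_cases hI : ∀ v, v ∈ A₂ → v ∉ B₁
    · have hc := comm_set hX hY hA hB hI hJ
      rw [if_pos hJ, if_pos hI, filter_subset_empty fun v h => hI v h.1 h.2,
        filter_subset_empty fun v h => hJ v h.1 h.2, sub_self, sub_eq_zero,
        B.fr_toMap (R := B₂ᶜ) (X := (A₁ ∪ B₂)ᶜ) (Y := Y)
          (Set.compl_subset_compl.2 Set.subset_union_right) (fun v hv => ((hY v).1 hv).2),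
        B.fr_toMap (R := A₁ᶜ) (fun v hv => ((hX v).1 hv).1) (Set.compl_subset_compl.2 Set.subset_union_left),
        B.fr_toMap (R := B₁ᶜ) (X := (A₂ ∪ B₁)ᶜ) (Y := Y)
          (Set.compl_subset_compl.2 Set.subset_union_right) (fun v hv => ((hY v).1 hv).1),
        B.fr_toMap (R := A₂ᶜ) (fun v hv => ((hX v).1 hv).2) (Set.compl_subset_compl.2 Set.subset_union_left),
        B.coeff_coeff_eq, B.coeff_coeff_eq]
      have t1 : coeffT k A₁ᶜ X (A₁ ∪ B₂)ᶜ = coeffT k B₁ᶜ (A₂ ∪ B₁)ᶜ Y := coeffT_congr (by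
        rw [Set.ext_iff, Set.ext_iff]
        exact forall_congr' fun v => (hc v).2.1)
      have t2 : coeffT k B₂ᶜ (A₁ ∪ B₂)ᶜ Y = coeffT k A₂ᶜ X (A₂ ∪ B₁)ᶜ := coeffT_congr (by
        rw [Set.ext_iff, Set.ext_iff]
        exact forall_congr' fun v => (hc v).2.2.1)
      have f1 : coeffF k A₁ᶜ X = coeffF k B₁ᶜ (A₂ ∪ B₁)ᶜ := by
        unfold coeffF
        rw [Set.ext fun v => (hc v).2.2.2.1]
      have f2 : coeffF k B₂ᶜ (A₁ ∪ B₂)ᶜ = coeffF k A₂ᶜ X := by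
        unfold coeffF
        rw [Set.ext fun v => (hc v).2.2.2.2]
      have hcomm := fun c c' => B.comm c c' (fun v => (hc v).1) x
      rw [hcomm, hcomm, hcomm, hcomm, t1, t2, f1, f2]
      module
    · rw [if_pos hJ, if_neg hI, sub_zero]
      exact B.merge_case hX hY hA hB hJ hI x
  · by_cases hI : ∀ v, v ∈ A₂ → v ∉ B₁
    · rw [if_neg hJ, if_pos hI, zero_sub, B.merge_case hX' hY' hA' hB' hI hJ x, neg_sub]
    · rw [if_neg hJ, if_neg hI]
      push Not at hI hJ
      obtain ⟨u, huA, huB⟩ := hI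
      obtain ⟨w, hwA, hwB⟩ := hJ
      have key : ∀ I : Set V, (∀ v ∈ I, v ∉ X) → (∀ v ∈ I, v ∉ Y) → I.Nonempty →
          (∃ w, w ∉ I ∧ w ∉ X ∧ w ∉ Y) →
          ∑ C ∈ Finset.univ.filter (fun C : Set V => C ⊆ I), fr B.toMap Cᶜ X Y x = 0 := by
        rintro I hIX hIY hI ⟨w, h1, h2, h3⟩
        rw [sum_blockForm B.fr_isBlockForm (S := Set.univ) (fun C => Cᶜ)
          (fun C v => ⟨fun h => ⟨trivial, h⟩, fun h => h.2⟩) (Set.subset_univ _)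
          (Set.subset_univ _) (Set.subset_univ _) hIX hIY hI]
        unfold coeffT
        rw [if_neg, zero_smul]
        intro h
        have : w ∈ X ∪ Y := h ▸ h1
        exact this.elim h2 h3
      rw [key (A₂ ∩ B₁) (fun v hv h => ((hX v).1 h).2 hv.1) (fun v hv h => ((hY v).1 h).1 hv.2)
        ⟨u, huA, huB⟩ ⟨w, fun h => hA w hwA h.1, fun h => ((hX w).1 h).1 hwA,
          fun h => ((hY w).1 h).2 hwB⟩,
        key (A₁ ∩ B₂) (fun v hv h => ((hX v).1 h).1 hv.1) (fun v hv h => ((hY v).1 h).2 hv.2)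
        ⟨w, hwA, hwB⟩ ⟨u, fun h => hA u h.1 huA, fun h => ((hX u).1 h).2 huA,
          fun h => ((hY u).1 h).1 huB⟩]

theorem opr_toMap_univ (B : BlockOps M d) (S : FB) (x : M.val (S.sub ∅ᶜ)) :
    opr B.toMap S ∅ᶜ ∅ᶜ x = (d true - d false) • x := by
  rw [opr_toMap, coeff_apply, B.scalar, B.scalar]
  have ht : coeffT k Set.univ (∅ᶜ : Set S) ∅ᶜ = 1 :=
    if_pos (by rw [Set.compl_empty, Set.union_self])
  have hf : coeffF k Set.univ (∅ᶜ : Set S) = -1 := by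
    unfold coeffF sgn
    rw [Set.compl_empty, Set.sdiff_self, Set.ncard_empty, pow_zero]
  rw [ht, hf]
  module

theorem univ_sdiff_compl {S : FB} (j : S) : (Set.univ \ ({j}ᶜ : Set S)) = {j} := by
  rw [← Set.compl_eq_univ_sdiff, compl_compl]

theorem opr_toMap_self (B : BlockOps M d) (S : FB) (j : S) (x : M.val (S.sub {j}ᶜ)) :
    opr B.toMap S {j}ᶜ {j}ᶜ x = d false • x := by
  rw [opr_toMap, coeff_apply, B.scalar, B.scalar]
  unfold coeffT coeffF
  rw [if_neg, univ_sdiff_compl, Set.ncard_singleton]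
  · unfold sgn
    rw [pow_one]
    module
  · intro h
    have : j ∈ ({j}ᶜ ∪ {j}ᶜ : Set S) := h ▸ Set.mem_univ j
    exact this.elim (fun h => h rfl) fun h => h rfl

theorem opr_toMap_move (B : BlockOps M d) (S : FB) (i j : S) (x : M.val (S.sub {j}ᶜ))
    (hij : i ≠ j) : opr B.toMap S {j}ᶜ {i}ᶜ x = M.act (iota i j) x := by
  rw [opr_toMap, coeff_apply, ← B.unit (iota i j) (u := i) (v := j) hij (fun h => h rfl)
    (Ne.symm hij) (fun h => h rfl) (fun _ h => iota_apply_ne h) (fun _ h => iota_apply_self h) x]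
  unfold coeffT coeffF
  rw [if_pos, univ_sdiff_compl, Set.ncard_singleton]
  · unfold sgn
    rw [pow_one]
    module
  · ext v
    refine ⟨fun _ => ?_, fun _ => trivial⟩
    by_cases h : v = i
    · exact Or.inl fun h' => hij (h.symm.trans h')
    · exact Or.inr h

end BlockOps

/-- A representation is determined by its block operators. -/
theorem opr_eq_blockOp {M : FBMod k} {a : tensor (const k) M ⟶ tensor (const k) M}
    (H : WeylRel (fr a)) (S : FB) (X Y : Set S) (x : M.val (S.sub X)) :
    opr a S X Y x = coeffT k Set.univ X Y • blockOp a true X Y x +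
      coeffF k Set.univ X • blockOp a false X Y x := by
  rw [opr_eq_fr]
  exact FBMod.fr_isBlockForm H (Set.subset_univ X) (Set.subset_univ Y) x

end FBMod
end

noncomputable section

namespace PartDiag

/-! ### Joining the blocks that meet a given set -/

/-- The partition obtained from `r` by joining all blocks that meet `b`. -/
def joinBlock {V : Type} (r : Setoid V) (b : Set V) : Setoid V where
  r v w := r v w ∨ (∃ u ∈ b, r v u) ∧ ∃ u ∈ b, r w u
  iseqv := by
    refine ⟨fun v => Or.inl (Setoid.refl' r v), ?_, ?_⟩
    · rintro v w (h | ⟨h, h'⟩)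
      exacts [Or.inl (Setoid.symm' r h), Or.inr ⟨h', h⟩]
    · rintro v w x (h | ⟨h, ⟨u, hu, hwu⟩⟩) (g | ⟨⟨u', hu', hwu'⟩, g'⟩)
      · exact Or.inl (Setoid.trans' r h g)
      · exact Or.inr ⟨⟨u', hu', Setoid.trans' r h hwu'⟩, g'⟩
      · exact Or.inr ⟨h, ⟨u, hu, Setoid.trans' r (Setoid.symm' r g) hwu⟩⟩
      · exact Or.inr ⟨h, g'⟩

theorem joinBlock_rel {V : Type} (r : Setoid V) (b : Set V) (v w : V) :
    joinBlock r b v w ↔ r v w ∨ (∃ u ∈ b, r v u) ∧ ∃ u ∈ b, r w u := Iff.rfl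

theorem joinBlock_bot_rel {V : Type} (b : Set V) (v w : V) :
    joinBlock ⊥ b v w ↔ v = w ∨ v ∈ b ∧ w ∈ b := by
  have h : ∀ v, (∃ u ∈ b, (⊥ : Setoid V) v u) ↔ v ∈ b := fun v =>
    ⟨fun ⟨u, hu, hvu⟩ => (show v = u from hvu) ▸ hu, fun hv => ⟨v, hv, rfl⟩⟩
  rw [joinBlock_rel, h, h]
  exact Iff.rfl

theorem hidden_eq_one {X Y : Type} (r : Setoid X) (f : Y → X) (x₀ : X) (h₀ : ∀ y, ¬ r (f y) x₀)
    (h : ∀ x, r x₀ x ∨ ∃ y, r (f y) x) : hidden r f = 1 := by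
  refine Nat.card_eq_one_iff_unique.2 ⟨⟨fun ⟨q, hq⟩ ⟨q', hq'⟩ => ?_⟩, ⟨⟨Quotient.mk r x₀, fun y hy =>
    h₀ y (Quotient.exact (s := r) hy)⟩⟩⟩
  induction q using Quotient.inductionOn with | h x =>
  induction q' using Quotient.inductionOn with | h x' =>
  have key : ∀ x, (∀ y, Quotient.mk r (f y) ≠ Quotient.mk r x) → r x₀ x := fun x hx =>
    (h x).resolve_right fun ⟨y, hy⟩ => hx y (Quotient.sound (s := r) hy)
  exact Subtype.ext (Quotient.sound (s := r) (Setoid.trans' r (Setoid.symm' r (key x hq))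
    (key x' hq')))

section

variable {S T U V : Type} {i : S → V} {j : T → V} {l : U → V} {r : Setoid V} {b : Set V}

theorem glue_joinBlock (hov : ∀ s u, i s = l u → ∃ t, j t = i s)
    (hr : ∀ x y : S ⊕ (T ⊕ U), r (Sum.elim i (Sum.elim j l) x) (Sum.elim i (Sum.elim j l) y) →
      Sum.elim i (Sum.elim j l) x = Sum.elim i (Sum.elim j l) y ∨
        (∃ x', Sum.elim i j x' = Sum.elim i (Sum.elim j l) x) ∧
        ∃ y', Sum.elim i j y' = Sum.elim i (Sum.elim j l) y)
    (hb : ∀ (x : S ⊕ (T ⊕ U)) (u : V), r (Sum.elim i (Sum.elim j l) x) u → u ∈ b →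
      ∃ z, Sum.elim j l z = u) :
    glue (r.comap (Sum.elim i j)) ((joinBlock ⊥ b).comap (Sum.elim j l)) =
      (joinBlock r b).comap (Sum.elim i (Sum.elim j l)) := by
  have hmap : ∀ x : S ⊕ T, Sum.elim i (Sum.elim j l) (Sum.map id Sum.inl x) = Sum.elim i j x := by
    rintro (x | x) <;> rfl
  apply le_antisymm
  · refine sup_le ((map_le _ _ _).2 fun x y h => ?_) ((map_le _ _ _).2 fun x y h => ?_)
    · refine Or.inl ?_
      rw [hmap, hmap]
      exact h
    · obtain h | ⟨h, h'⟩ := (joinBlock_bot_rel b _ _).1 h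
      · exact Or.inl (by
          change r (Sum.elim j l x) (Sum.elim j l y)
          rw [h])
      · exact Or.inr ⟨⟨_, h, Setoid.refl' r _⟩, ⟨_, h', Setoid.refl' r _⟩⟩
  · set G := glue (r.comap (Sum.elim i j)) ((joinBlock ⊥ b).comap (Sum.elim j l)) with hG
    have g₁ : ∀ x y : S ⊕ T, r (Sum.elim i j x) (Sum.elim i j y) →
        G (Sum.map id Sum.inl x) (Sum.map id Sum.inl y) := fun x y h =>
      le_sup_left (a := (r.comap (Sum.elim i j)).map _)
        (Relation.EqvGen.rel _ _ ⟨x, y, h, rfl, rfl⟩)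
    have g₂ : ∀ x y : T ⊕ U, joinBlock ⊥ b (Sum.elim j l x) (Sum.elim j l y) →
        G (Sum.inr x) (Sum.inr y) := fun x y h =>
      le_sup_right (a := (r.comap (Sum.elim i j)).map _)
        (Relation.EqvGen.rel _ _ ⟨x, y, h, rfl, rfl⟩)
    have g₁' : ∀ x y : S ⊕ T, Sum.elim i j x = Sum.elim i j y →
        G (Sum.map id Sum.inl x) (Sum.map id Sum.inl y) := fun x y h =>
      g₁ x y (by rw [h])
    have g₂' : ∀ x y : T ⊕ U, Sum.elim j l x = Sum.elim j l y → G (Sum.inr x) (Sum.inr y) :=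
      fun x y h => g₂ x y (by rw [h])
    have hSU : ∀ s u, i s = l u → G (Sum.inl s) (Sum.inr (Sum.inr u)) := fun s u h => by
      obtain ⟨t, ht⟩ := hov s u h
      exact Setoid.trans' _ (g₁' (Sum.inl s) (Sum.inr t) ht.symm)
        (g₂' (Sum.inl t) (Sum.inr u) (ht.trans h))
    have h0 : ∀ x y : S ⊕ (T ⊕ U),
        Sum.elim i (Sum.elim j l) x = Sum.elim i (Sum.elim j l) y → G x y := by
      rintro (s | t | u) (s' | t' | u') h
      · exact g₁' (Sum.inl s) (Sum.inl s') h
      · exact g₁' (Sum.inl s) (Sum.inr t') h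
      · exact hSU s u' h
      · exact g₁' (Sum.inr t) (Sum.inl s') h
      · exact g₁' (Sum.inr t) (Sum.inr t') h
      · exact g₂' (Sum.inl t) (Sum.inr u') h
      · exact Setoid.symm' _ (hSU s' u h.symm)
      · exact g₂' (Sum.inr u) (Sum.inl t') h
      · exact g₂' (Sum.inr u) (Sum.inr u') h
    have h1 : ∀ x y : S ⊕ (T ⊕ U),
        r (Sum.elim i (Sum.elim j l) x) (Sum.elim i (Sum.elim j l) y) → G x y := by
      intro x y h
      obtain h' | ⟨⟨x', hx⟩, ⟨y', hy⟩⟩ := hr x y h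
      · exact h0 x y h'
      · refine Setoid.trans' _ (h0 x (Sum.map id Sum.inl x') ((hmap x').trans hx).symm)
          (Setoid.trans' _ (g₁ x' y' ?_) (h0 (Sum.map id Sum.inl y') y ((hmap y').trans hy)))
        rw [hx, hy]
        exact h
    have h2 : ∀ x : S ⊕ (T ⊕ U), (∃ u ∈ b, r (Sum.elim i (Sum.elim j l) x) u) →
        ∃ z : T ⊕ U, Sum.elim j l z ∈ b ∧ G x (Sum.inr z) := by
      rintro x ⟨u, hu, hxu⟩
      obtain ⟨z, rfl⟩ := hb x u hxu hu
      exact ⟨z, hu, h1 x (Sum.inr z) hxu⟩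
    intro x y h
    obtain h | ⟨hx, hy⟩ := (joinBlock_rel r b _ _).1 h
    · exact h1 x y h
    · obtain ⟨z, hz, hxz⟩ := h2 x hx
      obtain ⟨z', hz', hyz⟩ := h2 y hy
      exact Setoid.trans' _ hxz (Setoid.trans' _ (g₂ z z'
        ((joinBlock_bot_rel b _ _).2 (Or.inr ⟨hz, hz'⟩))) (Setoid.symm' _ hyz))

theorem comp_joinBlock (h : glue (r.comap (Sum.elim i j)) ((joinBlock ⊥ b).comap (Sum.elim j l)) =
      (joinBlock r b).comap (Sum.elim i (Sum.elim j l))) :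
    comp (r.comap (Sum.elim i j)) ((joinBlock ⊥ b).comap (Sum.elim j l)) =
      (joinBlock r b).comap (Sum.elim i l) := by
  unfold comp
  rw [h, ← Setoid.comap_comp]
  congr 1
  funext x
  obtain x | x := x <;> rfl

theorem loops_joinBlock_eq_zero
    (h : glue (r.comap (Sum.elim i j)) ((joinBlock ⊥ b).comap (Sum.elim j l)) =
      (joinBlock r b).comap (Sum.elim i (Sum.elim j l)))
    (h' : ∀ t, ∃ y, joinBlock r b (Sum.elim i l y) (j t)) :
    loops (r.comap (Sum.elim i j)) ((joinBlock ⊥ b).comap (Sum.elim j l)) = 0 := by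
  unfold loops
  rw [h]
  apply hidden_eq_zero
  rintro (s | t | u)
  · exact ⟨Sum.inl s, Setoid.refl' _ _⟩
  · obtain ⟨s | u, hy⟩ := h' t
    exacts [⟨Sum.inl s, hy⟩, ⟨Sum.inr u, hy⟩]
  · exact ⟨Sum.inr u, Setoid.refl' _ _⟩

theorem loops_joinBlock_eq_one
    (h : glue (r.comap (Sum.elim i j)) ((joinBlock ⊥ b).comap (Sum.elim j l)) =
      (joinBlock r b).comap (Sum.elim i (Sum.elim j l))) (t₀ : T)
    (h₀ : ∀ y, ¬ joinBlock r b (Sum.elim i l y) (j t₀))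
    (h' : ∀ t, joinBlock r b (j t₀) (j t) ∨ ∃ y, joinBlock r b (Sum.elim i l y) (j t)) :
    loops (r.comap (Sum.elim i j)) ((joinBlock ⊥ b).comap (Sum.elim j l)) = 1 := by
  unfold loops
  rw [h]
  refine hidden_eq_one _ _ (Sum.inr (Sum.inl t₀)) ?_ ?_
  · rintro (s | u) hy
    exacts [h₀ (Sum.inl s) hy, h₀ (Sum.inr u) hy]
  · rintro (s | t | u)
    · exact Or.inr ⟨Sum.inl s, Setoid.refl' _ _⟩
    · obtain ht | ⟨s | u, hy⟩ := h' t
      exacts [Or.inl ht, Or.inr ⟨Sum.inl s, hy⟩, Or.inr ⟨Sum.inr u, hy⟩]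
    · exact Or.inr ⟨Sum.inr u, Setoid.refl' _ _⟩

end

end PartDiag
end

noncomputable section

namespace PartCat

open PartDiag

variable {k : Type u} [CommRing k]

/-- A partition diagram as a morphism between images of finite sets. -/
def dg (δ : k) {P Q : FB} (σ : Setoid (P ⊕ Q)) : (ofFB δ).obj P ⟶ (ofFB δ).obj Q :=
  diag (S := ⟨P⟩) (T := ⟨Q⟩) σ

/-- The partition diagram that is induced by a partition `r` along maps `i` and `j`. -/
def strand (δ : k) {V : Type} (r : Setoid V) {P Q : FB} (i : P → V) (j : Q → V) :
    (ofFB δ).obj P ⟶ (ofFB δ).obj Q :=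
  dg δ (r.comap (Sum.elim i j))

theorem strand_comp_strand (δ : k) {V : Type} (r r' : Setoid V) {P Q R : FB} (i : P → V)
    (j : Q → V) (l : R → V) : strand δ r i j ≫ strand δ r' j l =
      δ ^ loops (r.comap (Sum.elim i j)) (r'.comap (Sum.elim j l)) •
        dg δ (comp (r.comap (Sum.elim i j)) (r'.comap (Sum.elim j l))) :=
  compL_diag _ _

theorem strand_congr (δ : k) {V V' : Type} {r : Setoid V} {r' : Setoid V'} {P Q : FB} {i : P → V}
    {j : Q → V} {i' : P → V'} {j' : Q → V'} (h : ∀ x y : P ⊕ Q,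
      r (Sum.elim i j x) (Sum.elim i j y) ↔ r' (Sum.elim i' j' x) (Sum.elim i' j' y)) :
    strand δ r i j = strand δ r' i' j' :=
  congrArg (dg δ) (Setoid.ext h)

section

variable (δ : k) {V : Type} {r : Setoid V} {b : Set V} {S T U : FB} {i : S → V} {j : T → V}
  {l : U → V} {κ : V → Bool} {c : Bool} {P : Set S} {Q : Set T} {R : Set U}

theorem glue_part (hov : ∀ s u, i s = l u → ∃ t, j t = i s)
    (hr : ∀ v w, r v w → v = w ∨ (v ∈ Set.range i ∨ v ∈ Set.range j) ∧
      (w ∈ Set.range i ∨ w ∈ Set.range j)) (hκ : ∀ v w, r v w → κ v = κ w)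
    (hb : ∀ v ∈ b, v ∈ Set.range j ∨ v ∈ Set.range l) (hP : ∀ s, s ∈ P ↔ κ (i s) = c)
    (hQ : ∀ t, t ∈ Q ↔ κ (j t) = c) (hR : ∀ u, u ∈ R ↔ κ (l u) = c) :
    glue (r.comap (Sum.elim (fun s : S.sub P => i s.1) fun t : T.sub Q => j t.1))
      ((joinBlock ⊥ b).comap (Sum.elim (fun t : T.sub Q => j t.1) fun u : U.sub R => l u.1)) =
      (joinBlock r b).comap (Sum.elim (fun s : S.sub P => i s.1)
        (Sum.elim (fun t : T.sub Q => j t.1) fun u : U.sub R => l u.1)) := by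
  have hc : ∀ x : S.sub P ⊕ (T.sub Q ⊕ U.sub R), κ (Sum.elim (fun s : S.sub P => i s.1)
        (Sum.elim (fun t : T.sub Q => j t.1) fun u : U.sub R => l u.1) x) = c := by
    rintro (s | t | u)
    exacts [(hP _).1 s.2, (hQ _).1 t.2, (hR _).1 u.2]
  have hlift : ∀ v, κ v = c → v ∈ Set.range i ∨ v ∈ Set.range j →
      ∃ x', Sum.elim (fun s : S.sub P => i s.1) (fun t : T.sub Q => j t.1) x' = v := by
    rintro v hv (⟨s, rfl⟩ | ⟨t, rfl⟩)
    exacts [⟨Sum.inl ⟨s, (hP s).2 hv⟩, rfl⟩, ⟨Sum.inr ⟨t, (hQ t).2 hv⟩, rfl⟩]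
  refine glue_joinBlock (fun s u h => ?_) (fun x y h => ?_) fun x u h hu => ?_
  · obtain ⟨t, ht⟩ := hov s.1 u.1 h
    exact ⟨⟨t, (hQ t).2 (by rw [ht]; exact (hP _).1 s.2)⟩, ht⟩
  · obtain h' | ⟨h1, h2⟩ := hr _ _ h
    exacts [Or.inl h', Or.inr ⟨hlift _ (hc x) h1, hlift _ (hc y) h2⟩]
  · have hu' : κ u = c := (hκ _ _ h).symm.trans (hc x)
    obtain ⟨t, rfl⟩ | ⟨w, rfl⟩ := hb u hu
    exacts [⟨Sum.inl ⟨t, (hQ t).2 hu'⟩, rfl⟩, ⟨Sum.inr ⟨w, (hR w).2 hu'⟩, rfl⟩]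

theorem strand_comp_of_ne (hov : ∀ s u, i s = l u → ∃ t, j t = i s)
    (hr : ∀ v w, r v w → v = w ∨ (v ∈ Set.range i ∨ v ∈ Set.range j) ∧
      (w ∈ Set.range i ∨ w ∈ Set.range j)) (hκ : ∀ v w, r v w → κ v = κ w)
    (hb : ∀ v, v ∈ b ↔ ¬ (v ∈ Set.range j ↔ v ∈ Set.range l))
    (hP : ∀ s, s ∈ P ↔ κ (i s) = c) (hQ : ∀ t, t ∈ Q ↔ κ (j t) = c)
    (hR : ∀ u, u ∈ R ↔ κ (l u) = c) (hbc : ∀ v ∈ b, κ v ≠ c) :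
    strand δ r (fun s : S.sub P => i s.1) (fun t : T.sub Q => j t.1) ≫
      strand δ (joinBlock ⊥ b) (fun t : T.sub Q => j t.1) (fun u : U.sub R => l u.1) =
    strand δ (joinBlock r b) (fun s : S.sub P => i s.1) (fun u : U.sub R => l u.1) := by
  have hg := glue_part hov hr hκ (fun v hv => by have := (hb v).1 hv; tauto) hP hQ hR
  rw [strand_comp_strand, comp_joinBlock hg, loops_joinBlock_eq_zero hg, pow_zero, one_smul]
  · rfl
  · rintro ⟨t, ht⟩
    have ht' := (hQ t).1 ht
    have h1 : j t ∈ Set.range l := by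
      have h2 : j t ∉ b := fun h => hbc _ h ht'
      rw [hb, not_not] at h2
      exact h2.1 ⟨t, rfl⟩
    obtain ⟨u, hu⟩ := h1
    refine ⟨Sum.inr ⟨u, (hR u).2 (by rw [hu]; exact ht')⟩, ?_⟩
    change joinBlock r b (l u) (j t)
    rw [hu]

open Classical in
theorem strand_comp_of_eq (hov : ∀ s u, i s = l u → ∃ t, j t = i s)
    (hr : ∀ v w, r v w → v = w ∨ (v ∈ Set.range i ∨ v ∈ Set.range j) ∧
      (w ∈ Set.range i ∨ w ∈ Set.range j)) (hκ : ∀ v w, r v w → κ v = κ w)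
    (hb : ∀ v, v ∈ b ↔ ¬ (v ∈ Set.range j ↔ v ∈ Set.range l))
    (hP : ∀ s, s ∈ P ↔ κ (i s) = c) (hQ : ∀ t, t ∈ Q ↔ κ (j t) = c)
    (hR : ∀ u, u ∈ R ↔ κ (l u) = c) (hbc : ∀ v ∈ b, κ v = c) :
    (if b = ∅ then δ else 1) • (strand δ r (fun s : S.sub P => i s.1) (fun t : T.sub Q => j t.1) ≫
      strand δ (joinBlock ⊥ b) (fun t : T.sub Q => j t.1) (fun u : U.sub R => l u.1)) =
    (if ∀ v, (∃ u ∈ b, r v u) → v ∉ Set.range i ∧ v ∉ Set.range l then δ else 1) •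
      strand δ (joinBlock r b) (fun s : S.sub P => i s.1) (fun u : U.sub R => l u.1) := by
  have hg := glue_part hov hr hκ (fun v hv => by have := (hb v).1 hv; tauto) hP hQ hR
  have hl : ∀ t : T.sub Q, j t.1 ∈ Set.range l → ∃ y, joinBlock r b
      (Sum.elim (fun s : S.sub P => i s.1) (fun u : U.sub R => l u.1) y) (j t.1) := by
    rintro ⟨t, ht⟩ ⟨u, hu⟩
    refine ⟨Sum.inr ⟨u, (hR u).2 (by rw [hu]; exact (hQ t).1 ht)⟩, ?_⟩
    change joinBlock r b (l u) (j t)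
    rw [hu]
  have hjb : ∀ t, j t ∉ Set.range l → j t ∈ b := fun t ht => by
    rw [hb]
    exact fun h => ht (h.1 ⟨t, rfl⟩)
  rw [strand_comp_strand, comp_joinBlock hg, smul_smul]
  refine congrArg₂ _ ?_ rfl
  by_cases hcl : ∀ v, (∃ u ∈ b, r v u) → v ∉ Set.range i ∧ v ∉ Set.range l
  · rw [if_pos hcl]
    by_cases hbe : b = ∅
    · rw [if_pos hbe, loops_joinBlock_eq_zero hg fun t => hl t ?_, pow_zero, mul_one]
      by_contra h
      have := hjb t.1 h
      rw [hbe] at this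
      exact this
    · rw [if_neg hbe, one_mul]
      obtain ⟨v, hv⟩ := Set.nonempty_iff_ne_empty.2 hbe
      have hvl := (hcl v ⟨v, hv, Setoid.refl' r v⟩).2
      obtain ⟨t, rfl⟩ : v ∈ Set.range j := by
        have := (hb v).1 hv
        tauto
      rw [loops_joinBlock_eq_one hg ⟨t, (hQ t).2 (hbc _ hv)⟩, pow_one]
      · intro y hy
        have hh : ∃ u ∈ b, r (Sum.elim (fun s : S.sub P => i s.1) (fun u : U.sub R => l u.1) y) u :=
          hy.elim (fun h => ⟨_, hv, h⟩) fun h => h.1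
        obtain s | u := y
        · exact (hcl _ hh).1 ⟨s.1, rfl⟩
        · exact (hcl _ hh).2 ⟨u.1, rfl⟩
      · intro t'
        by_cases h : j t'.1 ∈ Set.range l
        · exact Or.inr (hl t' h)
        · exact Or.inl (Or.inr ⟨⟨_, hv, Setoid.refl' r _⟩, ⟨_, hjb _ h, Setoid.refl' r _⟩⟩)
  · have hbe : b ≠ ∅ := by
      rintro rfl
      exact hcl fun v ⟨u, hu, _⟩ => hu.elim
    rw [if_neg hcl, if_neg hbe, one_mul, loops_joinBlock_eq_zero hg fun t => ?_, pow_zero]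
    by_cases h : j t.1 ∈ Set.range l
    · exact hl t h
    · push Not at hcl
      obtain ⟨v, ⟨u, hu, hvu⟩, hv⟩ := hcl
      have hvc : κ v = c := (hκ _ _ hvu).trans (hbc _ hu)
      have hjoin : joinBlock r b v (j t.1) :=
        Or.inr ⟨⟨u, hu, hvu⟩, ⟨_, hjb _ h, Setoid.refl' r _⟩⟩
      by_cases hvi : v ∈ Set.range i
      · obtain ⟨s, rfl⟩ := hvi
        exact ⟨Sum.inl ⟨s, (hP s).2 hvc⟩, hjoin⟩
      · obtain ⟨w, rfl⟩ := hv hvi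
        exact ⟨Sum.inr ⟨w, (hR w).2 hvc⟩, hjoin⟩

end

end PartCat
end

noncomputable section

namespace PartStar

open PartDiag PartCat

variable {k : Type u} [CommRing k] {δ ε : k}

/-- A finite set as an object of the star product of two partition categories. -/
abbrev ob (δ ε : k) (S : FB) : StarProd k (ofFB δ) (ofFB ε) := ⟨S⟩

/-- The component of a morphism at a pair of subsets. -/
def entry {S T : FB} (f : ob δ ε S ⟶ ob δ ε T) (A : Set S) (B : Set T) :
    StarProd.Block (ob δ ε S) (ob δ ε T) A B := (show StarProd.Hom (ob δ ε S) (ob δ ε T) from f) A B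

/-- The morphism with given components. -/
def ofEntry {S T : FB} (f : ∀ A B, StarProd.Block (ob δ ε S) (ob δ ε T) A B) :
    ob δ ε S ⟶ ob δ ε T := show StarProd.Hom (ob δ ε S) (ob δ ε T) from f

theorem entry_ofEntry {S T : FB} (f : ∀ A B, StarProd.Block (ob δ ε S) (ob δ ε T) A B) (A : Set S)
    (B : Set T) : entry (ofEntry f) A B = f A B := rfl

theorem ext_entry {S T : FB} {f g : ob δ ε S ⟶ ob δ ε T} (h : ∀ A B, entry f A B = entry g A B) :
    f = g := funext fun A => funext fun B => h A B

theorem entry_add {S T : FB} (f g : ob δ ε S ⟶ ob δ ε T) (A : Set S) (B : Set T) :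
    entry (f + g) A B = entry f A B + entry g A B := rfl

theorem entry_smul {S T : FB} (c : k) (f : ob δ ε S ⟶ ob δ ε T) (A : Set S) (B : Set T) :
    entry (c • f) A B = c • entry f A B := rfl

theorem entry_zero {S T : FB} (A : Set S) (B : Set T) :
    entry (0 : ob δ ε S ⟶ ob δ ε T) A B = 0 := rfl

theorem entry_comp {S T U : FB} (f : ob δ ε S ⟶ ob δ ε T) (g : ob δ ε T ⟶ ob δ ε U) (A : Set S)
    (C : Set U) : entry (f ≫ g) A C = ∑ B, StarProd.blockComp (S := ob δ ε S) (T := ob δ ε T)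
      (U := ob δ ε U) A B C (entry f A B) (entry g B C) := rfl

/-- The component of the diagram that is induced by a partition `r` along maps `i` and `j`. -/
def blk (δ ε : k) {V : Type} (r : Setoid V) {S T : FB} (i : S → V) (j : T → V) (A : Set S)
    (B : Set T) : StarProd.Block (ob δ ε S) (ob δ ε T) A B :=
  strand δ r (fun s : S.sub A => i s.1) (fun t : T.sub B => j t.1) ⊗ₜ
    strand ε r (fun s : S.sub Aᶜ => i s.1) (fun t : T.sub Bᶜ => j t.1)

open Classical in
/-- The diagram that is induced by a partition `r` along maps `i` and `j`, with blocks coloured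
by `κ`. -/
def sk (δ ε : k) {V : Type} (r : Setoid V) (κ : V → Bool) {S T : FB} (i : S → V) (j : T → V) :
    ob δ ε S ⟶ ob δ ε T :=
  ofEntry fun A B => if (∀ s, s ∈ A ↔ κ (i s) = true) ∧ ∀ t, t ∈ B ↔ κ (j t) = true then
    blk δ ε r i j A B else 0

open Classical in
/-- The linear combination of the diagrams with one block of colour `c` that consists of all points
that are not common to the source and the target, and identity strands of any colours. -/
def block (δ ε : k) (c : Bool) {V : Type} {S T : FB} (i : S → V) (j : T → V) :
    ob δ ε S ⟶ ob δ ε T :=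
  ofEntry fun A B => if (∀ s, i s ∉ Set.range j → (s ∈ A ↔ c = true)) ∧
      (∀ t, j t ∉ Set.range i → (t ∈ B ↔ c = true)) ∧ ∀ s t, i s = j t → (s ∈ A ↔ t ∈ B) then
    (if {v | ¬ (v ∈ Set.range i ↔ v ∈ Set.range j)} = ∅ then cond c δ ε else 1) •
      blk δ ε (joinBlock ⊥ {v | ¬ (v ∈ Set.range i ↔ v ∈ Set.range j)}) i j A B else 0

section

variable {V : Type} {r : Setoid V} {κ : V → Bool} {S T U : FB} {i : S → V} {j : T → V}

theorem entry_sk_pos {A : Set S} {B : Set T} (hA : ∀ s, s ∈ A ↔ κ (i s) = true)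
    (hB : ∀ t, t ∈ B ↔ κ (j t) = true) : entry (sk δ ε r κ i j) A B = blk δ ε r i j A B :=
  if_pos ⟨hA, hB⟩

theorem entry_sk_neg {A : Set S} {B : Set T}
    (h : ¬ ((∀ s, s ∈ A ↔ κ (i s) = true) ∧ ∀ t, t ∈ B ↔ κ (j t) = true)) :
    entry (sk δ ε r κ i j) A B = 0 := if_neg h

theorem blk_congr {V' : Type} {r' : Setoid V'} {i' : S → V'} {j' : T → V'}
    (h : ∀ x y : S ⊕ T, r (Sum.elim i j x) (Sum.elim i j y) ↔
      r' (Sum.elim i' j' x) (Sum.elim i' j' y)) (A : Set S) (B : Set T) :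
    blk δ ε r i j A B = blk δ ε r' i' j' A B := by
  have h' : ∀ (A : Set S) (B : Set T) (x : S.sub A ⊕ T.sub B), ∃ x' : S ⊕ T,
      Sum.elim (fun s : S.sub A => i s.1) (fun t : T.sub B => j t.1) x = Sum.elim i j x' ∧
      Sum.elim (fun s : S.sub A => i' s.1) (fun t : T.sub B => j' t.1) x = Sum.elim i' j' x' := by
    rintro A B (x | x)
    exacts [⟨Sum.inl x.1, rfl, rfl⟩, ⟨Sum.inr x.1, rfl, rfl⟩]
  unfold blk
  congr 1
  all_goals
    refine strand_congr _ fun x y => ?_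
    obtain ⟨x', h1, h2⟩ := h' _ _ x
    obtain ⟨y', h3, h4⟩ := h' _ _ y
    rw [h1, h2, h3, h4]
    exact h x' y'

open Classical in
theorem sk_congr {V' : Type} {r' : Setoid V'} {κ' : V' → Bool} {i' : S → V'} {j' : T → V'}
    (h : ∀ x y : S ⊕ T, r (Sum.elim i j x) (Sum.elim i j y) ↔
      r' (Sum.elim i' j' x) (Sum.elim i' j' y)) (hi : ∀ s, κ (i s) = κ' (i' s))
    (hj : ∀ t, κ (j t) = κ' (j' t)) : sk δ ε r κ i j = sk δ ε r' κ' i' j' := by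
  refine ext_entry fun A B => ?_
  unfold sk
  rw [entry_ofEntry, entry_ofEntry, blk_congr h]
  exact if_congr (by simp only [hi, hj]) rfl rfl

theorem sk_comp_eq (f : ob δ ε T ⟶ ob δ ε U) (A : Set S) (C : Set U) (B : Set T)
    (hB : ∀ t, t ∈ B ↔ κ (j t) = true) :
    entry (sk δ ε r κ i j ≫ f) A C = StarProd.blockComp (S := ob δ ε S) (T := ob δ ε T)
      (U := ob δ ε U) A B C (entry (sk δ ε r κ i j) A B) (entry f B C) := by
  rw [entry_comp]
  refine Finset.sum_eq_single B (fun B' _ h => ?_) fun h => (h (Finset.mem_univ B)).elim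
  rw [entry_sk_neg fun h' => h (Set.ext fun t => (h'.2 t).trans (hB t).symm), map_zero,
    LinearMap.zero_apply]

theorem sk_comp_eq_zero {f : ob δ ε T ⟶ ob δ ε U} (h : ∀ B C, (∀ t, t ∈ B ↔ κ (j t) = true) →
    entry f B C = 0) : sk δ ε r κ i j ≫ f = 0 := by
  refine ext_entry fun A C => ?_
  rw [sk_comp_eq f A C {t | κ (j t) = true} fun _ => Iff.rfl, h {t | κ (j t) = true} C fun _ => Iff.rfl, map_zero]
  rfl

open Classical in
/-- The colouring that extends `κ` by `c` to the points that are new in `l`. -/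
def recolour (κ : V → Bool) (c : Bool) (j : T → V) (l : U → V) (v : V) : Bool :=
  if v ∈ Set.range l ∧ v ∉ Set.range j then c else κ v

variable {c : Bool} {l : U → V}

theorem sk_comp_block_eq_zero {t : T} (ht : j t ∉ Set.range l) (htc : κ (j t) ≠ c) :
    sk δ ε r κ i j ≫ block δ ε c j l = 0 :=
  sk_comp_eq_zero fun B C hB => if_neg fun h => htc (by
    have h1 := (hB t).symm.trans (h.1 t ht)
    cases c <;> simpa using h1)

open Classical in
theorem sk_comp_block (hov : ∀ s u, i s = l u → ∃ t, j t = i s)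
    (hr : ∀ v w, r v w → v = w ∨ (v ∈ Set.range i ∨ v ∈ Set.range j) ∧
      (w ∈ Set.range i ∨ w ∈ Set.range j)) (hκ : ∀ v w, r v w → κ v = κ w)
    (hc : ∀ t, j t ∉ Set.range l → κ (j t) = c) {b : Set V}
    (hb : ∀ v, v ∈ b ↔ ¬ (v ∈ Set.range j ↔ v ∈ Set.range l)) :
    sk δ ε r κ i j ≫ block δ ε c j l =
      (if ∀ v, (∃ u ∈ b, r v u) → v ∉ Set.range i ∧ v ∉ Set.range l then cond c δ ε else 1) •
        sk δ ε (joinBlock r b) (recolour κ c j l) i l := by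
  obtain rfl : b = {v | ¬ (v ∈ Set.range j ↔ v ∈ Set.range l)} := Set.ext hb
  set b := {v | ¬ (v ∈ Set.range j ↔ v ∈ Set.range l)} with hbdef
  set κ' := recolour κ c j l with hκ'
  have hj' : ∀ t, κ' (j t) = κ (j t) := fun t => if_neg fun h => h.2 ⟨t, rfl⟩
  have hi' : ∀ s, κ' (i s) = κ (i s) := fun s => if_neg fun h => by
    obtain ⟨⟨u, hu⟩, h2⟩ := h
    exact h2 (hov s u hu.symm)
  have hl' : ∀ u, l u ∉ Set.range j → κ' (l u) = c := fun u hu => if_pos ⟨⟨u, rfl⟩, hu⟩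
  have hrange : ∀ v, (v ∈ Set.range i ∨ v ∈ Set.range j) → κ' v = κ v := by
    rintro v (⟨s, rfl⟩ | ⟨t, rfl⟩)
    exacts [hi' s, hj' t]
  have hκ'r : ∀ v w, r v w → κ' v = κ' w := by
    intro v w h
    obtain rfl | ⟨h1, h2⟩ := hr v w h
    · rfl
    · rw [hrange v h1, hrange w h2, hκ v w h]
  have hbc : ∀ v ∈ b, κ' v = c := by
    intro v hv
    by_cases hvj : v ∈ Set.range j
    · obtain ⟨t, rfl⟩ := hvj
      rw [hj']
      exact hc t fun h => hv ⟨fun _ => h, fun _ => ⟨t, rfl⟩⟩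
    · by_cases hvl : v ∈ Set.range l
      · exact if_pos ⟨hvl, hvj⟩
      · exact (hv ⟨fun h => (hvj h).elim, fun h => (hvl h).elim⟩).elim
  refine ext_entry fun A C => ?_
  set B : Set T := {t | κ (j t) = true} with hBdef
  have hB : ∀ t, t ∈ B ↔ κ (j t) = true := fun t => Iff.rfl
  have hB' : ∀ t, t ∈ B ↔ κ' (j t) = true := fun t => by rw [hj']; exact hB t
  rw [sk_comp_eq _ A C B hB, entry_smul]
  by_cases hA : ∀ s, s ∈ A ↔ κ (i s) = true
  swap
  · rw [entry_sk_neg fun h => hA h.1, map_zero, LinearMap.zero_apply, entry_sk_neg fun h => hA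
      fun s => by rw [h.1 s, hi'], smul_zero]
  have hA' : ∀ s, s ∈ A ↔ κ' (i s) = true := fun s => by rw [hi']; exact hA s
  rw [entry_sk_pos hA hB]
  by_cases hC : ∀ u, u ∈ C ↔ κ' (l u) = true
  swap
  · rw [entry_sk_neg fun h => hC h.2, smul_zero]
    have : entry (block δ ε c j l) B C = 0 := by
      refine if_neg fun h => hC fun u => ?_
      by_cases hu : l u ∈ Set.range j
      · obtain ⟨t, ht⟩ := hu
        rw [← h.2.2 t u ht, hB' t, ht]
      · rw [h.2.1 u hu, hl' u hu]
    rw [this, map_zero]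
  have hblock : entry (block δ ε c j l) B C =
      (if b = ∅ then cond c δ ε else 1) • blk δ ε (joinBlock ⊥ b) j l B C := by
    refine if_pos ⟨fun t ht => ?_, fun u hu => ?_, fun t u h => ?_⟩
    · rw [hB, hc t ht]
    · rw [hC, hl' u hu]
    · rw [hB', hC, h]
  rw [hblock, entry_sk_pos hA' hC, map_smul]
  have hcompl : ∀ {W : FB} {X : Set W} {m : W → V} (_ : ∀ w, w ∈ X ↔ κ' (m w) = true) (w : W),
      w ∈ Xᶜ ↔ κ' (m w) = false := fun h w => by
    rw [Set.mem_compl_iff, h, Bool.not_eq_true]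
  unfold blk
  rw [StarProd.blockComp_tmul]
  cases c
  · rw [← TensorProduct.tmul_smul, ← TensorProduct.tmul_smul]
    refine congrArg₂ _ ?_ ?_
    · exact strand_comp_of_ne δ hov (fun v w h => hr v w h) hκ'r hb hA' hB' hC
        fun v hv => by rw [hbc v hv]; exact Bool.false_ne_true
    · exact strand_comp_of_eq ε hov hr hκ'r hb (hcompl hA') (hcompl hB') (hcompl hC) hbc
  · rw [TensorProduct.smul_tmul', TensorProduct.smul_tmul']
    refine congrArg₂ _ ?_ ?_
    · exact strand_comp_of_eq δ hov hr hκ'r hb hA' hB' hC hbc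
    · exact strand_comp_of_ne ε hov hr hκ'r hb (hcompl hA') (hcompl hB') (hcompl hC)
        fun v hv => by rw [hbc v hv]; exact Bool.false_ne_true.symm

end

end PartStar
end

noncomputable section

namespace PartStar

open PartDiag PartCat

variable {k : Type u} [CommRing k] {δ ε : k}

/-- The morphism given by a bijection. -/
def ofE (δ ε : k) {S T : FB} (e : S ≃ T) : ob δ ε S ⟶ ob δ ε T :=
  StarProd.ofEquiv (S := ob δ ε S) (T := ob δ ε T) e

theorem strand_comp_map (δ : k) {V : Type} (r : Setoid V) {P Q R : FB} (i : P → V) (j : Q → V)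
    (e : Q ≃ R) : strand δ r i j ≫ (ofFB δ).map (show Q ⟶ R from e) = strand δ r i (j ∘ e.symm) := by
  refine (compL_graph_right (S := ⟨P⟩) (T := ⟨Q⟩) (U := ⟨R⟩) (r.comap (Sum.elim i j)) e).trans
    (congrArg (dg δ) ?_)
  rw [← Setoid.comap_comp]
  congr 1
  funext x
  obtain x | x := x <;> rfl

theorem strand_bot (δ : k) {V : Type} {P : FB} {i : P → V} (hi : Function.Injective i) :
    strand δ ⊥ i i = 𝟙 ((ofFB δ).obj P) := by
  refine congrArg (dg δ) (Setoid.ext fun x y => ?_)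
  have h : ∀ x : P ⊕ P, Sum.elim i i x = i (Sum.elim (Equiv.refl P) id x) := by
    rintro (x | x) <;> rfl
  change Sum.elim i i x = Sum.elim i i y ↔ Sum.elim (Equiv.refl P) id x = Sum.elim (Equiv.refl P) id y
  rw [h, h, hi.eq_iff]

theorem blk_bot {V : Type} {S : FB} {i : S → V} (hi : Function.Injective i) (A : Set S) :
    blk δ ε ⊥ i i A A = 𝟙 _ ⊗ₜ 𝟙 _ := by
  unfold blk
  exact congrArg₂ _ (strand_bot δ (hi.comp Subtype.val_injective))
    (strand_bot ε (hi.comp Subtype.val_injective))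

variable {V : Type} {r : Setoid V} {κ : V → Bool} {S T U : FB} {i : S → V} {j : T → V}

theorem sk_comp_ofE (e : T ≃ U) : sk δ ε r κ i j ≫ ofE δ ε e = sk δ ε r κ i (j ∘ e.symm) := by
  refine ext_entry fun A C => ?_
  rw [sk_comp_eq _ A C {t | κ (j t) = true} fun _ => Iff.rfl]
  set B := {t | κ (j t) = true} with hB
  have hB' : ∀ t, t ∈ B ↔ κ (j t) = true := fun _ => Iff.rfl
  have hC' : ∀ u, (u ∈ C ↔ κ ((j ∘ e.symm) u) = true) ↔ (e.symm u ∈ B ↔ e (e.symm u) ∈ C) :=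
    fun u => by
      rw [hB', Equiv.apply_symm_apply, Function.comp_apply]
      exact iff_comm
  by_cases hA : ∀ s, s ∈ A ↔ κ (i s) = true
  swap
  · rw [entry_sk_neg fun h => hA h.1, map_zero, LinearMap.zero_apply, entry_sk_neg fun h => hA h.1]
  rw [entry_sk_pos hA hB']
  by_cases hC : ∀ u, u ∈ C ↔ κ ((j ∘ e.symm) u) = true
  · have hBC : ∀ t, t ∈ B ↔ e t ∈ C := fun t => by
      have := (hC' (e t)).1 (hC (e t))
      rwa [Equiv.symm_apply_apply] at this
    rw [entry_sk_pos hA hC]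
    refine (congrArg _ (StarProd.ofEquiv_pos (S := ob δ ε T) (T := ob δ ε U) e hBC)).trans ?_
    unfold blk
    rw [StarProd.blockComp_tmul]
    exact congrArg₂ _ (strand_comp_map δ r _ _ _) (strand_comp_map ε r _ _ _)
  · rw [entry_sk_neg fun h => hC h.2]
    refine (congrArg _ (StarProd.ofEquiv_neg (S := ob δ ε T) (T := ob δ ε U) e fun h =>
      hC fun u => (hC' u).2 (h _))).trans (map_zero _)

theorem sk_bot_comp_eq (hi : Function.Injective i) (f : ob δ ε S ⟶ ob δ ε T) {A : Set S}
    (hA : ∀ s, s ∈ A ↔ κ (i s) = true) (B : Set T) :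
    entry (sk δ ε ⊥ κ i i ≫ f) A B = entry f A B := by
  rw [sk_comp_eq f A B A hA, entry_sk_pos hA hA, blk_bot hi]
  exact StarProd.blockComp_id_left (S := ob δ ε S) (T := ob δ ε T) A B _

open Classical in
theorem eq_of_sk_bot_comp (hi : Function.Injective i) {f g : ob δ ε S ⟶ ob δ ε T}
    (h : ∀ κ : V → Bool, sk δ ε ⊥ κ i i ≫ f = sk δ ε ⊥ κ i i ≫ g) : f = g := by
  refine ext_entry fun A B => ?_
  have hA : ∀ s, s ∈ A ↔ decide (i s ∈ i '' A) = true := fun s => by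
    rw [decide_eq_true_iff, hi.mem_set_image]
  have h1 := sk_bot_comp_eq hi f (κ := fun v => decide (v ∈ i '' A)) hA B
  have h2 := sk_bot_comp_eq hi g (κ := fun v => decide (v ∈ i '' A)) hA B
  rw [← h1, ← h2, h]

theorem sk_bot_comp_sk (hi : Function.Injective i) {V' : Type} {r' : Setoid V'} {κ' : V' → Bool}
    {i' : S → V'} {j' : T → V'} (h : ∀ s, κ (i s) = κ' (i' s)) :
    sk δ ε ⊥ κ i i ≫ sk δ ε r' κ' i' j' = sk δ ε r' κ' i' j' := by
  refine ext_entry fun A B => ?_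
  by_cases hA : ∀ s, s ∈ A ↔ κ (i s) = true
  · rw [sk_bot_comp_eq hi _ hA]
  · rw [sk_comp_eq _ A B {s | κ (i s) = true} fun _ => Iff.rfl, entry_sk_neg fun h' => hA h'.1,
      map_zero, LinearMap.zero_apply, entry_sk_neg fun h' => hA fun s => by rw [h s]; exact h'.1 s]

theorem sk_bot_comp_sk_eq_zero {V' : Type} {r' : Setoid V'} {κ' : V' → Bool}
    {i' : S → V'} {j' : T → V'} {s : S} (h : κ (i s) ≠ κ' (i' s)) :
    sk δ ε ⊥ κ i i ≫ sk δ ε r' κ' i' j' = 0 :=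
  sk_comp_eq_zero fun B C hB => entry_sk_neg fun h' => h (by
    have := (hB s).symm.trans (h'.1 s)
    exact Bool.eq_iff_iff.2 this)

open Classical in
theorem sum_sk_bot (S : FB) :
    ∑ A : Set S, sk δ ε ⊥ (fun s => decide (s ∈ A)) id id = 𝟙 (ob δ ε S) := by
  refine eq_of_sk_bot_comp (i := id) Function.injective_id fun κ => ?_
  obtain ⟨K, hK⟩ : ∃ K : Set S, ∀ s, s ∈ K ↔ κ s = true := ⟨{s | κ s = true}, fun _ => Iff.rfl⟩
  have hκ : ∀ s, κ s = decide (s ∈ K) := fun s => by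
    rw [Bool.eq_iff_iff, decide_eq_true_iff, hK]
  rw [Preadditive.comp_sum, Finset.sum_eq_single K (fun A _ h => ?_)
    fun h => (h (Finset.mem_univ _)).elim, sk_bot_comp_sk Function.injective_id fun s => hκ s,
    Category.comp_id]
  · exact sk_congr (fun _ _ => Iff.rfl) (fun s => (hκ s).symm) fun s => (hκ s).symm
  · obtain ⟨s, hs⟩ : ∃ s, ¬ (s ∈ A ↔ s ∈ K) := by
      by_contra h'
      push Not at h'
      exact h (Set.ext h')
    refine sk_bot_comp_sk_eq_zero (s := s) fun h' => hs ?_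
    rw [hK, show κ s = decide (s ∈ A) from h', decide_eq_true_iff]

open Classical in
/-- The partition of `S ⊔ T` that is determined by partitions of `A ⊔ B` and of the complement. -/
theorem exists_comap_eq {S T : FB} (A : Set S) (B : Set T) (σ : Setoid (S.sub A ⊕ T.sub B))
    (τ : Setoid (S.sub Aᶜ ⊕ T.sub Bᶜ)) : ∃ r : Setoid (S ⊕ T),
      (∀ x y, r x y → Sum.elim (fun s => decide (s ∈ A)) (fun t => decide (t ∈ B)) x =
        Sum.elim (fun s => decide (s ∈ A)) (fun t => decide (t ∈ B)) y) ∧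
      r.comap (Sum.elim (fun s : S.sub A => Sum.inl s.1) fun t : T.sub B => Sum.inr t.1) = σ ∧
      r.comap (Sum.elim (fun s : S.sub Aᶜ => Sum.inl s.1) fun t : T.sub Bᶜ => Sum.inr t.1) = τ := by
  let F : S ⊕ T → Quotient σ ⊕ Quotient τ := Sum.elim
    (fun s => if h : s ∈ A then Sum.inl (Quotient.mk σ (Sum.inl ⟨s, h⟩)) else
      Sum.inr (Quotient.mk τ (Sum.inl ⟨s, h⟩)))
    (fun t => if h : t ∈ B then Sum.inl (Quotient.mk σ (Sum.inr ⟨t, h⟩)) else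
      Sum.inr (Quotient.mk τ (Sum.inr ⟨t, h⟩)))
  have hσ : ∀ x, F (Sum.elim (fun s : S.sub A => Sum.inl s.1) (fun t : T.sub B => Sum.inr t.1) x) =
      Sum.inl (Quotient.mk σ x) := by
    rintro (x | x)
    exacts [dif_pos x.2, dif_pos x.2]
  have hτ : ∀ x, F (Sum.elim (fun s : S.sub Aᶜ => Sum.inl s.1) (fun t : T.sub Bᶜ => Sum.inr t.1) x) =
      Sum.inr (Quotient.mk τ x) := by
    rintro (x | x)
    exacts [dif_neg x.2, dif_neg x.2]
  have hF : ∀ x, Sum.elim (fun s => decide (s ∈ A)) (fun t => decide (t ∈ B)) x =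
      (F x).isLeft := by
    rintro (x | x)
    · by_cases h : x ∈ A
      · rw [show F (Sum.inl x) = _ from dif_pos h]
        exact decide_eq_true h
      · rw [show F (Sum.inl x) = _ from dif_neg h]
        exact decide_eq_false h
    · by_cases h : x ∈ B
      · rw [show F (Sum.inr x) = _ from dif_pos h]
        exact decide_eq_true h
      · rw [show F (Sum.inr x) = _ from dif_neg h]
        exact decide_eq_false h
  refine ⟨Setoid.ker F, fun x y h => ?_, Setoid.ext fun x y => ?_, Setoid.ext fun x y => ?_⟩
  · rw [hF, hF, show F x = F y from h]
  · change F _ = F _ ↔ _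
    rw [hσ, hσ, Sum.inl.injEq]
    exact Quotient.eq (r := σ)
  · change F _ = F _ ↔ _
    rw [hτ, hτ, Sum.inr.injEq]
    exact Quotient.eq (r := τ)

open Classical in
theorem hom_induction {S T : FB} {p : (ob δ ε S ⟶ ob δ ε T) → Prop}
    (hsk : ∀ (r : Setoid (S ⊕ T)) (κ : S ⊕ T → Bool), (∀ v w, r v w → κ v = κ w) →
      p (sk δ ε r κ Sum.inl Sum.inr))
    (h0 : p 0) (hadd : ∀ f g, p f → p g → p (f + g)) (hsmul : ∀ (c : k) f, p f → p (c • f))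
    (f : ob δ ε S ⟶ ob δ ε T) : p f := by
  have hsum : ∀ {ι : Type} (s : Finset ι) (g : ι → (ob δ ε S ⟶ ob δ ε T)),
      (∀ i, p (g i)) → p (∑ i ∈ s, g i) := fun s g h => by
    induction s using Finset.induction_on with
    | empty => rw [Finset.sum_empty]; exact h0
    | insert a s ha ih => rw [Finset.sum_insert ha]; exact hadd _ _ (h a) ih
  let E : ∀ (A : Set S) (B : Set T), StarProd.Block (ob δ ε S) (ob δ ε T) A B →
      (ob δ ε S ⟶ ob δ ε T) := fun A B x => ofEntry (Function.update 0 A (Function.update 0 B x))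
  have hE : ∀ A B x A' B', entry (E A B x) A' B' =
      Function.update (0 : ∀ A B, StarProd.Block (ob δ ε S) (ob δ ε T) A B) A
        (Function.update 0 B x) A' B' := fun _ _ _ _ _ => rfl
  have hE₁ : ∀ A B x, entry (E A B x) A B = x := fun A B x => by
    rw [hE, Function.update_self, Function.update_self]
  have hE₂ : ∀ A B x A' B', ¬ (A = A' ∧ B = B') → entry (E A B x) A' B' = 0 := by
    intro A B x A' B' h
    rw [hE]
    by_cases hA : A = A'
    · subst hA
      rw [Function.update_self, Function.update_of_ne fun h' => h ⟨rfl, h'.symm⟩]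
      rfl
    · rw [Function.update_of_ne (Ne.symm hA)]
      rfl
  have hE₃ : ∀ A B y, (∀ A' B', entry y A' B' = if A = A' ∧ B = B' then entry y A' B' else 0) →
      y = E A B (entry y A B) := by
    intro A B y hy
    refine ext_entry fun A' B' => ?_
    by_cases h : A = A' ∧ B = B'
    · obtain ⟨rfl, rfl⟩ := h
      rw [hE₁]
    · rw [hE₂ _ _ _ _ _ h, hy, if_neg h]
  have hEadd : ∀ A B x y, E A B (x + y) = E A B x + E A B y := by
    intro A B x y
    refine ext_entry fun A' B' => ?_
    rw [entry_add]
    by_cases h : A = A' ∧ B = B'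
    · obtain ⟨rfl, rfl⟩ := h
      rw [hE₁, hE₁, hE₁]
    · rw [hE₂ _ _ _ _ _ h, hE₂ _ _ _ _ _ h, hE₂ _ _ _ _ _ h, add_zero]
  have hEsmul : ∀ A B (c : k) x, E A B (c • x) = c • E A B x := by
    intro A B c x
    refine ext_entry fun A' B' => ?_
    rw [entry_smul]
    by_cases h : A = A' ∧ B = B'
    · obtain ⟨rfl, rfl⟩ := h
      rw [hE₁, hE₁]
    · rw [hE₂ _ _ _ _ _ h, hE₂ _ _ _ _ _ h, smul_zero]
  have hEzero : ∀ A B, E A B 0 = 0 := fun A B => by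
    have := hEsmul A B 0 0
    rwa [zero_smul, zero_smul] at this
  have hpE : ∀ A B x, p (E A B x) := by
    intro A B x
    induction x using TensorProduct.induction_on with
    | zero => rw [hEzero]; exact h0
    | add x y hx hy => rw [hEadd]; exact hadd _ _ hx hy
    | tmul x y =>
      induction x using PartCat.Hom.induction with
      | h σ =>
        induction y using PartCat.Hom.induction with
        | h τ =>
          obtain ⟨r, hr, rfl, rfl⟩ := exists_comap_eq A B σ τ
          have := hsk r _ hr
          rw [hE₃ A B (sk δ ε r _ Sum.inl Sum.inr) fun A' B' => ?_,
            entry_sk_pos (fun s => (decide_eq_true_iff).symm) fun s => (decide_eq_true_iff).symm]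
            at this
          · exact this
          · split_ifs with h
            · rfl
            · refine entry_sk_neg fun h' => h ⟨Set.ext fun s => ?_, Set.ext fun s => ?_⟩
              · exact ((h'.1 s).trans decide_eq_true_iff).symm
              · exact ((h'.2 s).trans decide_eq_true_iff).symm
        | h0 => rw [TensorProduct.tmul_zero, hEzero]; exact h0
        | hadd y y' h h' => rw [TensorProduct.tmul_add, hEadd]; exact hadd _ _ h h'
        | hsmul c y h => rw [TensorProduct.tmul_smul, hEsmul]; exact hsmul _ _ h
      | h0 => rw [TensorProduct.zero_tmul, hEzero]; exact h0
      | hadd y y' h h' => rw [TensorProduct.add_tmul, hEadd]; exact hadd _ _ h h'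
      | hsmul c y h => rw [← TensorProduct.smul_tmul', hEsmul]; exact hsmul _ _ h
  have : f = ∑ AB : Set S × Set T, E AB.1 AB.2 (entry f AB.1 AB.2) := by
    refine ext_entry fun A B => ?_
    have hs : ∀ (s : Finset (Set S × Set T)) (g : Set S × Set T → (ob δ ε S ⟶ ob δ ε T)),
        entry (∑ i ∈ s, g i) A B = ∑ i ∈ s, entry (g i) A B := fun s g => by
      induction s using Finset.induction_on with
      | empty => rw [Finset.sum_empty, Finset.sum_empty]; rfl
      | insert a s ha ih => rw [Finset.sum_insert ha, Finset.sum_insert ha, entry_add, ih]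
    rw [hs, Finset.sum_eq_single (A, B) (fun AB _ h => hE₂ _ _ _ _ _ fun h' => h
      (Prod.ext h'.1 h'.2)) fun h => (h (Finset.mem_univ _)).elim, hE₁]
  rw [this]
  exact hsum _ _ fun AB => hpE _ _ _

end PartStar
end

noncomputable section

namespace PartStar

open PartDiag PartCat

variable {k : Type u} [CommRing k] {δ ε : k}

section

variable {V : Type} {κ : V → Bool} {S T U : FB} {i : S → V} {j : T → V} {l : U → V} {c c' : Bool}

theorem recolour_of_mem {v : V} (hv : v ∈ Set.range j) : recolour κ c j l v = κ v :=
  if_neg fun h => h.2 hv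

theorem recolour_of_notMem {v : V} (hv : v ∉ Set.range j) (hv' : v ∈ Set.range l) :
    recolour κ c j l v = c := if_pos ⟨hv', hv⟩

theorem recolour_of_notMem' {v : V} (hv : v ∉ Set.range l) :
    recolour κ c j l v = κ v := if_neg fun h => hv h.1

open Classical in
theorem sk_bot_comp_block (hij : Set.range i = Set.range j)
    (hc : ∀ t, j t ∉ Set.range l → κ (j t) = c) {b : Set V}
    (hb : ∀ v, v ∈ b ↔ ¬ (v ∈ Set.range j ↔ v ∈ Set.range l)) :
    sk δ ε ⊥ κ i j ≫ block δ ε c j l = (if b = ∅ then cond c δ ε else 1) •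
      sk δ ε (joinBlock ⊥ b) (recolour κ c j l) i l := by
  rw [sk_comp_block (fun s _ _ => Set.mem_range.1 (hij ▸ Set.mem_range_self s)) (fun v w h => Or.inl h)
    (fun v w (h : v = w) => by rw [h]) hc hb]
  refine congrArg₂ _ (if_congr ⟨fun h => ?_, fun h => ?_⟩ rfl rfl) rfl
  · refine Set.eq_empty_iff_forall_notMem.2 fun v hv => ?_
    have h1 := h v ⟨v, hv, rfl⟩
    rw [hij] at h1
    exact (hb v).1 hv ⟨fun h' => (h1.1 h').elim, fun h' => (h1.2 h').elim⟩
  · rintro v ⟨u, hu, _⟩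
    rw [h] at hu
    exact hu.elim

theorem sk_bot_comp_block_comp_eq_zero {W : FB} {t : T} (ht : j t ∉ Set.range l) (htc : κ (j t) ≠ c)
    (f : ob δ ε U ⟶ ob δ ε W) : sk δ ε ⊥ κ i j ≫ block δ ε c j l ≫ f = 0 := by
  rw [← Category.assoc, sk_comp_block_eq_zero ht htc, Limits.zero_comp]

open Classical in
theorem sk_bot_comp_block_comp_block (hov : ∀ s u, i s = l u → ∃ t, j t = i s)
    (hc : ∀ s, i s ∉ Set.range j → κ (i s) = c)
    (hc' : ∀ t, j t ∉ Set.range l → recolour κ c i j (j t) = c') {b b' : Set V}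
    (hb : ∀ v, v ∈ b ↔ ¬ (v ∈ Set.range i ↔ v ∈ Set.range j))
    (hb' : ∀ v, v ∈ b' ↔ ¬ (v ∈ Set.range j ↔ v ∈ Set.range l)) :
    sk δ ε ⊥ κ i i ≫ block δ ε c i j ≫ block δ ε c' j l =
      ((if b = ∅ then cond c δ ε else 1) *
        if ∀ v, (∃ u ∈ b', joinBlock ⊥ b v u) → v ∉ Set.range i ∧ v ∉ Set.range l then cond c' δ ε
          else 1) •
      sk δ ε (joinBlock (joinBlock ⊥ b) b') (recolour (recolour κ c i j) c' j l) i l := by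
  have hbc : ∀ v ∈ b, recolour κ c i j v = c := by
    intro v hv
    by_cases hvi : v ∈ Set.range i
    · rw [recolour_of_mem hvi]
      obtain ⟨s, rfl⟩ := hvi
      exact hc s fun h => (hb _).1 hv ⟨fun _ => h, fun _ => ⟨s, rfl⟩⟩
    · refine recolour_of_notMem hvi ?_
      by_contra hvj
      exact (hb _).1 hv ⟨fun h => (hvi h).elim, fun h => (hvj h).elim⟩
  rw [← Category.assoc, sk_bot_comp_block rfl hc hb, Linear.smul_comp,
    sk_comp_block hov (fun v w h => ?_) (fun v w h => ?_) hc' hb', smul_smul]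
  · obtain h | ⟨h, h'⟩ := (joinBlock_bot_rel _ _ _).1 h
    · exact Or.inl h
    · have h1 := (hb v).1 h
      have h2 := (hb w).1 h'
      exact Or.inr ⟨by tauto, by tauto⟩
  · obtain rfl | ⟨h, h'⟩ := (joinBlock_bot_rel _ _ _).1 h
    · rfl
    · rw [hbc v h, hbc w h']

theorem hit_iff {b b' : Set V} (v : V) : (∃ u ∈ b', joinBlock ⊥ b v u) ↔
    v ∈ b' ∨ v ∈ b ∧ ∃ u, u ∈ b ∧ u ∈ b' := by
  simp only [joinBlock_bot_rel]
  constructor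
  · rintro ⟨u, hu, rfl | ⟨h, h'⟩⟩
    exacts [Or.inl hu, Or.inr ⟨h, u, h', hu⟩]
  · rintro (h | ⟨h, u, h', hu⟩)
    exacts [⟨v, h, Or.inl rfl⟩, ⟨u, hu, Or.inr ⟨h, h'⟩⟩]

theorem elim_mem_range (x : S ⊕ U) :
    Sum.elim i l x ∈ Set.range i ∨ Sum.elim i l x ∈ Set.range l := by
  obtain x | x := x
  exacts [Or.inl ⟨x, rfl⟩, Or.inr ⟨x, rfl⟩]

open Classical in
theorem block_comp_block (hi : Function.Injective i) {w : V} (hw : w ∉ Set.range i)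
    (hw' : w ∈ Set.range j) (hw'' : w ∉ Set.range l)
    (hov : ∀ v, v ∈ Set.range i → v ∈ Set.range l → v ∈ Set.range j) :
    block δ ε c i j ≫ block δ ε c j l = block δ ε c i l := by
  refine eq_of_sk_bot_comp hi fun κ => ?_
  by_cases hm : ∀ s, i s ∉ Set.range l → κ (i s) = c
  · have hm₁ : ∀ s, i s ∉ Set.range j → κ (i s) = c := fun s hs =>
      hm s fun h => hs (hov _ ⟨s, rfl⟩ h)
    have hm₂ : ∀ t, j t ∉ Set.range l → recolour κ c i j (j t) = c := fun t ht => by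
      by_cases h : j t ∈ Set.range i
      · rw [recolour_of_mem h]
        obtain ⟨s, hs⟩ := h
        rw [← hs]
        exact hm s (hs ▸ ht)
      · exact recolour_of_notMem h ⟨t, rfl⟩
    rw [sk_bot_comp_block_comp_block (fun s u h => hov _ ⟨s, rfl⟩ ⟨u, h.symm⟩) hm₁ hm₂
      (b := {v | ¬ (v ∈ Set.range i ↔ v ∈ Set.range j)})
      (b' := {v | ¬ (v ∈ Set.range j ↔ v ∈ Set.range l)}) (fun _ => Iff.rfl) (fun _ => Iff.rfl),
      sk_bot_comp_block rfl hm (b := {v | ¬ (v ∈ Set.range i ↔ v ∈ Set.range l)})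
      (fun _ => Iff.rfl)]
    have hhit : ∀ v, (v ∈ Set.range i ∨ v ∈ Set.range l) →
        ((∃ u ∈ {v | ¬ (v ∈ Set.range j ↔ v ∈ Set.range l)},
          joinBlock ⊥ {v | ¬ (v ∈ Set.range i ↔ v ∈ Set.range j)} v u) ↔
        ¬ (v ∈ Set.range i ↔ v ∈ Set.range l)) := by
      intro v hv
      have h1 : ∃ u, u ∈ {v | ¬ (v ∈ Set.range i ↔ v ∈ Set.range j)} ∧
          u ∈ {v | ¬ (v ∈ Set.range j ↔ v ∈ Set.range l)} :=
        ⟨w, fun h => hw (h.2 hw'), fun h => hw'' (h.1 hw')⟩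
      rw [hit_iff, and_iff_left h1, Set.mem_ofPred_eq, Set.mem_ofPred_eq]
      have := hov v
      tauto
    have hne : {v | ¬ (v ∈ Set.range i ↔ v ∈ Set.range j)} ≠ ∅ :=
      Set.nonempty_iff_ne_empty.1 ⟨w, fun h => hw (h.2 hw')⟩
    refine congrArg₂ _ ?_ ?_
    · rw [if_neg hne, one_mul]
      refine if_congr ⟨fun h => ?_, fun h => ?_⟩ rfl rfl
      · refine Set.eq_empty_iff_forall_notMem.2 fun v hv => ?_
        have hv' : v ∈ Set.range i ∨ v ∈ Set.range l := by
          rw [Set.mem_ofPred_eq] at hv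
          tauto
        have := h v ((hhit v hv').2 hv)
        tauto
      · intro v hv
        by_contra hv'
        have h1 := (hhit v (by tauto)).1 hv
        exact Set.eq_empty_iff_forall_notMem.1 h v h1
    · refine sk_congr (fun x y => ?_) (fun s => ?_) fun u => ?_
      · rw [joinBlock_rel, hhit _ (elim_mem_range x), hhit _ (elim_mem_range y),
          joinBlock_bot_rel, joinBlock_bot_rel, Set.mem_ofPred_eq, Set.mem_ofPred_eq,
          Set.mem_ofPred_eq, Set.mem_ofPred_eq]
        have h1 := hov (Sum.elim i l x)
        have h2 := hov (Sum.elim i l y)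
        have h3 := elim_mem_range (i := i) (l := l) x
        have h4 := elim_mem_range (i := i) (l := l) y
        have key : ∀ v, (v ∈ Set.range i → v ∈ Set.range l → v ∈ Set.range j) →
            (v ∈ Set.range i ∨ v ∈ Set.range l) → ¬ (v ∈ Set.range i ↔ v ∈ Set.range j) →
            ¬ (v ∈ Set.range i ↔ v ∈ Set.range l) := by
          intro v
          tauto
        constructor
        · rintro ((h | ⟨h, h'⟩) | h)
          exacts [Or.inl h, Or.inr ⟨key _ h1 h3 h, key _ h2 h4 h'⟩, Or.inr h]
        · rintro (h | h)
          exacts [Or.inl (Or.inl h), Or.inr h]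
      · have h1 : i s ∈ Set.range i := ⟨s, rfl⟩
        have h2 := hov _ h1
        rw [recolour_of_mem (j := i) (l := l) h1]
        by_cases h3 : i s ∈ Set.range j
        · rw [recolour_of_mem h3, recolour_of_mem h1]
        · rw [recolour_of_notMem' fun h => h3 (h2 h), recolour_of_mem h1]
      · have h1 : l u ∈ Set.range l := ⟨u, rfl⟩
        by_cases h2 : l u ∈ Set.range i
        · rw [recolour_of_mem (hov _ h2 h1), recolour_of_mem h2, recolour_of_mem h2]
        · rw [recolour_of_notMem h2 h1]
          by_cases h3 : l u ∈ Set.range j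
          · rw [recolour_of_mem h3, recolour_of_notMem h2 h3]
          · rw [recolour_of_notMem h3 h1]
  · push Not at hm
    obtain ⟨s, hs, hsc⟩ := hm
    rw [sk_comp_block_eq_zero hs hsc]
    by_cases hsj : i s ∈ Set.range j
    · by_cases hm₁ : ∀ s, i s ∉ Set.range j → κ (i s) = c
      · rw [← Category.assoc, sk_bot_comp_block rfl hm₁ (b := {v | ¬ (v ∈ Set.range i ↔
          v ∈ Set.range j)}) (fun _ => Iff.rfl), Linear.smul_comp]
        obtain ⟨t, ht⟩ := hsj
        rw [sk_comp_block_eq_zero (t := t) (ht ▸ hs), smul_zero]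
        rw [ht, recolour_of_mem ⟨s, rfl⟩]
        exact hsc
      · push Not at hm₁
        obtain ⟨s', hs', hsc'⟩ := hm₁
        exact sk_bot_comp_block_comp_eq_zero hs' hsc' _
    · exact sk_bot_comp_block_comp_eq_zero hsj hsc _

theorem block_comp_block_of_ne (hcc : c ≠ c') (hi : Function.Injective i) {w : V}
    (hw : w ∉ Set.range i) (hw' : w ∈ Set.range j) (hw'' : w ∉ Set.range l) :
    block δ ε c' i j ≫ block δ ε c j l = 0 := by
  refine eq_of_sk_bot_comp hi fun κ => ?_
  rw [Limits.comp_zero]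
  by_cases hm₁ : ∀ s, i s ∉ Set.range j → κ (i s) = c'
  · rw [← Category.assoc, sk_bot_comp_block rfl hm₁ (b := {v | ¬ (v ∈ Set.range i ↔
      v ∈ Set.range j)}) (fun _ => Iff.rfl), Linear.smul_comp]
    have h1 := recolour_of_notMem (κ := κ) (c := c') hw hw'
    obtain ⟨t, rfl⟩ := hw'
    rw [sk_comp_block_eq_zero hw'' (by rw [h1]; exact hcc.symm), smul_zero]
  · push Not at hm₁
    obtain ⟨s', hs', hsc'⟩ := hm₁
    exact sk_bot_comp_block_comp_eq_zero hs' hsc' _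

theorem block_self (hi : Function.Injective i) : block δ ε c i i = cond c δ ε • 𝟙 (ob δ ε S) := by
  refine eq_of_sk_bot_comp hi fun κ => ?_
  rw [sk_bot_comp_block (b := ∅) rfl (fun t ht => (ht ⟨t, rfl⟩).elim) fun v =>
    ⟨fun h => h.elim, fun h => h Iff.rfl⟩, if_pos rfl, Linear.comp_smul, Category.comp_id]
  refine congrArg _ (sk_congr (fun x y => ?_) (fun s => recolour_of_mem ⟨s, rfl⟩)
    fun s => recolour_of_mem ⟨s, rfl⟩)
  rw [joinBlock_bot_rel]
  exact or_iff_left fun h => h.1.elim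

theorem block_add_block (hi : Function.Injective i) (e : S ≃ T) {u v : V} (hu : u ∈ Set.range i)
    (hu' : u ∉ Set.range j) (hv : v ∈ Set.range j) (hv' : v ∉ Set.range i)
    (he : ∀ s, i s ≠ u → j (e s) = i s) (he' : ∀ s, i s = u → j (e s) = v) :
    block δ ε true i j + block δ ε false i j = ofE δ ε e := by
  refine eq_of_sk_bot_comp hi fun κ => ?_
  obtain ⟨s₀, hs₀⟩ := hu
  have hne : u ≠ v := by
    rintro rfl
    exact hu' hv
  have hiv : ∀ s, i s ≠ v := fun s h => hv' ⟨s, h⟩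
  have hj₁ : ∀ t, i (e.symm t) ≠ u → j t = i (e.symm t) := fun t h => by
    have := he _ h
    rwa [e.apply_symm_apply] at this
  have hj₂ : ∀ t, i (e.symm t) = u → j t = v := fun t h => by
    have := he' _ h
    rwa [e.apply_symm_apply] at this
  have hS : ∀ s, i s ∈ Set.range j ↔ i s ≠ u := fun s =>
    ⟨fun h h' => hu' (h' ▸ h), fun h => ⟨e s, he s h⟩⟩
  have hT : ∀ t, j t ∈ Set.range i ↔ j t ≠ v := fun t =>
    ⟨fun h h' => hv' (h' ▸ h), fun h => ⟨e.symm t, (hj₁ t fun h' => h (hj₂ t h')).symm⟩⟩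
  have hb : ∀ w, w ∈ ({u, v} : Set V) ↔ ¬ (w ∈ Set.range i ↔ w ∈ Set.range j) := by
    intro w
    rw [Set.mem_insert_iff, Set.mem_singleton_iff]
    constructor
    · rintro (rfl | rfl) h
      exacts [hu' (h.1 ⟨s₀, hs₀⟩), hv' (h.2 hv)]
    · intro h
      by_cases hwi : w ∈ Set.range i
      · obtain ⟨s, rfl⟩ := hwi
        left
        by_contra h'
        exact h ⟨fun _ => (hS s).2 h', fun _ => ⟨s, rfl⟩⟩
      · by_cases hwj : w ∈ Set.range j
        · obtain ⟨t, rfl⟩ := hwj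
          right
          by_contra h'
          exact hwi ((hT t).2 h')
        · exact (h ⟨fun h => (hwi h).elim, fun h => (hwj h).elim⟩).elim
  have key : ∀ c, κ u = c → sk δ ε ⊥ κ i i ≫ block δ ε c i j = sk δ ε ⊥ κ i i ≫ ofE δ ε e := by
    intro c hc
    rw [sk_bot_comp_block rfl (fun s hs => ?_) hb, if_neg fun h =>
      Set.eq_empty_iff_forall_notMem.1 h u (Or.inl rfl), one_smul, sk_comp_ofE]
    · refine sk_congr (fun x y => ?_) (fun s => recolour_of_mem ⟨s, rfl⟩) fun t => ?_
      · have hx : ∀ x : S ⊕ T, (Sum.elim i j x = Sum.elim i (i ∘ e.symm) x ∧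
            Sum.elim i j x ≠ v) ∨
            Sum.elim i j x = v ∧ Sum.elim i (i ∘ e.symm) x = u := by
          rintro (s | t)
          · exact Or.inl ⟨rfl, hiv s⟩
          · by_cases h : i (e.symm t) = u
            · exact Or.inr ⟨hj₂ t h, h⟩
            · refine Or.inl ⟨hj₁ t h, ?_⟩
              change j t ≠ v
              rw [hj₁ t h]
              exact hiv _
        rw [joinBlock_bot_rel]
        change _ ↔ Sum.elim i (i ∘ e.symm) x = Sum.elim i (i ∘ e.symm) y
        simp only [Set.mem_insert_iff, Set.mem_singleton_iff]
        obtain ⟨h1, h1'⟩ | ⟨h1, h1'⟩ := hx x <;> obtain ⟨h2, h2'⟩ | ⟨h2, h2'⟩ := hx y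
        · rw [← h1, ← h2, or_iff_left h1', or_iff_left h2']
          exact ⟨fun h => h.elim id fun h => h.1.trans h.2.symm, Or.inl⟩
        · rw [← h1, h2', h2, or_iff_left h1']
          exact ⟨fun h => (h.resolve_left h1').1, fun h => Or.inr ⟨h, Or.inr rfl⟩⟩
        · rw [h1', ← h2, h1, or_iff_left h2']
          exact ⟨fun h => (h.resolve_left (Ne.symm h2')).2.symm,
            fun h => Or.inr ⟨Or.inr rfl, h.symm⟩⟩
        · rw [h1', h2', h1, h2]
          exact ⟨fun _ => rfl, fun _ => Or.inl rfl⟩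
      · by_cases h : i (e.symm t) = u
        · rw [recolour_of_notMem (fun h' => (hT t).1 h' (hj₂ t h)) ⟨t, rfl⟩, Function.comp_apply, h,
            hc]
        · rw [Function.comp_apply, ← hj₁ t h, recolour_of_mem]
          rw [hj₁ t h]
          exact ⟨_, rfl⟩
    · rw [hS, not_not] at hs
      rw [hs, hc]
  have key' : ∀ c, κ u ≠ c → sk δ ε ⊥ κ i i ≫ block δ ε c i j = 0 := fun c hc =>
    sk_comp_block_eq_zero (t := s₀) (by rw [hs₀]; exact hu') (by rw [hs₀]; exact hc)
  rw [Preadditive.comp_add]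
  cases h : κ u
  · rw [key false h, key' true (by rw [h]; exact Bool.false_ne_true), zero_add]
  · rw [key true h, key' false (by rw [h]; exact Bool.false_ne_true.symm), add_zero]

end

end PartStar
end

noncomputable section

namespace PartStar

open PartDiag PartCat

variable {k : Type u} [CommRing k] {δ ε : k}

section

variable {V : Type} {κ : V → Bool} {S T U : FB} {i : S → V} {j : T → V} {l : U → V} {c c' : Bool}

open Classical in
theorem block_comp {V' : Type} {φ : V → V'} (hφ : Function.Injective φ) :
    block δ ε c (φ ∘ i) (φ ∘ j) = block δ ε c i j := by
  have hmem : ∀ {W : FB} (m : W → V) v, φ v ∈ Set.range (φ ∘ m) ↔ v ∈ Set.range m := fun m v =>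
    ⟨fun ⟨w, hw⟩ => ⟨w, hφ hw⟩, fun ⟨w, hw⟩ => ⟨w, congrArg φ hw⟩⟩
  refine ext_entry fun A B => ?_
  unfold block
  rw [entry_ofEntry, entry_ofEntry]
  refine if_congr ?_ (congrArg₂ _ (if_congr ?_ rfl rfl) (blk_congr (fun x y => ?_) A B)) rfl
  · have hi : ∀ s, (φ ∘ i) s ∈ Set.range (φ ∘ j) ↔ i s ∈ Set.range j := fun s => hmem j (i s)
    have hj : ∀ t, (φ ∘ j) t ∈ Set.range (φ ∘ i) ↔ j t ∈ Set.range i := fun t => hmem i (j t)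
    have hij : ∀ s t, (φ ∘ i) s = (φ ∘ j) t ↔ i s = j t := fun s t => hφ.eq_iff
    simp only [hi, hj, hij]
  · rw [Set.eq_empty_iff_forall_notMem, Set.eq_empty_iff_forall_notMem]
    constructor
    · intro h v hv
      refine h (φ v) fun h' => hv ?_
      rwa [hmem, hmem] at h'
    · intro h v hv
      have hv' : v ∈ Set.range (φ ∘ i) ∨ v ∈ Set.range (φ ∘ j) := by
        by_contra h'
        push Not at h'
        exact hv ⟨fun h => (h'.1 h).elim, fun h => (h'.2 h).elim⟩
      obtain ⟨v', rfl⟩ : ∃ v', φ v' = v := by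
        obtain ⟨s, rfl⟩ | ⟨t, rfl⟩ := hv'
        exacts [⟨_, rfl⟩, ⟨_, rfl⟩]
      refine h v' fun h' => hv ?_
      rwa [hmem, hmem]
  · have hx : ∀ x, Sum.elim (φ ∘ i) (φ ∘ j) x = φ (Sum.elim i j x) := by
      rintro (x | x) <;> rfl
    rw [joinBlock_bot_rel, joinBlock_bot_rel, hx, hx, hφ.eq_iff]
    change _ ∨ ¬ _ ∧ ¬ _ ↔ _ ∨ ¬ _ ∧ ¬ _
    rw [hmem, hmem, hmem, hmem]

open Classical in
theorem ofE_comp_block (hi : Function.Injective i) (e : T ≃ S) :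
    ofE δ ε e ≫ block δ ε c i l = block δ ε c (i ∘ e) l := by
  have hr : Set.range (i ∘ e) = Set.range i := e.surjective.range_comp i
  refine eq_of_sk_bot_comp (hi.comp e.injective) fun κ => ?_
  have h1 : sk δ ε ⊥ κ (i ∘ e) ((i ∘ e) ∘ e.symm) = sk δ ε ⊥ κ (i ∘ e) i := by
    rw [Function.comp_assoc, e.self_comp_symm, Function.comp_id]
  rw [← Category.assoc, sk_comp_ofE, h1]
  by_cases hm : ∀ s, i s ∉ Set.range l → κ (i s) = c
  · rw [sk_bot_comp_block hr hm (b := {v | ¬ (v ∈ Set.range i ↔ v ∈ Set.range l)})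
      (fun _ => Iff.rfl), sk_bot_comp_block (i := i ∘ e) (j := i ∘ e) rfl (fun t ht => hm _ ht)
      (b := {v | ¬ (v ∈ Set.range i ↔ v ∈ Set.range l)}) (fun _ => by rw [hr]; exact Iff.rfl)]
    refine congrArg _ (sk_congr (fun _ _ => Iff.rfl) (fun s => ?_) fun u => ?_)
    · unfold recolour
      rw [hr]
    · unfold recolour
      rw [hr]
  · push Not at hm
    obtain ⟨s, hs, hsc⟩ := hm
    rw [sk_comp_block_eq_zero hs hsc, sk_comp_block_eq_zero (t := e.symm s)]
    · rw [Function.comp_apply, e.apply_symm_apply]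
      exact hs
    · rw [Function.comp_apply, e.apply_symm_apply]
      exact hsc

open Classical in
theorem block_comp_ofE (hi : Function.Injective i) (e : U ≃ T) :
    block δ ε c i l ≫ ofE δ ε e = block δ ε c i (l ∘ e.symm) := by
  have hr : Set.range (l ∘ e.symm) = Set.range l := e.symm.surjective.range_comp l
  refine eq_of_sk_bot_comp hi fun κ => ?_
  by_cases hm : ∀ s, i s ∉ Set.range l → κ (i s) = c
  · rw [← Category.assoc, sk_bot_comp_block rfl hm (b := {v | ¬ (v ∈ Set.range i ↔
      v ∈ Set.range l)}) (fun _ => Iff.rfl), sk_bot_comp_block rfl (fun t ht => hm _ (by rwa [← hr]))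
      (b := {v | ¬ (v ∈ Set.range i ↔ v ∈ Set.range l)}) (fun _ => by rw [hr]; exact Iff.rfl),
      Linear.smul_comp, sk_comp_ofE]
    refine congrArg _ (sk_congr (fun _ _ => Iff.rfl) (fun s => ?_) fun u => ?_)
    · unfold recolour
      rw [hr]
    · unfold recolour
      rw [hr]
  · push Not at hm
    obtain ⟨s, hs, hsc⟩ := hm
    rw [← Category.assoc, sk_comp_block_eq_zero hs hsc, sk_comp_block_eq_zero (by rwa [hr]) hsc,
      Limits.zero_comp]

theorem hit_iff_of_disjoint {b b' : Set V} (h : ∀ v, v ∈ b → v ∉ b') (v : V) :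
    (∃ u ∈ b', joinBlock ⊥ b v u) ↔ v ∈ b' := by
  rw [hit_iff]
  exact or_iff_left fun ⟨_, u, hu, hu'⟩ => h u hu hu'

variable {T' : FB} {j' : T' → V}

theorem sk_bot_comp_block_comp_block_eq_zero {s : S} (hs : i s ∈ Set.range j)
    (hs' : i s ∉ Set.range l) (hsc : κ (i s) ≠ c') :
    sk δ ε ⊥ κ i i ≫ block δ ε c i j ≫ block δ ε c' j l = 0 := by
  by_cases hm₁ : ∀ s, i s ∉ Set.range j → κ (i s) = c
  · rw [← Category.assoc, sk_bot_comp_block rfl hm₁ (b := {v | ¬ (v ∈ Set.range i ↔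
      v ∈ Set.range j)}) (fun _ => Iff.rfl), Linear.smul_comp]
    obtain ⟨t, ht⟩ := hs
    rw [sk_comp_block_eq_zero (t := t) (ht ▸ hs'), smul_zero]
    rw [ht, recolour_of_mem ⟨s, rfl⟩]
    exact hsc
  · push Not at hm₁
    obtain ⟨s', hs', hsc'⟩ := hm₁
    exact sk_bot_comp_block_comp_eq_zero hs' hsc' _

open Classical in
theorem sk_bot_comp_block_comp_block' (h : ∀ v,
      ((v ∈ Set.range i ↔ v ∈ Set.range j) ∧ (v ∈ Set.range j' ↔ v ∈ Set.range l)) ∨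
      ((v ∈ Set.range i ↔ v ∈ Set.range j') ∧ (v ∈ Set.range j ↔ v ∈ Set.range l)))
    (hc : ∀ s, i s ∉ Set.range j → κ (i s) = c) (hc' : ∀ s, i s ∉ Set.range j' → κ (i s) = c')
    {b b' : Set V} (hb : ∀ v, v ∈ b ↔ ¬ (v ∈ Set.range i ↔ v ∈ Set.range j))
    (hb' : ∀ v, v ∈ b' ↔ ¬ (v ∈ Set.range i ↔ v ∈ Set.range j')) :
    sk δ ε ⊥ κ i i ≫ block δ ε c i j ≫ block δ ε c' j l =
      ((if b = ∅ then cond c δ ε else 1) * if b' = ∅ then cond c' δ ε else 1) •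
      sk δ ε (joinBlock (joinBlock ⊥ b) b') (recolour (recolour κ c i j) c' i j') i l := by
  have hbj : ∀ v, v ∈ b' ↔ ¬ (v ∈ Set.range j ↔ v ∈ Set.range l) := fun v => by
    rw [hb']
    have := h v
    tauto
  have hdis : ∀ v, v ∈ b → v ∉ b' := fun v hv hv' => by
    have h1 := (hb v).1 hv
    have h2 := (hb' v).1 hv'
    have := h v
    tauto
  rw [sk_bot_comp_block_comp_block (fun s u hsu => ?_) hc (fun t ht => ?_) hb hbj]
  · refine congrArg₂ _ (congrArg _ (if_congr ⟨fun hcl => ?_, ?_⟩ rfl rfl))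
      (sk_congr (fun _ _ => Iff.rfl) (fun s => ?_) fun u => ?_)
    · refine Set.eq_empty_iff_forall_notMem.2 fun v hv => ?_
      have h1 := hcl v ⟨v, hv, Setoid.refl' _ v⟩
      have h2 := (hb' v).1 hv
      have := h v
      tauto
    · rintro rfl v ⟨u, hu, _⟩
      exact hu.elim
    · have h1 : i s ∈ Set.range i := ⟨s, rfl⟩
      rw [recolour_of_mem (j := i) (l := j') h1]
      by_cases h2 : i s ∈ Set.range j
      · rw [recolour_of_mem h2]
      · refine recolour_of_notMem' ?_
        have := h (i s)
        tauto
    · have h1 : l u ∈ Set.range l := ⟨u, rfl⟩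
      have h3 := h (l u)
      by_cases h2 : l u ∈ Set.range j
      · rw [recolour_of_mem h2]
        by_cases h4 : l u ∈ Set.range i
        · rw [recolour_of_mem (l := j') h4]
        · rw [recolour_of_notMem' (l := j')]
          tauto
      · rw [recolour_of_notMem h2 h1, recolour_of_notMem]
        · tauto
        · tauto
  · have h1 := h (i s)
    have h2 : i s ∈ Set.range i := ⟨s, rfl⟩
    have h3 : i s ∈ Set.range l := ⟨u, hsu.symm⟩
    have : i s ∈ Set.range j := by tauto
    exact this
  · have h1 := h (j t)
    have h2 : j t ∈ Set.range j := ⟨t, rfl⟩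
    have h3 : j t ∈ Set.range i ∧ j t ∉ Set.range j' := by tauto
    obtain ⟨⟨s, hs⟩, h4⟩ := h3
    rw [recolour_of_mem ⟨s, hs⟩, ← hs]
    exact hc' s (by rwa [hs])

theorem block_comp_block_comm (hi : Function.Injective i) (h : ∀ v,
      ((v ∈ Set.range i ↔ v ∈ Set.range j) ∧ (v ∈ Set.range j' ↔ v ∈ Set.range l)) ∨
      ((v ∈ Set.range i ↔ v ∈ Set.range j') ∧ (v ∈ Set.range j ↔ v ∈ Set.range l))) :
    block δ ε c i j ≫ block δ ε c' j l = block δ ε c' i j' ≫ block δ ε c j' l := by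
  refine eq_of_sk_bot_comp hi fun κ => ?_
  by_cases hc : ∀ s, i s ∉ Set.range j → κ (i s) = c
  swap
  · push Not at hc
    obtain ⟨s, hs, hsc⟩ := hc
    have h1 := h (i s)
    have h2 : i s ∈ Set.range i := ⟨s, rfl⟩
    rw [sk_bot_comp_block_comp_eq_zero hs hsc,
      sk_bot_comp_block_comp_block_eq_zero (by tauto) (by tauto) hsc]
  by_cases hc' : ∀ s, i s ∉ Set.range j' → κ (i s) = c'
  swap
  · push Not at hc'
    obtain ⟨s, hs, hsc⟩ := hc'
    have h1 := h (i s)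
    have h2 : i s ∈ Set.range i := ⟨s, rfl⟩
    rw [sk_bot_comp_block_comp_eq_zero hs hsc,
      sk_bot_comp_block_comp_block_eq_zero (by tauto) (by tauto) hsc]
  set b := {v | ¬ (v ∈ Set.range i ↔ v ∈ Set.range j)} with hbdef
  set b' := {v | ¬ (v ∈ Set.range i ↔ v ∈ Set.range j')} with hbdef'
  have hb : ∀ v, v ∈ b ↔ ¬ (v ∈ Set.range i ↔ v ∈ Set.range j) := fun _ => Iff.rfl
  have hb' : ∀ v, v ∈ b' ↔ ¬ (v ∈ Set.range i ↔ v ∈ Set.range j') := fun _ => Iff.rfl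
  have hdis : ∀ v, v ∈ b → v ∉ b' := fun v hv hv' => by
    have h1 := (hb v).1 hv
    have h2 := (hb' v).1 hv'
    have := h v
    tauto
  rw [sk_bot_comp_block_comp_block' h hc hc' hb hb',
    sk_bot_comp_block_comp_block' (fun v => (h v).symm) hc' hc hb' hb, mul_comm]
  refine congrArg _ (sk_congr (fun x y => ?_) (fun s => ?_) fun u => ?_)
  · rw [joinBlock_rel, joinBlock_rel (joinBlock ⊥ b'), hit_iff_of_disjoint hdis,
      hit_iff_of_disjoint hdis, hit_iff_of_disjoint fun v hv hv' => hdis v hv' hv,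
      hit_iff_of_disjoint fun v hv hv' => hdis v hv' hv, joinBlock_bot_rel, joinBlock_bot_rel,
      or_right_comm]
  · have h1 : i s ∈ Set.range i := ⟨s, rfl⟩
    rw [recolour_of_mem h1, recolour_of_mem h1, recolour_of_mem h1, recolour_of_mem h1]
  · by_cases h1 : l u ∈ Set.range i
    · rw [recolour_of_mem h1, recolour_of_mem h1, recolour_of_mem h1, recolour_of_mem h1]
    · have h3 := h (l u)
      by_cases h2 : l u ∈ Set.range j
      · have h4 : l u ∉ Set.range j' := by
          have : l u ∈ Set.range l := ⟨u, rfl⟩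
          tauto
        rw [recolour_of_notMem' h4, recolour_of_notMem h1 h2, recolour_of_notMem h1 h2]
      · have h4 : l u ∈ Set.range j' := by
          have : l u ∈ Set.range l := ⟨u, rfl⟩
          tauto
        rw [recolour_of_notMem h1 h4, recolour_of_notMem' h2, recolour_of_notMem h1 h4]

end

end PartStar

namespace FBMod

open PartStar

variable {k : Type u} [CommRing k] {δ ε : k}

/-- The `FB`-module underlying a representation of the star product. -/
abbrev res (N : LinRep k (StarProd k (PartCat.ofFB δ) (PartCat.ofFB ε))) : FBMod k :=
  (LinRep.restrict k (StarProd.ofFB k (PartCat.ofFB δ) (PartCat.ofFB ε))).obj N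

/-- The action of a morphism on a representation of the star product. -/
def mapN (N : LinRep k (StarProd k (PartCat.ofFB δ) (PartCat.ofFB ε))) {S T : FB}
    (f : ob δ ε S ⟶ ob δ ε T) : (res N).val S →ₗ[k] (res N).val T :=
  (N.obj.map f).hom

section

variable (N : LinRep k (StarProd k (PartCat.ofFB δ) (PartCat.ofFB ε))) {S T U : FB}

theorem mapN_comp (f : ob δ ε S ⟶ ob δ ε T) (g : ob δ ε T ⟶ ob δ ε U) (x : (res N).val S) :
    mapN N (f ≫ g) x = mapN N g (mapN N f x) :=
  congrArg (fun h => ModuleCat.Hom.hom h x) (N.obj.map_comp f g)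

theorem mapN_id (x : (res N).val S) : mapN N (𝟙 (ob δ ε S)) x = x :=
  congrArg (fun h => ModuleCat.Hom.hom h x) (N.obj.map_id (ob δ ε S))

theorem mapN_add (f g : ob δ ε S ⟶ ob δ ε T) : mapN N (f + g) = mapN N f + mapN N g := by
  have := N.property.1
  exact congrArg ModuleCat.Hom.hom (N.obj.map_add (f := f) (g := g))

theorem mapN_zero : mapN N (0 : ob δ ε S ⟶ ob δ ε T) = 0 := by
  have h := mapN_add N (0 : ob δ ε S ⟶ ob δ ε T) 0
  rwa [add_zero, left_eq_add] at h

theorem mapN_smul (c : k) (f : ob δ ε S ⟶ ob δ ε T) : mapN N (c • f) = c • mapN N f := by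
  have := N.property.2
  exact congrArg ModuleCat.Hom.hom (Functor.map_smul (R := k) N.obj c f)

theorem mapN_ofE (e : S ≃ T) : mapN N (ofE δ ε e) = (res N).act e := rfl

end

/-- The block operators of a representation of the star product. -/
def BlockOps.ofLinRep (N : LinRep k (StarProd k (PartCat.ofFB δ) (PartCat.ofFB ε))) :
    BlockOps (res N) (fun c => cond c δ ε) where
  D c {V} X Y := mapN N (block δ ε c (Subtype.val : V.sub X → V) (Subtype.val : V.sub Y → V))
  nat c {V V' φ} hφ {X Y X' Y'} a b ha hb x := by
    rw [← mapN_ofE, ← mapN_ofE, ← mapN_comp, ← mapN_comp, ofE_comp_block Subtype.val_injective,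
      block_comp_ofE Subtype.val_injective, ← block_comp hφ]
    have h1 : (Subtype.val : V'.sub X' → V') ∘ a = φ ∘ Subtype.val := funext ha
    have h2 : φ ∘ (Subtype.val : V.sub Y → V) ∘ b.symm = Subtype.val := funext fun y => by
      have := hb (b.symm y)
      rw [b.apply_symm_apply] at this
      exact this.symm
    rw [h1, h2]
  comm c c' {V X₀ X₁ X₂ X₃} h x := by
    rw [← mapN_comp, ← mapN_comp, block_comp_block_comm Subtype.val_injective]
    intro v
    simp only [Subtype.range_val]
    exact h v
  merge c {V X₀ X₁ X₂} hw h x := by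
    obtain ⟨w, h0, h1, h2⟩ := hw
    rw [← mapN_comp, block_comp_block (w := w) Subtype.val_injective] <;>
      simp only [Subtype.range_val] <;> assumption
  zero {c c'} hc {V X₀ X₁ X₂} hw h x := by
    obtain ⟨w, h0, h1, h2⟩ := hw
    rw [← mapN_comp, block_comp_block_of_ne (w := w) hc Subtype.val_injective, mapN_zero,
      LinearMap.zero_apply] <;> simp only [Subtype.range_val] <;> assumption
  scalar c {V} X x := by
    rw [block_self Subtype.val_injective, mapN_smul, LinearMap.smul_apply, mapN_id]
  unit {V X Y} e {u v} hu hu' hv hv' he he' x := by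
    rw [← LinearMap.add_apply, ← mapN_add, block_add_block (u := u) (v := v)
      Subtype.val_injective e, mapN_ofE]
    · simp only [Subtype.range_val]
      exact hu
    · simp only [Subtype.range_val]
      exact hu'
    · simp only [Subtype.range_val]
      exact hv
    · simp only [Subtype.range_val]
      exact hv'
    · exact he
    · exact he'

end FBMod
end

noncomputable section

namespace PartStar

open PartDiag PartCat

variable {k : Type u} [CommRing k] {δ ε : k}

/-- The disjoint union of two finite sets. -/
abbrev sumFB (S T : FB) : FB := ⟨S ⊕ T⟩

/-- The morphism `block` for two subsets of a finite set. -/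
abbrev blockS (δ ε : k) (c : Bool) {V : FB} (X Y : Set V) :
    ob δ ε (V.sub X) ⟶ ob δ ε (V.sub Y) :=
  block δ ε c (S := V.sub X) (T := V.sub Y) Subtype.val Subtype.val

/-- The partition obtained from `r` by splitting all points outside `W` off. -/
def restrictTo {V : Type} (r : Setoid V) (W : Set V) : Setoid V where
  r v w := v = w ∨ r v w ∧ v ∈ W ∧ w ∈ W
  iseqv := by
    refine ⟨fun v => Or.inl rfl, ?_, ?_⟩
    · rintro v w (rfl | ⟨h, h1, h2⟩)
      exacts [Or.inl rfl, Or.inr ⟨Setoid.symm' r h, h2, h1⟩]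
    · rintro v w x (rfl | ⟨h, h1, h2⟩) (rfl | ⟨g, g1, g2⟩)
      exacts [Or.inl rfl, Or.inr ⟨g, g1, g2⟩, Or.inr ⟨h, h1, h2⟩,
        Or.inr ⟨Setoid.trans' r h g, h1, g2⟩]

theorem restrictTo_rel {V : Type} (r : Setoid V) (W : Set V) (v w : V) :
    restrictTo r W v w ↔ v = w ∨ r v w ∧ v ∈ W ∧ w ∈ W := Iff.rfl

theorem joinBlock_restrictTo {V : Type} (r : Setoid V) {W W' : Set V} {a : V}
    (hW' : ∀ v, v ∈ W' ↔ v ∈ W ∨ r a v) (haW : ∀ v, r a v → v ∉ W) (v w : V) :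
    joinBlock (restrictTo r W) {v | r a v} v w ↔ restrictTo r W' v w := by
  have hhit : ∀ v, (∃ u ∈ {v | r a v}, restrictTo r W v u) ↔ r a v := by
    intro v
    constructor
    · rintro ⟨u, hu, rfl | ⟨_, _, h⟩⟩
      exacts [hu, (haW u hu h).elim]
    · exact fun h => ⟨v, h, Or.inl rfl⟩
  rw [joinBlock_rel, hhit, hhit, restrictTo_rel, restrictTo_rel, hW', hW']
  constructor
  · rintro ((h | ⟨h, h1, h2⟩) | ⟨h, h'⟩)
    exacts [Or.inl h, Or.inr ⟨h, Or.inl h1, Or.inl h2⟩,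
      Or.inr ⟨Setoid.trans' r (Setoid.symm' r h) h', Or.inr h, Or.inr h'⟩]
  · rintro (h | ⟨h, h1 | h1, h2 | h2⟩)
    exacts [Or.inl (Or.inl h), Or.inl (Or.inr ⟨h, h1, h2⟩),
      Or.inr ⟨Setoid.trans' r h2 (Setoid.symm' r h), h2⟩, Or.inr ⟨h1, Setoid.trans' r h1 h⟩,
      Or.inr ⟨h1, h2⟩]

/-- The elements of `S` outside `W` and the elements of `T` inside `W`. -/
def mixed {S T : FB} (W : Set (sumFB S T)) : Set (sumFB S T) :=
  {v | v ∈ W ∧ v.isRight = true ∨ v ∉ W ∧ v.isLeft = true}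

theorem inl_mem_mixed {S T : FB} {W : Set (sumFB S T)} (s : S) :
    Sum.inl s ∈ mixed W ↔ Sum.inl s ∉ W := by
  change _ ∧ false = true ∨ _ ∧ true = true ↔ _
  simp

theorem inr_mem_mixed {S T : FB} {W : Set (sumFB S T)} (t : T) :
    Sum.inr t ∈ mixed W ↔ Sum.inr t ∈ W := by
  change _ ∧ true = true ∨ _ ∧ false = true ↔ _
  simp

theorem mem_range_inl_or_mixed {S T : FB} {W : Set (sumFB S T)} {v : sumFB S T} (hv : v ∈ W) :
    v ∈ Set.range (Sum.inl : S → sumFB S T) ∨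
      v ∈ Set.range (Subtype.val : (sumFB S T).sub (mixed W) → sumFB S T) := by
  obtain s | t := v
  · exact Or.inl ⟨s, rfl⟩
  · rw [Subtype.range_val]
    exact Or.inr ((inr_mem_mixed t).2 hv)

open Classical in
/-- The colouring that agrees with `κ` on `W` and with `κ'` elsewhere. -/
def piecewise {V : Type} (W : Set V) (κ κ' : V → Bool) (v : V) : Bool :=
  if v ∈ W then κ v else κ' v

section

variable {p : ∀ {S T : FB}, (ob δ ε S ⟶ ob δ ε T) → Prop}

open Classical in
theorem generated_step {S T : FB} {r : Setoid (sumFB S T)} {κ : sumFB S T → Bool}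
    (hr : ∀ v w, r v w → κ v = κ w) {W W' : Set (sumFB S T)} {a : sumFB S T}
    (hW' : ∀ v, v ∈ W' ↔ v ∈ W ∨ r a v) (haW : ∀ v, r a v → v ∉ W) {κ' : sumFB S T → Bool}
    (hm : ∀ s, Sum.inl s ∈ W' → κ' (Sum.inl s) = κ (Sum.inl s)) :
    sk δ ε (restrictTo r W) (piecewise W κ κ') (T := (sumFB S T).sub (mixed W))
        Sum.inl Subtype.val ≫
      blockS δ ε (κ a) (mixed W) (mixed W') =
    sk δ ε (restrictTo r W') (piecewise W' κ κ') (T := (sumFB S T).sub (mixed W'))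
        Sum.inl Subtype.val := by
  have hb : ∀ v, v ∈ {v | r a v} ↔
      ¬ (v ∈ Set.range (Subtype.val : (sumFB S T).sub (mixed W) → sumFB S T) ↔
        v ∈ Set.range (Subtype.val : (sumFB S T).sub (mixed W') → sumFB S T)) := by
    intro v
    have h1 := hW' v
    have h2 := haW v
    rw [Subtype.range_val, Subtype.range_val, Set.mem_ofPred_eq]
    obtain s | t := v
    · rw [inl_mem_mixed, inl_mem_mixed]
      tauto
    · rw [inr_mem_mixed, inr_mem_mixed]
      tauto
  have hcol : ∀ v, r a v → piecewise W' κ κ' v = κ a := fun v h =>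
    (if_pos ((hW' v).2 (Or.inr h))).trans (hr a v h).symm
  have hcol' : ∀ v, ¬ r a v → piecewise W κ κ' v = piecewise W' κ κ' v := fun v h =>
    if_congr (by rw [hW', or_iff_left h]) rfl rfl
  have hinl : ∀ s, piecewise W κ κ' (Sum.inl s) = piecewise W' κ κ' (Sum.inl s) := fun s => by
    by_cases h : r a (Sum.inl s)
    · rw [hcol _ h, hr _ _ h, ← hm s ((hW' _).2 (Or.inr h))]
      exact if_neg (haW _ h)
    · exact hcol' _ h
  rw [sk_comp_block _ _ _ _ hb, if_neg, one_smul]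
  · refine sk_congr (fun x y => joinBlock_restrictTo r hW' haW _ _) (fun s => ?_) fun y => ?_
    · by_cases h : (Sum.inl s : sumFB S T) ∈
          Set.range (Subtype.val : (sumFB S T).sub (mixed W) → sumFB S T)
      · rw [recolour_of_mem h, hinl]
      · rw [recolour_of_notMem', hinl]
        rw [Subtype.range_val, inl_mem_mixed] at h ⊢
        exact fun h' => h fun h'' => h' ((hW' _).2 (Or.inl h''))
    · by_cases h : r a y.1
      · rw [hcol _ h, recolour_of_notMem _ ⟨y, rfl⟩]
        intro h'
        exact (hb y.1).1 h ⟨fun _ => ⟨y, rfl⟩, fun _ => h'⟩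
      · rw [recolour_of_mem, hcol' _ h]
        by_contra h'
        exact h ((hb y.1).2 fun h'' => h' (h''.2 ⟨y, rfl⟩))
  · intro h
    have h1 := h a ⟨a, Setoid.refl' r a, Or.inl rfl⟩
    obtain s | t := a
    · exact h1.1 ⟨s, rfl⟩
    · rw [Subtype.range_val, inr_mem_mixed, hW'] at h1
      exact h1.2 (Or.inr (Setoid.refl' r _))
  · rintro s ⟨y, hy⟩ h
    have h1 : (Sum.inl s : sumFB S T) ∈ mixed W' := by
      rw [show (Sum.inl s : sumFB S T) = y from h]
      exact hy
    rw [inl_mem_mixed, hW'] at h1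
    exact ⟨⟨Sum.inl s, (inl_mem_mixed s).2 fun h => h1 (Or.inl h)⟩, rfl⟩
  · rintro v w (h | ⟨_, h1, h2⟩)
    exacts [Or.inl h, Or.inr ⟨mem_range_inl_or_mixed h1, mem_range_inl_or_mixed h2⟩]
  · rintro v w (rfl | ⟨h, h1, h2⟩)
    · rfl
    · exact (if_pos h1).trans ((hr v w h).trans (if_pos h2).symm)
  · rintro ⟨v, hv⟩ ht
    have h1 : r a v := (hb v).2 fun h => ht (h.1 ⟨⟨v, hv⟩, rfl⟩)
    obtain s | t := v
    · rw [hinl, hcol _ h1]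
    · exact (haW _ h1 ((inr_mem_mixed t).1 hv)).elim

open Classical in
theorem exists_generated
    (hblock : ∀ (c : Bool) {V : FB} (X Y : Set V),
      p (blockS δ ε c X Y))
    (hofE : ∀ {S T : FB} (e : S ≃ T), p (ofE δ ε e))
    (hcomp : ∀ {S T U : FB} (f : ob δ ε S ⟶ ob δ ε T) (g : ob δ ε T ⟶ ob δ ε U),
      p f → p g → p (f ≫ g)) {S T : FB} {r : Setoid (sumFB S T)} {κ : sumFB S T → Bool}
    (hr : ∀ v w, r v w → κ v = κ w) (F : Finset (sumFB S T)) :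
    ∀ W : Set (sumFB S T), (∀ v, v ∈ W ↔ ∃ a ∈ F, r a v) →
      ∃ f : ob δ ε S ⟶ ob δ ε ((sumFB S T).sub (mixed W)), p f ∧ ∀ κ' : sumFB S T → Bool,
        sk δ ε ⊥ κ' (Sum.inl : S → sumFB S T) Sum.inl ≫ f =
          if ∀ s, Sum.inl s ∈ W → κ' (Sum.inl s) = κ (Sum.inl s) then
            sk δ ε (restrictTo r W) (piecewise W κ κ') (T := (sumFB S T).sub (mixed W))
              Sum.inl Subtype.val else 0 := by
  induction F using Finset.induction_on with
  | empty =>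
    intro W hW
    have hW' : ∀ v, v ∉ W := fun v hv => by
      obtain ⟨a, ha, _⟩ := (hW v).1 hv
      exact Finset.notMem_empty a ha
    obtain ⟨e, he⟩ := FBMod.exists_equiv_of_range (X := S) (S := sumFB S T) (i := Sum.inl)
      Sum.inl_injective (A := mixed W) (by
        rintro (s | t)
        · rw [inl_mem_mixed]
          exact ⟨fun _ => ⟨s, rfl⟩, fun _ => hW' _⟩
        · rw [inr_mem_mixed]
          exact ⟨fun h => (hW' _ h).elim, fun ⟨_, h⟩ => nomatch h⟩)
    have he' : ∀ y, Sum.inl (e.symm y) = y.1 := fun y => by rw [← he, e.apply_symm_apply]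
    refine ⟨ofE δ ε e, hofE e, fun κ' => ?_⟩
    rw [if_pos fun s hs => (hW' _ hs).elim, sk_comp_ofE]
    have hx : ∀ x, Sum.elim (Sum.inl : S → sumFB S T) (Sum.inl ∘ e.symm) x =
        Sum.elim Sum.inl Subtype.val x := by
      rintro (x | x)
      exacts [rfl, he' x]
    refine sk_congr (fun x y => ?_) (fun s => (if_neg (hW' _)).symm) fun y => ?_
    · rw [hx, hx, restrictTo_rel, or_iff_left fun h => hW' _ h.2.1]
      exact Iff.rfl
    · rw [Function.comp_apply, he']
      exact (if_neg (hW' _)).symm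
  | insert a F _ ih =>
    intro W' hW'
    obtain ⟨W, hW⟩ : ∃ W : Set (sumFB S T), ∀ v, v ∈ W ↔ ∃ a ∈ F, r a v :=
      ⟨{v | ∃ a ∈ F, r a v}, fun _ => Iff.rfl⟩
    obtain ⟨f, hf, hfκ⟩ := ih W hW
    have hWW' : ∀ v, v ∈ W' ↔ v ∈ W ∨ r a v := by
      intro v
      rw [hW', hW]
      simp only [Finset.mem_insert, exists_eq_or_imp]
      exact or_comm
    by_cases haW : a ∈ W
    · have hsat : ∀ v, r a v → v ∈ W := by
        intro v hv
        obtain ⟨a', ha', h⟩ := (hW a).1 haW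
        exact (hW v).2 ⟨a', ha', Setoid.trans' r h hv⟩
      obtain rfl : W' = W := Set.ext fun v => (hWW' v).trans
        ⟨fun h => h.elim id (hsat v), Or.inl⟩
      exact ⟨f, hf, hfκ⟩
    · have hdis : ∀ v, r a v → v ∉ W := by
        intro v hv hv'
        obtain ⟨a', ha', h⟩ := (hW v).1 hv'
        exact haW ((hW a).2 ⟨a', ha', Setoid.trans' r h (Setoid.symm' r hv)⟩)
      refine ⟨f ≫ blockS δ ε (κ a) (mixed W) (mixed W'), hcomp _ _ hf (hblock _ _ _),
        fun κ' => ?_⟩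
      rw [← Category.assoc, hfκ]
      by_cases hm : ∀ s, Sum.inl s ∈ W' → κ' (Sum.inl s) = κ (Sum.inl s)
      · rw [if_pos hm, if_pos fun s hs => hm s ((hWW' _).2 (Or.inl hs)),
          generated_step hr hWW' hdis hm]
      · rw [if_neg hm]
        by_cases hm' : ∀ s, Sum.inl s ∈ W → κ' (Sum.inl s) = κ (Sum.inl s)
        · rw [if_pos hm']
          push Not at hm
          obtain ⟨s, hs, hsc⟩ := hm
          have hsW : (Sum.inl s : sumFB S T) ∉ W := fun h => hsc (hm' s h)
          have has : r a (Sum.inl s) := ((hWW' _).1 hs).resolve_left hsW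
          refine sk_comp_block_eq_zero (t := ⟨Sum.inl s, (inl_mem_mixed s).2 hsW⟩) ?_ ?_
          · rw [Subtype.range_val, inl_mem_mixed, not_not]
            exact hs
          · rw [hr _ _ has]
            exact fun h => hsc ((if_neg hsW).symm.trans h)
        · rw [if_neg hm', Limits.zero_comp]

open Classical in
theorem star_induction
    (hblock : ∀ (c : Bool) {V : FB} (X Y : Set V),
      p (blockS δ ε c X Y))
    (hofE : ∀ {S T : FB} (e : S ≃ T), p (ofE δ ε e))
    (hcomp : ∀ {S T U : FB} (f : ob δ ε S ⟶ ob δ ε T) (g : ob δ ε T ⟶ ob δ ε U),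
      p f → p g → p (f ≫ g)) (h0 : ∀ {S T : FB}, p (0 : ob δ ε S ⟶ ob δ ε T))
    (hadd : ∀ {S T : FB} (f g : ob δ ε S ⟶ ob δ ε T), p f → p g → p (f + g))
    (hsmul : ∀ {S T : FB} (c : k) (f : ob δ ε S ⟶ ob δ ε T), p f → p (c • f)) {S T : FB}
    (f : ob δ ε S ⟶ ob δ ε T) : p f := by
  refine hom_induction (fun r κ hr => ?_) h0 hadd hsmul f
  have := Fintype.ofFinite (sumFB S T)
  obtain ⟨f, hf, hfκ⟩ := exists_generated hblock hofE hcomp hr Finset.univ Set.univ fun v =>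
    ⟨fun _ => ⟨v, Finset.mem_univ v, Setoid.refl' r v⟩, fun _ => Set.mem_univ v⟩
  obtain ⟨e, he⟩ := FBMod.exists_equiv_of_range (X := T) (S := sumFB S T) (i := Sum.inr)
    Sum.inr_injective (A := mixed Set.univ) (by
      rintro (s | t)
      · rw [inl_mem_mixed]
        exact ⟨fun h => (h (Set.mem_univ _)).elim, fun ⟨_, h⟩ => nomatch h⟩
      · rw [inr_mem_mixed]
        exact ⟨fun _ => ⟨t, rfl⟩, fun _ => Set.mem_univ _⟩)
  have hx : ∀ x, Sum.elim (Sum.inl : S → sumFB S T) (Subtype.val ∘ e) x =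
      Sum.elim Sum.inl Sum.inr x := by
    rintro (x | x)
    exacts [rfl, he x]
  have hfe : sk δ ε r κ Sum.inl Sum.inr = f ≫ ofE δ ε e.symm := by
    refine eq_of_sk_bot_comp (i := (Sum.inl : S → sumFB S T)) Sum.inl_injective fun κ' => ?_
    rw [← Category.assoc, hfκ]
    by_cases hm : ∀ s, κ' (Sum.inl s) = κ (Sum.inl s)
    · rw [if_pos fun s _ => hm s, sk_comp_ofE, sk_bot_comp_sk Sum.inl_injective hm]
      refine sk_congr (fun x y => ?_) (fun s => (if_pos (Set.mem_univ _)).symm) fun t => ?_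
      · rw [Equiv.symm_symm, hx, hx, restrictTo_rel]
        refine ⟨fun h => Or.inr ⟨h, Set.mem_univ _, Set.mem_univ _⟩, ?_⟩
        rintro (h | h)
        · rw [h]
        · exact h.1
      · rw [Equiv.symm_symm, Function.comp_apply, he]
        exact (if_pos (Set.mem_univ _)).symm
    · rw [if_neg fun h => hm fun s => h s (Set.mem_univ _), Limits.zero_comp]
      push Not at hm
      obtain ⟨s, hs⟩ := hm
      exact sk_bot_comp_sk_eq_zero (s := s) hs
  rw [hfe]
  exact hcomp _ _ hf (hofE _)

end

end PartStar
end

noncomputable section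

namespace FBMod

open PartDiag

variable {k : Type u} [CommRing k] {M : FBMod k} {d : Bool → k}

namespace BlockOps

/-- The sum of the values of `M` on all subsets of `V`. -/
abbrev Total (M : FBMod k) (V : FB) : Type u := ∀ X : Set V, M.val (V.sub X)

open Classical in
/-- The element of `Total M V` with a single component. -/
def one {V : FB} (X : Set V) : M.val (V.sub X) →ₗ[k] Total M V := LinearMap.single k (fun X : Set V => M.val (V.sub X)) X

theorem one_self {V : FB} (X : Set V) (x : M.val (V.sub X)) : one X x X = x := by
  unfold one
  rw [LinearMap.single_apply, Pi.single_eq_same]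

theorem one_ne {V : FB} {X Y : Set V} (h : Y ≠ X) (x : M.val (V.sub X)) :
    one X x Y = 0 := by
  unfold one
  rw [LinearMap.single_apply, Pi.single_eq_of_ne h]

theorem total_ext {V : FB} {f g : Total M V →ₗ[k] Total M V}
    (h : ∀ X x, f (one X x) = g (one X x)) : f = g := by
  classical
  refine LinearMap.pi_ext fun X x => ?_
  have := h X x
  unfold one at this
  rw [LinearMap.single_apply] at this
  convert this

/-- The sum of all operators `D c X Y` with `X \ Y ∪ Y \ X` a given set. -/
def step (B : BlockOps M d) {V : FB} (p : Bool × Set V) : Module.End k (Total M V) :=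
  LinearMap.pi fun X => B.D p.1 (symmDiff X p.2) X ∘ₗ LinearMap.proj (symmDiff X p.2)

theorem step_one (B : BlockOps M d) {V : FB} {c : Bool} {b X Y : Set V}
    (h : ∀ v, v ∈ b ↔ ¬ (v ∈ X ↔ v ∈ Y)) (x : M.val (V.sub X)) :
    B.step (c, b) (one X x) = one Y (B.D c X Y x) := by
  funext Z
  change B.D c (symmDiff Z b) Z (one X x (symmDiff Z b)) = _
  by_cases hZ : Z = Y
  · subst hZ
    obtain rfl : X = symmDiff Z b := Set.ext fun v => by
      rw [Set.mem_symmDiff, h]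
      tauto
    rw [one_self, one_self]
  · rw [one_ne hZ, one_ne, map_zero]
    rintro rfl
    refine hZ (Set.ext fun v => ?_)
    have := h v
    rw [Set.mem_symmDiff] at this
    tauto

theorem step_empty (B : BlockOps M d) {V : FB} {c : Bool} {b X : Set V} (hb : ∀ v, v ∉ b)
    (x : M.val (V.sub X)) : B.step (c, b) (one X x) = d c • one X x := by
  rw [B.step_one (fun v => ⟨fun h => (hb v h).elim, fun h => (h Iff.rfl).elim⟩), B.scalar, map_smul]

theorem step_comm (B : BlockOps M d) {V : FB} {p q : Bool × Set V} (h : ∀ v, v ∈ p.2 → v ∉ q.2) :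
    Commute (B.step p) (B.step q) := by
  obtain ⟨c, b⟩ := p
  obtain ⟨c', b'⟩ := q
  refine total_ext fun X x => ?_
  change B.step (c, b) (B.step (c', b') (one X x)) = B.step (c', b') (B.step (c, b) (one X x))
  have hX : ∀ v, v ∈ b → v ∉ b' := h
  rw [B.step_one (b := b') (Y := symmDiff X b') fun v => by rw [Set.mem_symmDiff]; tauto,
    B.step_one (b := b) (X := X) (Y := symmDiff X b) fun v => by rw [Set.mem_symmDiff]; tauto,
    B.step_one (Y := symmDiff (symmDiff X b) b') fun v => by
      have := hX v
      simp only [Set.mem_symmDiff]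
      tauto,
    B.step_one (Y := symmDiff (symmDiff X b) b') fun v => by
      simp only [Set.mem_symmDiff]
      tauto, B.comm]
  intro v
  have := hX v
  simp only [Set.mem_symmDiff]
  tauto

/-- The members of a finite set of coloured blocks are pairwise disjoint. -/
def Disj {V : FB} (H : Finset (Bool × Set V)) : Prop :=
  ∀ p ∈ H, ∀ q ∈ H, p ≠ q → ∀ v, v ∈ p.2 → v ∉ q.2

/-- The product of the operators for a finite set of coloured blocks. -/
def ops (B : BlockOps M d) {V : FB} (H : Finset (Bool × Set V)) : Module.End k (Total M V) :=
  (H.toList.map B.step).prod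

theorem ops_empty (B : BlockOps M d) {V : FB} : B.ops (∅ : Finset (Bool × Set V)) = 1 := by
  unfold ops
  rw [Finset.toList_empty, List.map_nil, List.prod_nil]

theorem ops_insert [∀ V : FB, DecidableEq (Bool × Set V)] (B : BlockOps M d) {V : FB}
    {p : Bool × Set V} {H : Finset (Bool × Set V)} (hp : p ∉ H) (hH : Disj (insert p H)) :
    B.ops (insert p H) = B.step p * B.ops H := by
  unfold ops
  rw [← List.prod_cons, ← List.map_cons]
  refine List.Perm.prod_eq' ((Finset.toList_insert hp).map _) ?_
  rw [List.pairwise_map]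
  refine (Finset.nodup_toList _).imp_of_mem fun {q q'} hq hq' hne => ?_
  rw [Finset.mem_toList] at hq hq'
  exact B.step_comm (hH q hq q' hq' hne)

theorem Disj.mono {V : FB} {H H' : Finset (Bool × Set V)} (hH : Disj H) (h : ∀ p ∈ H', p ∈ H) :
    Disj H' := fun p hp q hq => hH p (h p hp) q (h q hq)

theorem step_ops_comm (B : BlockOps M d) {V : FB} {p : Bool × Set V} {H : Finset (Bool × Set V)}
    (h : ∀ q ∈ H, ∀ v, v ∈ p.2 → v ∉ q.2) : Commute (B.step p) (B.ops H) := by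
  unfold ops
  refine Commute.list_prod_right _ _ fun f hf => ?_
  obtain ⟨q, hq, rfl⟩ := List.mem_map.1 hf
  exact B.step_comm (h q (Finset.mem_toList.1 hq))

theorem ops_union [∀ V : FB, DecidableEq (Bool × Set V)] (B : BlockOps M d) {V : FB}
    {H H' : Finset (Bool × Set V)} (hd : ∀ p ∈ H, p ∉ H') (hH : Disj (H ∪ H')) :
    B.ops (H ∪ H') = B.ops H * B.ops H' := by
  induction H using Finset.induction_on with
  | empty => rw [Finset.empty_union, ops_empty, one_mul]
  | insert p H hp ih =>
    rw [Finset.insert_union] at hH ⊢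
    rw [ops_insert B _ hH, ih (fun q hq => hd q (Finset.mem_insert_of_mem hq))
      (hH.mono fun q hq => Finset.mem_insert_of_mem hq), ops_insert B hp (hH.mono fun q hq => ?_),
      mul_assoc]
    · rw [Finset.mem_insert] at hq ⊢
      exact hq.imp id fun h => Finset.mem_union_left _ h
    · rw [Finset.mem_union]
      exact fun h => h.elim hp (hd p (Finset.mem_insert_self _ _))

theorem exists_ops_one [∀ V : FB, DecidableEq (Bool × Set V)] (B : BlockOps M d) {V : FB}
    {H : Finset (Bool × Set V)} (hH : Disj H)
    {X Y : Set V} (hY : ∀ v, v ∈ Y ↔ ¬ (v ∈ X ↔ ∃ p ∈ H, v ∈ p.2)) (x : M.val (V.sub X)) :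
    ∃ y, B.ops H (one X x) = one Y y := by
  induction H using Finset.induction_on generalizing Y with
  | empty =>
    obtain rfl : Y = X := Set.ext fun v => by
      rw [hY]
      simp
    exact ⟨x, by rw [ops_empty]; rfl⟩
  | insert p H hp ih =>
    obtain ⟨Y', hY'⟩ : ∃ Y' : Set V, ∀ v, v ∈ Y' ↔ ¬ (v ∈ X ↔ ∃ p ∈ H, v ∈ p.2) :=
      ⟨{v | ¬ (v ∈ X ↔ ∃ p ∈ H, v ∈ p.2)}, fun _ => Iff.rfl⟩
    obtain ⟨y, hy⟩ := ih (hH.mono fun q hq => Finset.mem_insert_of_mem hq) hY'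
    refine ⟨B.D p.1 Y' Y y, ?_⟩
    rw [ops_insert B hp hH, Module.End.mul_apply, hy]
    refine B.step_one (c := p.1) (b := p.2) (fun v => ?_) y
    have h1 : v ∈ p.2 → ¬ ∃ q ∈ H, v ∈ q.2 := fun hv ⟨q, hq, hv'⟩ =>
      hH p (Finset.mem_insert_self _ _) q (Finset.mem_insert_of_mem hq)
        (fun h => hp (h ▸ hq)) v hv hv'
    rw [hY', hY]
    simp only [Finset.mem_insert, exists_eq_or_imp]
    generalize (∃ q ∈ H, v ∈ q.2) = E at *
    tauto

theorem step_ops_one [∀ V : FB, DecidableEq (Bool × Set V)] (B : BlockOps M d) {V : FB}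
    {H : Finset (Bool × Set V)} (hH : Disj H)
    {c : Bool} {X b b' : Set V} (hc : ∀ p ∈ H, p.1 = c) (hne : ∀ p ∈ H, ∃ v ∈ p.2, v ∈ b)
    (hX : ∀ p ∈ H, ∀ v ∈ p.2, v ∈ b → v ∉ X)
    (hb' : ∀ v, v ∈ b' ↔ ¬ (v ∈ b ↔ ∃ p ∈ H, v ∈ p.2)) (x : M.val (V.sub X)) :
    B.step (c, b) (B.ops H (one X x)) = B.step (c, b') (one X x) := by
  induction H using Finset.induction_on generalizing b with
  | empty =>
    obtain rfl : b' = b := Set.ext fun v => by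
      rw [hb']
      simp
    rw [ops_empty]
    rfl
  | insert p H hp ih =>
    have hdis : ∀ v, v ∈ p.2 → ∀ q ∈ H, v ∉ q.2 := fun v hv q hq =>
      hH p (Finset.mem_insert_self _ _) q (Finset.mem_insert_of_mem hq) (fun h => hp (h ▸ hq)) v hv
    have hH' := hH.mono (H' := H) fun q hq => Finset.mem_insert_of_mem hq
    obtain ⟨Y, hY⟩ : ∃ Y : Set V, ∀ v, v ∈ Y ↔ ¬ (v ∈ X ↔ ∃ p ∈ H, v ∈ p.2) :=
      ⟨{v | ¬ (v ∈ X ↔ ∃ p ∈ H, v ∈ p.2)}, fun _ => Iff.rfl⟩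
    have hYX : ∀ v, v ∈ p.2 → (v ∈ Y ↔ v ∈ X) := fun v hv => by
      have : ¬ ∃ q ∈ H, v ∈ q.2 := fun ⟨q, hq, h⟩ => hdis v hv q hq h
      rw [hY]
      tauto
    have hstep : B.step (c, b) (B.step p (B.ops H (one X x))) =
        B.step (c, symmDiff b p.2) (B.ops H (one X x)) := by
      obtain ⟨y, hy⟩ := B.exists_ops_one hH' hY x
      obtain ⟨c', q⟩ := p
      obtain rfl : c' = c := hc _ (Finset.mem_insert_self _ _)
      obtain ⟨v, hv, hvb⟩ := hne _ (Finset.mem_insert_self _ _)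
      have hvX := hX _ (Finset.mem_insert_self _ _) v hv hvb
      rw [hy, B.step_one (Y := symmDiff Y q) fun v => by rw [Set.mem_symmDiff]; tauto,
        B.step_one (Y := symmDiff (symmDiff Y q) b) fun v => by
          simp only [Set.mem_symmDiff]; tauto,
        B.step_one (Y := symmDiff (symmDiff Y q) b) fun v => by
          simp only [Set.mem_symmDiff]; tauto, B.merge]
      · refine ⟨v, fun h => hvX ((hYX v hv).1 h), ?_, ?_⟩
        · rw [Set.mem_symmDiff]
          exact Or.inr ⟨hv, fun h => hvX ((hYX v hv).1 h)⟩
        · have := (hYX v hv).not.2 hvX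
          simp only [Set.mem_symmDiff]
          have hv' : v ∈ q := hv
          tauto
      · intro w hw hw'
        by_cases hwq : w ∈ q
        · have h1 := (hYX w hwq).1 hw
          have h2 : w ∉ b := fun h => hX _ (Finset.mem_insert_self _ _) w hwq h h1
          simp only [Set.mem_symmDiff] at hw' ⊢
          tauto
        · rw [Set.mem_symmDiff]
          exact Or.inl ⟨hw, hwq⟩
    rw [ops_insert B hp hH, Module.End.mul_apply, hstep]
    refine ih hH' (fun q hq => hc q (Finset.mem_insert_of_mem hq)) (fun q hq => ?_)
      (fun q hq v hv hvb => ?_) fun v => ?_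
    · obtain ⟨v, hv, hvb⟩ := hne q (Finset.mem_insert_of_mem hq)
      refine ⟨v, hv, ?_⟩
      rw [Set.mem_symmDiff]
      exact Or.inl ⟨hvb, fun h => hdis v h q hq hv⟩
    · refine hX q (Finset.mem_insert_of_mem hq) v hv ?_
      rw [Set.mem_symmDiff] at hvb
      exact hvb.elim (fun h => h.1) fun h => (hdis v h.1 q hq hv).elim
    · have h1 : v ∈ p.2 → ¬ ∃ q ∈ H, v ∈ q.2 := fun hv ⟨q, hq, h⟩ => hdis v hv q hq h
      rw [hb', Set.mem_symmDiff]
      simp only [Finset.mem_insert, exists_eq_or_imp]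
      generalize (∃ q ∈ H, v ∈ q.2) = E at *
      tauto

open Classical in
/-- The coloured blocks of the partition that `r` induces on `P`. -/
def blocks {V : FB} (r : Setoid V) (κ : V → Bool) (P : Set V) : Finset (Bool × Set V) :=
  Finset.univ.filter fun p => ∃ v ∈ P, p = (κ v, {w | w ∈ P ∧ r v w})

open Classical in
theorem mem_blocks {V : FB} {r : Setoid V} {κ : V → Bool} {P : Set V} {p : Bool × Set V} :
    p ∈ blocks r κ P ↔ ∃ v ∈ P, p = (κ v, {w | w ∈ P ∧ r v w}) := by
  unfold blocks
  rw [Finset.mem_filter]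
  exact and_iff_right (Finset.mem_univ p)

theorem blocks_eq {V : FB} {r : Setoid V} {κ : V → Bool} {P : Set V}
    (hκ : ∀ v ∈ P, ∀ w ∈ P, r v w → κ v = κ w) {v w : V} (hv : v ∈ P) (hw : w ∈ P) (h : r v w) :
    ((κ v, {u | u ∈ P ∧ r v u}) : Bool × Set V) = (κ w, {u | u ∈ P ∧ r w u}) := by
  rw [hκ v hv w hw h]
  refine congrArg _ (Set.ext fun u => and_congr_right fun _ => ?_)
  exact ⟨fun h' => Setoid.trans' r (Setoid.symm' r h) h', fun h' => Setoid.trans' r h h'⟩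

theorem disj_blocks {V : FB} {r : Setoid V} {κ : V → Bool} {P : Set V}
    (hκ : ∀ v ∈ P, ∀ w ∈ P, r v w → κ v = κ w) : Disj (blocks r κ P) := by
  rintro p hp q hq hne u hu hu'
  obtain ⟨v, hv, rfl⟩ := mem_blocks.1 hp
  obtain ⟨w, hw, rfl⟩ := mem_blocks.1 hq
  exact hne (blocks_eq hκ hv hw (Setoid.trans' r hu.2 (Setoid.symm' r hu'.2)))

theorem exists_mem_blocks {V : FB} {r : Setoid V} {κ : V → Bool} {P : Set V} (v : V) :
    (∃ p ∈ blocks r κ P, v ∈ p.2) ↔ v ∈ P := by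
  constructor
  · rintro ⟨p, hp, hv⟩
    obtain ⟨w, hw, rfl⟩ := mem_blocks.1 hp
    exact hv.1
  · exact fun hv => ⟨_, mem_blocks.2 ⟨v, hv, rfl⟩, hv, Setoid.refl' r v⟩

/-- The operator of a coloured partition of `X ⊔ Y`. -/
def opP (B : BlockOps M d) {V : FB} (r : Setoid V) (κ : V → Bool) (X Y : Set V) :
    M.val (V.sub X) →ₗ[k] M.val (V.sub Y) :=
  LinearMap.proj Y ∘ₗ B.ops (blocks r κ (X ∪ Y)) ∘ₗ one X

theorem ops_blocks_one (B : BlockOps M d) {V : FB} {r : Setoid V} {κ : V → Bool} {X Y : Set V}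
    (hXY : ∀ v, v ∈ X → v ∉ Y) (hκ : ∀ v ∈ X ∪ Y, ∀ w ∈ X ∪ Y, r v w → κ v = κ w)
    (x : M.val (V.sub X)) : B.ops (blocks r κ (X ∪ Y)) (one X x) = one Y (B.opP r κ X Y x) := by
  classical
  obtain ⟨y, hy⟩ := B.exists_ops_one (disj_blocks hκ) (X := X) (Y := Y) (fun v => by
    rw [exists_mem_blocks, Set.mem_union]
    have := hXY v
    tauto) x
  have : B.opP r κ X Y x = y := by
    change B.ops (blocks r κ (X ∪ Y)) (one X x) Y = y
    rw [hy, one_self]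
  rw [this, hy]

theorem one_injective {V : FB} {X : Set V} {x y : M.val (V.sub X)} (h : one X x = one X y) :
    x = y := by
  rw [← one_self X x, h, one_self]

end BlockOps

end FBMod
end

noncomputable section

namespace FBMod

open PartDiag

variable {k : Type u} [CommRing k] {M : FBMod k} {d : Bool → k}

namespace BlockOps

theorem D_opP_eq_zero (B : BlockOps M d) {V : FB} {r : Setoid V} {κ : V → Bool} {c : Bool}
    {X Y Z : Set V} (hXY : ∀ v, v ∈ X → v ∉ Y) (hXZ : ∀ v, v ∈ X → v ∉ Z)
    (hκ : ∀ v ∈ X ∪ Y, ∀ w ∈ X ∪ Y, r v w → κ v = κ w) {w : V} (hw : w ∈ Y) (hwZ : w ∉ Z)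
    (hwc : κ w ≠ c) (x : M.val (V.sub X)) : B.D c Y Z (B.opP r κ X Y x) = 0 := by
  classical
  set H := blocks r κ (X ∪ Y) with hH
  have hd : Disj H := disj_blocks hκ
  set p : Bool × Set V := (κ w, {u | u ∈ X ∪ Y ∧ r w u}) with hp
  have hpH : p ∈ H := mem_blocks.2 ⟨w, Or.inr hw, rfl⟩
  have hwp : w ∈ p.2 := ⟨Or.inr hw, Setoid.refl' r w⟩
  have hdis : ∀ q ∈ H.erase p, ∀ v, v ∈ p.2 → v ∉ q.2 := fun q hq =>
    hd p hpH q (Finset.mem_of_mem_erase hq) (Finset.ne_of_mem_erase hq).symm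
  obtain ⟨Y', hY'⟩ : ∃ Y' : Set V, ∀ v, v ∈ Y' ↔ ¬ (v ∈ X ↔ ∃ q ∈ H.erase p, v ∈ q.2) :=
    ⟨{v | ¬ (v ∈ X ↔ ∃ q ∈ H.erase p, v ∈ q.2)}, fun _ => Iff.rfl⟩
  have hd' := hd.mono (H' := H.erase p) fun q hq => Finset.mem_of_mem_erase hq
  obtain ⟨y, hy⟩ := B.exists_ops_one hd' hY' x
  have hins : insert p (H.erase p) = H := Finset.insert_erase hpH
  have h1 : one Y (B.opP r κ X Y x) = B.step p (one Y' y) := by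
    rw [← B.ops_blocks_one hXY hκ, ← hH, ← hy, ← Module.End.mul_apply, ← B.ops_insert
      (Finset.notMem_erase p H) (hd.mono fun q hq => by rwa [hins] at hq), hins]
  have hYp : ∀ v, v ∈ p.2 ↔ ¬ (v ∈ Y' ↔ v ∈ Y) := by
    intro v
    have h2 : (∃ q ∈ H, v ∈ q.2) ↔ v ∈ X ∪ Y := exists_mem_blocks v
    rw [← hins] at h2
    simp only [Finset.mem_insert, exists_eq_or_imp, Set.mem_union] at h2
    have h3 : v ∈ p.2 → ¬ ∃ q ∈ H.erase p, v ∈ q.2 := fun hv ⟨q, hq, h⟩ => hdis q hq v hv h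
    have h4 := hXY v
    rw [hY']
    generalize (∃ q ∈ H.erase p, v ∈ q.2) = E at *
    tauto
  have hY'' : ∀ v, v ∈ p.2 → (v ∈ Y' ↔ v ∈ X) := fun v hv => by
    have : ¬ ∃ q ∈ H.erase p, v ∈ q.2 := fun ⟨q, hq, h⟩ => hdis q hq v hv h
    rw [hY']
    tauto
  have h2 : B.opP r κ X Y x = B.D (κ w) Y' Y y := by
    refine one_injective (h1.trans ?_)
    exact B.step_one (c := κ w) hYp y
  rw [h2]
  refine B.zero hwc.symm ⟨w, fun h => ?_, hw, hwZ⟩ (fun v hv hv' => ?_) y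
  · exact hXY w ((hY'' w hwp).1 h) hw
  · by_contra h
    have hvp : v ∈ p.2 := (hYp v).2 fun h' => h (h'.1 hv)
    exact hXZ v ((hY'' v hvp).1 hv) hv'

open Classical in
theorem D_opP (B : BlockOps M d) {V : FB} {r : Setoid V} {κ κ' : V → Bool} {c : Bool}
    {X Y Z b : Set V} (hXY : ∀ v, v ∈ X → v ∉ Y) (hXZ : ∀ v, v ∈ X → v ∉ Z)
    (hr : ∀ v w, r v w → v = w ∨ v ∈ X ∪ Y ∧ w ∈ X ∪ Y)
    (hκ : ∀ v w, r v w → κ v = κ w) (hc : ∀ v, v ∈ Y → v ∉ Z → κ v = c)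
    (hκ' : ∀ v, v ∈ X ∪ Y → κ' v = κ v) (hκ'c : ∀ v, v ∈ Z → v ∉ Y → κ' v = c)
    (hb : ∀ v, v ∈ b ↔ ¬ (v ∈ Y ↔ v ∈ Z)) (x : M.val (V.sub X)) :
    B.D c Y Z (B.opP r κ X Y x) =
      (if ∀ v, (∃ u ∈ b, r v u) → v ∉ X ∧ v ∉ Z then d c else 1) •
        B.opP (joinBlock r b) κ' X Z x := by
  have hκP : ∀ v ∈ X ∪ Y, ∀ w ∈ X ∪ Y, r v w → κ v = κ w := fun v _ w _ => hκ v w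
  have hbκ : ∀ v, v ∈ X ∪ Z → (∃ u ∈ b, r v u) → κ' v = c := by
    rintro v hv ⟨u, hu, hvu⟩
    have hu' := (hb u).1 hu
    by_cases hvP : v ∈ X ∪ Y
    · rw [hκ' v hvP, hκ v u hvu]
      refine hc u ?_ ?_ <;>
      · have : u ∈ X ∪ Y := by
          obtain rfl | h := hr v u hvu
          exacts [hvP, h.2]
        have := hXZ u
        have h3 : u ∈ X ∨ u ∈ Y := ‹_›
        tauto
    · rw [Set.mem_union] at hvP hv
      exact hκ'c v (by tauto) (by tauto)
  have hjκ : ∀ v ∈ X ∪ Z, ∀ w ∈ X ∪ Z, joinBlock r b v w → κ' v = κ' w := by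
    rintro v hv w hw (h | ⟨h, h'⟩)
    · obtain rfl | ⟨h1, h2⟩ := hr v w h
      · rfl
      · rw [hκ' v h1, hκ' w h2, hκ v w h]
    · rw [hbκ v hv h, hbκ w hw h']
  set H := blocks r κ (X ∪ Y) with hH
  have hd : Disj H := disj_blocks hκP
  set hit : Finset (Bool × Set V) := H.filter fun p => ∃ v ∈ p.2, v ∈ b with hhit
  set rest : Finset (Bool × Set V) := H.filter fun p => ¬ ∃ v ∈ p.2, v ∈ b with hrest
  have hHu : rest ∪ hit = H := by
    rw [Finset.union_comm]
    exact Finset.filter_union_filter_not_eq _ _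
  have hdis : ∀ p ∈ rest, p ∉ hit := fun p hp hp' =>
    (Finset.mem_filter.1 hp).2 (Finset.mem_filter.1 hp').2
  have hops : B.ops H = B.ops rest * B.ops hit := by
    rw [← hHu]
    exact B.ops_union hdis (by rwa [hHu])
  have hcomm : Commute (B.step (c, b)) (B.ops rest) := B.step_ops_comm fun q hq v hv hv' =>
    (Finset.mem_filter.1 hq).2 ⟨v, hv', hv⟩
  have hdhit : Disj hit := hd.mono fun p hp => (Finset.mem_filter.1 hp).1
  have hdrest : Disj rest := hd.mono fun p hp => (Finset.mem_filter.1 hp).1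
  have hmemhit : ∀ v, (∃ p ∈ hit, v ∈ p.2) ↔ v ∈ X ∪ Y ∧ ∃ u ∈ b, u ∈ X ∪ Y ∧ r v u := by
    intro v
    constructor
    · rintro ⟨p, hp, hv⟩
      obtain ⟨hpH, u, hu, hub⟩ := Finset.mem_filter.1 hp
      obtain ⟨w, hw, rfl⟩ := mem_blocks.1 hpH
      exact ⟨hv.1, u, hub, hu.1, Setoid.trans' r (Setoid.symm' r hv.2) hu.2⟩
    · rintro ⟨hv, u, hub, hu, hvu⟩
      exact ⟨_, Finset.mem_filter.2 ⟨mem_blocks.2 ⟨v, hv, rfl⟩, u, ⟨hu, hvu⟩, hub⟩, hv,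
        Setoid.refl' r v⟩
  obtain ⟨b', hb'⟩ : ∃ b' : Set V, ∀ v, v ∈ b' ↔ v ∈ X ∪ Z ∧ ∃ u ∈ b, r v u :=
    ⟨{v | v ∈ X ∪ Z ∧ ∃ u ∈ b, r v u}, fun _ => Iff.rfl⟩
  have htel : B.step (c, b) (B.ops hit (one X x)) = B.step (c, b') (one X x) := by
    refine B.step_ops_one hdhit (fun p hp => ?_) (fun p hp => (Finset.mem_filter.1 hp).2)
      (fun p hp v hv hvb hvX => ?_) (fun v => ?_) x
    · obtain ⟨hpH, u, hu, hub⟩ := Finset.mem_filter.1 hp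
      obtain ⟨w, hw, rfl⟩ := mem_blocks.1 hpH
      change κ w = c
      rw [hκ w u hu.2]
      have h1 := (hb u).1 hub
      have h2 : u ∈ X ∨ u ∈ Y := hu.1
      have h3 := hXZ u
      have h4 := hXY u
      exact hc u (by tauto) (by tauto)
    · have h1 := (hb v).1 hvb
      have h3 := hXZ v hvX
      have h4 := hXY v hvX
      tauto
    · rw [hb', hmemhit]
      by_cases hvb : v ∈ b
      · have hex : ∃ u ∈ b, r v u := ⟨v, hvb, Setoid.refl' r v⟩
        have h1 := (hb v).1 hvb
        have h3 := hXZ v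
        have h4 := hXY v
        have hex' : v ∈ X ∪ Y → ∃ u ∈ b, u ∈ X ∪ Y ∧ r v u := fun h =>
          ⟨v, hvb, h, Setoid.refl' r v⟩
        rw [and_iff_left hex, and_iff_left_of_imp hex', Set.mem_union, Set.mem_union]
        tauto
      · have hex : (∃ u ∈ b, r v u) ↔ ∃ u ∈ b, u ∈ X ∪ Y ∧ r v u := by
          constructor
          · rintro ⟨u, hu, hvu⟩
            obtain rfl | h := hr v u hvu
            exacts [(hvb hu).elim, ⟨u, hu, h.2, hvu⟩]
          · rintro ⟨u, hu, _, hvu⟩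
            exact ⟨u, hu, hvu⟩
        have h1 := (hb v).not.1 hvb
        rw [hex, iff_false_left hvb, not_not, Set.mem_union, Set.mem_union]
        have : v ∈ Y ↔ v ∈ Z := by tauto
        rw [this]
  have hmain : B.step (c, b) (B.ops H (one X x)) = B.ops rest (B.step (c, b') (one X x)) := by
    rw [hops, Module.End.mul_apply, ← htel, ← Module.End.mul_apply, hcomm.eq,
      Module.End.mul_apply]
  have hmemrest : ∀ p, p ∈ rest ↔ ∃ v ∈ X ∪ Z, (¬ ∃ u ∈ b, r v u) ∧
      p = (κ' v, {w | w ∈ X ∪ Z ∧ joinBlock r b v w}) := by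
    have hPQ : ∀ v, v ∉ b → (v ∈ X ∪ Y ↔ v ∈ X ∪ Z) := fun v hv => by
      have h1 := (hb v).not.1 hv
      have : v ∈ Y ↔ v ∈ Z := by tauto
      rw [Set.mem_union, Set.mem_union, this]
    have hnb : ∀ v, (¬ ∃ u ∈ b, r v u) → v ∉ b := fun v h h' => h ⟨v, h', Setoid.refl' r v⟩
    have hset : ∀ v, v ∈ X ∪ Y → (¬ ∃ u ∈ b, r v u) →
        ((κ v, {w | w ∈ X ∪ Y ∧ r v w}) : Bool × Set V) =
          (κ' v, {w | w ∈ X ∪ Z ∧ joinBlock r b v w}) := by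
      intro v hv hn
      rw [hκ' v hv]
      refine congrArg _ (Set.ext fun w => ?_)
      change _ ∧ _ ↔ _ ∧ (_ ∨ _)
      rw [or_iff_left fun h => hn h.1]
      refine and_congr_left fun h => hPQ w fun hw => hn ⟨w, hw, h⟩
    intro p
    constructor
    · intro hp
      obtain ⟨hpH, hn⟩ := Finset.mem_filter.1 hp
      obtain ⟨v, hv, rfl⟩ := mem_blocks.1 hpH
      have hn' : ¬ ∃ u ∈ b, r v u := by
        rintro ⟨u, hu, hvu⟩
        obtain rfl | h := hr v u hvu
        · exact hn ⟨v, ⟨hv, Setoid.refl' r v⟩, hu⟩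
        · exact hn ⟨u, ⟨h.2, hvu⟩, hu⟩
      exact ⟨v, (hPQ v (hnb v hn')).1 hv, hn', hset v hv hn'⟩
    · rintro ⟨v, hv, hn, rfl⟩
      have hv' := (hPQ v (hnb v hn)).2 hv
      rw [← hset v hv' hn]
      refine Finset.mem_filter.2 ⟨mem_blocks.2 ⟨v, hv', rfl⟩, ?_⟩
      rintro ⟨u, hu, hub⟩
      exact hn ⟨u, hub, hu.2⟩
  have hblocks : ∀ p, p ∈ blocks (joinBlock r b) κ' (X ∪ Z) ↔
      (b' ≠ ∅ ∧ p = (c, b')) ∨ p ∈ rest := by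
    intro p
    have hset : ∀ v, v ∈ X ∪ Z → (∃ u ∈ b, r v u) →
        ((κ' v, {w | w ∈ X ∪ Z ∧ joinBlock r b v w}) : Bool × Set V) = (c, b') := by
      intro v hv hh
      rw [hbκ v hv hh]
      refine congrArg _ (Set.ext fun w => ?_)
      rw [hb']
      refine and_congr_right fun _ => ⟨?_, fun h => Or.inr ⟨hh, h⟩⟩
      rintro (h | h)
      · obtain ⟨u, hu, hvu⟩ := hh
        exact ⟨u, hu, Setoid.trans' r (Setoid.symm' r h) hvu⟩
      · exact h.2
    rw [mem_blocks, hmemrest]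
    constructor
    · rintro ⟨v, hv, rfl⟩
      by_cases hh : ∃ u ∈ b, r v u
      · exact Or.inl ⟨Set.nonempty_iff_ne_empty.1 ⟨v, (hb' v).2 ⟨hv, hh⟩⟩, hset v hv hh⟩
      · exact Or.inr ⟨v, hv, hh, rfl⟩
    · rintro (⟨hne, rfl⟩ | ⟨v, hv, _, rfl⟩)
      · obtain ⟨v, hv⟩ := Set.nonempty_iff_ne_empty.2 hne
        obtain ⟨h1, h2⟩ := (hb' v).1 hv
        exact ⟨v, h1, (hset v h1 h2).symm⟩
      · exact ⟨v, hv, rfl⟩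
  have hb'e : (∀ v, (∃ u ∈ b, r v u) → v ∉ X ∧ v ∉ Z) ↔ b' = ∅ := by
    rw [Set.eq_empty_iff_forall_notMem]
    refine forall_congr' fun v => ?_
    rw [hb', Set.mem_union]
    generalize (∃ u ∈ b, r v u) = E
    tauto
  refine one_injective ?_
  rw [← B.step_one hb, ← B.ops_blocks_one hXY hκP, ← hH, hmain, map_smul,
    ← B.ops_blocks_one hXZ hjκ]
  by_cases hbe : b' = ∅
  · rw [if_pos (hb'e.2 hbe), B.step_empty (fun v hv => by rw [hbe] at hv; exact hv), map_smul]
    congr 3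
    ext p
    rw [hblocks, or_iff_right fun h => h.1 hbe]
  · have hins : blocks (joinBlock r b) κ' (X ∪ Z) = insert (c, b') rest := by
      ext p
      rw [hblocks, Finset.mem_insert, and_iff_right hbe]
    have hb'rest : ∀ q ∈ rest, ∀ v, v ∈ b' → v ∉ q.2 := by
      intro q hq v hv hvq
      obtain ⟨w, hw, hn, rfl⟩ := (hmemrest q).1 hq
      obtain ⟨_, u, hu, hvu⟩ := (hb' v).1 hv
      obtain h | h := hvq.2
      · exact hn ⟨u, hu, Setoid.trans' r h hvu⟩
      · exact hn h.1
    have hnm : (c, b') ∉ rest := fun h => by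
      obtain ⟨v, hv⟩ := Set.nonempty_iff_ne_empty.2 hbe
      exact hb'rest _ h v hv hv
    rw [if_neg fun h => hbe (hb'e.1 h), one_smul, hins, B.ops_insert hnm (by
      rw [← hins]
      exact disj_blocks hjκ), (B.step_ops_comm hb'rest).eq, Module.End.mul_apply]

theorem ops_map [∀ V : FB, DecidableEq (Bool × Set V)] (B : BlockOps M d) {V V' : FB} {φ : V → V'}
    (hφ : Function.Injective φ) {H : Finset (Bool × Set V)} (hH : Disj H) {X Y : Set V}
    {X' Y' : Set V'} (a : V.sub X ≃ V'.sub X') (e : V.sub Y ≃ V'.sub Y')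
    (ha : ∀ x, (a x).1 = φ x.1) (he : ∀ y, (e y).1 = φ y.1)
    (hY : ∀ v, v ∈ Y ↔ ¬ (v ∈ X ↔ ∃ p ∈ H, v ∈ p.2)) {x : M.val (V.sub X)} {y : M.val (V.sub Y)}
    (h : B.ops H (one X x) = one Y y) :
    B.ops (H.image (Prod.map id (φ '' ·))) (one X' (M.act a x)) = one Y' (M.act e y) := by
  have hinj : Function.Injective (Prod.map id (φ '' ·) : Bool × Set V → Bool × Set V') :=
    Function.injective_id.prodMap hφ.image_injective
  induction H using Finset.induction_on generalizing Y Y' with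
  | empty =>
    obtain rfl : Y = X := Set.ext fun v => by
      rw [hY]
      simp
    obtain rfl : x = y := one_injective (by rw [← h, ops_empty]; rfl)
    have hXY' : X' = Y' := by
      ext v
      constructor
      · intro hv
        obtain ⟨x, hx⟩ := a.surjective ⟨v, hv⟩
        have h1 := (e x).2
        rw [he, ← ha, hx] at h1
        exact h1
      · intro hv
        obtain ⟨x, hx⟩ := e.surjective ⟨v, hv⟩
        have h1 := (a x).2
        rw [ha, ← he, hx] at h1
        exact h1
    subst hXY'
    rw [Finset.image_empty, ops_empty]
    obtain rfl : a = e := Equiv.ext fun x => Subtype.ext ((ha x).trans (he x).symm)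
    rfl
  | insert p H hp ih =>
    have hdis : ∀ v, v ∈ p.2 → ∀ q ∈ H, v ∉ q.2 := fun v hv q hq =>
      hH p (Finset.mem_insert_self _ _) q (Finset.mem_insert_of_mem hq) (fun h => hp (h ▸ hq)) v hv
    have hH' := hH.mono (H' := H) fun q hq => Finset.mem_insert_of_mem hq
    obtain ⟨Z, hZ⟩ : ∃ Z : Set V, ∀ v, v ∈ Z ↔ ¬ (v ∈ X ↔ ∃ p ∈ H, v ∈ p.2) :=
      ⟨{v | ¬ (v ∈ X ↔ ∃ p ∈ H, v ∈ p.2)}, fun _ => Iff.rfl⟩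
    have hpZ : ∀ v, v ∈ p.2 ↔ ¬ (v ∈ Z ↔ v ∈ Y) := by
      intro v
      have h1 : v ∈ p.2 → ¬ ∃ q ∈ H, v ∈ q.2 := fun hv ⟨q, hq, h⟩ => hdis v hv q hq h
      rw [hZ, hY]
      simp only [Finset.mem_insert, exists_eq_or_imp]
      generalize (∃ q ∈ H, v ∈ q.2) = E at *
      tauto
    obtain ⟨z, hz⟩ := B.exists_ops_one hH' hZ x
    obtain ⟨e', he'⟩ := exists_image_equiv hφ Z
    have hih := ih hH' e' he' hZ hz
    have hdimg : Disj ((insert p H).image (Prod.map id (φ '' ·))) := by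
      intro q hq q' hq' hne v hv hv'
      obtain ⟨q₁, hq₁, rfl⟩ := Finset.mem_image.1 hq
      obtain ⟨q₂, hq₂, rfl⟩ := Finset.mem_image.1 hq'
      obtain ⟨w, hw, rfl⟩ := hv
      obtain ⟨w', hw', hww⟩ := hv'
      obtain rfl := hφ hww
      exact hH q₁ hq₁ q₂ hq₂ (fun h => hne (by rw [h])) _ hw hw'
    obtain rfl : y = B.D p.1 Z Y z := one_injective (by
      rw [← h, B.ops_insert hp hH, Module.End.mul_apply, hz]
      exact B.step_one hpZ z)
    have hY' : Y' = φ '' Y := by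
      ext v
      constructor
      · intro hv
        obtain ⟨x, hx⟩ := e.surjective ⟨v, hv⟩
        exact ⟨x.1, x.2, by rw [← he, hx]⟩
      · rintro ⟨w, hw, rfl⟩
        have := (e ⟨w, hw⟩).2
        rwa [he] at this
    subst hY'
    rw [Finset.image_insert] at hdimg ⊢
    rw [B.ops_insert (fun h => hp (by
        obtain ⟨q, hq, hqp⟩ := Finset.mem_image.1 h
        rwa [← hinj hqp])) hdimg, Module.End.mul_apply, hih, ← B.nat p.1 hφ e' e he' he z]
    refine B.step_one (c := p.1) (b := φ '' p.2) (fun v => ?_) _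
    by_cases hv : ∃ w, φ w = v
    · obtain ⟨w, rfl⟩ := hv
      rw [hφ.mem_set_image, hφ.mem_set_image, hφ.mem_set_image]
      exact hpZ w
    · have h1 : ∀ A : Set V, v ∉ φ '' A := fun A ⟨w, _, hw⟩ => hv ⟨w, hw⟩
      exact ⟨fun h => (h1 _ h).elim, fun h => (h ⟨fun h => (h1 _ h).elim,
        fun h => (h1 _ h).elim⟩).elim⟩

theorem opP_map (B : BlockOps M d) {V V' : FB} {φ : V → V'}
    (hφ : Function.Injective φ) {r : Setoid V} {κ : V → Bool} {r' : Setoid V'} {κ' : V' → Bool}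
    (hr : ∀ v w, r' (φ v) (φ w) ↔ r v w) (hκ' : ∀ v, κ' (φ v) = κ v) {X Y : Set V}
    {X' Y' : Set V'} (a : V.sub X ≃ V'.sub X') (e : V.sub Y ≃ V'.sub Y')
    (ha : ∀ x, (a x).1 = φ x.1) (he : ∀ y, (e y).1 = φ y.1)
    (hXY : ∀ v, v ∈ X → v ∉ Y) (hκ : ∀ v ∈ X ∪ Y, ∀ w ∈ X ∪ Y, r v w → κ v = κ w)
    (x : M.val (V.sub X)) : B.opP r' κ' X' Y' (M.act a x) = M.act e (B.opP r κ X Y x) := by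
  classical
  have h := B.ops_map hφ (disj_blocks hκ) a e ha he (fun v => by
    rw [exists_mem_blocks, Set.mem_union]
    have := hXY v
    tauto) (B.ops_blocks_one hXY hκ x)
  have hX' : ∀ v, v ∈ X' ↔ v ∈ φ '' X := fun v => ⟨fun hv => by
    obtain ⟨x, hx⟩ := a.surjective ⟨v, hv⟩
    exact ⟨x.1, x.2, by rw [← ha, hx]⟩, by
    rintro ⟨w, hw, rfl⟩
    have := (a ⟨w, hw⟩).2
    rwa [ha] at this⟩
  have hY' : ∀ v, v ∈ Y' ↔ v ∈ φ '' Y := fun v => ⟨fun hv => by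
    obtain ⟨x, hx⟩ := e.surjective ⟨v, hv⟩
    exact ⟨x.1, x.2, by rw [← he, hx]⟩, by
    rintro ⟨w, hw, rfl⟩
    have := (e ⟨w, hw⟩).2
    rwa [he] at this⟩
  obtain rfl : X' = φ '' X := Set.ext hX'
  obtain rfl : Y' = φ '' Y := Set.ext hY'
  have hblocks : (blocks r κ (X ∪ Y)).image (Prod.map id (φ '' ·)) =
      blocks r' κ' (φ '' X ∪ φ '' Y) := by
    have hset : ∀ v, ((κ' (φ v), {w | w ∈ φ '' X ∪ φ '' Y ∧ r' (φ v) w}) : Bool × Set V') =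
        Prod.map id (φ '' ·) ((κ v, {w | w ∈ X ∪ Y ∧ r v w}) : Bool × Set V) := by
      intro v
      refine Prod.ext (hκ' v) (Set.ext fun w => ?_)
      change _ ∧ _ ↔ w ∈ φ '' {w | w ∈ X ∪ Y ∧ r v w}
      rw [← Set.image_union]
      constructor
      · rintro ⟨⟨u, hu, rfl⟩, h⟩
        exact ⟨u, ⟨hu, (hr v u).1 h⟩, rfl⟩
      · rintro ⟨u, ⟨hu, h⟩, rfl⟩
        exact ⟨⟨u, hu, rfl⟩, (hr v u).2 h⟩
    ext p
    rw [Finset.mem_image, mem_blocks]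
    constructor
    · rintro ⟨q, hq, rfl⟩
      obtain ⟨v, hv, rfl⟩ := mem_blocks.1 hq
      refine ⟨φ v, ?_, (hset v).symm⟩
      rw [← Set.image_union]
      exact ⟨v, hv, rfl⟩
    · rintro ⟨v, hv, rfl⟩
      rw [← Set.image_union] at hv
      obtain ⟨v, hv, rfl⟩ := hv
      exact ⟨_, mem_blocks.2 ⟨v, hv, rfl⟩, (hset v).symm⟩
  rw [hblocks] at h
  change B.ops (blocks r' κ' (φ '' X ∪ φ '' Y)) (one _ (M.act a x)) (φ '' Y) = _
  rw [h, one_self]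

end BlockOps

end FBMod
end

noncomputable section

namespace FBMod

open PartDiag PartStar

variable {k : Type u} [CommRing k] {M : FBMod k} {d : Bool → k}

theorem equiv_eq_of_val {S V : FB} {i : S → V} {X : Set V} (a b : S ≃ V.sub X)
    (ha : ∀ s, (a s).1 = i s) (hb : ∀ s, (b s).1 = i s) : a = b :=
  Equiv.ext fun s => Subtype.ext ((ha s).trans (hb s).symm)

namespace BlockOps

/-- The operator of a coloured partition that is induced along injective maps `i` and `j`. -/
def opM (B : BlockOps M d) {V S T : FB} (r : Setoid V) (κ : V → Bool) {i : S → V} {j : T → V}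
    (hi : Function.Injective i) (hj : Function.Injective j) : M.val S →ₗ[k] M.val T :=
  M.act (Equiv.ofInjective j hj : T ≃ V.sub (Set.range j)).symm ∘ₗ
    B.opP r κ (Set.range i) (Set.range j) ∘ₗ
      M.act (Equiv.ofInjective i hi : S ≃ V.sub (Set.range i))

theorem act_opM (B : BlockOps M d) {V S T : FB} (r : Setoid V) (κ : V → Bool) {i : S → V}
    {j : T → V} (hi : Function.Injective i) (hj : Function.Injective j) {X Y : Set V}
    (a : S ≃ V.sub X) (e : T ≃ V.sub Y) (ha : ∀ s, (a s).1 = i s) (he : ∀ t, (e t).1 = j t)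
    (x : M.val S) : M.act e (B.opM r κ hi hj x) = B.opP r κ X Y (M.act a x) := by
  obtain rfl : X = Set.range i := Set.ext fun v => ⟨fun hv => by
    obtain ⟨s, hs⟩ := a.surjective ⟨v, hv⟩
    exact ⟨s, by rw [← ha, hs]⟩, by
    rintro ⟨s, rfl⟩
    rw [← ha]
    exact (a s).2⟩
  obtain rfl : Y = Set.range j := Set.ext fun v => ⟨fun hv => by
    obtain ⟨s, hs⟩ := e.surjective ⟨v, hv⟩
    exact ⟨s, by rw [← he, hs]⟩, by
    rintro ⟨s, rfl⟩
    rw [← he]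
    exact (e s).2⟩
  obtain rfl := equiv_eq_of_val a (Equiv.ofInjective i hi) ha fun _ => rfl
  obtain rfl := equiv_eq_of_val e (Equiv.ofInjective j hj) he fun _ => rfl
  exact M.act_act_symm _ _

theorem opM_map (B : BlockOps M d) {V V' S T : FB} {φ : V → V'} (hφ : Function.Injective φ)
    {r : Setoid V} {κ : V → Bool} {r' : Setoid V'} {κ' : V' → Bool}
    (hr : ∀ v w, r' (φ v) (φ w) ↔ r v w) (hκ' : ∀ v, κ' (φ v) = κ v) {i : S → V} {j : T → V}
    (hi : Function.Injective i) (hj : Function.Injective j) {i' : S → V'} {j' : T → V'}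
    (hi' : Function.Injective i') (hj' : Function.Injective j') (hii : ∀ s, i' s = φ (i s))
    (hjj : ∀ t, j' t = φ (j t)) (hij : ∀ s t, i s ≠ j t)
    (hκ : ∀ x y : S ⊕ T, r (Sum.elim i j x) (Sum.elim i j y) →
      κ (Sum.elim i j x) = κ (Sum.elim i j y)) :
    B.opM r' κ' hi' hj' = B.opM r κ hi hj := by
  refine LinearMap.ext fun x => ?_
  have hmem : ∀ v, v ∈ Set.range i ∪ Set.range j → ∃ x, Sum.elim i j x = v := by
    rintro v (⟨s, rfl⟩ | ⟨t, rfl⟩)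
    exacts [⟨Sum.inl s, rfl⟩, ⟨Sum.inr t, rfl⟩]
  let a : S ≃ V.sub (Set.range i) := Equiv.ofInjective i hi
  let e : T ≃ V.sub (Set.range j) := Equiv.ofInjective j hj
  let a' : S ≃ V'.sub (Set.range i') := Equiv.ofInjective i' hi'
  let e' : T ≃ V'.sub (Set.range j') := Equiv.ofInjective j' hj'
  have ha : ∀ s, (a s).1 = i s := fun _ => rfl
  have he : ∀ s, (e s).1 = j s := fun _ => rfl
  have ha' : ∀ s, (a' s).1 = i' s := fun _ => rfl
  have he' : ∀ s, (e' s).1 = j' s := fun _ => rfl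
  refine M.act_injective e' ?_
  rw [B.act_opM r' κ' hi' hj' a' e' ha' he']
  have h := B.opP_map hφ hr hκ' (a.symm.trans a') (e.symm.trans e') (fun x => by
      obtain ⟨s, rfl⟩ := a.surjective x
      rw [Equiv.trans_apply, Equiv.symm_apply_apply, ha, ha', hii])
    (fun x => by
      obtain ⟨s, rfl⟩ := e.surjective x
      rw [Equiv.trans_apply, Equiv.symm_apply_apply, he, he', hjj])
    (by
      rintro _ ⟨s, rfl⟩ ⟨t, ht⟩
      exact hij s t ht.symm) (fun v hv w hw h => by
      obtain ⟨x, rfl⟩ := hmem v hv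
      obtain ⟨y, rfl⟩ := hmem w hw
      exact hκ x y h) (M.act a x)
  rw [← B.act_opM r κ hi hj a e ha he, act_act, act_act] at h
  refine Eq.trans (congrArg _ (M.act_congr (fun s => ?_) x)) (h.trans (M.act_congr (fun s => ?_) _))
  · rw [Equiv.trans_apply, Equiv.trans_apply, Equiv.symm_apply_apply]
  · rw [Equiv.trans_apply, Equiv.trans_apply, Equiv.symm_apply_apply]

/-- The operator of a coloured partition of `S ⊔ T`. -/
def opS (B : BlockOps M d) {S T : FB} (r : Setoid (sumFB S T)) (κ : sumFB S T → Bool) :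
    M.val S →ₗ[k] M.val T :=
  B.opM (V := sumFB S T) r κ (i := Sum.inl) (j := Sum.inr) Sum.inl_injective Sum.inr_injective

theorem opM_eq_opS (B : BlockOps M d) {V S T : FB} {r : Setoid V} {κ : V → Bool} {i : S → V}
    {j : T → V} (hi : Function.Injective i) (hj : Function.Injective j) (hij : ∀ s t, i s ≠ j t)
    {r' : Setoid (sumFB S T)} {κ' : sumFB S T → Bool}
    (hr : ∀ x y, r (Sum.elim i j x) (Sum.elim i j y) ↔ r' x y)
    (hκ : ∀ x, κ (Sum.elim i j x) = κ' x) (hr' : ∀ x y, r' x y → κ' x = κ' y) :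
    B.opM r κ hi hj = B.opS r' κ' :=
  B.opM_map (V := sumFB S T) (φ := Sum.elim i j) (by
    rintro (s | t) (s' | t') h
    · exact congrArg _ (hi h)
    · exact (hij s t' h).elim
    · exact (hij s' t h.symm).elim
    · exact congrArg _ (hj h)) hr hκ Sum.inl_injective Sum.inr_injective hi hj (fun _ => rfl)
    (fun _ => rfl) (fun _ _ h => nomatch h) fun x y h => hr' _ _ h

end BlockOps

end FBMod

namespace PartCat

variable {k : Type u} [CommRing k]

/-- The linear map with given values on partition diagrams. -/
def liftHom (δ : k) {P Q : FB} {E : Type u} [AddCommGroup E] [Module k E]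
    (f : Setoid (P ⊕ Q) → E) : ((ofFB δ).obj P ⟶ (ofFB δ).obj Q) →ₗ[k] E :=
  show (Setoid (P ⊕ Q) →₀ k) →ₗ[k] E from Finsupp.linearCombination k f

theorem liftHom_dg (δ : k) {P Q : FB} {E : Type u} [AddCommGroup E] [Module k E]
    (f : Setoid (P ⊕ Q) → E) (σ : Setoid (P ⊕ Q)) : liftHom δ f (dg δ σ) = f σ :=
  (Finsupp.linearCombination_single k (1 : k) σ).trans (one_smul k _)

end PartCat

namespace FBMod

open PartDiag PartStar PartCat

variable {k : Type u} [CommRing k] {M : FBMod k} {d : Bool → k} {δ ε : k}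

namespace BlockOps

open Classical in
/-- The operator of a pair of partitions of complementary parts of `S ⊔ T`. -/
def opPair (B : BlockOps M d) {S T : FB} (A : Set S) (C : Set T) (σ : Setoid (S.sub A ⊕ T.sub C))
    (τ : Setoid (S.sub Aᶜ ⊕ T.sub Cᶜ)) : M.val S →ₗ[k] M.val T :=
  B.opS (exists_comap_eq A C σ τ).choose
    (Sum.elim (fun s => decide (s ∈ A)) fun t => decide (t ∈ C))

open Classical in
theorem opPair_eq (B : BlockOps M d) {S T : FB} {A : Set S} {C : Set T} {r : Setoid (sumFB S T)}
    {κ : sumFB S T → Bool} (hr : ∀ v w, r v w → κ v = κ w) (hA : ∀ s, s ∈ A ↔ κ (Sum.inl s) = true)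
    (hC : ∀ t, t ∈ C ↔ κ (Sum.inr t) = true) : B.opPair A C
      (r.comap (Sum.elim (fun s : S.sub A => Sum.inl s.1) fun t : T.sub C => Sum.inr t.1))
      (r.comap (Sum.elim (fun s : S.sub Aᶜ => Sum.inl s.1) fun t : T.sub Cᶜ => Sum.inr t.1)) =
    B.opS r κ := by
  unfold opPair
  have hκ : Sum.elim (fun s => decide (s ∈ A)) (fun t => decide (t ∈ C)) = κ := by
    funext x
    obtain s | t := x
    · rw [Sum.elim_inl, Bool.eq_iff_iff, decide_eq_true_iff, hA]
    · rw [Sum.elim_inr, Bool.eq_iff_iff, decide_eq_true_iff, hC]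
  generalize_proofs h
  obtain ⟨h1, h2, h3⟩ := h.choose_spec
  generalize h.choose = r' at *
  rw [hκ] at h1 ⊢
  congr 1
  have hlift : ∀ x, κ x = true → ∃ x', Sum.elim (fun s : S.sub A => (Sum.inl s.1 : sumFB S T))
      (fun t : T.sub C => Sum.inr t.1) x' = x := by
    rintro (s | t) h
    exacts [⟨Sum.inl ⟨s, (hA s).2 h⟩, rfl⟩, ⟨Sum.inr ⟨t, (hC t).2 h⟩, rfl⟩]
  have hlift' : ∀ x, κ x = false → ∃ x', Sum.elim (fun s : S.sub Aᶜ => (Sum.inl s.1 : sumFB S T))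
      (fun t : T.sub Cᶜ => Sum.inr t.1) x' = x := by
    rintro (s | t) h
    · exact ⟨Sum.inl ⟨s, fun h' => Bool.false_ne_true (h.symm.trans ((hA s).1 h'))⟩, rfl⟩
    · exact ⟨Sum.inr ⟨t, fun h' => Bool.false_ne_true (h.symm.trans ((hC t).1 h'))⟩, rfl⟩
  refine Setoid.ext fun x y => ?_
  by_cases hxy : κ x = κ y
  · cases h : κ x
    · obtain ⟨x', rfl⟩ := hlift' x h
      obtain ⟨y', rfl⟩ := hlift' y (hxy ▸ h)
      exact Setoid.ext_iff.1 h3 x' y'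
    · obtain ⟨x', rfl⟩ := hlift x h
      obtain ⟨y', rfl⟩ := hlift y (hxy ▸ h)
      exact Setoid.ext_iff.1 h2 x' y'
  · exact ⟨fun h => (hxy (h1 x y h)).elim, fun h => (hxy (hr x y h)).elim⟩

/-- The operator of a morphism of the star product. -/
def opHom (B : BlockOps M d) {S T : FB} (f : ob δ ε S ⟶ ob δ ε T) : M.val S →ₗ[k] M.val T :=
  ∑ A : Set S, ∑ C : Set T, TensorProduct.lift (liftHom δ fun σ => liftHom ε fun τ =>
    B.opPair A C σ τ) (entry f A C)

theorem opHom_add (B : BlockOps M d) {S T : FB} (f g : ob δ ε S ⟶ ob δ ε T) :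
    B.opHom (f + g) = B.opHom f + B.opHom g := by
  unfold opHom
  simp only [entry_add, map_add, Finset.sum_add_distrib]

theorem opHom_smul (B : BlockOps M d) {S T : FB} (c : k) (f : ob δ ε S ⟶ ob δ ε T) :
    B.opHom (c • f) = c • B.opHom f := by
  unfold opHom
  simp only [entry_smul, map_smul, Finset.smul_sum]

theorem opHom_zero (B : BlockOps M d) {S T : FB} : B.opHom (0 : ob δ ε S ⟶ ob δ ε T) = 0 := by
  unfold opHom
  simp only [entry_zero, map_zero, Finset.sum_const_zero]

theorem opHom_sum (B : BlockOps M d) {S T : FB} {ι : Type} (s : Finset ι)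
    (f : ι → (ob δ ε S ⟶ ob δ ε T)) : B.opHom (∑ i ∈ s, f i) = ∑ i ∈ s, B.opHom (f i) := by
  classical
  induction s using Finset.induction_on with
  | empty => rw [Finset.sum_empty, Finset.sum_empty, opHom_zero]
  | insert a s ha ih => rw [Finset.sum_insert ha, Finset.sum_insert ha, opHom_add, ih]

theorem opHom_sk_inl_inr (B : BlockOps M d) {S T : FB} {r : Setoid (sumFB S T)}
    {κ : sumFB S T → Bool} (hr : ∀ v w, r v w → κ v = κ w) :
    B.opHom (sk δ ε r κ (S := S) (T := T) Sum.inl Sum.inr) = B.opS r κ := by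
  obtain ⟨A, hA⟩ : ∃ A : Set S, ∀ s, s ∈ A ↔ κ (Sum.inl s) = true :=
    ⟨{s | κ (Sum.inl s) = true}, fun _ => Iff.rfl⟩
  obtain ⟨C, hC⟩ : ∃ C : Set T, ∀ s, s ∈ C ↔ κ (Sum.inr s) = true :=
    ⟨{s | κ (Sum.inr s) = true}, fun _ => Iff.rfl⟩
  unfold opHom
  rw [Finset.sum_eq_single A (fun A' _ h => Finset.sum_eq_zero fun C' _ => ?_)
    fun h => (h (Finset.mem_univ A)).elim, Finset.sum_eq_single C (fun C' _ h => ?_)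
    fun h => (h (Finset.mem_univ C)).elim, entry_sk_pos hA hC, blk]
  · refine (TensorProduct.lift.tmul _ _).trans ?_
    unfold strand
    rw [liftHom_dg, liftHom_dg]
    exact B.opPair_eq hr hA hC
  · rw [entry_sk_neg fun h' => h (Set.ext fun s => (h'.2 s).trans (hC s).symm), map_zero]
  · rw [entry_sk_neg fun h' => h (Set.ext fun s => (h'.1 s).trans (hA s).symm), map_zero]

theorem opHom_sk (B : BlockOps M d) {V S T : FB} {r : Setoid V} {κ : V → Bool} {i : S → V}
    {j : T → V} (hi : Function.Injective i) (hj : Function.Injective j) (hij : ∀ s t, i s ≠ j t)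
    (hr : ∀ x y : S ⊕ T, r (Sum.elim i j x) (Sum.elim i j y) →
      κ (Sum.elim i j x) = κ (Sum.elim i j y)) :
    B.opHom (sk δ ε r κ i j) = B.opM r κ hi hj := by
  rw [B.opM_eq_opS (r' := r.comap (Sum.elim i j)) (κ' := κ ∘ Sum.elim i j) hi hj hij
    (fun _ _ => Iff.rfl) (fun _ => rfl) hr, ← B.opHom_sk_inl_inr (δ := δ) (ε := ε) hr]
  refine congrArg _ (sk_congr (fun x y => ?_) (fun _ => rfl) fun _ => rfl)
  rw [Sum.elim_inl_inr]
  exact Iff.rfl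

theorem opHom_comp_ofE (B : BlockOps M d) {S T U : FB} (f : ob δ ε S ⟶ ob δ ε T) (e : T ≃ U)
    (x : M.val S) : B.opHom (f ≫ ofE δ ε e) x = M.act e (B.opHom f x) := by
  induction f using hom_induction with
  | hsk r κ hr =>
    have hij : ∀ (s : S) (u : U), (Sum.inl s : sumFB S T) ≠ (Sum.inr ∘ e.symm) u :=
      fun _ _ h => nomatch h
    have hj : Function.Injective (Sum.inr ∘ e.symm : U → sumFB S T) :=
      Sum.inr_injective.comp e.symm.injective
    rw [sk_comp_ofE, B.opHom_sk_inl_inr hr, B.opHom_sk (V := sumFB S T) Sum.inl_injective hj hij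
      fun x y h => hr _ _ h]
    let a : S ≃ (sumFB S T).sub (Set.range Sum.inl) := Equiv.ofInjective _ Sum.inl_injective
    let b : T ≃ (sumFB S T).sub (Set.range Sum.inr) := Equiv.ofInjective _ Sum.inr_injective
    refine M.act_injective (e.symm.trans b) ?_
    rw [B.act_opM (V := sumFB S T) r κ Sum.inl_injective hj a (e.symm.trans b) (fun _ => rfl)
      (fun _ => rfl)]
    unfold opS
    rw [← B.act_opM (V := sumFB S T) r κ Sum.inl_injective Sum.inr_injective a b (fun _ => rfl)
      (fun _ => rfl), act_act]
    exact M.act_congr (fun t => by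
      rw [Equiv.trans_apply, Equiv.trans_apply, Equiv.symm_apply_apply]) _
  | h0 => rw [Limits.zero_comp, opHom_zero, opHom_zero, LinearMap.zero_apply, LinearMap.zero_apply,
      map_zero]
  | hadd f g hf hg => rw [Preadditive.add_comp, opHom_add, opHom_add, LinearMap.add_apply,
      LinearMap.add_apply, hf, hg, map_add]
  | hsmul c f hf => rw [Linear.smul_comp, opHom_smul, opHom_smul, LinearMap.smul_apply,
      LinearMap.smul_apply, hf, map_smul]

end BlockOps

end FBMod
end

noncomputable section

namespace FBMod

open PartDiag PartStar PartCat

variable {k : Type u} [CommRing k] {M : FBMod k} {δ ε : k}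

namespace BlockOps

theorem opHom_comp_block (B : BlockOps M (fun c => cond c δ ε)) {S V : FB} (c : Bool) (Y Z : Set V)
    (f : ob δ ε S ⟶ ob δ ε (V.sub Y)) (x : M.val S) :
    B.opHom (f ≫ blockS δ ε c Y Z) x = B.D c Y Z (B.opHom f x) := by
  classical
  induction f using hom_induction with
  | h0 => rw [Limits.zero_comp, opHom_zero, opHom_zero, LinearMap.zero_apply, LinearMap.zero_apply,
      map_zero]
  | hadd f g hf hg => rw [Preadditive.add_comp, opHom_add, opHom_add, LinearMap.add_apply,
      LinearMap.add_apply, hf, hg, map_add]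
  | hsmul c f hf => rw [Linear.smul_comp, opHom_smul, opHom_smul, LinearMap.smul_apply,
      LinearMap.smul_apply, hf, map_smul]
  | hsk r κ hr =>
    let i : S → sumFB S V := Sum.inl
    let j : V.sub Y → sumFB S V := Sum.inr ∘ Subtype.val
    let l : V.sub Z → sumFB S V := Sum.inr ∘ Subtype.val
    have hi : Function.Injective i := Sum.inl_injective
    have hj : Function.Injective j := Sum.inr_injective.comp Subtype.val_injective
    have hl : Function.Injective l := Sum.inr_injective.comp Subtype.val_injective
    have hij : ∀ s t, i s ≠ j t := fun _ _ h => nomatch h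
    have hil : ∀ s t, i s ≠ l t := fun _ _ h => nomatch h
    have hφ : Function.Injective (Sum.elim i j) := by
      rintro (s | t) (s' | t') h
      · exact congrArg _ (hi h)
      · exact (hij s t' h).elim
      · exact (hij s' t h.symm).elim
      · exact congrArg _ (hj h)
    have hφ' : ∀ x, Sum.elim i j x ∈ Set.range i ∪ Set.range j := by
      rintro (s | t)
      exacts [Or.inl ⟨s, rfl⟩, Or.inr ⟨t, rfl⟩]
    obtain ⟨r', hr'⟩ : ∃ r' : Setoid (sumFB S V), ∀ v w, r' v w ↔
        (∃ a b, r a b ∧ Sum.elim i j a = v ∧ Sum.elim i j b = w) ∨ v = w :=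
      ⟨r.map (Sum.elim i j), PartDiag.map_rel r hφ⟩
    obtain ⟨κ', hκφ, hκc⟩ : ∃ κ' : sumFB S V → Bool, (∀ x, κ' (Sum.elim i j x) = κ x) ∧
        ∀ v, v ∉ Set.range i → v ∉ Set.range j → κ' v = c := by
      refine ⟨Sum.elim (κ ∘ Sum.inl) fun v => if h : v ∈ Y then κ (Sum.inr ⟨v, h⟩) else c, ?_, ?_⟩
      · rintro (s | t)
        · rfl
        · exact dif_pos t.2
      · rintro (s | t) h1 h2
        · exact (h1 ⟨s, rfl⟩).elim
        · exact dif_neg fun h => h2 ⟨⟨t, h⟩, rfl⟩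
    have hrφ : ∀ x y, r' (Sum.elim i j x) (Sum.elim i j y) ↔ r x y := fun x y => by
      rw [hr']
      constructor
      · rintro (⟨a, b, hab, ha, hb⟩ | h)
        · rwa [← hφ ha, ← hφ hb]
        · rw [hφ h]
      · exact fun h => Or.inl ⟨x, y, h, rfl, rfl⟩
    have hrP : ∀ v w, r' v w → v = w ∨ v ∈ Set.range i ∪ Set.range j ∧
        w ∈ Set.range i ∪ Set.range j := by
      intro v w h
      obtain ⟨a, b, -, rfl, rfl⟩ | h := (hr' v w).1 h
      exacts [Or.inr ⟨hφ' a, hφ' b⟩, Or.inl h]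
    have hκr : ∀ v w, r' v w → κ' v = κ' w := by
      intro v w h
      obtain ⟨a, b, h, rfl, rfl⟩ | h := (hr' v w).1 h
      · rw [hκφ, hκφ, hr a b ((hrφ a b).1 h)]
      · rw [h]
    have hsk : sk δ ε r κ (S := S) (T := V.sub Y) Sum.inl Sum.inr = sk δ ε r' κ' i j :=
      sk_congr (fun x y => by
        rw [hrφ, Sum.elim_inl_inr]
        exact Iff.rfl) (fun s => (hκφ (Sum.inl s)).symm) fun t => (hκφ (Sum.inr t)).symm
    have hblock : blockS δ ε c Y Z = block δ ε c j l :=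
      (block_comp (Sum.inr_injective : Function.Injective (Sum.inr : V → S ⊕ V))).symm
    have hdis : ∀ v, v ∈ Set.range i → v ∉ Set.range j := by
      rintro _ ⟨s, rfl⟩ ⟨t, h⟩
      exact hij s t h.symm
    have hdis' : ∀ v, v ∈ Set.range i → v ∉ Set.range l := by
      rintro _ ⟨s, rfl⟩ ⟨t, h⟩
      exact hil s t h.symm
    let a : S ≃ (sumFB S V).sub (Set.range i) := Equiv.ofInjective i hi
    let e : V.sub Y ≃ (sumFB S V).sub (Set.range j) := Equiv.ofInjective j hj
    let e' : V.sub Z ≃ (sumFB S V).sub (Set.range l) := Equiv.ofInjective l hl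
    have hD : M.act e' (B.D c Y Z (B.opM r' κ' hi hj x)) =
        B.D c _ _ (B.opP r' κ' (Set.range i) (Set.range j) (M.act a x)) := by
      rw [← B.act_opM r' κ' hi hj a e (fun _ => rfl) (fun _ => rfl)]
      exact (B.nat c (φ := (Sum.inr : V → sumFB S V)) Sum.inr_injective e e' (fun _ => rfl)
        (fun _ => rfl) _).symm
    have hκij : ∀ x y : S ⊕ V.sub Y, r' (Sum.elim i j x) (Sum.elim i j y) →
        κ' (Sum.elim i j x) = κ' (Sum.elim i j y) := fun x y h => hκr _ _ h
    rw [hsk, hblock, B.opHom_sk hi hj hij hκij]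
    refine M.act_injective e' ?_
    rw [hD]
    by_cases hm : ∀ t, j t ∉ Set.range l → κ' (j t) = c
    · obtain ⟨b, hb⟩ : ∃ b : Set (sumFB S V), ∀ v, v ∈ b ↔ ¬ (v ∈ Set.range j ↔ v ∈ Set.range l) :=
        ⟨{v | ¬ (v ∈ Set.range j ↔ v ∈ Set.range l)}, fun _ => Iff.rfl⟩
      have hrec : recolour κ' c j l = κ' := funext fun v => by
        by_cases hv : v ∈ Set.range l ∧ v ∉ Set.range j
        · rw [recolour_of_notMem hv.2 hv.1, hκc v (fun h => hdis' v h hv.1) hv.2]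
        · exact if_neg hv
      have hκb : ∀ v, v ∈ b → κ' v = c := by
        intro v hv
        rw [hb] at hv
        by_cases hvj : v ∈ Set.range j
        · obtain ⟨t, rfl⟩ := hvj
          exact hm t fun h => hv ⟨fun _ => h, fun _ => ⟨t, rfl⟩⟩
        · refine hκc v (fun h => hv ⟨fun h' => (hvj h').elim, fun h' => (hdis' v h h').elim⟩) hvj
      have hjκ : ∀ v w, joinBlock r' b v w → κ' v = κ' w := by
        intro v w h
        obtain h | ⟨⟨u, hu, hvu⟩, u', hu', hwu⟩ := (joinBlock_rel r' b v w).1 h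
        · exact hκr v w h
        · rw [hκr v u hvu, hκr w u' hwu, hκb u hu, hκb u' hu']
      rw [sk_comp_block (fun s u h => (hil s u h).elim) hrP hκr hm hb, opHom_smul,
        LinearMap.smul_apply, hrec, B.opHom_sk hi hl hil fun x y h => hjκ _ _ h, map_smul,
        B.act_opM (joinBlock r' b) κ' hi hl a e' (fun _ => rfl) (fun _ => rfl)]
      refine (B.D_opP hdis hdis' hrP hκr ?_ (fun _ _ => rfl) ?_ hb _).symm
      · rintro _ ⟨t, rfl⟩ h
        exact hm t h
      · exact fun v hv hv' => hκc v (fun h => hdis' v h hv) hv'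
    · push Not at hm
      obtain ⟨t, ht, htc⟩ := hm
      rw [sk_comp_block_eq_zero ht htc, opHom_zero, LinearMap.zero_apply, map_zero]
      exact (B.D_opP_eq_zero hdis hdis' (fun v _ w _ => hκr v w) ⟨t, rfl⟩ ht htc _).symm

end BlockOps

end FBMod
end

noncomputable section

namespace FBMod

open PartDiag PartStar PartCat

variable {k : Type u} [CommRing k] {M : FBMod k} {d : Bool → k} {δ ε : k}

namespace BlockOps

open Classical in
/-- The coloured two-element blocks that join the two copies of the elements of `F`. -/
def pairs {S : FB} (A F : Finset S) : Finset (Bool × Set (sumFB S S)) :=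
  F.image fun s => (decide (s ∈ A), {Sum.inl s, Sum.inr s})

theorem mem_pairs {S : FB} {A F : Finset S} {p : Bool × Set (sumFB S S)} : p ∈ pairs A F ↔
    ∃ s ∈ F, (p.1 = true ↔ s ∈ A) ∧ ∀ v, v ∈ p.2 ↔ Sum.elim id id v = s := by
  classical
  unfold pairs
  rw [Finset.mem_image]
  refine exists_congr fun s => and_congr_right fun _ => ?_
  have hs : ∀ v : sumFB S S, v ∈ ({Sum.inl s, Sum.inr s} : Set (sumFB S S)) ↔
      Sum.elim id id v = s := by
    rintro (t | t)
    · rw [Set.mem_insert_iff, Set.mem_singleton_iff, Sum.inl.injEq]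
      exact or_iff_left fun h => nomatch h
    · rw [Set.mem_insert_iff, Set.mem_singleton_iff, Sum.inr.injEq]
      exact or_iff_right fun h => nomatch h
  constructor
  · rintro rfl
    exact ⟨decide_eq_true_iff, hs⟩
  · rintro ⟨h1, h2⟩
    refine Prod.ext (Bool.eq_iff_iff.2 (decide_eq_true_iff.trans h1.symm)) (Set.ext fun v => ?_)
    exact (hs v).trans (h2 v).symm

theorem disj_pairs {S : FB} (A F : Finset S) : Disj (pairs A F) := by
  intro p hp q hq hne v hv hv'
  obtain ⟨s, hs, h1, h2⟩ := mem_pairs.1 hp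
  obtain ⟨t, ht, h3, h4⟩ := mem_pairs.1 hq
  obtain rfl : s = t := ((h2 v).1 hv).symm.trans ((h4 v).1 hv')
  exact hne (Prod.ext (Bool.eq_iff_iff.2 (h1.trans h3.symm))
    (Set.ext fun v => (h2 v).trans (h4 v).symm))

open Classical in
theorem pairs_insert {S : FB} {A A' F : Finset S} {s : S} (hAA' : ∀ t ∈ F, t ∈ A' ↔ t ∈ A) :
    pairs A' (insert s F) = insert (decide (s ∈ A'), {Sum.inl s, Sum.inr s}) (pairs A F) := by
  unfold pairs
  rw [Finset.image_insert]
  congr 1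
  refine Finset.image_congr fun t ht => ?_
  simp only [hAA' t ht]

open Classical in
theorem ops_pairs_insert (B : BlockOps M d) {S : FB} {A A' F : Finset S} {s : S} (hs : s ∉ F)
    (hAA' : ∀ t ∈ F, t ∈ A' ↔ t ∈ A) : B.ops (pairs A' (insert s F)) =
      B.step (V := sumFB S S) (decide (s ∈ A'), {Sum.inl s, Sum.inr s}) * B.ops (pairs A F) := by
  have h := disj_pairs A' (insert s F)
  rw [pairs_insert hAA'] at h ⊢
  refine B.ops_insert (fun h' => ?_) h
  obtain ⟨t, ht, -, h2⟩ := mem_pairs.1 h'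
  obtain rfl : s = t := (h2 (Sum.inl s)).1 (Set.mem_insert _ _)
  exact hs ht

open Classical in
theorem sum_ops_pairs (B : BlockOps M d) {S : FB} {X : Set (sumFB S S)}
    (a : S ≃ (sumFB S S).sub X) (ha : ∀ s, (a s).1 = Sum.inl s) (x : M.val S) (F : Finset S)
    {Y : Set (sumFB S S)} (e : S ≃ (sumFB S S).sub Y)
    (he : ∀ s, (e s).1 = if s ∈ F then Sum.inr s else Sum.inl s) :
    ∑ A ∈ F.powerset, B.ops (pairs A F) (one X (M.act a x)) = one Y (M.act e x) := by
  induction F using Finset.induction_on generalizing Y with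
  | empty =>
    have he' : ∀ s, (e s).1 = Sum.inl s := fun s => (he s).trans (if_neg (Finset.notMem_empty s))
    obtain rfl : X = Y := Set.ext fun v => ⟨fun hv => by
      obtain ⟨s, hs⟩ := a.surjective ⟨v, hv⟩
      have := (e s).2
      rwa [he', ← ha, hs] at this, fun hv => by
      obtain ⟨s, hs⟩ := e.surjective ⟨v, hv⟩
      have := (a s).2
      rwa [ha, ← he', hs] at this⟩
    obtain rfl := equiv_eq_of_val a e ha he'
    rw [Finset.powerset_empty, Finset.sum_singleton, pairs, Finset.image_empty, ops_empty]
    rfl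
  | insert s F hs ih =>
    let m : S → sumFB S S := fun t => if t ∈ F then Sum.inr t else Sum.inl t
    have hmt : ∀ t, Sum.elim id id (m t) = t := fun t => by
      by_cases ht : t ∈ F
      · rw [show m t = Sum.inr t from if_pos ht]; rfl
      · rw [show m t = Sum.inl t from if_neg ht]; rfl
    have hm : Function.Injective m := fun t t' h => by rw [← hmt t, h, hmt]
    let e₀ : S ≃ (sumFB S S).sub (Set.range m) := Equiv.ofInjective m hm
    have he₀ : ∀ t, (e₀ t).1 = m t := fun _ => rfl
    have hne : ∀ t, t ≠ s → (e t).1 = m t := fun t ht => by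
      rw [he]
      refine if_congr ?_ rfl rfl
      rw [Finset.mem_insert]
      exact or_iff_right ht
    have hms : m s = Sum.inl s := if_neg hs
    have hes : (e s).1 = Sum.inr s := (he s).trans (if_pos (Finset.mem_insert_self s F))
    have hY : ∀ v, v ∈ Y ↔ ∃ t, (e t).1 = v := fun v => ⟨fun hv => by
      obtain ⟨t, ht⟩ := e.surjective ⟨v, hv⟩
      exact ⟨t, by rw [ht]⟩, by
      rintro ⟨t, rfl⟩
      exact (e t).2⟩
    have hsY : (Sum.inl s : sumFB S S) ∉ Y := fun h => by
      obtain ⟨t, ht⟩ := (hY _).1 h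
      by_cases hts : t = s
      · rw [hts, hes] at ht
        exact nomatch ht
      · rw [hne t hts] at ht
        exact hts ((hmt t).symm.trans (congrArg _ ht))
    have hsm : (Sum.inr s : sumFB S S) ∉ Set.range m := by
      rintro ⟨t, ht⟩
      obtain rfl : t = s := (hmt t).symm.trans (congrArg _ ht)
      rw [hms] at ht
      exact nomatch ht
    have hb : ∀ v, v ∈ ({Sum.inl s, Sum.inr s} : Set (sumFB S S)) ↔ ¬ (v ∈ Set.range m ↔ v ∈ Y) := by
      intro v
      by_cases h1 : v = Sum.inl s
      · subst h1
        exact ⟨fun _ h => hsY (h.1 ⟨s, hms⟩), fun _ => Set.mem_insert _ _⟩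
      · by_cases h2 : v = Sum.inr s
        · subst h2
          exact ⟨fun _ h => hsm (h.2 ((hY _).2 ⟨s, hes⟩)), fun _ => Set.mem_insert_of_mem _ rfl⟩
        · refine ⟨fun h => (h.elim h1 h2).elim, fun h => (h ?_).elim⟩
          rw [hY]
          constructor
          · rintro ⟨t, rfl⟩
            exact ⟨t, hne t fun h => h1 (h ▸ hms)⟩
          · rintro ⟨t, rfl⟩
            exact ⟨t, (hne t fun h => h2 (h ▸ hes)).symm⟩
    have h1 : ∀ A ∈ F.powerset, B.ops (pairs A (insert s F)) (one X (M.act a x)) =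
        B.step (V := sumFB S S) (false, {Sum.inl s, Sum.inr s}) (B.ops (pairs A F) (one X (M.act a x))) :=
      fun A hA => by
        rw [B.ops_pairs_insert hs fun _ _ => Iff.rfl, Module.End.mul_apply,
          decide_eq_false fun h => hs (Finset.mem_powerset.1 hA h)]
    have h2 : ∀ A ∈ F.powerset, B.ops (pairs (insert s A) (insert s F)) (one X (M.act a x)) =
        B.step (V := sumFB S S) (true, {Sum.inl s, Sum.inr s}) (B.ops (pairs A F) (one X (M.act a x))) :=
      fun A hA => by
        rw [B.ops_pairs_insert (A := A) hs fun t ht => Finset.mem_insert.trans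
          (or_iff_right fun h : t = s => hs (h ▸ ht)), Module.End.mul_apply,
          decide_eq_true (Finset.mem_insert_self s A)]
    rw [Finset.sum_powerset_insert hs, Finset.sum_congr rfl h1, Finset.sum_congr rfl h2, ← map_sum,
      ← map_sum, ih e₀ he₀, B.step_one hb, B.step_one hb, ← map_add, add_comm,
      B.unit (e₀.symm.trans e) (u := Sum.inl s) (v := Sum.inr s) ⟨s, hms⟩ hsY
        ((hY _).2 ⟨s, hes⟩) hsm, act_act]
    · exact congrArg _ (M.act_congr (fun t => by
        rw [Equiv.trans_apply, Equiv.trans_apply, Equiv.symm_apply_apply]) x)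
    · intro y hy
      obtain ⟨t, rfl⟩ := e₀.surjective y
      rw [Equiv.trans_apply, Equiv.symm_apply_apply, he₀]
      exact hne t fun h => hy (by rw [h, he₀, hms])
    · intro y hy
      obtain ⟨t, rfl⟩ := e₀.surjective y
      rw [Equiv.trans_apply, Equiv.symm_apply_apply]
      obtain rfl : t = s := (hmt t).symm.trans (congrArg _ hy)
      exact hes

theorem opHom_id (B : BlockOps M d) {S : FB} (x : M.val S) : B.opHom (𝟙 (ob δ ε S)) x = x := by
  classical
  have := Fintype.ofFinite S
  let r : Setoid (sumFB S S) := Setoid.ker (Sum.elim id id)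
  let X : Set (sumFB S S) := Set.range Sum.inl
  let Y : Set (sumFB S S) := Set.range Sum.inr
  let a : S ≃ (sumFB S S).sub X := Equiv.ofInjective _ Sum.inl_injective
  let e : S ≃ (sumFB S S).sub Y := Equiv.ofInjective _ Sum.inr_injective
  have hXY : ∀ v, v ∈ X → v ∉ Y := by
    rintro _ ⟨s, rfl⟩ ⟨t, h⟩
    exact nomatch h
  have hP : ∀ v, v ∈ X ∪ Y := by
    rintro (s | s)
    exacts [Or.inl ⟨s, rfl⟩, Or.inr ⟨s, rfl⟩]
  have h1 : ∀ A : Finset S, one Y (M.act e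
      (B.opHom (sk δ ε ⊥ (fun s : S => decide (s ∈ (A : Set S))) id id) x)) =
        B.ops (pairs A Finset.univ) (one X (M.act a x)) := by
    intro A
    let κ : sumFB S S → Bool := fun v => decide (Sum.elim id id v ∈ A)
    have hκ : ∀ v w, r v w → κ v = κ w := fun v w (h : Sum.elim id id v = Sum.elim id id w) => by
      change decide _ = decide _
      rw [h]
    have hsk : sk δ ε ⊥ (fun s : S => decide (s ∈ (A : Set S))) id id =
        sk δ ε r κ (S := S) (T := S) Sum.inl Sum.inr :=
      sk_congr (fun x y => by
        rw [Sum.elim_inl_inr]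
        exact Iff.rfl) (fun _ => rfl) fun _ => rfl
    have hpairs : blocks r κ (X ∪ Y) = pairs A Finset.univ := by
      ext p
      rw [mem_blocks, mem_pairs]
      constructor
      · rintro ⟨v, -, rfl⟩
        exact ⟨Sum.elim id id v, Finset.mem_univ _, decide_eq_true_iff, fun w =>
          ⟨fun h => h.2.symm, fun h => ⟨hP w, h.symm⟩⟩⟩
      · rintro ⟨s, -, hs1, hs2⟩
        refine ⟨Sum.inl s, hP _, Prod.ext (Bool.eq_iff_iff.2 (hs1.trans decide_eq_true_iff.symm))
          (Set.ext fun w => ?_)⟩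
        exact (hs2 w).trans ⟨fun h => ⟨hP w, h.symm⟩, fun h => h.2.symm⟩
    rw [hsk, B.opHom_sk_inl_inr hκ]
    unfold opS
    rw [B.act_opM (V := sumFB S S) r κ Sum.inl_injective Sum.inr_injective a e (fun _ => rfl)
      (fun _ => rfl), ← B.ops_blocks_one hXY fun v _ w _ => hκ v w, hpairs]
  have hsum : ∑ A : Finset S, sk δ ε ⊥ (fun s : S => decide (s ∈ (A : Set S))) id id =
      𝟙 (ob δ ε S) :=
    (Fintype.sum_equiv (Fintype.finsetEquivSet (α := S)) _
      (fun A : Set S => sk δ ε ⊥ (fun s : S => decide (s ∈ A)) id id)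
      fun A => sk_congr (fun _ _ => Iff.rfl) (fun _ => decide_eq_decide.2 Iff.rfl)
        fun _ => decide_eq_decide.2 Iff.rfl).trans (sum_sk_bot S)
  refine M.act_injective e (one_injective ?_)
  rw [← B.sum_ops_pairs a (fun _ => rfl) x Finset.univ e
    fun s => (if_pos (Finset.mem_univ s)).symm, Finset.powerset_univ,
    ← Finset.sum_congr rfl fun A _ => h1 A, ← map_sum, ← map_sum, ← LinearMap.sum_apply,
    ← B.opHom_sum, hsum]

theorem opHom_comp (B : BlockOps M (fun c => cond c δ ε)) {S T U : FB} (f : ob δ ε S ⟶ ob δ ε T)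
    (g : ob δ ε T ⟶ ob δ ε U) (x : M.val S) : B.opHom (f ≫ g) x = B.opHom g (B.opHom f x) := by
  have key : ∃ F : M.val T →ₗ[k] M.val U, ∀ {S : FB} (f : ob δ ε S ⟶ ob δ ε T) (x : M.val S),
      B.opHom (f ≫ g) x = F (B.opHom f x) := by
    clear f
    induction g using star_induction with
    | hblock c X Y => exact ⟨B.D c X Y, fun f x => B.opHom_comp_block c X Y f x⟩
    | hofE e => exact ⟨M.act e, fun f x => B.opHom_comp_ofE f e x⟩
    | hcomp g h hg hh =>
      obtain ⟨F, hF⟩ := hg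
      obtain ⟨G, hG⟩ := hh
      exact ⟨G ∘ₗ F, fun f x => by rw [← Category.assoc, hG, hF]; rfl⟩
    | h0 => exact ⟨0, fun f x => by rw [Limits.comp_zero, opHom_zero]; rfl⟩
    | hadd g h hg hh =>
      obtain ⟨F, hF⟩ := hg
      obtain ⟨G, hG⟩ := hh
      exact ⟨F + G, fun f x => by rw [Preadditive.comp_add, opHom_add, LinearMap.add_apply, hF, hG]; rfl⟩
    | hsmul c g hg =>
      obtain ⟨F, hF⟩ := hg
      exact ⟨c • F, fun f x => by rw [Linear.comp_smul, opHom_smul, LinearMap.smul_apply, hF]; rfl⟩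
  obtain ⟨F, hF⟩ := key
  have h := hF (𝟙 (ob δ ε T)) (B.opHom f x)
  rw [Category.id_comp, opHom_id] at h
  rw [hF, h]

theorem opHom_ofE (B : BlockOps M d) {S T : FB} (e : S ≃ T) (x : M.val S) :
    B.opHom (ofE δ ε e) x = M.act e x := by
  rw [← Category.id_comp (ofE δ ε e), opHom_comp_ofE, opHom_id]

theorem opHom_blockS (B : BlockOps M (fun c => cond c δ ε)) {V : FB} (c : Bool) (X Y : Set V)
    (x : M.val (V.sub X)) : B.opHom (blockS δ ε c X Y) x = B.D c X Y x := by
  rw [← Category.id_comp (blockS δ ε c X Y), opHom_comp_block, opHom_id]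

/-- The representation of the star product that is determined by block operators. -/
def toLinRep (B : BlockOps M (fun c => cond c δ ε)) :
    LinRep k (StarProd k (PartCat.ofFB δ) (PartCat.ofFB ε)) where
  obj :=
    { obj := fun S => ModuleCat.of k (M.val S.set)
      map := fun {S T} f => ModuleCat.ofHom (B.opHom (S := S.set) (T := T.set) f)
      map_id := fun S => ModuleCat.hom_ext (LinearMap.ext fun x => B.opHom_id (S := S.set) x)
      map_comp := fun {S T U} f g => ModuleCat.hom_ext (LinearMap.ext fun x =>
        B.opHom_comp (S := S.set) (T := T.set) (U := U.set) f g x) }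
  property := ⟨⟨fun {S T f g} => ModuleCat.hom_ext (B.opHom_add (S := S.set) (T := T.set) f g)⟩,
    ⟨fun {S T} f c => ModuleCat.hom_ext (B.opHom_smul (S := S.set) (T := T.set) c f)⟩⟩

/-- The underlying module of the representation determined by block operators. -/
def resToLinRep (B : BlockOps M (fun c => cond c δ ε)) : res B.toLinRep ≅ M where
  hom := mkHom (M := res B.toLinRep) (N := M) (fun _ => LinearMap.id)
    fun e x => B.opHom_ofE (δ := δ) (ε := ε) e x
  inv := mkHom (M := M) (N := res B.toLinRep) (fun _ => LinearMap.id)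
    fun e x => (B.opHom_ofE (δ := δ) (ε := ε) e x).symm
  hom_inv_id := rfl
  inv_hom_id := rfl

end BlockOps

end FBMod
end

noncomputable section

namespace FBMod

open PartStar

variable {k : Type u} [CommRing k] {δ ε : k}

namespace BlockOps

section

variable {M N : FBMod k} {d d' : Bool → k}

theorem app_D_iff (B : BlockOps M d) (B' : BlockOps N d') (h : M ⟶ N) (c : Bool) {V V' : FB}
    {φ : V → V'} (hφ : Function.Injective φ) {X Y : Set V} {X' Y' : Set V'}
    (a : V.sub X ≃ V'.sub X') (b : V.sub Y ≃ V'.sub Y') (ha : ∀ x, (a x).1 = φ x.1)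
    (hb : ∀ y, (b y).1 = φ y.1) (x : M.val (V.sub X)) :
    app h _ (B.D c X' Y' (M.act a x)) = B'.D c X' Y' (app h _ (M.act a x)) ↔
      app h _ (B.D c X Y x) = B'.D c X Y (app h _ x) := by
  rw [app_act, B.nat c hφ a b ha hb, B'.nat c hφ a b ha hb, app_act]
  exact (N.act_injective b).eq_iff

theorem app_D (B : BlockOps M d) (B' : BlockOps N d') {h : M ⟶ N}
    (H : ∀ (S : FB) (X Y : Set S) (x : M.val (S.sub X)),
      app h _ (B.coeff Set.univ X Y x) = B'.coeff Set.univ X Y (app h _ x))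
    (c : Bool) {V : FB} (X Y : Set V) (x : M.val (V.sub X)) :
    app h _ (B.D c X Y x) = B'.D c X Y (app h _ x) := by
  have hfalse : ∀ {V : FB} (X Y : Set V) (x : M.val (V.sub X)),
      app h _ (B.D false X Y x) = B'.D false X Y (app h _ x) := by
    intro V X Y x
    let V' : FB := ⟨Option V⟩
    have hs : Function.Injective (some : V → V') := Option.some_injective V
    let a : V.sub X ≃ V'.sub (some '' X) := Equiv.Set.image some X hs
    let b : V.sub Y ≃ V'.sub (some '' Y) := Equiv.Set.image some Y hs
    refine (app_D_iff B B' h false hs a b (fun _ => rfl) (fun _ => rfl) x).1 ?_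
    have h1 := H V' (some '' X) (some '' Y) (M.act a x)
    have hT : coeffT k (V := V') Set.univ (some '' X) (some '' Y) = 0 := if_neg fun h' => by
      have : (none : V') ∈ (some '' X ∪ some '' Y : Set V') := h' ▸ Set.mem_univ _
      obtain ⟨_, _, h⟩ | ⟨_, _, h⟩ := this <;> exact nomatch h
    rw [coeff_apply, coeff_apply, hT, zero_smul, zero_smul, zero_add, zero_add, map_smul] at h1
    have h2 := congrArg (fun y => coeffF k (V := V') Set.univ (some '' X) • y) h1
    have hF : coeffF k (V := V') Set.univ (some '' X) * coeffF k (V := V') Set.univ (some '' X) =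
        1 := by
      unfold coeffF sgn
      rw [neg_mul_neg, ← mul_pow, neg_one_mul, neg_neg, one_pow]
    simpa only [smul_smul, hF, one_smul] using h2
  cases c
  · exact hfalse X Y x
  · let V' : FB := V.sub (X ∪ Y)
    let X' : Set V' := {v | v.1 ∈ X}
    let Y' : Set V' := {v | v.1 ∈ Y}
    let a : V'.sub X' ≃ V.sub X := ⟨fun v => ⟨v.1.1, v.2⟩, fun v => ⟨⟨v.1, Or.inl v.2⟩, v.2⟩,
      fun _ => rfl, fun _ => rfl⟩
    let b : V'.sub Y' ≃ V.sub Y := ⟨fun v => ⟨v.1.1, v.2⟩, fun v => ⟨⟨v.1, Or.inr v.2⟩, v.2⟩,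
      fun _ => rfl, fun _ => rfl⟩
    have h1 := H V' X' Y' (M.act a.symm x)
    have hT : coeffT k (V := V') Set.univ X' Y' = 1 :=
      if_pos (Set.ext fun v => ⟨fun _ => v.2, fun _ => trivial⟩)
    rw [coeff_apply, coeff_apply, hT, one_smul, one_smul, map_add, map_smul, hfalse,
      add_left_inj] at h1
    have h2 := (app_D_iff B B' h true (φ := (Subtype.val : V' → V)) Subtype.val_injective a b
      (fun _ => rfl) (fun _ => rfl) (M.act a.symm x)).2 h1
    rwa [M.act_act_symm] at h2

end

/-- The standard representation of the curried Weyl Lie algebra determined by block operators. -/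
def toStdRep {M : FBMod k} (B : BlockOps M (fun c => cond c δ ε)) : WeylRep.StdRep ε (δ - ε) where
  obj := ⟨M, B.toMap, (rel_iff_weylRel B.toMap).2 B.weylRel_toMap⟩
  property := ⟨(isStandard_iff _ ε).2 ⟨B.opr_toMap_self, fun S i j x => B.opr_toMap_move S i j x⟩,
    (hasCentralCharacter_iff _ _).2 B.opr_toMap_univ⟩

end BlockOps

theorem app_mapN {N N' : LinRep k (StarProd k (PartCat.ofFB δ) (PartCat.ofFB ε))} (f : N ⟶ N')
    {S T : FB} (g : ob δ ε S ⟶ ob δ ε T) (x : (res N).val S) :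
    app ((LinRep.restrict k (StarProd.ofFB k (PartCat.ofFB δ) (PartCat.ofFB ε))).map f) T
        (mapN N g x) =
      mapN N' g
        (app ((LinRep.restrict k (StarProd.ofFB k (PartCat.ofFB δ) (PartCat.ofFB ε))).map f) S x) :=
  congrArg (fun h => ModuleCat.Hom.hom h x) (f.hom.naturality g)

theorem app_mapN_of_comm {N N' : LinRep k (StarProd k (PartCat.ofFB δ) (PartCat.ofFB ε))}
    {f : res N ⟶ res N'} (H : ∀ (S : FB) (X Y : Set S) (x : (res N).val (S.sub X)),
      app f _ (opr (BlockOps.ofLinRep N).toMap S X Y x) =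
        opr (BlockOps.ofLinRep N').toMap S X Y (app f _ x)) {S T : FB} (g : ob δ ε S ⟶ ob δ ε T) :
    ∀ x : (res N).val S, app f T (mapN N g x) = mapN N' g (app f S x) := by
  induction g using star_induction with
  | hblock c X Y =>
    intro x
    refine (BlockOps.ofLinRep N).app_D (BlockOps.ofLinRep N') (fun S X Y x => ?_) c X Y x
    rw [← BlockOps.opr_toMap, ← BlockOps.opr_toMap]
    exact H S X Y x
  | hofE e => exact fun x => app_act f e x
  | hcomp f g hf hg =>
    intro x
    rw [mapN_comp, mapN_comp, hg, hf]
  | h0 =>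
    intro x
    rw [mapN_zero, mapN_zero, LinearMap.zero_apply, LinearMap.zero_apply, map_zero]
  | hadd f g hf hg =>
    intro x
    rw [mapN_add, mapN_add, LinearMap.add_apply, LinearMap.add_apply, map_add, hf, hg]
  | hsmul c f hf =>
    intro x
    rw [mapN_smul, mapN_smul, LinearMap.smul_apply, LinearMap.smul_apply, map_smul, hf]

variable (δ ε) in
/-- The standard representation of the curried Weyl Lie algebra that is determined by a
representation of the star product of partition categories. -/
def starToWeyl : LinRep k (StarProd k (PartCat.ofFB δ) (PartCat.ofFB ε)) ⥤
    WeylRep.StdRep ε (δ - ε) where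
  obj N := (BlockOps.ofLinRep N).toStdRep
  map {N N'} f := ObjectProperty.homMk
    { hom := (LinRep.restrict k (StarProd.ofFB k (PartCat.ofFB δ) (PartCat.ofFB ε))).map f
      comm := (comm_iff (BlockOps.ofLinRep N).toMap (BlockOps.ofLinRep N').toMap _).2
        fun S X Y x => by
          rw [BlockOps.opr_toMap, BlockOps.opr_toMap, BlockOps.coeff_apply, BlockOps.coeff_apply,
            map_add, map_smul, map_smul]
          exact congrArg₂ (fun y z => _ • y + _ • z) (app_mapN f _ x) (app_mapN f _ x) }
  map_id _ := rfl
  map_comp _ _ := rfl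

instance : (starToWeyl δ ε).Faithful where
  map_injective {N N' f g} h := by
    have h' : (LinRep.restrict k (StarProd.ofFB k (PartCat.ofFB δ) (PartCat.ofFB ε))).map f =
        (LinRep.restrict k (StarProd.ofFB k (PartCat.ofFB δ) (PartCat.ofFB ε))).map g :=
      congrArg (fun F : (starToWeyl δ ε).obj N ⟶ (starToWeyl δ ε).obj N' => F.hom.hom) h
    exact ObjectProperty.hom_ext _ (NatTrans.ext (funext fun S => congrArg
      (fun F : (res N).toFunctor ⟶ (res N').toFunctor => F.app S.set) h'))

instance : (starToWeyl δ ε).Full where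
  map_surjective {N N'} h := by
    let f : res N ⟶ res N' := h.hom.hom
    have key : ∀ {S T : FB} (g : ob δ ε S ⟶ ob δ ε T) (x : (res N).val S),
        app f T (mapN N g x) = mapN N' g (app f S x) :=
      fun g x => app_mapN_of_comm ((comm_iff (BlockOps.ofLinRep N).toMap
        (BlockOps.ofLinRep N').toMap f).1 h.hom.comm) g x
    exact ⟨ObjectProperty.homMk
      { app := fun S => ModuleCat.ofHom (app f S.set)
        naturality := fun S T g => ModuleCat.hom_ext (LinearMap.ext fun x =>
          key (S := S.set) (T := T.set) g x) }, rfl⟩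

instance : (starToWeyl δ ε).EssSurj where
  mem_essImage R := by
    have H : WeylRel (fr R.obj.a) := (rel_iff_weylRel R.obj.a).1 R.obj.rel
    obtain ⟨hε, hι⟩ := (isStandard_iff R.obj ε).1 R.property.1
    have hχ := (hasCentralCharacter_iff R.obj (δ - ε)).1 R.property.2
    let B : BlockOps R.obj.M (fun c => cond c δ ε) := BlockOps.ofRep R.obj.a H hχ hε hι
    have hB : ∀ (S : FB) (X Y : Set S) (x : R.obj.M.val (S.sub X)),
        opr (BlockOps.ofLinRep B.toLinRep).toMap S X Y x = opr R.obj.a S X Y x := by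
      intro S X Y x
      rw [BlockOps.opr_toMap, opr_eq_blockOp H]
      exact congrArg₂ (fun y z : R.obj.M.val (S.sub Y) => coeffT k Set.univ X Y • y +
        coeffF k Set.univ X • z) (B.opHom_blockS true X Y x)
        (B.opHom_blockS false X Y x)
    refine ⟨B.toLinRep, ⟨ObjectProperty.isoMk _
      { hom := ⟨B.resToLinRep.hom, (comm_iff (BlockOps.ofLinRep B.toLinRep).toMap R.obj.a _).2 hB⟩
        inv := ⟨B.resToLinRep.inv, (comm_iff R.obj.a (BlockOps.ofLinRep B.toLinRep).toMap _).2
          fun S X Y x => (hB S X Y x).symm⟩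
        hom_inv_id := WeylRep.Hom.ext B.resToLinRep.hom_inv_id
        inv_hom_id := WeylRep.Hom.ext B.resToLinRep.inv_hom_id }⟩⟩

end FBMod

end

theorem mainTheorem3 {k : Type u} [CommRing k] (δ ε : k) :
    ∃ e : WeylRep.StdRep ε (δ - ε) ≌
        LinRep k (StarProd k (PartCat.ofFB δ) (PartCat.ofFB ε)),
      Nonempty (e.functor ⋙ LinRep.restrict k (StarProd.ofFB k (PartCat.ofFB δ) (PartCat.ofFB ε)) ≅
        ObjectProperty.ι _ ⋙ WeylRep.forget k) := by
  have : (FBMod.starToWeyl δ ε).IsEquivalence := { }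
  refine ⟨(FBMod.starToWeyl δ ε).asEquivalence.symm, ⟨?_⟩⟩
  exact Functor.isoWhiskerRight (FBMod.starToWeyl δ ε).asEquivalence.counitIso
    (ObjectProperty.ι _ ⋙ WeylRep.forget k)
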